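/- Let $V:\mathbb R^4\to\mathbb R$ be measurable and let $H_0=-\Delta$, $H=-\Delta+V$ on $L^2(\mathbb R^4)$. Write $\langle z\rangle=(1+|z|^2)^{1/2}$, and for $\lambda>0$ let $$R_0^\pm(\lambda^2)=\lim_{\varepsilon\to0^+}\bigl(H_0-(\lambda\pm i\varepsilon)^2\bigr)^{-1}$$ be the boundary values of the free resolvent, as operators from $L^{2,\sigma}=\langle x\rangle^{-\sigma}L^2(\mathbb R^4)$ to $L^{2,-\sigma}=\langle x\rangle^{\sigma}L^2(\mathbb R^4)$ (here with $\sigma=3$). Let $P_e$ be the orthogonal projection of $L^2(\mathbb R^4)$ onto the zero energy eigenspace $\{\psi\in L^2(\mathbb R^4): H\psi=0\}$. Let $\tilde\Phi\in C_c^\infty(\mathbb R)$ be equal to $1$ in a neighborhood of $0$, and let $$W_s=\frac1{\pi i}\int_0^\infty R_0^+(\lambda^2)\,V P_e V\,\bigl(R_0^+(\lambda^2)-R_0^-(\lambda^2)\bigr)\,\tilde\Phi(\lambda)\,\lambda^{-1}\,d\lambda .$$ Assume that $|V(z)|\le C\langle z\rangle^{-\delta}$ for all $z\in\mathbb R^4$,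 with constants $C$ and $\delta$. (i) If $\delta>4$, then $W_s$ is well defined from $L^{2,\sigma}$ to $L^{2,-\sigma}$ (the limits $R_0^\pm(\lambda^2)$ exist strongly, and for each $f\in L^{2,\sigma}$ the integral for $W_sf$ converges absolutely in $L^{2,-\sigma}$), and $W_s$ is bounded on $L^p(\mathbb R^4)$ for all $1\le p<4$; that is, there is a bounded operator on $L^p(\mathbb R^4)$ that agrees with $W_s$ on $L^p\cap L^{2,\sigma}$. (ii) If $\delta>6$ and $\int_{\mathbb R^4}x_jV(x)\psi(x)\,dx=0$ for every $\psi\in L^2(\mathbb R^4)$ with $H\psi=0$ and every $j=1,\dots,4$, then $W_s$ is bounded on $L^p(\mathbb R^4)$ in the same sense for all $1\le p<\infty$. -/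

import Mathlib

open MeasureTheory Filter Topology Set
open scoped ENNReal SchwartzMap ContDiff

noncomputable section

namespace WaveOp

/-- `ℝ⁴` with the Euclidean norm. -/
abbrev R4 : Type := EuclideanSpace ℝ (Fin 4)

/-- The Hilbert space `L²(ℝ⁴; ℂ)`. -/
abbrev L2 : Type := Lp ℂ 2 (volume : Measure R4)

/-- The Japanese bracket `⟨x⟩ = (1 + |x|²)^{1/2}`. -/
def bracket (x : R4) : ℝ := Real.sqrt (1 + ‖x‖ ^ 2)

open Classical in
/-- Multiplication by an essentially bounded function `m`, as a bounded operator on `L²(ℝ⁴)`.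
(It is only used for essentially bounded `m`; otherwise the value is `0`.) -/
def mulOp (m : R4 → ℂ) : L2 →L[ℂ] L2 :=
  if h : MemLp m ∞ volume then
    (ContinuousLinearMap.mul ℂ ℂ).holderL volume ∞ 2 2 (h.toLp m)
  else 0

/-- The free resolvent `(H₀ - z)⁻¹`, `H₀ = -Δ`, `z ∈ ℂ \ [0,∞)`, on `L²(ℝ⁴)`: the Fourier
multiplier with symbol `(4π²|ξ|² - z)⁻¹`, for the Fourier transform with phase `e^{-2πi x·ξ}`. -/
def freeResolvent (z : ℂ) : L2 →L[ℂ] L2 :=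
  (Lp.fourierTransformₗᵢ R4 ℂ).symm.toContinuousLinearEquiv.toContinuousLinearMap ∘L
    mulOp (fun ξ => ((4 * Real.pi ^ 2 * ‖ξ‖ ^ 2 : ℝ) - z)⁻¹) ∘L
    (Lp.fourierTransformₗᵢ R4 ℂ).toContinuousLinearEquiv.toContinuousLinearMap

/-- The map `ψ ↦ Hψ = -Δψ + Vψ` from `L²(ℝ⁴)` to tempered distributions. -/
def schrodingerOp (V : R4 → ℝ) : L2 →L[ℂ] 𝓢'(R4, ℂ) :=
  -(LineDeriv.laplacianCLM ℂ R4 𝓢'(R4, ℂ) ∘L Lp.toTemperedDistributionCLM ℂ volume 2) +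
    Lp.toTemperedDistributionCLM ℂ volume 2 ∘L mulOp (fun x => (V x : ℂ))

/-- The zero energy eigenspace `{ψ ∈ L²(ℝ⁴) : Hψ = 0}`. -/
def zeroEigenspace (V : R4 → ℝ) : Submodule ℂ L2 :=
  (schrodingerOp V).ker

instance (V : R4 → ℝ) : CompleteSpace (zeroEigenspace V) :=
  (schrodingerOp V).isClosed_ker.completeSpace_coe

/-- `P_e`, the orthogonal projection of `L²(ℝ⁴)` onto the zero energy eigenspace. -/
def eigenProj (V : R4 → ℝ) : L2 →L[ℂ] L2 :=
  (zeroEigenspace V).starProjection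

/-- The condition `P_e V x = 0`: every zero energy eigenfunction `ψ` satisfies
`∫ x_j V(x) ψ(x) dx = 0` for each coordinate `j`. -/
def FirstMomentsVanish (V : R4 → ℝ) : Prop :=
  ∀ ψ ∈ zeroEigenspace V, ∀ j : Fin 4, ∫ x : R4, ((x j * V x : ℝ) : ℂ) * ψ x = 0

/-- The exponent `σ` of the weighted spaces `L^{2,±σ} = ⟨x⟩^{∓σ} L²` between which the boundary
values of the free resolvent act.  An element `f` of `L^{2,σ}` is represented by
`h = ⟨x⟩^σ f ∈ L²`, and an element `u` of `L^{2,-σ}` by `⟨x⟩^{-σ} u ∈ L²`.  (The limits below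
exist for every `σ > 1/2`, and do not depend on it.) -/
def wt : ℕ := 3

/-- The operator `⟨x⟩^{-σ} (H₀ - (λ + i s ε)²)⁻¹ ⟨x⟩^{-σ}` on `L²(ℝ⁴)`, where `s = ±1`. -/
def weightedResolvent (s l ε : ℝ) : L2 →L[ℂ] L2 :=
  mulOp (fun x => ((bracket x ^ wt)⁻¹ : ℝ)) ∘L
    freeResolvent (((l : ℂ) + Complex.I * (s * ε : ℝ)) ^ 2) ∘L
    mulOp (fun x => ((bracket x ^ wt)⁻¹ : ℝ))

/-- The limiting absorption principle at energy `λ²`: the limits that define `R₀^±(λ²)` exist,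
strongly from `L^{2,σ}` to `L^{2,-σ}`. -/
def LimitsExist (l : ℝ) : Prop :=
  ∀ h : L2, (∃ u, Tendsto (fun ε => weightedResolvent 1 l ε h) (𝓝[>] 0) (𝓝 u)) ∧
    ∃ u, Tendsto (fun ε => weightedResolvent (-1) l ε h) (𝓝[>] 0) (𝓝 u)

/-- `⟨x⟩^{-σ} R₀^±(λ²) ⟨x⟩^{-σ} h`, where `R₀^±(λ²) = lim_{ε → 0+} (H₀ - (λ ± iε)²)⁻¹` and the sign
is that of `s = ±1`. -/
def weightedBoundaryResolvent (s l : ℝ) (h : L2) : L2 :=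
  limUnder (𝓝[>] 0) (fun ε : ℝ => weightedResolvent s l ε h)

/-- Multiplication by `⟨x⟩^σ V` on `L²(ℝ⁴)`. -/
def weightedPotential (V : R4 → ℝ) : L2 →L[ℂ] L2 :=
  mulOp (fun x => (bracket x ^ wt * V x : ℝ))

/-- The integrand of `W_s` applied to `f = ⟨x⟩^{-σ} h`, multiplied by `⟨x⟩^{-σ}`:
`⟨x⟩^{-σ} R₀⁺(λ²) V P_e V (R₀⁺(λ²) - R₀⁻(λ²)) f · Φ(λ) λ⁻¹`. -/
def wsIntegrand (V : R4 → ℝ) (Φ : ℝ → ℝ) (h : L2) (l : ℝ) : L2 :=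
  ((Φ l * l⁻¹ : ℝ) : ℂ) •
    weightedBoundaryResolvent 1 l
      (weightedPotential V (eigenProj V (weightedPotential V
        (weightedBoundaryResolvent 1 l h - weightedBoundaryResolvent (-1) l h))))

/-- The defining formula of `W_s` is meaningful on `L^{2,σ}`: the boundary values of the free
resolvent exist at all positive energies, and the integral over `λ` converges absolutely in
`L^{2,-σ}`. -/
def WsDefined (V : R4 → ℝ) (Φ : ℝ → ℝ) : Prop :=
  (∀ l : ℝ, 0 < l → LimitsExist l) ∧ ∀ h : L2, IntegrableOn (wsIntegrand V Φ h) (Ioi 0)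

/-- `⟨x⟩^{-σ} W_s ⟨x⟩^{-σ} h`. -/
def weightedWs (V : R4 → ℝ) (Φ : ℝ → ℝ) (h : L2) : L2 :=
  ((Real.pi : ℂ) * Complex.I)⁻¹ • ∫ l in Ioi (0 : ℝ), wsIntegrand V Φ h l

/-- For `h = ⟨x⟩^σ f ∈ L²`, the function `W_s f ∈ L^{2,-σ}`, where
`W_s = (1/πi) ∫₀^∞ R₀⁺(λ²) V P_e V (R₀⁺(λ²) - R₀⁻(λ²)) Φ(λ) λ⁻¹ dλ`. -/
def Ws (V : R4 → ℝ) (Φ : ℝ → ℝ) (h : L2) (x : R4) : ℂ :=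
  (bracket x ^ wt : ℝ) * weightedWs V Φ h x

/-- `W_s` is bounded on `L^p(ℝ⁴)`: some bounded operator on `L^p` agrees with `W_s` on
`L^p ∩ L^{2,σ}`, which is dense in `L^p` for `p < ∞`. -/
def WsBoundedOn (V : R4 → ℝ) (Φ : ℝ → ℝ) (p : ℝ≥0∞) [Fact (1 ≤ p)] : Prop :=
  ∃ T : Lp ℂ p (volume : Measure R4) →L[ℂ] Lp ℂ p (volume : Measure R4),
    ∀ (f : Lp ℂ p (volume : Measure R4)) (h : L2),
      (∀ᵐ x, h x = (bracket x ^ wt : ℝ) * f x) → ∀ᵐ x, T f x = Ws V Φ h x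

/-- The cut-off functions `Φ̃` that occur in `W_s`: smooth, compactly supported, and equal to `1`
near `0`. -/
def IsLowEnergyCutoff (Φ : ℝ → ℝ) : Prop :=
  ContDiff ℝ ∞ Φ ∧ HasCompactSupport Φ ∧ ∀ᶠ l in 𝓝 (0 : ℝ), Φ l = 1

end WaveOp

end

/-! Why it is true. The zero energy eigenspace is finite dimensional, so `P_e` is a finite sum of
rank one projections and, up to a constant, `W_s f` is a finite sum of integrals `∫ ⟨φ, (R₀⁺ - R₀⁻)
f⟩ R₀⁺φ Φ(λ) dλ/λ` with `φ = Vψ`, `ψ` an eigenfunction (`exists_eigenProj_eq_sum`, `ws_ae_eq_sum`).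
Everything rests on a cancellation. On the Fourier side `4π²|ξ|² ψ̂ = -φ̂`; since `ψ̂ ∈ L²`, `φ̂` is
continuous and `|ξ|⁻⁴` is not integrable near `0` in `ℝ⁴`, `φ̂(0) = 0`, that is `∫ φ = 0`
(`integral_potMul_eq_zero`).

Cut the energies dyadically, `Φ(λ) = ∑ χ(2ʲλ)` with `χ(λ) = Φ(λ) - Φ(2λ)`, and consider the piece at
scale `s = 2⁻ʲ`. At energies `λ ≲ s` the kernel of `R₀⁺ - R₀⁻` has frequencies of size at most about
`s`, so it is reproduced by a low-pass kernel `η_s = s⁴η(s·)` (`conv_jumpKer_eq`). This low-pass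
kernel can be moved onto `φ`: the pairing becomes the integral of the jump kernel against `g =
correl(φ, η_s) * f`. Taylor expansion of `η` makes the `L¹` norm of the correlation `O(sᵐ)`, with `m
= 1` because `∫ φ = 0`, and `m = 2` when the first moments of `φ` vanish too. Hence `‖g‖_p ≲ sᵐ
‖f‖_p` by Young.

What remains is an operator with kernel `s⁴ K(s|x-w|, s|u|)` acting on `g(u)` and integrated against
`φ(w)`. Writing the Green function of `ℝ⁴` as `r⁻² e^{±iλr}` times a symbol (`hankelAmp`) and
integrating by parts three times in `λ` gives `|K(r,ρ)| ≲ r⁻² (1+r)^{1/2} (1+ρ)^{-3/2} (1+|r-ρ|)⁻³`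
(`exists_norm_radialKer_le`). For `r ≥ 1` this is a symmetric kernel satisfying Schur's test,
bounded on every `L^p` uniformly in `s`. For `r < 1` the singularity `r⁻²` remains, multiplied by
`(1+ρ)^{-9/2}`; Hölder in `u` and the truncation `r < 1` cost `s^{4/p-2-θ}` at scale `s`, where `θ ≥
0` is any number for which `(1+|z|)^{-2-θ}` lies in `L^p` (`exists_eLpNorm_piece_le`).

So the piece has norm `O(sᵐ(1 + s^{4/p-2-θ}))`. The sum over `s = 2⁻ʲ` converges for a suitable `θ`
as soon as `m + 4/p > 2`: for `m = 1` this says `p < 4`, for `m = 2` it says `p < ∞`. Fatou's lemma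
sums the series, and density of `L^p ∩ L^{2,σ}` gives the bounded operator on `L^p`. -/

namespace WaveOp

open FourierTransform

/-! ### Schur's test, Young's inequality, and the Fourier transform on `L¹ ∩ L²`. -/

section Schur

variable {α β : Type*} [MeasurableSpace α] [MeasurableSpace β] {μ : Measure α} {ν : Measure β}

/-- Schur's test. -/
theorem eLpNorm_lintegral_le_of_schur [SFinite μ] [SFinite ν] {K : α → β → ℝ≥0∞}
    (hK : Measurable (Function.uncurry K)) {f : β → ℝ≥0∞} (hf : AEMeasurable f ν) {C : ℝ≥0∞}
    (h₁ : ∀ x, ∫⁻ y, K x y ∂ν ≤ C) (h₂ : ∀ y, ∫⁻ x, K x y ∂μ ≤ C) {p : ℝ≥0∞} (hp : 1 ≤ p)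
    (hp' : p ≠ ⊤) :
    eLpNorm (fun x => ∫⁻ y, K x y * f y ∂ν) p μ ≤ C * eLpNorm f p ν := by
  have hp0 : p ≠ 0 := (zero_lt_one.trans_le hp).ne'
  set q : ℝ := p.toReal with hq
  have hq1 : 1 ≤ q := by
    simpa using (ENNReal.toReal_le_toReal ENNReal.one_ne_top hp').2 hp
  have hq0 : 0 < q := by linarith
  have hqinv : 0 ≤ 1 - 1 / q := by
    rw [sub_nonneg, div_le_one hq0]; exact hq1
  rw [eLpNorm_eq_lintegral_rpow_enorm_toReal hp0 hp', eLpNorm_eq_lintegral_rpow_enorm_toReal hp0 hp',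
    ← hq]
  simp only [enorm_eq_self]
  have hKx : ∀ x, Measurable (K x) := fun x => hK.comp measurable_prodMk_left
  -- Hölder with exponents `1 - 1/q` and `1/q`, after writing `K f = K^{1-1/q} (K f^q)^{1/q}`; this
  -- form also covers `q = 1`.
  have hpt : ∀ x, (∫⁻ y, K x y * f y ∂ν) ^ q ≤ C ^ (q - 1) * ∫⁻ y, K x y * f y ^ q ∂ν := by
    intro x
    have h := ENNReal.lintegral_mul_norm_pow_le (μ := ν) (f := K x) (g := fun y => K x y * f y ^ q)
      (hKx x).aemeasurable ((hKx x).aemeasurable.mul (hf.pow_const q)) hqinv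
      (by positivity : 0 ≤ 1 / q) (by ring)
    have he : ∀ y, K x y ^ (1 - 1 / q) * (K x y * f y ^ q) ^ (1 / q) = K x y * f y := by
      intro y
      rw [ENNReal.mul_rpow_of_nonneg _ _ (by positivity), ← mul_assoc,
        ← ENNReal.rpow_add_of_nonneg _ _ hqinv (by positivity), ← ENNReal.rpow_mul,
        mul_one_div_cancel hq0.ne']
      simp
    simp only [he] at h
    calc (∫⁻ y, K x y * f y ∂ν) ^ q
        ≤ ((∫⁻ y, K x y ∂ν) ^ (1 - 1 / q) * (∫⁻ y, K x y * f y ^ q ∂ν) ^ (1 / q)) ^ q := by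
          gcongr
      _ = (∫⁻ y, K x y ∂ν) ^ (q - 1) * ∫⁻ y, K x y * f y ^ q ∂ν := by
          rw [ENNReal.mul_rpow_of_nonneg _ _ hq0.le, ← ENNReal.rpow_mul, ← ENNReal.rpow_mul,
            one_div_mul_cancel hq0.ne', ENNReal.rpow_one]
          congr 2
          field_simp
      _ ≤ _ := by
          gcongr
          exact h₁ x
  have hmeas : AEMeasurable (Function.uncurry fun x y => K x y * f y ^ q) (μ.prod ν) :=
    hK.aemeasurable.mul ((hf.pow_const q).comp_quasiMeasurePreserving
      Measure.quasiMeasurePreserving_snd)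
  have hInt : ∫⁻ x, (∫⁻ y, K x y * f y ∂ν) ^ q ∂μ ≤ C ^ q * ∫⁻ y, f y ^ q ∂ν := by
    have hKy : ∀ y, Measurable fun x => K x y := fun y => hK.comp measurable_prodMk_right
    calc ∫⁻ x, (∫⁻ y, K x y * f y ∂ν) ^ q ∂μ
        ≤ ∫⁻ x, C ^ (q - 1) * ∫⁻ y, K x y * f y ^ q ∂ν ∂μ := lintegral_mono hpt
      _ = C ^ (q - 1) * ∫⁻ x, ∫⁻ y, K x y * f y ^ q ∂ν ∂μ :=
          lintegral_const_mul'' _ hmeas.lintegral_prod_right'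
      _ = C ^ (q - 1) * ∫⁻ y, ∫⁻ x, K x y * f y ^ q ∂μ ∂ν := by
          rw [lintegral_lintegral_swap hmeas]
      _ ≤ C ^ (q - 1) * ∫⁻ y, C * f y ^ q ∂ν := by
          gcongr with y
          rw [lintegral_mul_const _ (hKy y)]
          gcongr
          exact h₂ y
      _ = C ^ q * ∫⁻ y, f y ^ q ∂ν := by
          rw [lintegral_const_mul'' _ (hf.pow_const q), ← mul_assoc]
          congr 1
          conv_lhs => rw [← ENNReal.rpow_one C, ← ENNReal.rpow_mul, one_mul,
            ← ENNReal.rpow_add_of_nonneg _ _ (by linarith) (by linarith)]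
          simp
  calc (∫⁻ x, (∫⁻ y, K x y * f y ∂ν) ^ q ∂μ) ^ (1 / q)
      ≤ (C ^ q * ∫⁻ y, f y ^ q ∂ν) ^ (1 / q) := by gcongr
    _ = _ := by
      rw [ENNReal.mul_rpow_of_nonneg _ _ (by positivity), ← ENNReal.rpow_mul,
        mul_one_div_cancel hq0.ne', ENNReal.rpow_one]

end Schur

/-- Young's inequality `‖a * f‖_p ≤ ‖a‖₁ ‖f‖_p` for nonnegative functions. -/
theorem eLpNorm_lconvolution_le {a f : R4 → ℝ≥0∞} (ha : AEMeasurable a) (hf : AEMeasurable f)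
    {p : ℝ≥0∞} (hp : 1 ≤ p) (hp' : p ≠ ⊤) :
    eLpNorm (fun x => ∫⁻ y, a (x - y) * f y) p volume ≤ (∫⁻ x, a x) * eLpNorm f p volume := by
  have hae := ha.ae_eq_mk
  have h1 : ∀ x, ∫⁻ y, a (x - y) * f y = ∫⁻ y, ha.mk a (x - y) * f y := by
    intro x
    apply lintegral_congr_ae
    have := (quasiMeasurePreserving_sub_left volume x).ae_eq_comp hae
    filter_upwards [this] with y hy
    simp only [Function.comp] at hy
    rw [hy]
  simp only [h1]
  rw [lintegral_congr_ae hae]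
  refine eLpNorm_lintegral_le_of_schur (K := fun x y => ha.mk a (x - y)) ?_ hf ?_ ?_ hp hp'
  · exact ha.measurable_mk.comp (measurable_fst.sub measurable_snd)
  · intro x
    rw [lintegral_sub_left_eq_self (fun y => ha.mk a y)]
  · intro y
    rw [lintegral_sub_right_eq_self (fun x => ha.mk a x)]

theorem mulOp_ae {m : R4 → ℂ} (h : MemLp m ∞ volume) (f : L2) :
    mulOp m f =ᵐ[volume] fun x => m x * f x := by
  rw [mulOp, dif_pos h]
  have h1 := (ContinuousLinearMap.mul ℂ ℂ).coeFn_holder (r := 2) (h.toLp m) f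
  filter_upwards [h1, h.coeFn_toLp] with x hx hy
  simp only [ContinuousLinearMap.holderL, ContinuousLinearMap.holder] at *
  rw [← hy]
  exact hx

/-- On `L¹ ∩ L²` the Fourier transform of `L²` is given by the Fourier integral. -/
theorem fourier_toLp_ae {f : R4 → ℂ} (hf₁ : Integrable f) (hf₂ : MemLp f 2 volume) :
    (𝓕 (hf₂.toLp f) : L2) =ᵐ[volume] 𝓕 f := by
  have hcont : Continuous (𝓕 f) := VectorFourier.fourierIntegral_continuous
    Real.continuous_fourierChar (by exact continuous_inner) hf₁
  -- Both sides are tested against `g`: for the `L²` transform, `𝓕` moves to `g` by the definition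
  -- for distributions, for the Fourier integral by Fubini.
  apply ae_eq_of_integral_contDiff_smul_eq
  · exact (Lp.memLp _).locallyIntegrable (by norm_num)
  · exact hcont.locallyIntegrable
  intro g hg hgc
  have hg' : ContDiff ℝ ∞ (fun x => (g x : ℂ)) := Complex.ofRealCLM.contDiff.comp hg
  have hgc' : HasCompactSupport (fun x => (g x : ℂ)) := hgc.comp_left (g := Complex.ofReal) rfl
  let u : 𝓢(R4, ℂ) := hgc'.toSchwartzMap hg'
  have hu : ∀ x, u x = g x := fun x => rfl
  have h := congrArg (fun T : 𝓢'(R4, ℂ) => T u)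
    (Lp.fourier_toTemperedDistribution_eq (hf₂.toLp f))
  simp only [TemperedDistribution.fourier_apply, Lp.toTemperedDistribution_apply] at h
  have h2 : ∫ x, (𝓕 u) x • (hf₂.toLp f) x = ∫ x, (𝓕 u) x * f x := by
    apply integral_congr_ae
    filter_upwards [hf₂.coeFn_toLp] with x hx
    rw [hx, smul_eq_mul]
  rw [h2] at h
  have h3 := VectorFourier.integral_fourierIntegral_smul_eq_flip (L := innerₗ R4) (μ := volume)
    (ν := volume) (f := (u : R4 → ℂ)) (g := f) Real.continuous_fourierChar
    (by exact continuous_inner) u.integrable hf₁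
  calc ∫ x, g x • (𝓕 (hf₂.toLp f) : L2) x = ∫ x, u x • (𝓕 (hf₂.toLp f) : L2) x := by
        simp [hu]
    _ = ∫ x, (𝓕 u) x * f x := h.symm
    _ = ∫ x, u x • 𝓕 f x := by
        rw [flip_innerₗ] at h3
        exact h3
    _ = _ := by simp [hu]

/-! ### The amplitude of the Green function. -/

/-- The amplitude `∫₀^∞ e^{-s} s^{1/2} (2 z + s)^α ds`. -/
noncomputable def hankelAmp (α : ℝ) (z : ℂ) : ℂ :=
  ∫ s in Ioi (0 : ℝ), ((Real.exp (-s) * √s : ℝ) : ℂ) * (2 * z + s) ^ (α : ℂ)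

/-- For `Re z ≥ 0` adding `s ≥ 0` only moves `2z` away from the origin. This keeps the amplitudes
with negative exponent under control up to the imaginary axis, where the boundary values of the
resolvent live. -/
theorem two_mul_norm_le_norm_add {z : ℂ} (hz : 0 ≤ z.re) {s : ℝ} (hs : 0 ≤ s) :
    2 * ‖z‖ ≤ ‖2 * z + s‖ := by
  have h : (2 * ‖z‖) ^ 2 ≤ ‖2 * z + s‖ ^ 2 := by
    rw [mul_pow, Complex.sq_norm, Complex.sq_norm, Complex.normSq_apply, Complex.normSq_apply]
    simp
    nlinarith [mul_nonneg hz hs]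
  exact le_of_sq_le_sq h (norm_nonneg _)

theorem sqrt_add_le_add_sqrt {a b : ℝ} (ha : 0 ≤ a) (hb : 0 ≤ b) : √(a + b) ≤ √a + √b := by
  rw [Real.sqrt_le_left (by positivity)]
  nlinarith [Real.sq_sqrt ha, Real.sq_sqrt hb, mul_nonneg (Real.sqrt_nonneg a) (Real.sqrt_nonneg b)]

theorem norm_two_mul_add_le (z : ℂ) {s : ℝ} (hs : 0 ≤ s) : ‖2 * z + s‖ ≤ 2 * ‖z‖ + s := by
  refine (norm_add_le _ _).trans ?_
  simp [abs_of_nonneg hs]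

theorem integrableOn_exp_neg_mul_sqrt :
    IntegrableOn (fun s : ℝ => Real.exp (-s) * √s) (Ioi 0) := by
  have := Real.GammaIntegral_convergent (s := 3 / 2) (by norm_num)
  refine this.congr_fun (fun s _ => ?_) measurableSet_Ioi
  simp only [Real.sqrt_eq_rpow]
  norm_num

theorem integrableOn_exp_neg_mul_self :
    IntegrableOn (fun s : ℝ => Real.exp (-s) * s) (Ioi 0) := by
  have := Real.GammaIntegral_convergent (s := 2) (by norm_num)
  refine this.congr_fun (fun s _ => ?_) measurableSet_Ioi
  norm_num

theorem measurable_hankelAmp_integrand (α : ℝ) :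
    Measurable fun q : ℂ × ℝ =>
      ((Real.exp (-q.2) * √q.2 : ℝ) : ℂ) * (2 * q.1 + q.2) ^ (α : ℂ) := by
  fun_prop

theorem norm_hankelAmp_integrand_half_le (z : ℂ) {s : ℝ} (hs : 0 ≤ s) :
    ‖((Real.exp (-s) * √s : ℝ) : ℂ) * (2 * z + s) ^ (((1 / 2 : ℝ)) : ℂ)‖ ≤
      √(2 * ‖z‖) * (Real.exp (-s) * √s) + Real.exp (-s) * s := by
  rw [norm_mul, Complex.norm_cpow_real, ← Real.sqrt_eq_rpow, Complex.norm_real, Real.norm_of_nonneg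
    (by positivity)]
  calc Real.exp (-s) * √s * √‖2 * z + s‖
      ≤ Real.exp (-s) * √s * (√(2 * ‖z‖) + √s) := by
        gcongr
        exact (Real.sqrt_le_sqrt (norm_two_mul_add_le z hs)).trans
          (sqrt_add_le_add_sqrt (by positivity) hs)
    _ = _ := by
        rw [mul_add, mul_assoc _ √s √s, Real.mul_self_sqrt hs]
        ring

theorem norm_hankelAmp_integrand_le {α : ℝ} (hα : α ≤ 0) {z : ℂ} {s ρ : ℝ}
    (hρ : 0 < ρ) (hz : ρ ≤ ‖2 * z + s‖) :
    ‖((Real.exp (-s) * √s : ℝ) : ℂ) * (2 * z + s) ^ (α : ℂ)‖ ≤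
      ρ ^ α * (Real.exp (-s) * √s) := by
  rw [norm_mul, Complex.norm_cpow_real, Complex.norm_real, Real.norm_of_nonneg
    (by positivity), mul_comm]
  exact mul_le_mul_of_nonneg_right (Real.rpow_le_rpow_of_nonpos hρ hz hα) (by positivity)

theorem integrableOn_hankelAmp_half (z : ℂ) : IntegrableOn (fun s : ℝ =>
    ((Real.exp (-s) * √s : ℝ) : ℂ) * (2 * z + s) ^ (((1 / 2 : ℝ)) : ℂ)) (Ioi 0) := by
  refine Integrable.mono' ((integrableOn_exp_neg_mul_sqrt.const_mul √(2 * ‖z‖)).add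
    integrableOn_exp_neg_mul_self) ?_ ?_
  · exact ((measurable_hankelAmp_integrand (1 / 2)).comp
      (measurable_const.prodMk measurable_id)).aestronglyMeasurable
  · filter_upwards [self_mem_ae_restrict measurableSet_Ioi] with s hs
    exact norm_hankelAmp_integrand_half_le z (le_of_lt hs)

theorem integrableOn_hankelAmp {α : ℝ} (hα : α ≤ 0) {z : ℂ} (hz : 0 ≤ z.re) (hz0 : z ≠ 0) :
    IntegrableOn (fun s : ℝ =>
      ((Real.exp (-s) * √s : ℝ) : ℂ) * (2 * z + s) ^ (α : ℂ)) (Ioi 0) := by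
  refine Integrable.mono' (integrableOn_exp_neg_mul_sqrt.const_mul ((2 * ‖z‖) ^ α)) ?_ ?_
  · exact ((measurable_hankelAmp_integrand α).comp
      (measurable_const.prodMk measurable_id)).aestronglyMeasurable
  · filter_upwards [self_mem_ae_restrict measurableSet_Ioi] with s hs
    exact norm_hankelAmp_integrand_le hα (by positivity)
      (two_mul_norm_le_norm_add hz (le_of_lt hs))

/-- `∫₀^∞ e^{-s} s^{1/2} ds`. -/
noncomputable def hankelConst : ℝ := ∫ s in Ioi (0 : ℝ), Real.exp (-s) * √s

theorem hankelConst_nonneg : 0 ≤ hankelConst :=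
  setIntegral_nonneg measurableSet_Ioi fun s _ => by positivity

theorem norm_hankelAmp_half_le (z : ℂ) :
    ‖hankelAmp (1 / 2) z‖ ≤ hankelConst * √(2 * ‖z‖) + 1 := by
  have h1 : ∫ s in Ioi (0 : ℝ), Real.exp (-s) * s = 1 := by
    have := Real.Gamma_eq_integral (s := 2) (by norm_num)
    rw [Real.Gamma_two] at this
    rw [this]
    refine setIntegral_congr_fun measurableSet_Ioi fun s _ => ?_
    norm_num
  calc ‖hankelAmp (1 / 2) z‖
      ≤ ∫ s in Ioi (0 : ℝ), (√(2 * ‖z‖) * (Real.exp (-s) * √s) + Real.exp (-s) * s) := by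
        refine norm_integral_le_of_norm_le ((integrableOn_exp_neg_mul_sqrt.const_mul √(2 * ‖z‖)).add
          integrableOn_exp_neg_mul_self) ?_
        filter_upwards [self_mem_ae_restrict measurableSet_Ioi] with s hs
        exact norm_hankelAmp_integrand_half_le z (le_of_lt hs)
    _ = _ := by
        rw [integral_add (integrableOn_exp_neg_mul_sqrt.const_mul √(2 * ‖z‖))
          integrableOn_exp_neg_mul_self, integral_const_mul, h1, hankelConst, mul_comm]

theorem norm_hankelAmp_le {α : ℝ} (hα : α ≤ 0) {z : ℂ} (hz : 0 ≤ z.re) (hz0 : z ≠ 0) :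
    ‖hankelAmp α z‖ ≤ hankelConst * (2 * ‖z‖) ^ α := by
  calc ‖hankelAmp α z‖
      ≤ ∫ s in Ioi (0 : ℝ), (2 * ‖z‖) ^ α * (Real.exp (-s) * √s) := by
        refine norm_integral_le_of_norm_le
          (integrableOn_exp_neg_mul_sqrt.const_mul ((2 * ‖z‖) ^ α)) ?_
        filter_upwards [self_mem_ae_restrict measurableSet_Ioi] with s hs
        exact norm_hankelAmp_integrand_le hα (by positivity)
          (two_mul_norm_le_norm_add hz (le_of_lt hs))
    _ = _ := by rw [integral_const_mul, hankelConst, mul_comm]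

/-- Differentiation under the integral. On the ball of radius `‖z‖/2` about `z`, `2w + s` stays at
distance at least `‖z‖` from the origin and off the branch cut, even though `w` itself may have
negative real part. Each derivative lowers the exponent by one, which is the symbol behaviour used
later in the integrations by parts. -/
theorem hasDerivAt_hankelAmp {α : ℝ} (hα : α ≤ 1) {z : ℂ} (hz : 0 ≤ z.re) (hz0 : z ≠ 0)
    (hInt : IntegrableOn (fun s : ℝ =>
      ((Real.exp (-s) * √s : ℝ) : ℂ) * (2 * z + s) ^ (α : ℂ)) (Ioi 0)) :
    HasDerivAt (hankelAmp α) (2 * α * hankelAmp (α - 1) z) z := by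
  have hnz : 0 < ‖z‖ := norm_pos_iff.2 hz0
  have hlow : ∀ w ∈ Metric.ball z (‖z‖ / 2), ∀ s : ℝ, 0 ≤ s → ‖z‖ ≤ ‖2 * w + s‖ := by
    intro w hw s hs
    have h1 := two_mul_norm_le_norm_add hz hs
    have h2 : ‖(2 * z + s) - (2 * w + s)‖ ≤ ‖z‖ := by
      have : (2 * z + s) - (2 * w + s) = 2 * (z - w) := by ring
      rw [this, norm_mul, Complex.norm_ofNat, norm_sub_rev]
      have := mem_ball_iff_norm.1 hw
      linarith
    have := norm_le_norm_add_norm_sub' (2 * z + (s : ℂ)) (2 * w + s)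
    linarith
  have hslit : ∀ w ∈ Metric.ball z (‖z‖ / 2), ∀ s : ℝ, 0 ≤ s → 2 * w + s ∈ Complex.slitPlane := by
    intro w hw s hs
    by_contra hcon
    rw [Complex.mem_slitPlane_iff, not_or, not_lt, not_not] at hcon
    obtain ⟨hre, him⟩ := hcon
    simp only [Complex.add_re, Complex.mul_re, Complex.re_ofNat, Complex.im_ofNat, zero_mul,
      sub_zero, Complex.ofReal_re, Complex.add_im, Complex.mul_im, Complex.ofReal_im,
      add_zero] at hre him
    have h1 : ‖z‖ ≤ ‖z - w‖ := by
      rw [← abs_of_nonneg (norm_nonneg z), ← abs_of_nonneg (norm_nonneg (z - w)), ← sq_le_sq,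
        Complex.sq_norm, Complex.sq_norm, Complex.normSq_apply, Complex.normSq_apply]
      simp only [Complex.sub_re, Complex.sub_im]
      have hw0 : w.im = 0 := by linarith
      rw [hw0]
      nlinarith
    have := mem_ball_iff_norm.1 hw
    rw [norm_sub_rev] at this
    linarith
  have key := hasDerivAt_integral_of_dominated_loc_of_deriv_le (μ := volume.restrict (Ioi (0 : ℝ)))
    (F := fun (z : ℂ) (s : ℝ) => ((Real.exp (-s) * √s : ℝ) : ℂ) * (2 * z + s) ^ (α : ℂ))
    (F' := fun (z : ℂ) (s : ℝ) => ((Real.exp (-s) * √s : ℝ) : ℂ) *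
      (2 * α * (2 * z + s) ^ (((α - 1 : ℝ)) : ℂ)))
    (bound := fun s => 2 * |α| * (‖z‖ ^ (α - 1) * (Real.exp (-s) * √s)))
    (x₀ := z) (s := Metric.ball z (‖z‖ / 2)) (Metric.ball_mem_nhds _ (by positivity))
    (Eventually.of_forall fun w => ((measurable_hankelAmp_integrand α).comp
      (measurable_const.prodMk measurable_id)).aestronglyMeasurable)
    hInt (by apply Measurable.aestronglyMeasurable; fun_prop) ?_
    ((integrableOn_exp_neg_mul_sqrt.const_mul _).const_mul _) ?_
  · have h2 := key.2
    have h3 : ∫ s in Ioi (0 : ℝ), ((Real.exp (-s) * √s : ℝ) : ℂ) *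
        (2 * α * (2 * z + s) ^ (((α - 1 : ℝ)) : ℂ)) = 2 * α * hankelAmp (α - 1) z := by
      rw [hankelAmp, ← integral_const_mul]
      congr 1
      ext s
      ring
    rw [h3] at h2
    exact h2
  · filter_upwards [self_mem_ae_restrict measurableSet_Ioi] with s hs w hw
    have := norm_hankelAmp_integrand_le (α := α - 1) (by linarith) hnz
      (hlow w hw s (le_of_lt hs))
    have he : ((Real.exp (-s) * √s : ℝ) : ℂ) * (2 * α * (2 * w + s) ^ (((α - 1 : ℝ)) : ℂ)) =
        (2 * α) * (((Real.exp (-s) * √s : ℝ) : ℂ) * (2 * w + s) ^ (((α - 1 : ℝ)) : ℂ)) := by ring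
    rw [he, norm_mul, norm_mul, Complex.norm_ofNat, Complex.norm_real, Real.norm_eq_abs]
    gcongr
  · filter_upwards [self_mem_ae_restrict measurableSet_Ioi] with s hs w hw
    have h1 : HasDerivAt (fun w : ℂ => 2 * w + s) 2 w := by
      simpa using ((hasDerivAt_id w).const_mul 2).add_const (s : ℂ)
    have h2 := (h1.cpow_const (c := (α : ℂ)) (hslit w hw s (le_of_lt hs))).const_mul
      ((Real.exp (-s) * √s : ℝ) : ℂ)
    exact h2.congr_deriv (by push_cast; ring)

theorem hasDerivAt_hankelAmp_half {z : ℂ} (hz : 0 ≤ z.re) (hz0 : z ≠ 0) :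
    HasDerivAt (hankelAmp (1 / 2)) (hankelAmp (-1 / 2) z) z := by
  have := hasDerivAt_hankelAmp (α := 1 / 2) (by norm_num) hz hz0 (integrableOn_hankelAmp_half z)
  convert this using 1
  norm_num

theorem continuous_hankelAmp_half_comp {X : Type*} [TopologicalSpace X] [FirstCountableTopology X]
    {g : X → ℂ} (hg : Continuous g) (hre : ∀ x, 0 ≤ (g x).re) :
    Continuous fun x => hankelAmp (1 / 2) (g x) := by
  rw [continuous_iff_continuousAt]
  intro x₀
  have hev : ∀ᶠ x in 𝓝 x₀, ‖g x‖ ≤ ‖g x₀‖ + 1 := by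
    have := (hg.norm.tendsto x₀).eventually (gt_mem_nhds (lt_add_one ‖g x₀‖))
    exact this.mono fun x hx => le_of_lt hx
  refine tendsto_integral_filter_of_dominated_convergence
    (fun s => √(2 * (‖g x₀‖ + 1)) * (Real.exp (-s) * √s) + Real.exp (-s) * s) ?_ ?_
    ((integrableOn_exp_neg_mul_sqrt.const_mul _).add integrableOn_exp_neg_mul_self) ?_
  · exact Eventually.of_forall fun x => ((measurable_hankelAmp_integrand (1 / 2)).comp
      (measurable_const.prodMk measurable_id)).aestronglyMeasurable
  · filter_upwards [hev] with x hx
    filter_upwards [self_mem_ae_restrict measurableSet_Ioi] with s hs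
    refine (norm_hankelAmp_integrand_half_le (g x) (le_of_lt hs)).trans ?_
    gcongr
  · filter_upwards [self_mem_ae_restrict measurableSet_Ioi] with s hs
    apply Tendsto.const_mul
    have hs' : (2 * g x₀ + s) ∈ Complex.slitPlane := by
      left
      have := hre x₀
      have : (0 : ℝ) < s := hs
      simp
      linarith
    have h1 : ContinuousAt (fun x => 2 * g x + (s : ℂ)) x₀ := by fun_prop
    exact h1.cpow continuousAt_const hs'

/-! ### The Laplace transform of the heat kernel. -/

theorem integrable_mul_exp_neg_sq {F : ℝ → ℝ} (hF : Continuous F) {C : ℝ}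
    (hC : ∀ w, |F w| ≤ C * (1 + w ^ 4)) : Integrable fun w : ℝ => Real.exp (-w ^ 2) * F w := by
  have h0 : Integrable fun w : ℝ => Real.exp (-w ^ 2) := by
    simpa using integrable_exp_neg_mul_sq (b := 1) one_pos
  have h4 : Integrable fun w : ℝ => w ^ 4 * Real.exp (-w ^ 2) := by
    have := integrable_rpow_mul_exp_neg_mul_sq (b := 1) one_pos (s := (4 : ℕ)) (by norm_num)
    simpa using this
  refine Integrable.mono' ((h0.add h4).const_mul C) (by fun_prop) (Eventually.of_forall fun w => ?_)
  rw [norm_mul, Real.norm_of_nonneg (Real.exp_pos _).le, Real.norm_eq_abs]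
  calc Real.exp (-w ^ 2) * |F w| ≤ Real.exp (-w ^ 2) * (C * (1 + w ^ 4)) := by gcongr; exact hC w
    _ = _ := by simp; ring

/-- With `S = √(w² + 2z)` the factor `(S - w)²/S` is the derivative of `wS - w²`. Integrating by
parts against `e^{-w²}` leaves `2w²S` and an odd term that integrates to `0`; the even part becomes
the right side under `s = w²`. -/
theorem integral_exp_neg_mul_sqrt_mul_sqrt {z : ℝ} (hz : 0 < z) :
    ∫ w : ℝ, Real.exp (-w ^ 2) * ((√(w ^ 2 + 2 * z) - w) ^ 2 / √(w ^ 2 + 2 * z)) =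
      2 * ∫ s in Ioi (0 : ℝ), Real.exp (-s) * √s * √(2 * z + s) := by
  set S : ℝ → ℝ := fun w => √(w ^ 2 + 2 * z) with hS
  have hSpos : ∀ w, 0 < S w := fun w => Real.sqrt_pos.2 (by positivity)
  have hSsq : ∀ w, S w ^ 2 = w ^ 2 + 2 * z := fun w => Real.sq_sqrt (by positivity)
  have hScont : Continuous S := by fun_prop
  have hSd : ∀ w, HasDerivAt S (w / S w) w := by
    intro w
    have h := ((hasDerivAt_pow 2 w).add_const (2 * z)).sqrt (by positivity)
    refine h.congr_deriv ?_
    simp only [hS]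
    field_simp
    norm_num
  have hSle : ∀ w, S w ≤ 1 + w ^ 2 + 2 * z := by
    intro w
    have := hSsq w
    have := hSpos w
    nlinarith [sq_nonneg (S w - 1)]
  have habs : ∀ w : ℝ, |w| ≤ S w := fun w => by
    rw [← Real.sqrt_sq_eq_abs]
    exact Real.sqrt_le_sqrt (by linarith)
  have hw4 : ∀ w : ℝ, w ^ 2 ≤ 1 + w ^ 4 := fun w => by nlinarith [sq_nonneg (w ^ 2 - 1)]
  set v : ℝ → ℝ := fun w => w * S w - w ^ 2 with hv
  have hvd : ∀ w, HasDerivAt v ((S w - w) ^ 2 / S w) w := by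
    intro w
    have h := ((hasDerivAt_id w).mul (hSd w)).sub (hasDerivAt_pow 2 w)
    refine h.congr_deriv ?_
    have := (hSpos w).ne'
    field_simp
    simp
    ring
  have hud : ∀ w : ℝ, HasDerivAt (fun w : ℝ => Real.exp (-w ^ 2)) (-(2 * w) * Real.exp (-w ^ 2)) w := by
    intro w
    have h := ((hasDerivAt_pow 2 w).neg).exp
    refine h.congr_deriv ?_
    simp
    ring
  have i1 : Integrable fun w => Real.exp (-w ^ 2) * ((S w - w) ^ 2 / S w) := by
    refine integrable_mul_exp_neg_sq (C := 4 * (2 + 2 * z)) (Continuous.div (by fun_prop) hScont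
      fun w => (hSpos w).ne') fun w => ?_
    rw [abs_div, abs_of_pos (hSpos w), div_le_iff₀ (hSpos w), abs_of_nonneg (sq_nonneg _)]
    have h1 : (S w - w) ^ 2 ≤ (2 * S w) ^ 2 := by
      apply sq_le_sq'
      · have := (abs_le.1 (habs w)).2
        have := hSpos w
        linarith
      · have := (abs_le.1 (habs w)).1
        linarith
    have h2 := hSle w
    have h3 := hw4 w
    calc (S w - w) ^ 2 ≤ 4 * S w * S w := by linarith
      _ ≤ 4 * ((2 + 2 * z) * (1 + w ^ 4)) * S w := by
        have h5 : S w ≤ (2 + 2 * z) * (1 + w ^ 4) := by nlinarith [sq_nonneg (w ^ 2)]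
        have := hSpos w
        gcongr
      _ = _ := by ring
  have i3 : Integrable fun w => Real.exp (-w ^ 2) * v w := by
    refine integrable_mul_exp_neg_sq (C := 4 * (2 + 2 * z)) (by fun_prop) fun w => ?_
    have h2 := hSsq w
    have h3 := hw4 w
    have h4 : |w * S w| ≤ S w ^ 2 := by
      rw [abs_mul, abs_of_pos (hSpos w), sq]
      exact mul_le_mul_of_nonneg_right (habs w) (hSpos w).le
    calc |v w| ≤ |w * S w| + |w ^ 2| := abs_sub _ _
      _ ≤ S w ^ 2 + w ^ 2 := by rw [abs_of_nonneg (sq_nonneg w)]; linarith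
      _ ≤ _ := by nlinarith [sq_nonneg (w ^ 2)]
  have i2 : Integrable fun w => Real.exp (-w ^ 2) * (2 * w ^ 2 * S w) := by
    refine integrable_mul_exp_neg_sq (C := 2 * (1 + (2 + 2 * z))) (by fun_prop) fun w => ?_
    have h2 := hSle w
    have h3 := hw4 w
    rw [abs_of_nonneg (by have := hSpos w; positivity)]
    have : w ^ 2 * S w ≤ w ^ 2 * (1 + w ^ 2 + 2 * z) := by gcongr
    nlinarith [sq_nonneg (w ^ 2), sq_nonneg w]
  have i4 : Integrable fun w : ℝ => Real.exp (-w ^ 2) * (2 * w ^ 3) := by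
    refine integrable_mul_exp_neg_sq (C := 2) (by fun_prop) fun w => ?_
    rw [abs_mul, abs_pow]
    have : |w| ^ 3 ≤ 1 + |w| ^ 4 := by
      have := abs_nonneg w
      nlinarith [sq_nonneg (|w| ^ 2 - |w|), sq_nonneg (|w| ^ 2 - 1), sq_nonneg (|w| - 1)]
    have h4 : |w| ^ 4 = w ^ 4 := by
      rw [← abs_pow]; exact abs_of_nonneg (by positivity)
    rw [h4] at this
    simpa using this
  have hsplit : ∀ w, -(2 * w) * Real.exp (-w ^ 2) * v w =
      Real.exp (-w ^ 2) * (2 * w ^ 3) - Real.exp (-w ^ 2) * (2 * w ^ 2 * S w) := fun w => by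
    simp only [hv]; ring
  have ibp := integral_mul_deriv_eq_deriv_mul_of_integrable (u := fun w : ℝ => Real.exp (-w ^ 2))
    (u' := fun w => -(2 * w) * Real.exp (-w ^ 2)) (v := v) (v' := fun w => (S w - w) ^ 2 / S w)
    (fun w _ => hud w) (fun w _ => hvd w) i1 (by
      refine (i4.sub i2).congr (Eventually.of_forall fun w => ?_)
      exact (hsplit w).symm) i3
  rw [ibp]
  simp only [hsplit]
  rw [integral_sub i4 i2]
  have hodd : ∫ w : ℝ, Real.exp (-w ^ 2) * (2 * w ^ 3) = 0 := by
    have h := integral_neg_eq_self (fun w : ℝ => Real.exp (-w ^ 2) * (2 * w ^ 3)) volume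
    have h2 : ∀ w : ℝ, Real.exp (-(-w) ^ 2) * (2 * (-w) ^ 3) =
        -(Real.exp (-w ^ 2) * (2 * w ^ 3)) := fun w => by rw [neg_sq]; ring
    simp only [h2] at h
    rw [integral_neg] at h
    linarith
  have heven : ∫ w : ℝ, Real.exp (-w ^ 2) * (2 * w ^ 2 * S w) =
      2 * ∫ w in Ioi (0 : ℝ), Real.exp (-w ^ 2) * (2 * w ^ 2 * S w) := by
    rw [← integral_comp_abs (f := fun w => Real.exp (-w ^ 2) * (2 * w ^ 2 * S w))]
    congr 1
    ext w
    simp [hS]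
  have hsub : ∫ s in Ioi (0 : ℝ), Real.exp (-s) * √s * √(2 * z + s) =
      ∫ w in Ioi (0 : ℝ), Real.exp (-w ^ 2) * (2 * w ^ 2 * S w) := by
    have himg : (fun w : ℝ => w ^ 2) '' Ioi 0 = Ioi 0 := by
      ext s
      constructor
      · rintro ⟨w, hw, rfl⟩
        have : (0 : ℝ) < w := hw
        simp only [mem_Ioi]; positivity
      · intro hs
        exact ⟨√s, Real.sqrt_pos.2 hs, Real.sq_sqrt (le_of_lt hs)⟩
    have h := integral_image_eq_integral_abs_deriv_smul (s := Ioi (0 : ℝ))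
      (f := fun w : ℝ => w ^ 2) (f' := fun w => 2 * w) measurableSet_Ioi
      (fun w _ => by simpa using (hasDerivAt_pow 2 w).hasDerivWithinAt)
      (fun a ha b hb hab => (pow_left_inj₀ (le_of_lt ha) (le_of_lt hb) two_ne_zero).1 hab)
      (fun s => Real.exp (-s) * √s * √(2 * z + s))
    rw [himg] at h
    rw [h]
    refine setIntegral_congr_fun measurableSet_Ioi fun w hw => ?_
    have hw0 : (0 : ℝ) < w := hw
    simp only [smul_eq_mul, hS, Real.sqrt_sq hw0.le, abs_of_pos (by positivity : 0 < 2 * w)]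
    rw [add_comm (2 * z)]
    ring
  rw [hodd, heven, hsub]
  ring

/-- The Laplace transform in time of the heat kernel of `ℝ⁴`. -/
theorem integral_heat {k r : ℝ} (hk : 0 < k) (hr : 0 < r) :
    ∫ s in Ioi (0 : ℝ), Real.exp (-(s * k ^ 2)) * ((4 * Real.pi * s) ^ 2)⁻¹ *
        Real.exp (-(r ^ 2 / (4 * s))) =
      (4 * Real.pi ^ 2 * r ^ 2)⁻¹ * Real.exp (-(k * r)) *
        ∫ s in Ioi (0 : ℝ), Real.exp (-s) * √s * √(2 * (k * r) + s) := by
  have hz : 0 < k * r := by positivity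
  set z := k * r with hzdef
  set S : ℝ → ℝ := fun w => √(w ^ 2 + 2 * z) with hS
  have hSpos : ∀ w, 0 < S w := fun w => Real.sqrt_pos.2 (by positivity)
  have hSsq : ∀ w, S w ^ 2 = w ^ 2 + 2 * z := fun w => Real.sq_sqrt (by positivity)
  have hSd : ∀ w, HasDerivAt S (w / S w) w := by
    intro w
    have h := ((hasDerivAt_pow 2 w).add_const (2 * z)).sqrt (by positivity)
    refine h.congr_deriv ?_
    simp only [hS]
    field_simp
    norm_num
  have habs : ∀ w : ℝ, |w| < S w := fun w => by
    rw [← Real.sqrt_sq_eq_abs]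
    exact Real.sqrt_lt_sqrt (sq_nonneg _) (by linarith)
  -- The substitution is `s = q(w)²`, the inverse of `w = k√s - r/(2√s)`. It completes the square in
  -- the exponent: `k²s + r²/(4s) = w² + kr`.
  set q : ℝ → ℝ := fun w => (w + S w) / (2 * k) with hq
  have hqpos : ∀ w, 0 < q w := fun w => by
    have := (abs_lt.1 (habs w)).1
    have : 0 < w + S w := by linarith
    simp only [hq]; positivity
  have hqd : ∀ w, HasDerivAt (fun w => q w ^ 2) (2 * q w ^ 2 / S w) w := by
    intro w
    have h := ((((hasDerivAt_id w).add (hSd w)).div_const (2 * k)).pow 2)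
    refine h.congr_deriv ?_
    have := (hSpos w).ne'
    simp only [hq, Pi.add_apply, id]
    have hk' := hk.ne'
    push_cast
    field_simp
    ring_nf
  have hqr : ∀ w, r / q w = S w - w := by
    intro w
    rw [div_eq_iff (hqpos w).ne']
    simp only [hq]
    field_simp
    have := hSsq w
    nlinarith
  have hkq : ∀ w, k * q w = (w + S w) / 2 := fun w => by
    simp only [hq]; field_simp
  have himg : (fun w => q w ^ 2) '' univ = Ioi 0 := by
    ext s
    constructor
    · rintro ⟨w, -, rfl⟩
      have := hqpos w
      simp only [mem_Ioi]; positivity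
    · intro hs
      have hs0 : 0 < √s := Real.sqrt_pos.2 hs
      have hss : √s ^ 2 = s := Real.sq_sqrt (le_of_lt hs)
      refine ⟨k * √s - r / (2 * √s), mem_univ _, ?_⟩
      have h1 : S (k * √s - r / (2 * √s)) = k * √s + r / (2 * √s) := by
        have h2 : (k * √s - r / (2 * √s)) ^ 2 + 2 * z = (k * √s + r / (2 * √s)) ^ 2 := by
          rw [hzdef]; field_simp; ring
        simp only [hS]
        rw [h2, Real.sqrt_sq (by positivity)]
      simp only [hq]
      rw [h1]
      have h3 : (k * √s - r / (2 * √s) + (k * √s + r / (2 * √s))) / (2 * k) = √s := by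
        field_simp; ring
      rw [h3, hss]
  have hinj : InjOn (fun w => q w ^ 2) univ := by
    intro a _ b _ hab
    have h1 : q a = q b := (pow_left_inj₀ (hqpos a).le (hqpos b).le two_ne_zero).1 hab
    have h2 : ∀ w, w = k * q w - r / q w / 2 := fun w => by rw [hqr, hkq]; ring
    rw [h2 a, h2 b, h1]
  have h := integral_image_eq_integral_abs_deriv_smul (s := univ)
    (f := fun w => q w ^ 2) (f' := fun w => 2 * q w ^ 2 / S w) MeasurableSet.univ
    (fun w _ => (hqd w).hasDerivWithinAt) hinj
    (fun s => Real.exp (-(s * k ^ 2)) * ((4 * Real.pi * s) ^ 2)⁻¹ * Real.exp (-(r ^ 2 / (4 * s))))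
  rw [himg, setIntegral_univ] at h
  rw [h]
  have hpt : ∀ w, |2 * q w ^ 2 / S w| • (Real.exp (-(q w ^ 2 * k ^ 2)) *
      ((4 * Real.pi * q w ^ 2) ^ 2)⁻¹ * Real.exp (-(r ^ 2 / (4 * q w ^ 2)))) =
      (8 * Real.pi ^ 2 * r ^ 2)⁻¹ * Real.exp (-z) *
        (Real.exp (-w ^ 2) * ((S w - w) ^ 2 / S w)) := by
    intro w
    have hq0 := hqpos w
    have hS0 := hSpos w
    have e1 : Real.exp (-(q w ^ 2 * k ^ 2)) * Real.exp (-(r ^ 2 / (4 * q w ^ 2))) =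
        Real.exp (-z) * Real.exp (-w ^ 2) := by
      rw [← Real.exp_add, ← Real.exp_add]
      congr 1
      have a1 : q w ^ 2 * k ^ 2 = ((w + S w) / 2) ^ 2 := by rw [← hkq]; ring
      have a2 : r ^ 2 / (4 * q w ^ 2) = ((S w - w) / 2) ^ 2 := by rw [← hqr]; field_simp; norm_num
      rw [a1, a2]
      have := hSsq w
      nlinarith
    rw [abs_of_pos (by positivity), smul_eq_mul, ← hqr]
    calc _ = 2 * q w ^ 2 / S w * ((4 * Real.pi * q w ^ 2) ^ 2)⁻¹ *
          (Real.exp (-(q w ^ 2 * k ^ 2)) * Real.exp (-(r ^ 2 / (4 * q w ^ 2)))) := by ring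
      _ = _ := by
        rw [e1]
        field_simp
        norm_num
  simp only [hpt]
  rw [integral_const_mul, integral_exp_neg_mul_sqrt_mul_sqrt hz]
  generalize ∫ s in Ioi (0 : ℝ), Real.exp (-s) * √s * √(2 * z + s) = I
  have : Real.pi ≠ 0 := Real.pi_ne_zero
  field_simp
  ring

/-! ### The Green function and its majorants. -/

theorem measurable_hankelAmp (α : ℝ) : Measurable (hankelAmp α) :=
  ((measurable_hankelAmp_integrand α).stronglyMeasurable.integral_prod_right
    (ν := volume.restrict (Ioi (0 : ℝ)))).measurable

/-- The kernel of `(-Δ + k²)⁻¹` on `ℝ⁴` at distance `r`, for `Re k ≥ 0`. -/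
noncomputable def green (k : ℂ) (r : ℝ) : ℂ :=
  ((4 * Real.pi ^ 2 * r ^ 2 : ℝ) : ℂ)⁻¹ * Complex.exp (-(k * r)) * hankelAmp (1 / 2) (k * r)

theorem measurable_green : Measurable fun q : ℂ × ℝ => green q.1 q.2 := by
  unfold green
  have := measurable_hankelAmp (1 / 2)
  fun_prop

/-- The function `|x|⁻²` cut off to the unit ball. -/
noncomputable def nearInv (x : R4) : ℝ := (Metric.ball (0 : R4) 1).indicator (fun x => (‖x‖ ^ 2)⁻¹) x

theorem nearInv_nonneg (x : R4) : 0 ≤ nearInv x :=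
  indicator_nonneg (fun x _ => by positivity) x

theorem measurable_nearInv : Measurable nearInv :=
  Measurable.indicator (by fun_prop) measurableSet_ball

theorem nearInv_of_lt {x : R4} (hx : ‖x‖ < 1) : nearInv x = (‖x‖ ^ 2)⁻¹ :=
  indicator_of_mem (by simpa using hx) _

theorem integrable_nearInv : Integrable nearInv := by
  unfold nearInv
  rw [integrable_indicator_iff measurableSet_ball]
  refine integrableOn_ball_of_norm_le_rpow (α := 2) (C := 1) ?_ ?_ ?_ ?_
  · simp
  · simp; norm_num
  · refine Eventually.of_forall fun x => ?_
    rw [Real.rpow_neg (norm_nonneg _), Real.norm_of_nonneg (by positivity)]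
    norm_num
  · apply Measurable.aestronglyMeasurable; fun_prop

theorem integrable_exp_neg_mul_norm {a : ℝ} (ha : 0 < a) :
    Integrable fun x : R4 => Real.exp (-a * ‖x‖) := by
  have : Integrable (fun x : R4 => (fun y => Real.exp (-a * y)) ‖x‖) := by
    rw [integrable_fun_norm_addHaar volume (f := fun y => Real.exp (-a * y))]
    have := integrableOn_rpow_mul_exp_neg_mul_rpow (p := 1) (s := (3 : ℕ)) (b := a)
      (by norm_num) one_pos ha
    simpa using this
  exact this

theorem norm_green_le {k : ℂ} {r : ℝ} (hr : 0 ≤ r) :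
    ‖green k r‖ ≤ (r ^ 2)⁻¹ * Real.exp (-k.re * r) * (hankelConst * √(2 * (‖k‖ * r)) + 1) := by
  have h1 := norm_hankelAmp_half_le (k * r)
  rw [norm_mul, Complex.norm_real, Real.norm_of_nonneg hr] at h1
  have hπ : 1 ≤ 4 * Real.pi ^ 2 := by nlinarith [Real.pi_gt_three]
  rw [green, norm_mul, norm_mul, norm_inv, Complex.norm_real, Complex.norm_exp,
    Real.norm_of_nonneg (by positivity)]
  have h2 : (-(k * (r : ℂ))).re = -k.re * r := by simp
  rw [h2]
  have h3 : (4 * Real.pi ^ 2 * r ^ 2)⁻¹ ≤ (r ^ 2)⁻¹ := by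
    rw [mul_inv]
    refine mul_le_of_le_one_left (by positivity) (inv_le_one_of_one_le₀ hπ)
  gcongr

/-- The exponential decay is given up so that the bound holds up to `Re k = 0`: the singularity
`r⁻²` near the origin and a constant elsewhere, uniformly for `k` bounded. This is the majorant for
the dominated convergence arguments that approach the spectrum. -/
theorem norm_green_le_nearInv {k : ℂ} (hk : 0 ≤ k.re) {M : ℝ} (hM : ‖k‖ ≤ M) (x : R4) :
    ‖green k ‖x‖‖ ≤ (hankelConst * √(2 * M) + 1) * (nearInv x + 1) := by
  have hc := hankelConst_nonneg
  have hn := nearInv_nonneg x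
  have hx := norm_nonneg x
  have hM0 : 0 ≤ M := (norm_nonneg k).trans hM
  refine (norm_green_le (norm_nonneg x)).trans ?_
  have he : Real.exp (-k.re * ‖x‖) ≤ 1 := by
    rw [Real.exp_le_one_iff]; nlinarith
  rcases lt_or_ge ‖x‖ 1 with h | h
  · rw [nearInv_of_lt h] at *
    calc (‖x‖ ^ 2)⁻¹ * Real.exp (-k.re * ‖x‖) * (hankelConst * √(2 * (‖k‖ * ‖x‖)) + 1)
        ≤ (‖x‖ ^ 2)⁻¹ * 1 * (hankelConst * √(2 * (M * 1)) + 1) := by gcongr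
      _ ≤ _ := by
        rw [mul_one, mul_one, mul_comm, mul_add]
        have : 0 ≤ (hankelConst * √(2 * M) + 1) * 1 := by positivity
        linarith
  · have h0 : 0 < ‖x‖ := by linarith
    have hs : √(2 * (‖k‖ * ‖x‖)) ≤ √(2 * M) * ‖x‖ ^ 2 := by
      rw [Real.sqrt_le_left (by positivity), mul_pow, Real.sq_sqrt (by positivity)]
      have : ‖x‖ ≤ (‖x‖ ^ 2) ^ 2 := by
        rw [← pow_mul]; exact le_self_pow₀ h (by norm_num)
      calc 2 * (‖k‖ * ‖x‖) ≤ 2 * (M * (‖x‖ ^ 2) ^ 2) := by gcongr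
        _ = _ := by ring
    have hx2 : 1 ≤ ‖x‖ ^ 2 := one_le_pow₀ h
    calc (‖x‖ ^ 2)⁻¹ * Real.exp (-k.re * ‖x‖) * (hankelConst * √(2 * (‖k‖ * ‖x‖)) + 1)
        ≤ (‖x‖ ^ 2)⁻¹ * 1 * (hankelConst * (√(2 * M) * ‖x‖ ^ 2) + 1 * ‖x‖ ^ 2) := by
          gcongr; linarith
      _ = hankelConst * √(2 * M) + 1 := by field_simp
      _ ≤ _ := by nlinarith [mul_nonneg (by positivity : 0 ≤ hankelConst * √(2 * M) + 1) hn]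

/-- The derivative of `green` with respect to `k`. -/
noncomputable def greenDeriv (k : ℂ) (r : ℝ) : ℂ :=
  ((4 * Real.pi ^ 2 * r ^ 2 : ℝ) : ℂ)⁻¹ * (r * Complex.exp (-(k * r)) *
    (hankelAmp (-1 / 2) (k * r) - hankelAmp (1 / 2) (k * r)))

theorem hasDerivAt_green {k : ℂ} (hk : 0 < k.re) {r : ℝ} (hr : 0 < r) :
    HasDerivAt (fun k => green k r) (greenDeriv k r) k := by
  have hk0 : k ≠ 0 := by rintro rfl; simp at hk
  have hkr : HasDerivAt (fun k : ℂ => k * (r : ℂ)) r k := by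
    simpa using (hasDerivAt_id k).mul_const (r : ℂ)
  have h1 : HasDerivAt (hankelAmp (1 / 2)) (hankelAmp (-1 / 2) (k * r)) (k * r) :=
    hasDerivAt_hankelAmp_half (by simpa using (by positivity : 0 ≤ k.re * r))
      (mul_ne_zero hk0 (by exact_mod_cast hr.ne'))
  have h2 : HasDerivAt (fun k : ℂ => hankelAmp (1 / 2) (k * r)) (hankelAmp (-1 / 2) (k * r) * r) k :=
    h1.comp_of_eq (h := fun k : ℂ => k * (r : ℂ)) k hkr rfl
  have h3 := (hkr.neg.cexp.const_mul ((4 * Real.pi ^ 2 * r ^ 2 : ℝ) : ℂ)⁻¹).mul h2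
  refine h3.congr_deriv ?_
  rw [greenDeriv]
  simp only [Pi.neg_apply]
  ring

theorem norm_greenDeriv_le {k : ℂ} (hk : 0 < k.re) {r : ℝ} (hr : 0 ≤ r) :
    ‖greenDeriv k r‖ ≤ (r ^ 2)⁻¹ * (r * Real.exp (-k.re * r) *
      (hankelConst * (2 * (‖k‖ * r)) ^ (-1 / 2 : ℝ) + (hankelConst * √(2 * (‖k‖ * r)) + 1))) := by
  rcases hr.eq_or_lt with rfl | hr0
  · simp [greenDeriv]
  have hk0 : k ≠ 0 := by rintro rfl; simp at hk
  have h1 := norm_hankelAmp_half_le (k * r)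
  have h0 := norm_hankelAmp_le (α := -1 / 2) (by norm_num) (z := k * r)
    (by simpa using (by positivity : 0 ≤ k.re * r)) (mul_ne_zero hk0 (by exact_mod_cast hr0.ne'))
  rw [norm_mul, Complex.norm_real, Real.norm_of_nonneg hr] at h1 h0
  have hπ : 1 ≤ 4 * Real.pi ^ 2 := by nlinarith [Real.pi_gt_three]
  rw [greenDeriv, norm_mul, norm_mul, norm_mul, norm_inv, Complex.norm_real, Complex.norm_real,
    Complex.norm_exp, Real.norm_of_nonneg (by positivity), Real.norm_of_nonneg hr]
  have h2 : (-(k * (r : ℂ))).re = -k.re * r := by simp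
  rw [h2]
  have h3 : (4 * Real.pi ^ 2 * r ^ 2)⁻¹ ≤ (r ^ 2)⁻¹ := by
    rw [mul_inv]
    refine mul_le_of_le_one_left (by positivity) (inv_le_one_of_one_le₀ hπ)
  have h4 := norm_sub_le (hankelAmp (-1 / 2) (k * r)) (hankelAmp (1 / 2) (k * r))
  gcongr
  exact h4.trans (add_le_add h0 h1)

/-- A common majorant for `green` and `greenDeriv`, locally uniform in `Re k > 0`. -/
theorem norm_green_add_norm_greenDeriv_le {k : ℂ} {a M : ℝ} (ha : 0 < a) (hk : a ≤ k.re)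
    (hM : ‖k‖ ≤ M) (x : R4) :
    ‖green k ‖x‖‖ + ‖greenDeriv k ‖x‖‖ ≤
      2 * (hankelConst * (2 * a) ^ (-1 / 2 : ℝ) + (hankelConst * √(2 * M) + 1)) *
        (nearInv x + Real.exp (-a * ‖x‖)) := by
  have hc := hankelConst_nonneg
  have hn := nearInv_nonneg x
  set r := ‖x‖ with hr
  have hr0 : 0 ≤ r := norm_nonneg x
  rcases hr0.eq_or_lt with h0 | hrpos
  · rw [← h0]
    simp only [green, greenDeriv]
    simp
    positivity
  have hkpos : 0 < k.re := ha.trans_le hk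
  have hka : a ≤ ‖k‖ := hk.trans (Complex.re_le_norm k)
  have hM0 : 0 < M := by linarith
  have he : Real.exp (-k.re * r) ≤ Real.exp (-a * r) := by
    gcongr
  set B := hankelConst * (2 * a) ^ (-1 / 2 : ℝ) + (hankelConst * √(2 * M) + 1) with hB
  have hsum : (2 * (‖k‖ * r)) ^ (-1 / 2 : ℝ) ≤ (2 * a) ^ (-1 / 2 : ℝ) * r ^ (-1 / 2 : ℝ) := by
    rw [← Real.mul_rpow (by positivity) hr0, mul_assoc 2 a r]
    exact Real.rpow_le_rpow_of_nonpos (by positivity) (by gcongr) (by norm_num)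
  have hsq : √(2 * (‖k‖ * r)) ≤ √(2 * M) * √r := by
    rw [← Real.sqrt_mul (by positivity), mul_assoc]
    exact Real.sqrt_le_sqrt (by gcongr)
  have g1 := norm_green_le (k := k) hr0
  have g2 := norm_greenDeriv_le hkpos hr0
  have hrp : 0 ≤ r ^ (-1 / 2 : ℝ) := by positivity
  have hap : 0 ≤ (2 * a) ^ (-1 / 2 : ℝ) := by positivity
  -- the amplitude is at most `B r⁻¹` for `r ≤ 1` and `B r` for `r ≥ 1`
  rcases lt_or_ge r 1 with h | h
  · have hnear : nearInv x = (r ^ 2)⁻¹ := nearInv_of_lt h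
    have e1 : Real.exp (-k.re * r) ≤ 1 := by rw [Real.exp_le_one_iff]; nlinarith
    have s1 : √r ≤ 1 := Real.sqrt_le_one.2 h.le
    have p1 : r * r ^ (-1 / 2 : ℝ) ≤ 1 := by
      have : r * r ^ (-1 / 2 : ℝ) = r ^ (1 / 2 : ℝ) := by
        nth_rewrite 1 [← Real.rpow_one r]
        rw [← Real.rpow_add hrpos]; norm_num
      rw [this]
      exact Real.rpow_le_one hr0 h.le (by norm_num)
    have c1 : ‖green k r‖ ≤ (r ^ 2)⁻¹ * B := by
      refine g1.trans ?_
      calc _ ≤ (r ^ 2)⁻¹ * 1 * (hankelConst * (√(2 * M) * 1) + 1) := by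
            gcongr
            exact hsq.trans (by gcongr)
        _ ≤ _ := by
            rw [mul_one, mul_one, hB]
            refine mul_le_mul_of_nonneg_left ?_ (by positivity)
            linarith [mul_nonneg hc hap]
    have c2 : ‖greenDeriv k r‖ ≤ (r ^ 2)⁻¹ * B := by
      refine g2.trans ?_
      gcongr
      calc _ ≤ r * 1 * (hankelConst * ((2 * a) ^ (-1 / 2 : ℝ) * r ^ (-1 / 2 : ℝ)) +
            (hankelConst * (√(2 * M) * 1) + 1)) := by
            gcongr
            exact hsq.trans (by gcongr)
        _ = hankelConst * (2 * a) ^ (-1 / 2 : ℝ) * (r * r ^ (-1 / 2 : ℝ)) +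
            r * (hankelConst * √(2 * M) + 1) := by ring
        _ ≤ hankelConst * (2 * a) ^ (-1 / 2 : ℝ) * 1 + 1 * (hankelConst * √(2 * M) + 1) := by
            gcongr
        _ = B := by rw [hB]; ring
    rw [hnear]
    have hBpos : 0 ≤ B := by positivity
    have : 0 ≤ 2 * B * Real.exp (-a * r) := by positivity
    nlinarith
  · have s1 : √r ≤ r := by
      rw [Real.sqrt_le_left hr0]; nlinarith
    have p1 : r ^ (-1 / 2 : ℝ) ≤ r := by
      refine (Real.rpow_le_one_of_one_le_of_nonpos h (by norm_num)).trans h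
    have c2 : r * (hankelConst * (2 * (‖k‖ * r)) ^ (-1 / 2 : ℝ) +
        (hankelConst * √(2 * (‖k‖ * r)) + 1)) ≤ r ^ 2 * B := by
      calc _ ≤ r * (hankelConst * ((2 * a) ^ (-1 / 2 : ℝ) * r) +
            (hankelConst * (√(2 * M) * r) + r)) := by
            gcongr
            · exact hsum.trans (by gcongr)
            · exact hsq.trans (by gcongr)
        _ = r ^ 2 * B := by rw [hB]; ring
    have c1 : hankelConst * √(2 * (‖k‖ * r)) + 1 ≤ r ^ 2 * B := by
      refine le_trans ?_ c2
      have h5 : 0 ≤ hankelConst * (2 * (‖k‖ * r)) ^ (-1 / 2 : ℝ) := by positivity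
      have h6 : 0 ≤ hankelConst * √(2 * (‖k‖ * r)) + 1 := by positivity
      nlinarith
    have hE := Real.exp_pos (-a * r)
    have d1 : ‖green k r‖ ≤ Real.exp (-a * r) * B := by
      refine g1.trans ?_
      calc _ ≤ (r ^ 2)⁻¹ * Real.exp (-a * r) * (r ^ 2 * B) := by gcongr
        _ = _ := by field_simp
    have d2 : ‖greenDeriv k r‖ ≤ Real.exp (-a * r) * B := by
      refine g2.trans ?_
      calc (r ^ 2)⁻¹ * (r * Real.exp (-k.re * r) *
          (hankelConst * (2 * (‖k‖ * r)) ^ (-1 / 2 : ℝ) + (hankelConst * √(2 * (‖k‖ * r)) + 1)))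
          = (r ^ 2)⁻¹ * Real.exp (-k.re * r) * (r * (hankelConst * (2 * (‖k‖ * r)) ^ (-1 / 2 : ℝ) +
            (hankelConst * √(2 * (‖k‖ * r)) + 1))) := by ring
        _ ≤ (r ^ 2)⁻¹ * Real.exp (-a * r) * (r ^ 2 * B) := by gcongr
        _ = _ := by field_simp
    have hBpos : 0 ≤ B := by positivity
    have : 0 ≤ 2 * B * nearInv x := by positivity
    nlinarith

theorem measurable_green_norm (k : ℂ) : Measurable fun x : R4 => green k ‖x‖ :=
  Measurable.comp (g := fun q : ℂ × ℝ => green q.1 q.2) (f := fun x : R4 => (k, ‖x‖))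
    measurable_green (by fun_prop)

theorem integrable_green {k : ℂ} (hk : 0 < k.re) : Integrable fun x : R4 => green k ‖x‖ := by
  refine Integrable.mono' ((integrable_nearInv.add (integrable_exp_neg_mul_norm hk)).const_mul
    (2 * (hankelConst * (2 * k.re) ^ (-1 / 2 : ℝ) + (hankelConst * √(2 * ‖k‖) + 1))))
    (measurable_green_norm k).aestronglyMeasurable (Eventually.of_forall fun x => ?_)
  have := norm_green_add_norm_greenDeriv_le hk le_rfl le_rfl x
  have h2 := norm_nonneg (greenDeriv k ‖x‖)
  simp only [Pi.add_apply]
  linarith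

/-! ### The Fourier transform of the Green function. -/

theorem continuous_fourierChar_inner (ξ : R4) :
    Continuous fun x : R4 => ((Real.fourierChar (-inner ℝ x ξ) : Circle) : ℂ) :=
  continuous_subtype_val.comp (Real.continuous_fourierChar.comp (by fun_prop))

theorem hankelAmp_half_ofReal {z : ℝ} (hz : 0 ≤ z) :
    hankelAmp (1 / 2) z =
      ((∫ s in Ioi (0 : ℝ), Real.exp (-s) * √s * √(2 * z + s) : ℝ) : ℂ) := by
  rw [hankelAmp, ← integral_complex_ofReal]
  refine setIntegral_congr_fun measurableSet_Ioi fun s hs => ?_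
  have hs0 : (0 : ℝ) < s := hs
  rw [Real.sqrt_eq_rpow (2 * z + s)]
  push_cast [Complex.ofReal_cpow (by positivity : 0 ≤ 2 * z + s)]
  ring

theorem green_ofReal {k r : ℝ} (hk : 0 < k) (hr : 0 < r) :
    green k r = ((∫ s in Ioi (0 : ℝ), Real.exp (-(s * k ^ 2)) * ((4 * Real.pi * s) ^ 2)⁻¹ *
        Real.exp (-(r ^ 2 / (4 * s))) : ℝ) : ℂ) := by
  rw [integral_heat hk hr, green, ← Complex.ofReal_mul k r, hankelAmp_half_ofReal (by positivity)]
  push_cast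
  ring

theorem integral_heat_space {s : ℝ} (hs : 0 < s) :
    ∫ x : R4, Real.exp (-(‖x‖ ^ 2 / (4 * s))) = (4 * Real.pi * s) ^ 2 := by
  have h := GaussianFourier.integral_rexp_neg_mul_sq_norm (V := R4) (b := 1 / (4 * s)) (by positivity)
  have h2 : ∀ x : R4, -(‖x‖ ^ 2 / (4 * s)) = -(1 / (4 * s)) * ‖x‖ ^ 2 := fun x => by ring
  simp only [h2]
  rw [h]
  have h3 : ((Module.finrank ℝ R4 : ℝ) / 2) = (2 : ℕ) := by simp; norm_num
  rw [h3, Real.rpow_natCast]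
  field_simp

theorem integrable_heat_space {s : ℝ} (hs : 0 < s) :
    Integrable fun x : R4 => Real.exp (-(‖x‖ ^ 2 / (4 * s))) := by
  by_contra hcon
  have h := integral_heat_space hs
  rw [integral_undef hcon] at h
  have : 0 < (4 * Real.pi * s) ^ 2 := by positivity
  linarith

theorem fourier_heat {s : ℝ} (hs : 0 < s) (ξ : R4) :
    𝓕 (fun x : R4 => ((Real.exp (-(‖x‖ ^ 2 / (4 * s))) : ℝ) : ℂ)) ξ =
      (((4 * Real.pi * s) ^ 2 * Real.exp (-(s * (4 * Real.pi ^ 2 * ‖ξ‖ ^ 2))) : ℝ) : ℂ) := by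
  have hb : 0 < (((1 / (4 * s) : ℝ)) : ℂ).re := by
    rw [Complex.ofReal_re]; positivity
  have h := fourier_gaussian_innerProductSpace (V := R4) hb ξ
  have h1 : (fun x : R4 => ((Real.exp (-(‖x‖ ^ 2 / (4 * s))) : ℝ) : ℂ)) =
      fun x : R4 => Complex.exp (-((1 / (4 * s) : ℝ) : ℂ) * ‖x‖ ^ 2) := by
    ext x
    push_cast
    congr 1
    ring
  rw [h1, h]
  have h3 : ((Module.finrank ℝ R4 : ℂ) / 2) = (2 : ℕ) := by simp; norm_num
  have hs' : (s : ℂ) ≠ 0 := by exact_mod_cast hs.ne'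
  rw [h3, Complex.cpow_natCast]
  push_cast
  congr 1
  · field_simp
  · congr 1
    field_simp

/-- For real `k` the Green function is the Laplace transform in time of the heat kernel, so Fubini
reduces the claim to the Fourier transform of a Gaussian and `∫ e^{-(k² + 4π²|ξ|²)s} ds`. -/
theorem fourier_green_ofReal {k : ℝ} (hk : 0 < k) (ξ : R4) :
    𝓕 (fun x : R4 => green k ‖x‖) ξ = ((4 * Real.pi ^ 2 * ‖ξ‖ ^ 2 : ℝ) + (k : ℂ) ^ 2)⁻¹ := by
  set H : R4 × ℝ → ℝ := fun q => Real.exp (-(q.2 * k ^ 2)) * ((4 * Real.pi * q.2) ^ 2)⁻¹ *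
        Real.exp (-(‖q.1‖ ^ 2 / (4 * q.2))) with hH
  have hHm : Measurable H := by
    simp only [hH]; fun_prop
  have hHint : Integrable H (volume.prod (volume.restrict (Ioi (0 : ℝ)))) := by
    rw [integrable_prod_iff' hHm.aestronglyMeasurable]
    constructor
    · filter_upwards [self_mem_ae_restrict measurableSet_Ioi] with s hs
      exact (integrable_heat_space hs).const_mul
        (Real.exp (-(s * k ^ 2)) * ((4 * Real.pi * s) ^ 2)⁻¹)
    · have : IntegrableOn (fun s : ℝ => Real.exp (-k ^ 2 * s)) (Ioi 0) :=
        integrableOn_exp_mul_Ioi (by nlinarith) 0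
      refine this.congr_fun (fun s hs => ?_) measurableSet_Ioi
      have hs0 : (0 : ℝ) < s := hs
      have h1 : ∀ x : R4, ‖H (x, s)‖ = Real.exp (-(s * k ^ 2)) * ((4 * Real.pi * s) ^ 2)⁻¹ *
          Real.exp (-(‖x‖ ^ 2 / (4 * s))) := fun x => Real.norm_of_nonneg (by positivity)
      simp only [h1]
      rw [integral_const_mul, integral_heat_space hs0]
      have : Real.pi ≠ 0 := Real.pi_ne_zero
      have h2 : (4 * Real.pi * s) ^ 2 ≠ 0 := by positivity
      rw [mul_assoc, inv_mul_cancel₀ h2, mul_one]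
      congr 1; ring
  have hae : ∀ᵐ x : R4, x ≠ 0 := by simp [ae_iff]
  have h1 : 𝓕 (fun x : R4 => green k ‖x‖) ξ =
      ∫ x : R4, ∫ s in Ioi (0 : ℝ), Real.fourierChar (-inner ℝ x ξ) • ((H (x, s) : ℝ) : ℂ) := by
    rw [Real.fourier_eq]
    apply integral_congr_ae
    filter_upwards [hae] with x hx
    rw [green_ofReal hk (norm_pos_iff.2 hx), ← integral_complex_ofReal]
    simp only [Circle.smul_def, smul_eq_mul]
    rw [integral_const_mul]
  rw [h1, integral_integral_swap]
  · have h2 : ∀ s ∈ Ioi (0 : ℝ),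
        ∫ x : R4, Real.fourierChar (-inner ℝ x ξ) • ((H (x, s) : ℝ) : ℂ) =
        ((Real.exp (-(k ^ 2 + 4 * Real.pi ^ 2 * ‖ξ‖ ^ 2) * s) : ℝ) : ℂ) := by
      intro s hs
      have hs0 : (0 : ℝ) < s := hs
      have h3 : ∀ x : R4, Real.fourierChar (-inner ℝ x ξ) • ((H (x, s) : ℝ) : ℂ) =
          ((Real.exp (-(s * k ^ 2)) * ((4 * Real.pi * s) ^ 2)⁻¹ : ℝ) : ℂ) *
          (Real.fourierChar (-inner ℝ x ξ) • ((Real.exp (-(‖x‖ ^ 2 / (4 * s))) : ℝ) : ℂ)) := by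
        intro x
        simp only [hH, Circle.smul_def, smul_eq_mul]
        push_cast
        ring
      simp only [h3]
      rw [integral_const_mul, ← Real.fourier_eq
        (fun x : R4 => ((Real.exp (-(‖x‖ ^ 2 / (4 * s))) : ℝ) : ℂ)), fourier_heat hs0,
        ← Complex.ofReal_mul]
      congr 1
      have h2 : (4 * Real.pi * s) ^ 2 ≠ 0 := by positivity
      rw [mul_assoc, ← mul_assoc _ ((4 * Real.pi * s) ^ 2) _, inv_mul_cancel₀ h2, one_mul,
        ← Real.exp_add]
      congr 1
      ring
    rw [setIntegral_congr_fun measurableSet_Ioi h2, integral_complex_ofReal,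
      integral_exp_mul_Ioi (by nlinarith [sq_nonneg (Real.pi * ‖ξ‖)]) 0]
    push_cast
    simp
    rw [← neg_add, div_neg, neg_div, neg_neg, one_div]
  · refine (hHint.ofReal (𝕜 := ℂ)).norm.mono' ?_ (Eventually.of_forall fun q => ?_)
    · refine AEStronglyMeasurable.smul ?_ (hHm.complex_ofReal).aestronglyMeasurable
      exact ((continuous_fourierChar_inner ξ).comp (continuous_fst (Y := ℝ))).aestronglyMeasurable
    · simp only [Function.uncurry, Circle.smul_def, norm_smul, Circle.norm_coe, one_mul]
      exact le_rfl

theorem isPreconnected_re_pos : IsPreconnected {k : ℂ | 0 < k.re} :=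
  (convex_halfSpace_re_gt 0).isPreconnected

theorem isOpen_re_pos : IsOpen {k : ℂ | 0 < k.re} :=
  isOpen_lt continuous_const Complex.continuous_re

/-- Holomorphy in `k` at fixed `ξ`, needed to continue the formula from positive `k` to the half
plane `Re k > 0`. -/
theorem differentiableOn_fourier_green (ξ : R4) :
    DifferentiableOn ℂ (fun k => 𝓕 (fun x : R4 => green k ‖x‖) ξ) {k : ℂ | 0 < k.re} := by
  intro k₀ hk₀
  have hk₀' : 0 < k₀.re := hk₀
  refine DifferentiableAt.differentiableWithinAt ?_
  set a := k₀.re / 2 with ha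
  have ha0 : 0 < a := by positivity
  have hball : ∀ k ∈ Metric.ball k₀ a, a ≤ k.re ∧ ‖k‖ ≤ ‖k₀‖ + a := by
    intro k hk
    have h1 : ‖k - k₀‖ < a := mem_ball_iff_norm.1 hk
    have h2 := (Complex.abs_re_le_norm (k - k₀)).trans h1.le
    rw [Complex.sub_re, abs_le] at h2
    constructor
    · linarith
    · have := norm_le_norm_add_norm_sub' k k₀
      linarith
  have hae : ∀ᵐ x : R4, x ≠ 0 := by simp [ae_iff]
  have key := hasDerivAt_integral_of_dominated_loc_of_deriv_le (μ := (volume : Measure R4))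
    (F := fun (k : ℂ) (x : R4) => Real.fourierChar (-inner ℝ x ξ) • green k ‖x‖)
    (F' := fun (k : ℂ) (x : R4) => Real.fourierChar (-inner ℝ x ξ) • greenDeriv k ‖x‖)
    (x₀ := k₀) (s := Metric.ball k₀ a)
    (bound := fun x => 2 * (hankelConst * (2 * a) ^ (-1 / 2 : ℝ) +
      (hankelConst * √(2 * (‖k₀‖ + a)) + 1)) * (nearInv x + Real.exp (-a * ‖x‖)))
    (Metric.ball_mem_nhds _ ha0) (Eventually.of_forall fun k => ?_)
    ((Real.fourierIntegral_convergent_iff ξ).2 (integrable_green hk₀')) ?_ ?_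
    ((integrable_nearInv.add (integrable_exp_neg_mul_norm ha0)).const_mul _) ?_
  · have h := key.2.differentiableAt
    have he : (fun k => 𝓕 (fun x : R4 => green k ‖x‖) ξ) =
        fun k => ∫ x : R4, Real.fourierChar (-inner ℝ x ξ) • green k ‖x‖ := by
      ext k
      rw [Real.fourier_eq]
    rw [he]
    exact h
  · refine AEStronglyMeasurable.smul ?_ (measurable_green_norm k).aestronglyMeasurable
    exact (continuous_fourierChar_inner ξ).aestronglyMeasurable
  · refine AEStronglyMeasurable.smul ?_ ?_
    · exact (continuous_fourierChar_inner ξ).aestronglyMeasurable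
    · apply Measurable.aestronglyMeasurable
      unfold greenDeriv
      have h1 := measurable_hankelAmp (1 / 2)
      have h2 := measurable_hankelAmp (-1 / 2)
      fun_prop
  · refine Eventually.of_forall fun x k hk => ?_
    have := norm_green_add_norm_greenDeriv_le ha0 (hball k hk).1 (hball k hk).2 x
    rw [Circle.smul_def, norm_smul]
    simp only [Circle.norm_coe, one_mul]
    linarith [norm_nonneg (green k ‖x‖)]
  · filter_upwards [hae] with x hx k hk
    have hk' : 0 < k.re := ha0.trans_le (hball k hk).1
    have := (hasDerivAt_green hk' (norm_pos_iff.2 hx)).const_mul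
      ((Real.fourierChar (-inner ℝ x ξ) : Circle) : ℂ)
    simpa only [Circle.smul_def, smul_eq_mul] using this

theorem four_pi_sq_add_ne_zero {k : ℂ} (hk : 0 < k.re) {t : ℝ} (ht : 0 ≤ t) :
    ((t : ℂ) + k ^ 2) ≠ 0 := by
  intro h
  have hre := congrArg Complex.re h
  have him := congrArg Complex.im h
  simp only [sq, Complex.add_re, Complex.add_im, Complex.ofReal_re, Complex.ofReal_im,
    Complex.mul_re, Complex.mul_im, Complex.zero_re, Complex.zero_im] at hre him
  have h0 : k.im = 0 := by
    have : k.re * k.im = 0 := by linarith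
    exact (mul_eq_zero.1 this).resolve_left hk.ne'
  rw [h0] at hre
  nlinarith

/-- The Fourier transform of the Green function. -/
theorem fourier_green {k : ℂ} (hk : 0 < k.re) (ξ : R4) :
    𝓕 (fun x : R4 => green k ‖x‖) ξ = ((4 * Real.pi ^ 2 * ‖ξ‖ ^ 2 : ℝ) + k ^ 2)⁻¹ := by
  have hU := isOpen_re_pos
  have h1 : AnalyticOnNhd ℂ (fun k => 𝓕 (fun x : R4 => green k ‖x‖) ξ) {k : ℂ | 0 < k.re} :=
    (differentiableOn_fourier_green ξ).analyticOnNhd hU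
  have h2 : AnalyticOnNhd ℂ (fun k : ℂ => ((4 * Real.pi ^ 2 * ‖ξ‖ ^ 2 : ℝ) + k ^ 2)⁻¹)
      {k : ℂ | 0 < k.re} := by
    refine DifferentiableOn.analyticOnNhd ?_ hU
    intro k hk
    refine DifferentiableAt.differentiableWithinAt ?_
    exact DifferentiableAt.inv (by fun_prop) (four_pi_sq_add_ne_zero hk (by positivity))
  -- Identity theorem: the two holomorphic functions agree on positive reals, which accumulate at
  -- `1`.
  refine h1.eqOn_of_preconnected_of_frequently_eq h2 isPreconnected_re_pos
    (z₀ := 1) (by simp) ?_ hk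
  have hfreq : ∃ᶠ t : ℝ in 𝓝[≠] 1, 0 < t := by
    refine Eventually.frequently ?_
    exact eventually_nhdsWithin_of_eventually_nhds (lt_mem_nhds one_pos)
  have htend : Tendsto (fun t : ℝ => (t : ℂ)) (𝓝[≠] 1) (𝓝[≠] 1) := by
    refine tendsto_nhdsWithin_of_tendsto_nhds_of_eventually_within _ ?_ ?_
    · exact (Complex.continuous_ofReal.tendsto 1).mono_left nhdsWithin_le_nhds
    · filter_upwards [self_mem_nhdsWithin] with t ht
      simpa using ht
  refine htend.frequently (hfreq.mono fun t ht => ?_)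
  exact fourier_green_ofReal ht ξ

/-! ### The jump of the Green function across the spectrum. -/

theorem ofReal_mul_cpow {a : ℝ} (ha : 0 < a) (z : ℂ) (c : ℂ) (hc : c ≠ 0) :
    ((a : ℂ) * z) ^ c = (a : ℂ) ^ c * z ^ c := by
  rcases eq_or_ne z 0 with rfl | hz
  · simp [hc]
  · have ha' : (a : ℂ) ≠ 0 := by exact_mod_cast ha.ne'
    rw [Complex.cpow_def_of_ne_zero (mul_ne_zero ha' hz), Complex.cpow_def_of_ne_zero ha',
      Complex.cpow_def_of_ne_zero hz, Complex.log_ofReal_mul ha hz, ← Complex.exp_add,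
      Complex.ofReal_log ha.le]
    ring_nf

/-- The radial profile `∫_{-1}^{1} (1 - s²)^{1/2} e^{iρs} ds` of the Fourier transform of the
surface measure of the unit sphere of `ℝ⁴`. -/
noncomputable def sphereProfile (ρ : ℝ) : ℂ :=
  ∫ s in (-1 : ℝ)..1, (√(1 - s ^ 2) : ℂ) * Complex.exp (Complex.I * (ρ * s : ℝ))

/-- Scaling `s = ρy` turns the integral of `e^{iρt}(1-t²)^{1/2}` along a vertical half line issuing
from `t = ±1` into the amplitude; `b = ∓i` are the two cases needed. The square root may be split
because one factor is a positive real. -/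
theorem integral_exp_neg_mul_cpow {ρ : ℝ} (hρ : 0 < ρ) (b : ℂ) :
    ∫ y in Ioi (0 : ℝ), (Real.exp (-(ρ * y)) : ℂ) * ((y : ℂ) ^ 2 + 2 * b * y) ^ (1 / 2 : ℂ) =
      ((ρ : ℂ) ^ 2)⁻¹ * hankelAmp (1 / 2) (b * ρ) := by
  have h := integral_comp_mul_left_Ioi (fun s : ℝ => ((Real.exp (-s) * √s : ℝ) : ℂ) *
    (2 * (b * ρ) + s) ^ (((1 / 2 : ℝ)) : ℂ)) 0 hρ
  rw [mul_zero] at h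
  have h1 : hankelAmp (1 / 2) (b * ρ) = (ρ : ℂ) *
      ∫ y in Ioi (0 : ℝ), ((Real.exp (-(ρ * y)) * √(ρ * y) : ℝ) : ℂ) *
        (2 * (b * ρ) + ((ρ * y : ℝ) : ℂ)) ^ (((1 / 2 : ℝ)) : ℂ) := by
    rw [h, hankelAmp, Complex.real_smul, Complex.ofReal_inv,
      mul_inv_cancel_left₀ (by exact_mod_cast hρ.ne')]
  rw [h1, ← mul_assoc]
  have hρ' : (ρ : ℂ) ≠ 0 := by exact_mod_cast hρ.ne'
  have h2 : ((ρ : ℂ) ^ 2)⁻¹ * ρ = (ρ : ℂ)⁻¹ := by field_simp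
  rw [h2, ← integral_const_mul]
  refine setIntegral_congr_fun measurableSet_Ioi fun y hy => ?_
  have hy0 : (0 : ℝ) < y := hy
  have hhalf : (((1 / 2 : ℝ)) : ℂ) = (1 / 2 : ℂ) := by norm_num
  have e1 : (y : ℂ) ^ 2 + 2 * b * y = (y : ℂ) * (2 * b + y) := by ring
  have e2 : 2 * (b * ρ) + ((ρ * y : ℝ) : ℂ) = (ρ : ℂ) * (2 * b + y) := by push_cast; ring
  have e3 : ∀ t : ℝ, 0 < t → (t : ℂ) ^ (1 / 2 : ℂ) = (√t : ℝ) := by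
    intro t ht
    rw [Real.sqrt_eq_rpow, Complex.ofReal_cpow ht.le]
    norm_num
  have e4 : ((√ρ : ℝ) : ℂ) * (√ρ : ℝ) = ρ := by
    rw [← Complex.ofReal_mul, Real.mul_self_sqrt hρ.le]
  rw [hhalf, e1, e2, ofReal_mul_cpow hy0 _ _ (by norm_num), ofReal_mul_cpow hρ _ _ (by norm_num),
    e3 y hy0, e3 ρ hρ, Real.sqrt_mul hρ.le]
  push_cast
  have : (ρ : ℂ)⁻¹ * (Complex.exp (-(ρ * y)) * (((√ρ : ℝ) : ℂ) * ((√y : ℝ) : ℂ)) *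
      (((√ρ : ℝ) : ℂ) * (2 * b + y) ^ (1 / 2 : ℂ))) = (ρ : ℂ)⁻¹ * (((√ρ : ℝ) : ℂ) * (√ρ : ℝ)) *
      (Complex.exp (-(ρ * y)) * (((√y : ℝ) : ℂ) * (2 * b + y) ^ (1 / 2 : ℂ))) := by ring
  rw [this, e4, inv_mul_cancel₀ hρ', one_mul]

theorem integrableOn_exp_neg_mul_cpow {ρ : ℝ} (hρ : 0 < ρ) {b : ℂ} (hb : ‖b‖ ≤ 1) :
    IntegrableOn (fun y : ℝ => (Real.exp (-(ρ * y)) : ℂ) *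
      ((y : ℂ) ^ 2 + 2 * b * y) ^ (1 / 2 : ℂ)) (Ioi 0) := by
  have h1 := integrableOn_rpow_mul_exp_neg_mul_rpow (p := 1) (s := 1) (b := ρ)
    (by norm_num) one_pos hρ
  have h0 := integrableOn_rpow_mul_exp_neg_mul_rpow (p := 1) (s := 0) (b := ρ)
    (by norm_num) one_pos hρ
  refine Integrable.mono' (h1.add h0) ?_ ?_
  · apply Measurable.aestronglyMeasurable
    fun_prop
  · filter_upwards [self_mem_ae_restrict measurableSet_Ioi] with y hy
    have hy0 : (0 : ℝ) < y := hy
    have hhalf : (1 / 2 : ℂ) = (((1 / 2 : ℝ)) : ℂ) := by norm_num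
    rw [hhalf, norm_mul, Complex.norm_cpow_real, ← Real.sqrt_eq_rpow, Complex.norm_real,
      Real.norm_of_nonneg (Real.exp_pos _).le]
    have h2 : √‖(y : ℂ) ^ 2 + 2 * b * y‖ ≤ y + 1 := by
      rw [Real.sqrt_le_left (by positivity)]
      refine (norm_add_le _ _).trans ?_
      simp only [norm_pow, norm_mul, Complex.norm_real, Complex.norm_ofNat,
        Real.norm_of_nonneg hy0.le]
      nlinarith
    calc Real.exp (-(ρ * y)) * √‖(y : ℂ) ^ 2 + 2 * b * y‖
        ≤ Real.exp (-(ρ * y)) * (y + 1) := by gcongr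
      _ = _ := by simp; ring

/-- Cauchy's theorem for `e^{iρt}(1-t²)^{1/2}` on the rectangle over `[-1,1]` of height `R`. As `R →
∞` the top side vanishes because of `e^{-ρR}`, the vertical sides give the two amplitudes, and the
base gives `sphereProfile`. -/
theorem exp_mul_hankelAmp_sub {ρ : ℝ} (hρ : 0 < ρ) :
    Complex.exp (Complex.I * ρ) * hankelAmp (1 / 2) (-Complex.I * ρ) -
      Complex.exp (-(Complex.I * ρ)) * hankelAmp (1 / 2) (Complex.I * ρ) =
      Complex.I * ρ ^ 2 * sphereProfile ρ := by
  set F : ℂ → ℂ := fun t => Complex.exp (Complex.I * ρ * t) * (1 - t ^ 2) ^ (1 / 2 : ℂ) with hF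
  have hre : ∀ x y : ℝ, (1 - ((x : ℂ) + y * Complex.I) ^ 2).re = 1 - x ^ 2 + y ^ 2 := by
    intro x y; simp [sq]; ring
  have him : ∀ x y : ℝ, (1 - ((x : ℂ) + y * Complex.I) ^ 2).im = -(2 * x * y) := by
    intro x y; simp [sq]; ring
  have hrect : ∀ R : ℝ, 0 < R →
      ((∫ x : ℝ in (-1 : ℝ)..1, F x) - (∫ x : ℝ in (-1 : ℝ)..1, F (x + R * Complex.I))) +
        Complex.I * (∫ y : ℝ in (0 : ℝ)..R, F (1 + y * Complex.I)) -
        Complex.I * (∫ y : ℝ in (0 : ℝ)..R, F (-1 + y * Complex.I)) = 0 := by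
    intro R hR
    have h := Complex.integral_boundary_rect_eq_zero_of_continuousOn_of_differentiableOn F
      (-1 : ℂ) (1 + R * Complex.I) ?_ ?_
    · simpa using h
    · intro t ht
      rw [Complex.mem_reProdIm] at ht
      obtain ⟨h1, h2⟩ := ht
      simp only [Complex.neg_re, Complex.one_re, Complex.add_re, Complex.mul_re, Complex.ofReal_re,
        Complex.I_re, mul_zero, Complex.ofReal_im, Complex.I_im, mul_one, sub_self, add_zero,
        Complex.neg_im, Complex.one_im, neg_zero, Complex.add_im, Complex.mul_im, zero_add] at h1 h2
      rw [uIcc_of_le (by norm_num)] at h1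
      rw [uIcc_of_le hR.le] at h2
      have ht : t = (t.re : ℂ) + t.im * Complex.I := (Complex.re_add_im t).symm
      refine ContinuousAt.continuousWithinAt ?_
      refine ContinuousAt.mul (by fun_prop) ?_
      -- At the corners `t = ±1` the square root sits at its branch point. It is still continuous
      -- there, and Cauchy's theorem asks only for continuity on the closed rectangle.
      by_cases h0 : (1 - t ^ 2) = 0
      · have : ContinuousAt (fun z : ℂ => z ^ (1 / 2 : ℂ)) (1 - t ^ 2) := by
          rw [h0]
          have hh : (1 / 2 : ℂ) = (((1 / 2 : ℝ)) : ℂ) := by norm_num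
          rw [hh]
          exact Complex.continuousAt_cpow_zero_of_re_pos (z := (((1 / 2 : ℝ)) : ℂ))
            (by simp) |>.comp_of_eq (f := fun z : ℂ => (z, (((1 / 2 : ℝ)) : ℂ))) (by fun_prop) rfl
        exact this.comp_of_eq (f := fun t : ℂ => 1 - t ^ 2) (by fun_prop) rfl
      · refine ContinuousAt.cpow (by fun_prop) continuousAt_const ?_
        rw [Complex.mem_slitPlane_iff]
        by_contra hcon
        rw [not_or, not_lt, not_not] at hcon
        have hr := hre t.re t.im
        have hi := him t.re t.im
        rw [← ht] at hr hi
        rw [hr, hi] at hcon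
        have a1 : t.re ^ 2 ≤ 1 := by nlinarith [h1.1, h1.2]
        have a2 : t.im = 0 := by nlinarith [hcon.1, sq_nonneg t.im]
        apply h0
        apply Complex.ext
        · rw [hr, a2]; rw [a2] at hcon; simp; nlinarith [hcon.1]
        · rw [hi, a2]; simp
    · intro t ht
      rw [Complex.mem_reProdIm] at ht
      obtain ⟨h1, h2⟩ := ht
      simp only [Complex.neg_re, Complex.one_re, Complex.add_re, Complex.mul_re, Complex.ofReal_re,
        Complex.I_re, mul_zero, Complex.ofReal_im, Complex.I_im, mul_one, sub_self, add_zero,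
        Complex.neg_im, Complex.one_im, neg_zero, Complex.add_im, Complex.mul_im, zero_add] at h1 h2
      rw [min_eq_left (by norm_num), max_eq_right (by norm_num)] at h1
      have ht : t = (t.re : ℂ) + t.im * Complex.I := (Complex.re_add_im t).symm
      refine DifferentiableAt.differentiableWithinAt ?_
      refine DifferentiableAt.mul (by fun_prop) ?_
      refine DifferentiableAt.cpow (by fun_prop) (by fun_prop) ?_
      left
      have hr := hre t.re t.im
      rw [← ht] at hr
      rw [hr]
      nlinarith [h1.1, h1.2, sq_nonneg t.im]
  have hF1 : ∀ y : ℝ, F (1 + y * Complex.I) = Complex.exp (Complex.I * ρ) *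
      ((Real.exp (-(ρ * y)) : ℂ) * ((y : ℂ) ^ 2 + 2 * (-Complex.I) * y) ^ (1 / 2 : ℂ)) := by
    intro y
    simp only [hF]
    rw [← mul_assoc, Complex.ofReal_exp, ← Complex.exp_add]
    have e1 : Complex.I * ρ * (1 + y * Complex.I) = Complex.I * ρ + ((-(ρ * y) : ℝ) : ℂ) := by
      push_cast; linear_combination (ρ * y : ℂ) * Complex.I_sq
    have e2 : (1 : ℂ) - (1 + y * Complex.I) ^ 2 = (y : ℂ) ^ 2 + 2 * (-Complex.I) * y := by
      linear_combination (-(y : ℂ) ^ 2) * Complex.I_sq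
    rw [e1, e2]
  have hF2 : ∀ y : ℝ, F (-1 + y * Complex.I) = Complex.exp (-(Complex.I * ρ)) *
      ((Real.exp (-(ρ * y)) : ℂ) * ((y : ℂ) ^ 2 + 2 * Complex.I * y) ^ (1 / 2 : ℂ)) := by
    intro y
    simp only [hF]
    rw [← mul_assoc, Complex.ofReal_exp, ← Complex.exp_add]
    have e1 : Complex.I * ρ * (-1 + y * Complex.I) = -(Complex.I * ρ) + ((-(ρ * y) : ℝ) : ℂ) := by
      push_cast; linear_combination (ρ * y : ℂ) * Complex.I_sq
    have e2 : (1 : ℂ) - (-1 + y * Complex.I) ^ 2 = (y : ℂ) ^ 2 + 2 * Complex.I * y := by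
      linear_combination (-(y : ℂ) ^ 2) * Complex.I_sq
    rw [e1, e2]
  have hF0 : (∫ x : ℝ in (-1 : ℝ)..1, F x) = sphereProfile ρ := by
    refine intervalIntegral.integral_congr fun x hx => ?_
    rw [uIcc_of_le (by norm_num)] at hx
    have h1 : 0 ≤ 1 - x ^ 2 := by nlinarith [hx.1, hx.2]
    simp only [hF]
    rw [mul_comm, Real.sqrt_eq_rpow, Complex.ofReal_cpow h1]
    push_cast
    ring_nf
  have lim1 := (intervalIntegral_tendsto_integral_Ioi 0
    (integrableOn_exp_neg_mul_cpow hρ (b := -Complex.I) (by simp)) tendsto_id)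
  have lim2 := (intervalIntegral_tendsto_integral_Ioi 0
    (integrableOn_exp_neg_mul_cpow hρ (b := Complex.I) (by simp)) tendsto_id)
  rw [integral_exp_neg_mul_cpow hρ] at lim1 lim2
  have lim3 : Tendsto (fun R : ℝ => ∫ x : ℝ in (-1 : ℝ)..1, F (x + R * Complex.I)) atTop (𝓝 0) := by
    have hbound : ∀ R : ℝ, 0 < R →
        ‖∫ x : ℝ in (-1 : ℝ)..1, F (x + R * Complex.I)‖ ≤ 2 * (Real.exp (-ρ * R) * (R + 2)) := by
      intro R hR
      have := intervalIntegral.norm_integral_le_of_norm_le_const (a := (-1 : ℝ)) (b := 1)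
        (f := fun x : ℝ => F (x + R * Complex.I)) (C := Real.exp (-ρ * R) * (R + 2)) ?_
      · refine this.trans (le_of_eq ?_)
        norm_num
        ring
      · intro x hx
        rw [uIoc_of_le (by norm_num)] at hx
        have hhalf : (1 / 2 : ℂ) = (((1 / 2 : ℝ)) : ℂ) := by norm_num
        simp only [hF]
        rw [hhalf, norm_mul, Complex.norm_cpow_real, ← Real.sqrt_eq_rpow, Complex.norm_exp]
        have e1 : (Complex.I * ρ * (x + R * Complex.I)).re = -ρ * R := by simp
        rw [e1]
        gcongr
        rw [Real.sqrt_le_left (by positivity)]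
        refine (norm_sub_le _ _).trans ?_
        rw [norm_one, norm_pow]
        have h2 : ‖(x : ℂ) + R * Complex.I‖ ≤ 1 + R := by
          refine (norm_add_le _ _).trans ?_
          simp only [norm_mul, Complex.norm_real, Complex.norm_I, mul_one, Real.norm_eq_abs,
            abs_of_pos hR]
          have : |x| ≤ 1 := abs_le.2 ⟨hx.1.le, hx.2⟩
          linarith
        have h3 := norm_nonneg ((x : ℂ) + R * Complex.I)
        nlinarith
    have hlim : Tendsto (fun R : ℝ => 2 * (Real.exp (-ρ * R) * (R + 2))) atTop (𝓝 0) := by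
      have t1 := tendsto_rpow_mul_exp_neg_mul_atTop_nhds_zero 1 ρ hρ
      have t0 := tendsto_rpow_mul_exp_neg_mul_atTop_nhds_zero 0 ρ hρ
      have := ((t1.add (t0.const_mul 2)).const_mul 2)
      simp only [mul_zero, add_zero] at this
      refine this.congr fun R => ?_
      simp
      ring
    refine squeeze_zero_norm' ?_ hlim
    filter_upwards [eventually_gt_atTop 0] with R hR using hbound R hR
  have htot : Tendsto (fun R : ℝ => ((∫ x : ℝ in (-1 : ℝ)..1, F x) -
      (∫ x : ℝ in (-1 : ℝ)..1, F (x + R * Complex.I))) +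
        Complex.I * (∫ y : ℝ in (0 : ℝ)..R, F (1 + y * Complex.I)) -
        Complex.I * (∫ y : ℝ in (0 : ℝ)..R, F (-1 + y * Complex.I))) atTop
      (𝓝 (sphereProfile ρ - 0 + Complex.I * (Complex.exp (Complex.I * ρ) *
        (((ρ : ℂ) ^ 2)⁻¹ * hankelAmp (1 / 2) (-Complex.I * ρ))) -
        Complex.I * (Complex.exp (-(Complex.I * ρ)) *
        (((ρ : ℂ) ^ 2)⁻¹ * hankelAmp (1 / 2) (Complex.I * ρ))))) := by
    rw [hF0]
    simp only [hF1, hF2, intervalIntegral.integral_const_mul]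
    refine ((tendsto_const_nhds.sub lim3).add ?_).sub ?_
    · exact (lim1.const_mul _).const_mul _
    · exact (lim2.const_mul _).const_mul _
  have hzero := tendsto_nhds_unique htot (tendsto_const_nhds.congr' (by
    filter_upwards [eventually_gt_atTop 0] with R hR
    exact (hrect R hR).symm))
  have hρ' : (ρ : ℂ) ≠ 0 := by exact_mod_cast hρ.ne'
  have hρ2 : ((ρ : ℂ) ^ 2) * ((ρ : ℂ) ^ 2)⁻¹ = 1 := mul_inv_cancel₀ (pow_ne_zero 2 hρ')
  have hI := Complex.I_sq
  generalize hankelAmp (1 / 2) (-Complex.I * ρ) = A₁ at *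
  generalize hankelAmp (1 / 2) (Complex.I * ρ) = A₂ at *
  generalize Complex.exp (Complex.I * ρ) = E₁ at *
  generalize Complex.exp (-(Complex.I * ρ)) = E₂ at *
  generalize ((ρ : ℂ) ^ 2)⁻¹ = P at *
  linear_combination (-Complex.I * (ρ : ℂ) ^ 2) * hzero - (E₁ * A₁ - E₂ * A₂) * hρ2 +
    (ρ ^ 2 * P * (E₁ * A₁ - E₂ * A₂)) * hI

theorem norm_sphereProfile_le (ρ : ℝ) : ‖sphereProfile ρ‖ ≤ 2 := by
  have := intervalIntegral.norm_integral_le_of_norm_le_const (a := (-1 : ℝ)) (b := 1)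
    (f := fun s : ℝ => (√(1 - s ^ 2) : ℂ) * Complex.exp (Complex.I * (ρ * s : ℝ))) (C := 1) ?_
  · refine this.trans (by norm_num)
  · intro s _
    rw [norm_mul, mul_comm Complex.I, Complex.norm_exp_ofReal_mul_I, mul_one, Complex.norm_real,
      Real.norm_of_nonneg (Real.sqrt_nonneg _), Real.sqrt_le_one]
    nlinarith [sq_nonneg s]

/-- The jump of the Green function across the spectrum. -/
theorem green_sub_green {l r : ℝ} (hl : 0 < l) (hr : 0 < r) :
    green (-Complex.I * l) r - green (Complex.I * l) r =
      Complex.I * ((l ^ 2 / (4 * Real.pi ^ 2) : ℝ) : ℂ) * sphereProfile (l * r) := by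
  have h := exp_mul_hankelAmp_sub (mul_pos hl hr)
  have hr' : (r : ℂ) ≠ 0 := by exact_mod_cast hr.ne'
  have hπ : (Real.pi : ℂ) ≠ 0 := by exact_mod_cast Real.pi_ne_zero
  rw [green, green]
  have e1 : -(-Complex.I * (l : ℂ) * r) = Complex.I * ((l * r : ℝ) : ℂ) := by push_cast; ring
  have e2 : -(Complex.I * (l : ℂ) * r) = -(Complex.I * ((l * r : ℝ) : ℂ)) := by push_cast; ring
  have e3 : -Complex.I * (l : ℂ) * r = -Complex.I * ((l * r : ℝ) : ℂ) := by push_cast; ring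
  have e4 : Complex.I * (l : ℂ) * r = Complex.I * ((l * r : ℝ) : ℂ) := by push_cast; ring
  rw [e1, e2, e3, e4, mul_assoc _ (Complex.exp (Complex.I * _)),
    mul_assoc _ (Complex.exp (-(Complex.I * _))), ← mul_sub, h]
  push_cast
  field_simp

/-! ### Convolution on `ℝ⁴`. -/

section Conv

variable {𝕜 : Type*} [RCLike 𝕜]

/-- The convolution `∫ a(x - y) f(y) dy` on `ℝ⁴`. -/
noncomputable def conv (a f : R4 → 𝕜) (x : R4) : 𝕜 := ∫ y, a (x - y) * f y

theorem aestronglyMeasurable_conv_integrand {a f : R4 → 𝕜} (ha : AEStronglyMeasurable a volume)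
    (hf : AEStronglyMeasurable f volume) :
    AEStronglyMeasurable (fun q : R4 × R4 => a (q.1 - q.2) * f q.2) (volume.prod volume) :=
  (ha.comp_quasiMeasurePreserving (quasiMeasurePreserving_sub volume volume)).mul hf.comp_snd

theorem aestronglyMeasurable_conv {a f : R4 → 𝕜} (ha : AEStronglyMeasurable a volume)
    (hf : AEStronglyMeasurable f volume) : AEStronglyMeasurable (conv a f) volume :=
  (aestronglyMeasurable_conv_integrand ha hf).integral_prod_right'

theorem enorm_conv_le (a f : R4 → 𝕜) (x : R4) :
    ‖conv a f x‖ₑ ≤ ∫⁻ y, ‖a (x - y)‖ₑ * ‖f y‖ₑ := by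
  refine (enorm_integral_le_lintegral_enorm _).trans (le_of_eq ?_)
  simp only [enorm_mul]

theorem eLpNorm_conv_le {a f : R4 → 𝕜} (ha : AEStronglyMeasurable a volume)
    (hf : AEStronglyMeasurable f volume) {p : ℝ≥0∞} (hp : 1 ≤ p) (hp' : p ≠ ⊤) :
    eLpNorm (conv a f) p volume ≤ (∫⁻ x, ‖a x‖ₑ) * eLpNorm f p volume := by
  have h := eLpNorm_lconvolution_le ha.enorm hf.enorm hp hp'
  rw [eLpNorm_enorm] at h
  refine le_trans (eLpNorm_mono_enorm fun x => ?_) h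
  simpa using enorm_conv_le a f x

theorem memLp_conv {a f : R4 → 𝕜} (ha : Integrable a) {p : ℝ≥0∞} (hp : 1 ≤ p) (hp' : p ≠ ⊤)
    (hf : MemLp f p volume) : MemLp (conv a f) p volume :=
  ⟨aestronglyMeasurable_conv ha.1 hf.1, (eLpNorm_conv_le ha.1 hf.1 hp hp').trans_lt
    (ENNReal.mul_lt_top ha.2 hf.2)⟩

theorem integrable_conv {a f : R4 → 𝕜} (ha : Integrable a) (hf : Integrable f) :
    Integrable (conv a f) :=
  memLp_one_iff_integrable.1
    (memLp_conv ha le_rfl ENNReal.one_ne_top (memLp_one_iff_integrable.2 hf))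

theorem integrable_conv_integrand {a f : R4 → 𝕜} (ha : Integrable a) (hf : Integrable f) :
    Integrable (fun q : R4 × R4 => a (q.1 - q.2) * f q.2) (volume.prod volume) := by
  refine (hf.convolution_integrand (ContinuousLinearMap.mul ℝ 𝕜) ha).congr
    (Eventually.of_forall fun q => ?_)
  simp only [ContinuousLinearMap.mul_apply']
  ring

theorem ae_integrable_conv {a f : R4 → 𝕜} (ha : Integrable a) (hf : Integrable f) :
    ∀ᵐ x, Integrable fun y => a (x - y) * f y :=
  (integrable_conv_integrand ha hf).prod_right_ae

theorem fourier_conv {a f : R4 → ℂ} (ha : Integrable a) (hf : Integrable f) (ξ : R4) :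
    𝓕 (conv a f) ξ = 𝓕 a ξ * 𝓕 f ξ := by
  have h := Real.fourier_mul_convolution_eq hf ha ξ
  have h2 : conv a f = MeasureTheory.convolution f a (ContinuousLinearMap.mul ℂ ℂ) volume := by
    ext x
    simp only [conv, MeasureTheory.convolution, ContinuousLinearMap.mul_apply']
    congr 1
    ext y
    ring
  rw [h2, h, mul_comm]

end Conv

/-! ### The free resolvent as a convolution, up to the boundary of the spectrum. -/

section Resolvent

/-- Factor `t + k² = (k + i√t)(k - i√t)`; each factor has real part `Re k`. -/
theorem re_sq_le_norm_add_sq {k : ℂ} (hk : 0 < k.re) {t : ℝ} (ht : 0 ≤ t) :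
    k.re ^ 2 ≤ ‖(t : ℂ) + k ^ 2‖ := by
  have h : (t : ℂ) + k ^ 2 = (k + Complex.I * (√t : ℝ)) * (k - Complex.I * (√t : ℝ)) := by
    have h1 : ((√t : ℝ) : ℂ) ^ 2 = t := by rw [← Complex.ofReal_pow, Real.sq_sqrt ht]
    have := Complex.I_sq
    linear_combination (-(1 : ℂ)) * h1 + ((√t : ℝ) : ℂ) ^ 2 * this
  rw [h, norm_mul, sq]
  have h1 : k.re ≤ ‖k + Complex.I * (√t : ℝ)‖ := by
    simpa using Complex.re_le_norm (k + Complex.I * (√t : ℝ))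
  have h2 : k.re ≤ ‖k - Complex.I * (√t : ℝ)‖ := by
    simpa using Complex.re_le_norm (k - Complex.I * (√t : ℝ))
  gcongr

theorem memLp_top_resolvent_symbol {k : ℂ} (hk : 0 < k.re) :
    MemLp (fun ξ : R4 => ((4 * Real.pi ^ 2 * ‖ξ‖ ^ 2 : ℝ) - (-k ^ 2))⁻¹) ⊤ volume := by
  refine memLp_top_of_bound (by apply Measurable.aestronglyMeasurable; fun_prop) ((k.re ^ 2)⁻¹)
    (Eventually.of_forall fun ξ => ?_)
  rw [norm_inv, sub_neg_eq_add]
  exact inv_anti₀ (by positivity) (re_sq_le_norm_add_sq hk (by positivity))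

/-- On `L¹ ∩ L²` the free resolvent is convolution with the Green function. -/
theorem freeResolvent_toLp_ae {k : ℂ} (hk : 0 < k.re) {f : R4 → ℂ} (hf₁ : Integrable f)
    (hf₂ : MemLp f 2 volume) :
    freeResolvent (-k ^ 2) (hf₂.toLp f) =ᵐ[volume] conv (fun x => green k ‖x‖) f := by
  have hg := integrable_green hk
  have hm := memLp_top_resolvent_symbol hk
  have hc₁ := integrable_conv hg hf₁
  have hc₂ := memLp_conv hg one_le_two ENNReal.ofNat_ne_top hf₂
  have h1 : (𝓕 (hc₂.toLp _) : L2) = mulOp (fun ξ : R4 => ((4 * Real.pi ^ 2 * ‖ξ‖ ^ 2 : ℝ) - (-k ^ 2))⁻¹)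
      (𝓕 (hf₂.toLp f) : L2) := by
    apply Lp.ext
    filter_upwards [mulOp_ae hm (𝓕 (hf₂.toLp f) : L2), fourier_toLp_ae hf₁ hf₂,
      fourier_toLp_ae hc₁ hc₂] with ξ a1 a2 a3
    -- Both sides have the same Fourier transform, since the transform of the Green function is the
    -- resolvent symbol.
    rw [a1, a2, a3, fourier_conv hg hf₁, fourier_green hk, sub_neg_eq_add]
  have h2 : freeResolvent (-k ^ 2) (hf₂.toLp f) = hc₂.toLp _ := by
    change (Lp.fourierTransformₗᵢ R4 ℂ).symm (mulOp _ (𝓕 (hf₂.toLp f) : L2)) = _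
    rw [← h1]
    exact (Lp.fourierTransformₗᵢ R4 ℂ).symm_apply_apply _
  rw [h2]
  exact hc₂.coeFn_toLp

theorem continuous_green_subtype (r : ℝ) (hr : 0 ≤ r) :
    Continuous fun k : {k : ℂ // 0 ≤ k.re} => green k r := by
  unfold green
  refine Continuous.mul (by fun_prop) ?_
  refine continuous_hankelAmp_half_comp (g := fun k : {k : ℂ // 0 ≤ k.re} => (k : ℂ) * r)
    (by fun_prop) fun k => ?_
  simpa using mul_nonneg k.2 hr

theorem tendsto_green {ι : Type*} {l : Filter ι} {κ : ι → ℂ} (hκ : ∀ i, 0 ≤ (κ i).re) {k : ℂ}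
    (hk : 0 ≤ k.re) (h : Tendsto κ l (𝓝 k)) {r : ℝ} (hr : 0 ≤ r) :
    Tendsto (fun i => green (κ i) r) l (𝓝 (green k r)) := by
  have h1 : ContinuousOn (fun k => green k r) {k : ℂ | 0 ≤ k.re} :=
    continuousOn_iff_continuous_domRestrict.2 (continuous_green_subtype r hr)
  have h2 : Tendsto κ l (𝓝[{k : ℂ | 0 ≤ k.re}] k) :=
    tendsto_nhdsWithin_iff.2 ⟨h, Eventually.of_forall hκ⟩
  exact Tendsto.comp (h1 k hk) h2

/-- A majorant for the convolutions with the Green functions. -/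
noncomputable def greenMaj (f : R4 → ℂ) (x : R4) : ℝ :=
  conv nearInv (fun y => ‖f y‖) x + ∫ y, ‖f y‖

theorem conv_nearInv_nonneg (f : R4 → ℂ) (x : R4) : 0 ≤ conv nearInv (fun y => ‖f y‖) x :=
  integral_nonneg fun _ => mul_nonneg (nearInv_nonneg _) (norm_nonneg _)

theorem greenMaj_nonneg (f : R4 → ℂ) (x : R4) : 0 ≤ greenMaj f x :=
  add_nonneg (conv_nearInv_nonneg f x) (integral_nonneg fun _ => norm_nonneg _)

theorem integral_greenMaj_integrand {f : R4 → ℂ} (hf : Integrable f) {x : R4}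
    (hx : Integrable fun y => nearInv (x - y) * ‖f y‖) :
    Integrable (fun y => (nearInv (x - y) + 1) * ‖f y‖) ∧
      ∫ y, (nearInv (x - y) + 1) * ‖f y‖ = greenMaj f x := by
  have h : ∀ y, (nearInv (x - y) + 1) * ‖f y‖ = nearInv (x - y) * ‖f y‖ + ‖f y‖ := fun y => by ring
  simp only [h]
  exact ⟨hx.add hf.norm, integral_add hx hf.norm⟩

theorem norm_conv_green_le {f : R4 → ℂ} (hf : Integrable f) {x : R4}
    (hx : Integrable fun y => nearInv (x - y) * ‖f y‖) {k : ℂ} (hk : 0 ≤ k.re) {M : ℝ}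
    (hM : ‖k‖ ≤ M) :
    ‖conv (fun x => green k ‖x‖) f x‖ ≤ (hankelConst * √(2 * M) + 1) * greenMaj f x := by
  obtain ⟨h1, h2⟩ := integral_greenMaj_integrand hf hx
  rw [← h2, ← integral_const_mul]
  refine norm_integral_le_of_norm_le (h1.const_mul _) (Eventually.of_forall fun y => ?_)
  rw [norm_mul, ← mul_assoc]
  exact mul_le_mul_of_nonneg_right (norm_green_le_nearInv hk hM _) (norm_nonneg _)

/-- Dominated convergence with the majorant valid on the closed half plane `Re k ≥ 0`. The
integrability hypothesis at `x` holds for almost every `x`, by `ae_integrable_nearInv`. -/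
theorem tendsto_conv_green {f : R4 → ℂ} (hf : Integrable f) {x : R4}
    (hx : Integrable fun y => nearInv (x - y) * ‖f y‖) {ι : Type*} {l : Filter ι}
    [l.IsCountablyGenerated] {κ : ι → ℂ}
    (hκ : ∀ i, 0 ≤ (κ i).re) {k : ℂ} (hk : 0 ≤ k.re) (h : Tendsto κ l (𝓝 k)) :
    Tendsto (fun i => conv (fun x => green (κ i) ‖x‖) f x) l
      (𝓝 (conv (fun x => green k ‖x‖) f x)) := by
  obtain ⟨h1, -⟩ := integral_greenMaj_integrand hf hx
  have hev : ∀ᶠ i in l, ‖κ i‖ ≤ ‖k‖ + 1 :=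
    (h.norm.eventually (gt_mem_nhds (lt_add_one ‖k‖))).mono fun x hx => le_of_lt hx
  refine tendsto_integral_filter_of_dominated_convergence
    (fun y => (hankelConst * √(2 * (‖k‖ + 1)) + 1) * ((nearInv (x - y) + 1) * ‖f y‖)) ?_ ?_
    (h1.const_mul _) ?_
  · refine Eventually.of_forall fun i => AEStronglyMeasurable.mul ?_ hf.1
    exact ((measurable_green_norm (κ i)).comp (measurable_const.sub measurable_id)).aestronglyMeasurable
  · filter_upwards [hev] with i hi
    refine Eventually.of_forall fun y => ?_
    rw [norm_mul, ← mul_assoc]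
    exact mul_le_mul_of_nonneg_right (norm_green_le_nearInv (hκ i) hi _) (norm_nonneg _)
  · exact Eventually.of_forall fun y => (tendsto_green hκ hk h (norm_nonneg _)).mul_const _

theorem ae_integrable_nearInv {f : R4 → ℂ} (hf : Integrable f) :
    ∀ᵐ x, Integrable fun y => nearInv (x - y) * ‖f y‖ :=
  ae_integrable_conv integrable_nearInv hf.norm

end Resolvent

/-! ### The weights. -/

section Bracket

theorem bracket_pos (x : R4) : 0 < bracket x := Real.sqrt_pos.2 (by positivity)

theorem one_le_bracket (x : R4) : 1 ≤ bracket x := by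
  rw [bracket, Real.one_le_sqrt]
  nlinarith [norm_nonneg x]

theorem norm_le_bracket (x : R4) : ‖x‖ ≤ bracket x := by
  rw [bracket]
  exact Real.le_sqrt_of_sq_le (by linarith)

theorem continuous_bracket : Continuous bracket := by
  unfold bracket; fun_prop

theorem integrable_bracket_rpow {r : ℝ} (hr : 4 < r) : Integrable fun x => bracket x ^ (-r) := by
  have h := integrable_rpow_neg_one_add_norm_sq (E := R4) (μ := volume) (r := r) (by simpa using hr)
  refine h.congr (Eventually.of_forall fun x => ?_)
  simp only [bracket]
  rw [Real.sqrt_eq_rpow, ← Real.rpow_mul (by positivity)]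
  congr 1
  ring

theorem memLp_bracket_rpow {r : ℝ} (hr : 2 < r) :
    MemLp (fun x => bracket x ^ (-r)) 2 volume := by
  have hm : Measurable fun x => bracket x ^ (-r) := continuous_bracket.measurable.pow_const _
  rw [memLp_two_iff_integrable_sq hm.aestronglyMeasurable]
  refine (integrable_bracket_rpow (r := 2 * r) (by linarith)).congr (Eventually.of_forall fun x => ?_)
  simp only
  rw [← Real.rpow_natCast, ← Real.rpow_mul (bracket_pos x).le]
  congr 1
  push_cast
  ring

/-- The weight `⟨x⟩^{-σ}`. -/
noncomputable def invWeight (x : R4) : ℝ := (bracket x ^ wt)⁻¹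

theorem invWeight_pos (x : R4) : 0 < invWeight x := inv_pos.2 (pow_pos (bracket_pos x) _)

theorem invWeight_le_one (x : R4) : invWeight x ≤ 1 :=
  inv_le_one_of_one_le₀ (one_le_pow₀ (one_le_bracket x))

theorem continuous_invWeight : Continuous invWeight :=
  (continuous_bracket.pow _).inv₀ fun x => (pow_pos (bracket_pos x) _).ne'

theorem memLp_invWeight : MemLp invWeight 2 volume := by
  have h := memLp_bracket_rpow (r := 3) (by norm_num)
  refine h.ae_eq (Eventually.of_forall fun x => ?_)
  simp only [invWeight, wt]
  rw [Real.rpow_neg (bracket_pos x).le]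
  norm_cast

theorem memLp_top_invWeight : MemLp (fun x => (invWeight x : ℂ)) ⊤ volume := by
  refine memLp_top_of_bound
    (Complex.continuous_ofReal.comp continuous_invWeight).aestronglyMeasurable 1
    (Eventually.of_forall fun x => ?_)
  rw [Complex.norm_real, Real.norm_of_nonneg (invWeight_pos x).le]
  exact invWeight_le_one x

end Bracket

/-! ### The limiting absorption principle. -/

section LimitingAbsorption

/-- The function `f = ⟨x⟩^{-σ} h`. -/
noncomputable def unweight (h : R4 → ℂ) (x : R4) : ℂ := (invWeight x : ℂ) * h x

theorem memLp_unweight {h : R4 → ℂ} (hh : MemLp h 2 volume) : MemLp (unweight h) 2 volume := by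
  refine hh.mono ((Complex.continuous_ofReal.comp
    continuous_invWeight).aestronglyMeasurable.mul hh.1) (Eventually.of_forall fun x => ?_)
  rw [unweight, norm_mul, Complex.norm_real, Real.norm_of_nonneg (invWeight_pos x).le]
  exact mul_le_of_le_one_left (norm_nonneg _) (invWeight_le_one x)

/-- The weight `⟨x⟩⁻³` lies in `L²(ℝ⁴)` because `6 > 4`, so Cauchy–Schwarz puts `L^{2,σ}` inside
`L¹`. All later work with `f` uses only `f ∈ L¹ ∩ L²`. -/
theorem integrable_unweight {h : R4 → ℂ} (hh : MemLp h 2 volume) : Integrable (unweight h) :=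
  MemLp.integrable_mul (memLp_invWeight.ofReal (K := ℂ)) hh

/-- The local part of the majorant is in `L²` by Young; the constant part `‖f‖₁` is in `L²` after
multiplication by the weight. -/
theorem memLp_invWeight_mul_greenMaj {f : R4 → ℂ} (hf₂ : MemLp f 2 volume) :
    MemLp (fun x => invWeight x * greenMaj f x) 2 volume := by
  have h1 : MemLp (conv nearInv fun y => ‖f y‖) 2 volume :=
    memLp_conv integrable_nearInv one_le_two ENNReal.ofNat_ne_top hf₂.norm
  have h2 : MemLp (fun x => invWeight x * conv nearInv (fun y => ‖f y‖) x) 2 volume := by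
    refine h1.mono (continuous_invWeight.aestronglyMeasurable.mul h1.1)
      (Eventually.of_forall fun x => ?_)
    rw [norm_mul, Real.norm_of_nonneg (invWeight_pos x).le]
    exact mul_le_of_le_one_left (norm_nonneg _) (invWeight_le_one x)
  have h3 := h2.add (memLp_invWeight.mul_const (∫ y, ‖f y‖))
  refine h3.ae_eq (Eventually.of_forall fun x => ?_)
  simp only [Pi.add_apply, greenMaj]
  ring

theorem aestronglyMeasurable_conv_green {f : R4 → ℂ} (hf : Integrable f) (k : ℂ) :
    AEStronglyMeasurable (conv (fun x => green k ‖x‖) f) volume :=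
  aestronglyMeasurable_conv (measurable_green_norm k).aestronglyMeasurable hf.1

theorem memLp_unweight_conv_green {f : R4 → ℂ} (hf₁ : Integrable f) (hf₂ : MemLp f 2 volume)
    {k : ℂ} (hk : 0 ≤ k.re) : MemLp (unweight (conv (fun x => green k ‖x‖) f)) 2 volume := by
  refine ((memLp_invWeight_mul_greenMaj hf₂).const_mul
    (hankelConst * √(2 * ‖k‖) + 1)).mono' ((Complex.continuous_ofReal.comp
    continuous_invWeight).aestronglyMeasurable.mul (aestronglyMeasurable_conv_green hf₁ k)) ?_
  filter_upwards [ae_integrable_nearInv hf₁] with x hx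
  have := norm_conv_green_le hf₁ hx hk le_rfl
  rw [unweight, norm_mul, Complex.norm_real, Real.norm_of_nonneg (invWeight_pos x).le,
    mul_left_comm]
  exact mul_le_mul_of_nonneg_left this (invWeight_pos x).le

/-- `L²` dominated convergence. For a general filter, so that it yields both the boundary values as
`ε → 0` and their continuity in the energy. -/
theorem tendsto_unweight_conv_green {f : R4 → ℂ} (hf₁ : Integrable f) (hf₂ : MemLp f 2 volume)
    {ι : Type*} {l : Filter ι} [l.IsCountablyGenerated] {κ : ι → ℂ} (hκ : ∀ i, 0 ≤ (κ i).re)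
    {k : ℂ} (hk : 0 ≤ k.re) (h : Tendsto κ l (𝓝 k)) :
    Tendsto (fun i => (memLp_unweight_conv_green hf₁ hf₂ (hκ i)).toLp _) l
      (𝓝 ((memLp_unweight_conv_green hf₁ hf₂ hk).toLp _)) := by
  rw [Lp.tendsto_Lp_iff_tendsto_eLpNorm'']
  have hev : ∀ᶠ i in l, ‖κ i‖ ≤ ‖k‖ + 1 :=
    (h.norm.eventually (gt_mem_nhds (lt_add_one ‖k‖))).mono fun x hx => le_of_lt hx
  set B := hankelConst * √(2 * (‖k‖ + 1)) + 1 with hB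
  have hB0 : 0 ≤ B := by have := hankelConst_nonneg; positivity
  have hmaj := ((memLp_invWeight_mul_greenMaj hf₂).const_mul (2 * B))
  have hlim : Tendsto (fun i => ∫⁻ x, ‖(unweight (conv (fun x => green (κ i) ‖x‖) f) -
      unweight (conv (fun x => green k ‖x‖) f)) x‖ₑ ^ (2 : ℝ)) l (𝓝 (∫⁻ _ : R4, 0)) := by
    refine tendsto_lintegral_filter_of_dominated_convergence'
      (fun x => ‖2 * B * (invWeight x * greenMaj f x)‖ₑ ^ (2 : ℝ)) ?_ ?_ ?_ ?_
    · refine Eventually.of_forall fun i => ?_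
      exact ((((memLp_unweight_conv_green hf₁ hf₂ (hκ i)).1.sub
        (memLp_unweight_conv_green hf₁ hf₂ hk).1)).enorm).pow_const _
    · filter_upwards [hev] with i hi
      filter_upwards [ae_integrable_nearInv hf₁] with x hx
      have a1 := norm_conv_green_le hf₁ hx (hκ i) hi
      have a2 := norm_conv_green_le hf₁ hx hk (le_add_of_nonneg_right zero_le_one : ‖k‖ ≤ ‖k‖ + 1)
      gcongr
      rw [enorm_le_iff_norm_le]
      simp only [Pi.sub_apply, unweight]
      rw [← mul_sub, norm_mul, Complex.norm_real, Real.norm_of_nonneg (invWeight_pos x).le,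
        Real.norm_of_nonneg (by
          have := greenMaj_nonneg f x; have := invWeight_pos x; positivity)]
      have a3 := norm_sub_le (conv (fun x => green (κ i) ‖x‖) f x)
        (conv (fun x => green k ‖x‖) f x)
      calc invWeight x * _ ≤ invWeight x * (B * greenMaj f x + B * greenMaj f x) := by
            refine mul_le_mul_of_nonneg_left (a3.trans (add_le_add a1 a2)) (invWeight_pos x).le
        _ = _ := by ring
    · have := hmaj.2
      rw [eLpNorm_lt_top_iff_lintegral_rpow_enorm_lt_top (by norm_num) (by norm_num)] at this
      exact this.ne
    · filter_upwards [ae_integrable_nearInv hf₁] with x hx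
      have a1 := tendsto_conv_green hf₁ hx hκ hk h
      have a2 : Tendsto (fun i => (unweight (conv (fun x => green (κ i) ‖x‖) f) -
        unweight (conv (fun x => green k ‖x‖) f)) x) l (𝓝 0) := by
        have := (a1.const_mul (invWeight x : ℂ)).sub_const
          ((invWeight x : ℂ) * conv (fun x => green k ‖x‖) f x)
        simpa [unweight] using this
      have a3 := a2.enorm.ennrpow_const 2
      simpa using a3
  rw [lintegral_zero] at hlim
  have h5 := hlim.ennrpow_const (1 / 2)
  rw [ENNReal.zero_rpow_of_pos (by norm_num)] at h5
  refine h5.congr fun i => ?_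
  rw [eLpNorm_eq_lintegral_rpow_enorm_toReal (by norm_num) (by norm_num)]
  norm_num

end LimitingAbsorption

theorem conv_congr_ae {𝕜 : Type*} [RCLike 𝕜] {a f g : R4 → 𝕜} (h : f =ᵐ[volume] g) :
    conv a f = conv a g := by
  ext x
  refine integral_congr_ae ?_
  filter_upwards [h] with y hy
  rw [hy]

theorem re_sub_I_mul (ε t : ℝ) : ((ε : ℂ) - Complex.I * t).re = ε := by simp

/-- The boundary value at `k = -it` of the weighted resolvent. -/
noncomputable def boundaryVec {f : R4 → ℂ} (hf₁ : Integrable f) (hf₂ : MemLp f 2 volume) (t : ℝ) : L2 :=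
  (memLp_unweight_conv_green hf₁ hf₂ (k := (0 : ℝ) - Complex.I * t)
    (re_sub_I_mul 0 t).ge).toLp _

theorem boundaryVec_ae {f : R4 → ℂ} (hf₁ : Integrable f) (hf₂ : MemLp f 2 volume) (t : ℝ) :
    boundaryVec hf₁ hf₂ t =ᵐ[volume] unweight (conv (fun x => green (-Complex.I * t) ‖x‖) f) := by
  have := (memLp_unweight_conv_green hf₁ hf₂ (k := (0 : ℝ) - Complex.I * t)
    (re_sub_I_mul 0 t).ge).coeFn_toLp
  have h : ((0 : ℝ) : ℂ) - Complex.I * t = -Complex.I * t := by simp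
  rw [← h]
  exact this

theorem continuous_boundaryVec {f : R4 → ℂ} (hf₁ : Integrable f) (hf₂ : MemLp f 2 volume) :
    Continuous (boundaryVec hf₁ hf₂) := by
  rw [continuous_iff_continuousAt]
  intro t
  refine tendsto_unweight_conv_green hf₁ hf₂ (κ := fun t : ℝ => (0 : ℝ) - Complex.I * t)
    (fun t => (re_sub_I_mul 0 t).ge) (re_sub_I_mul 0 t).ge ?_
  exact Continuous.tendsto (by fun_prop) t

theorem integrable_unweight_coe (h : L2) : Integrable (unweight h) :=
  integrable_unweight (Lp.memLp h)

theorem memLp_unweight_coe (h : L2) : MemLp (unweight h) 2 volume :=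
  memLp_unweight (Lp.memLp h)

theorem mulOp_invWeight (h : L2) :
    mulOp (fun x => ((bracket x ^ wt)⁻¹ : ℝ)) h = (memLp_unweight_coe h).toLp _ := by
  apply Lp.ext
  filter_upwards [mulOp_ae memLp_top_invWeight h, (memLp_unweight_coe h).coeFn_toLp] with x h1 h2
  rw [h2]
  exact h1

/-- With `k = ε - isl` one has `-k² = (l + isε)²` for `s = ±1`, and `Re k = ε > 0`, so this is the
branch for which the resolvent is convolution with `green k`. The outgoing boundary value is thus `k
= -il`. -/
theorem weightedResolvent_eq {s : ℝ} (hs : s ^ 2 = 1) (l : ℝ) {ε : ℝ} (hε : 0 < ε) (h : L2) :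
    weightedResolvent s l ε h = (memLp_unweight_conv_green (integrable_unweight_coe h)
      (memLp_unweight_coe h) (k := ε - Complex.I * (s * l : ℝ))
      (hε.le.trans (re_sub_I_mul ε _).ge)).toLp _ := by
  set k : ℂ := ε - Complex.I * (s * l : ℝ) with hk
  have hkre : 0 < k.re := hε.trans_le (re_sub_I_mul ε _).ge
  have hs' : (s : ℂ) ^ 2 = 1 := by exact_mod_cast hs
  have hz : ((l : ℂ) + Complex.I * (s * ε : ℝ)) ^ 2 = -k ^ 2 := by
    rw [hk]
    push_cast
    linear_combination ((s : ℂ) ^ 2 * (ε ^ 2 + l ^ 2)) * Complex.I_sq - (ε ^ 2 + l ^ 2 : ℂ) * hs'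
  have h1 : weightedResolvent s l ε h = mulOp (fun x => ((bracket x ^ wt)⁻¹ : ℝ))
      (freeResolvent (-k ^ 2) (mulOp (fun x => ((bracket x ^ wt)⁻¹ : ℝ)) h)) := by
    rw [← hz]; rfl
  rw [h1, mulOp_invWeight h]
  apply Lp.ext
  filter_upwards [mulOp_ae memLp_top_invWeight
    (freeResolvent (-k ^ 2) ((memLp_unweight_coe h).toLp _)),
    freeResolvent_toLp_ae hkre (integrable_unweight_coe h) (memLp_unweight_coe h),
    (memLp_unweight_conv_green (integrable_unweight_coe h)
      (memLp_unweight_coe h) hkre.le).coeFn_toLp] with x a1 a2 a3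
  rw [a3, unweight, ← a2]
  exact a1

theorem tendsto_weightedResolvent {s : ℝ} (hs : s ^ 2 = 1) (l : ℝ) (h : L2) :
    Tendsto (fun ε => weightedResolvent s l ε h) (𝓝[>] 0)
      (𝓝 (boundaryVec (integrable_unweight_coe h) (memLp_unweight_coe h) (s * l))) := by
  have h1 := tendsto_unweight_conv_green (integrable_unweight_coe h) (memLp_unweight_coe h)
    -- The absolute value makes `Re k ≥ 0` hold for every `ε`, not only for those on the right of
    -- `0`.
    (ι := ℝ) (l := 𝓝[>] 0) (κ := fun ε : ℝ => (|ε| : ℝ) - Complex.I * (s * l : ℝ))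
    (fun ε => (abs_nonneg ε).trans (re_sub_I_mul |ε| _).ge)
    (k := (0 : ℝ) - Complex.I * (s * l : ℝ)) (re_sub_I_mul 0 _).ge ?_
  · refine h1.congr' ?_
    filter_upwards [self_mem_nhdsWithin] with ε hε
    have hε0 : (0 : ℝ) < ε := hε
    rw [weightedResolvent_eq hs l hε0]
    simp only [abs_of_pos hε0]
  · have h2 : Continuous fun ε : ℝ => (((|ε| : ℝ) : ℂ) - Complex.I * (s * l : ℝ)) := by fun_prop
    have h3 := h2.tendsto 0
    rw [abs_zero] at h3
    exact h3.mono_left nhdsWithin_le_nhds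

theorem weightedBoundaryResolvent_eq {s : ℝ} (hs : s ^ 2 = 1) (l : ℝ) (h : L2) :
    weightedBoundaryResolvent s l h =
      boundaryVec (integrable_unweight_coe h) (memLp_unweight_coe h) (s * l) :=
  (tendsto_weightedResolvent hs l h).limUnder_eq

theorem limitsExist (l : ℝ) : LimitsExist l := fun h =>
  ⟨⟨_, tendsto_weightedResolvent (by norm_num) l h⟩,
    ⟨_, tendsto_weightedResolvent (by norm_num) l h⟩⟩

/-- `limUnder` is linear only because the limits exist; linearity passes from the resolvents at `ε >
0` by uniqueness of limits. -/
theorem weightedBoundaryResolvent_sum {s : ℝ} (hs : s ^ 2 = 1) (l : ℝ) {ι : Type*} (S : Finset ι)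
    (c : ι → ℂ) (h : ι → L2) :
    weightedBoundaryResolvent s l (∑ i ∈ S, c i • h i) =
      ∑ i ∈ S, c i • weightedBoundaryResolvent s l (h i) := by
  have h1 : ∀ h, Tendsto (fun ε => weightedResolvent s l ε h) (𝓝[>] 0)
      (𝓝 (weightedBoundaryResolvent s l h)) := fun h => by
    rw [weightedBoundaryResolvent_eq hs]
    exact tendsto_weightedResolvent hs l h
  have h2 := tendsto_finsetSum S fun i _ => (h1 (h i)).const_smul (c i)
  have h3 := h1 (∑ i ∈ S, c i • h i)
  simp only [map_sum, map_smul] at h3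
  exact tendsto_nhds_unique h3 h2

/-! ### The jump kernel. -/

/-- The kernel of `R₀⁺(l²) - R₀⁻(l²)`. -/
noncomputable def jumpKer (l : ℝ) (x : R4) : ℂ :=
  Complex.I * ((l ^ 2 / (4 * Real.pi ^ 2) : ℝ) : ℂ) * sphereProfile (l * ‖x‖)

theorem continuous_sphereProfile : Continuous sphereProfile := by
  unfold sphereProfile
  refine intervalIntegral.continuous_parametric_intervalIntegral_of_continuous' ?_ _ _
  simp only [Function.uncurry_def]
  fun_prop

theorem continuous_jumpKer (l : ℝ) : Continuous (jumpKer l) := by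
  unfold jumpKer
  have := continuous_sphereProfile
  fun_prop

theorem continuous_uncurry_jumpKer : Continuous fun q : ℝ × R4 => jumpKer q.1 q.2 := by
  unfold jumpKer
  have := continuous_sphereProfile
  fun_prop

/-- The factor `l²` is what makes the integral against `dl/l` converge at zero energy; unlike the
Green function, the jump kernel has no singularity at `x = 0`. -/
theorem norm_jumpKer_le (l : ℝ) (x : R4) : ‖jumpKer l x‖ ≤ l ^ 2 := by
  have h := norm_sphereProfile_le (l * ‖x‖)
  rw [jumpKer, norm_mul, norm_mul, Complex.norm_I, one_mul, Complex.norm_real,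
    Real.norm_of_nonneg (by positivity)]
  have hπ : 2 ≤ 4 * Real.pi ^ 2 := by nlinarith [Real.pi_gt_three]
  calc l ^ 2 / (4 * Real.pi ^ 2) * ‖sphereProfile (l * ‖x‖)‖ ≤ l ^ 2 / (4 * Real.pi ^ 2) * 2 := by
        gcongr
    _ ≤ l ^ 2 := by
        rw [div_mul_eq_mul_div, div_le_iff₀ (by positivity)]
        gcongr

theorem jumpKer_neg (l : ℝ) (x : R4) : jumpKer l (-x) = jumpKer l x := by
  simp [jumpKer]

theorem boundaryVec_sub_ae {f : R4 → ℂ} (hf₁ : Integrable f) (hf₂ : MemLp f 2 volume) {l : ℝ}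
    (hl : 0 < l) :
    (boundaryVec hf₁ hf₂ l - boundaryVec hf₁ hf₂ (-l) : L2) =ᵐ[volume]
      unweight (conv (jumpKer l) f) := by
  have hInt : ∀ t : ℝ, ∀ᵐ x, Integrable fun y => green (-Complex.I * t) ‖x - y‖ * f y := by
    intro t
    filter_upwards [ae_integrable_nearInv hf₁] with x hx
    obtain ⟨h1, -⟩ := integral_greenMaj_integrand hf₁ hx
    refine (h1.const_mul (hankelConst * √(2 * |t|) + 1)).mono' ?_ (Eventually.of_forall fun y => ?_)
    · refine AEStronglyMeasurable.mul ?_ hf₁.1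
      exact ((measurable_green_norm _).comp
        (measurable_const.sub measurable_id)).aestronglyMeasurable
    · rw [norm_mul, ← mul_assoc]
      exact mul_le_mul_of_nonneg_right (norm_green_le_nearInv (by simp) (by simp) _)
        (norm_nonneg _)
  filter_upwards [Lp.coeFn_sub (boundaryVec hf₁ hf₂ l) (boundaryVec hf₁ hf₂ (-l)),
    boundaryVec_ae hf₁ hf₂ l, boundaryVec_ae hf₁ hf₂ (-l), hInt l, hInt (-l)] with x a1 a2 a3 a4 a5
  rw [a1, Pi.sub_apply, a2, a3, unweight, unweight, unweight, ← mul_sub]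
  congr 1
  simp only [conv]
  rw [← integral_sub a4 a5]
  refine integral_congr_ae ?_
  have hae : ∀ᵐ y : R4, y ≠ x := by simp [ae_iff]
  filter_upwards [hae] with y hy
  have hr : 0 < ‖x - y‖ := norm_pos_iff.2 (sub_ne_zero.2 hy.symm)
  have h2 : -Complex.I * ((-l : ℝ) : ℂ) = Complex.I * l := by push_cast; ring
  rw [← sub_mul, h2, green_sub_green hl hr, jumpKer]

theorem norm_conv_jumpKer_le {f : R4 → ℂ} (hf : Integrable f) (l : ℝ) (x : R4) :
    ‖conv (jumpKer l) f x‖ ≤ l ^ 2 * ∫ y, ‖f y‖ := by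
  rw [← integral_const_mul]
  refine norm_integral_le_of_norm_le (hf.norm.const_mul _) (Eventually.of_forall fun y => ?_)
  rw [norm_mul]
  exact mul_le_mul_of_nonneg_right (norm_jumpKer_le l _) (norm_nonneg _)

/-! ### Zero energy eigenfunctions: mean zero and finite multiplicity. -/

section Potential

variable {V : R4 → ℝ} {δ C : ℝ}

theorem abs_bracket_rpow_mul_le (hd : ∀ z, |V z| ≤ C * bracket z ^ (-δ)) (m : ℝ) (x : R4) :
    |bracket x ^ m * V x| ≤ C * bracket x ^ (-(δ - m)) := by
  have hb := bracket_pos x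
  rw [abs_mul, abs_of_pos (Real.rpow_pos_of_pos hb m)]
  calc bracket x ^ m * |V x| ≤ bracket x ^ m * (C * bracket x ^ (-δ)) := by
        gcongr; exact hd x
    _ = C * (bracket x ^ m * bracket x ^ (-δ)) := by ring
    _ = _ := by rw [← Real.rpow_add hb]; congr 2; ring

theorem decay_const_nonneg (hd : ∀ z, |V z| ≤ C * bracket z ^ (-δ)) : 0 ≤ C := by
  have h := (abs_nonneg _).trans (hd 0)
  have : bracket 0 = 1 := by simp [bracket]
  simpa [this] using h

theorem measurable_bracket_rpow_mul (hV : Measurable V) (m : ℝ) :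
    Measurable fun x => bracket x ^ m * V x :=
  (continuous_bracket.measurable.pow_const m).mul hV

theorem memLp_bracket_rpow_mul (hV : Measurable V) (hd : ∀ z, |V z| ≤ C * bracket z ^ (-δ))
    {m : ℝ} (hm : m + 2 < δ) : MemLp (fun x => bracket x ^ m * V x) 2 volume := by
  refine ((memLp_bracket_rpow (r := δ - m) (by linarith)).const_mul C).mono
    (measurable_bracket_rpow_mul hV m).aestronglyMeasurable (ae_of_all _ fun x => ?_)
  rw [Real.norm_eq_abs, Real.norm_eq_abs]
  exact (abs_bracket_rpow_mul_le hd m x).trans (le_abs_self _)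

theorem abs_bracket_rpow_mul_le_const (hd : ∀ z, |V z| ≤ C * bracket z ^ (-δ)) {m : ℝ}
    (hm : m ≤ δ) (x : R4) : |bracket x ^ m * V x| ≤ C := by
  refine (abs_bracket_rpow_mul_le hd m x).trans ?_
  have : bracket x ^ (-(δ - m)) ≤ 1 :=
    Real.rpow_le_one_of_one_le_of_nonpos (one_le_bracket x) (by linarith)
  nlinarith [decay_const_nonneg hd]

theorem abs_potential_le (hd : ∀ z, |V z| ≤ C * bracket z ^ (-δ)) (hδ : 0 ≤ δ) (x : R4) :
    |V x| ≤ C := by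
  simpa using abs_bracket_rpow_mul_le_const hd hδ x

theorem memLp_top_potential (hV : Measurable V) (hd : ∀ z, |V z| ≤ C * bracket z ^ (-δ))
    (hδ : 0 ≤ δ) : MemLp (fun x => (V x : ℂ)) ⊤ volume :=
  memLp_top_of_bound (Complex.measurable_ofReal.comp hV).aestronglyMeasurable C
    (ae_of_all _ fun x => by simpa using abs_potential_le hd hδ x)

theorem memLp_top_weightedPotential (hV : Measurable V)
    (hd : ∀ z, |V z| ≤ C * bracket z ^ (-δ)) (hδ : 3 ≤ δ) :
    MemLp (fun x => ((bracket x ^ wt * V x : ℝ) : ℂ)) ⊤ volume := by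
  refine memLp_top_of_bound (Complex.measurable_ofReal.comp
    ((continuous_bracket.measurable.pow_const _).mul hV)).aestronglyMeasurable C
    (ae_of_all _ fun x => ?_)
  have := abs_bracket_rpow_mul_le_const hd hδ x
  rw [Complex.norm_real, Real.norm_eq_abs]
  rwa [show bracket x ^ (3 : ℝ) = bracket x ^ wt from Real.rpow_natCast _ 3] at this

/-- The function `V ψ`. -/
noncomputable def potMul (V : R4 → ℝ) (ψ : R4 → ℂ) (x : R4) : ℂ := (V x : ℂ) * ψ x

theorem memLp_potMul (hV : Measurable V) (hd : ∀ z, |V z| ≤ C * bracket z ^ (-δ))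
    (hδ : 0 ≤ δ) (ψ : L2) : MemLp (potMul V ψ) 2 volume :=
  (Lp.memLp ψ).of_le_mul (c := C) ((Complex.measurable_ofReal.comp hV).aestronglyMeasurable.mul
    (Lp.memLp ψ).1) (ae_of_all _ fun x => by
      rw [potMul, norm_mul, Complex.norm_real, Real.norm_eq_abs]
      gcongr; exact abs_potential_le hd hδ x)

/-- Cauchy–Schwarz: `ψ ∈ L²`, and `⟨x⟩ᵐV ∈ L²` once `2(δ - m) > 4`. This is the source of all decay
requirements on `V`: moments of order `m` of `Vψ` cost `δ > m + 2`. -/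
theorem integrable_bracket_rpow_mul_norm_potMul (hV : Measurable V)
    (hd : ∀ z, |V z| ≤ C * bracket z ^ (-δ)) {m : ℝ} (hm : m + 2 < δ) (ψ : L2) :
    Integrable fun x => bracket x ^ m * ‖potMul V ψ x‖ := by
  have h := (memLp_bracket_rpow_mul hV hd hm).norm.integrable_mul (Lp.memLp ψ).norm
  refine h.congr (ae_of_all _ fun x => ?_)
  simp only [Pi.mul_apply, potMul, norm_mul, Complex.norm_real, Real.norm_eq_abs,
    abs_of_pos (Real.rpow_pos_of_pos (bracket_pos x) m)]
  ring

theorem aestronglyMeasurable_potMul (hV : Measurable V) (ψ : L2) :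
    AEStronglyMeasurable (potMul V ψ) volume :=
  (Complex.measurable_ofReal.comp hV).aestronglyMeasurable.mul (Lp.memLp ψ).1

theorem integrable_potMul (hV : Measurable V) (hd : ∀ z, |V z| ≤ C * bracket z ^ (-δ))
    (hδ : 2 < δ) (ψ : L2) : Integrable (potMul V ψ) := by
  have h := integrable_bracket_rpow_mul_norm_potMul hV hd (m := 0) (by linarith) ψ
  simp only [Real.rpow_zero, one_mul] at h
  exact (integrable_norm_iff (aestronglyMeasurable_potMul hV ψ)).1 h

theorem integrable_norm_pow_mul_norm_potMul (hV : Measurable V)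
    (hd : ∀ z, |V z| ≤ C * bracket z ^ (-δ)) {m : ℕ} (hm : (m : ℝ) + 2 < δ) (ψ : L2) :
    Integrable fun x => ‖x‖ ^ m * ‖potMul V ψ x‖ := by
  refine (integrable_bracket_rpow_mul_norm_potMul hV hd hm ψ).mono'
    ((continuous_norm.pow m).aestronglyMeasurable.mul (aestronglyMeasurable_potMul hV ψ).norm)
    (ae_of_all _ fun x => ?_)
  rw [Real.norm_of_nonneg (by positivity), Real.rpow_natCast]
  gcongr
  exact norm_le_bracket x

theorem mulOp_potential (hV : Measurable V) (hd : ∀ z, |V z| ≤ C * bracket z ^ (-δ))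
    (hδ : 0 ≤ δ) (ψ : L2) :
    mulOp (fun x => (V x : ℂ)) ψ = (memLp_potMul hV hd hδ ψ).toLp _ := by
  apply Lp.ext
  filter_upwards [mulOp_ae (memLp_top_potential hV hd hδ) ψ,
    (memLp_potMul hV hd hδ ψ).coeFn_toLp] with x h1 h2
  rw [h1, h2, potMul]

/-- The eigenvalue equation `-Δψ + Vψ = 0` on the Fourier side. -/
theorem fourier_eigenfunction (hV : Measurable V) (hd : ∀ z, |V z| ≤ C * bracket z ^ (-δ))
    (hδ : 2 < δ) {ψ : L2} (hψ : ψ ∈ zeroEigenspace V) :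
    ∀ᵐ ξ : R4, ((4 * Real.pi ^ 2 * ‖ξ‖ ^ 2 : ℝ) : ℂ) * (𝓕 ψ : L2) ξ = - 𝓕 (potMul V ψ) ξ := by
  have hδ' : 0 ≤ δ := by linarith
  have h0 : schrodingerOp V ψ = 0 := hψ
  rw [schrodingerOp] at h0
  simp only [add_apply, neg_apply,
    ContinuousLinearMap.comp_apply, Lp.toTemperedDistributionCLM_apply,
    TemperedDistribution.laplacianCLM_apply, mulOp_potential hV hd hδ'] at h0
  rw [TemperedDistribution.laplacian_eq_fourierMultiplierCLM,
    TemperedDistribution.fourierMultiplierCLM_apply] at h0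
  have hφ := memLp_potMul hV hd hδ' ψ
  have hφ₁ := integrable_potMul hV hd hδ ψ
  have hcont : Continuous (𝓕 (potMul V ψ)) := VectorFourier.fourierIntegral_continuous
    Real.continuous_fourierChar (by exact continuous_inner) hφ₁
  have hsym : Continuous fun ξ : R4 => ((4 * Real.pi ^ 2 * ‖ξ‖ ^ 2 : ℝ) : ℂ) := by fun_prop
  apply ae_eq_of_integral_contDiff_smul_eq
  · have := (Lp.memLp (𝓕 ψ : L2)).locallyIntegrable (by norm_num)
    have h2 := this.locallyIntegrableOn univ
    exact locallyIntegrableOn_univ.1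
      (h2.continuousOn_mul hsym.continuousOn isOpen_univ.isLocallyClosed)
  · exact hcont.neg.locallyIntegrable
  intro g hg hgc
  have hg' : ContDiff ℝ ∞ (fun x => (g x : ℂ)) := Complex.ofRealCLM.contDiff.comp hg
  have hgc' : HasCompactSupport (fun x => (g x : ℂ)) := hgc.comp_left (g := Complex.ofReal) rfl
  let u : 𝓢(R4, ℂ) := hgc'.toSchwartzMap hg'
  have hu : ∀ x, u x = g x := fun x => rfl
  -- Evaluating the equation at `𝓕 u` rather than at `u` turns the Laplacian into multiplication by
  -- `4π²|ξ|²` in the pairing with `u`.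
  have h := congrArg (fun T : 𝓢'(R4, ℂ) => T (𝓕 u)) h0
  have htg : (fun x : R4 => Complex.ofReal (‖x‖ ^ 2)).HasTemperateGrowth := by fun_prop
  have hsm : (-(-(2 * Real.pi) ^ 2 • 𝓕⁻ ((TemperedDistribution.smulLeftCLM ℂ
      fun x : R4 => Complex.ofReal (‖x‖ ^ 2)) (𝓕 (Lp.toTemperedDistribution ψ)))) :
        𝓢'(R4, ℂ)) (𝓕 u) = ∫ x, u x • (((4 * Real.pi ^ 2 * ‖x‖ ^ 2 : ℝ) : ℂ) * (𝓕 ψ : L2) x) := by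
    rw [Lp.fourier_toTemperedDistribution_eq]
    change -((-(2 * Real.pi) ^ 2) • (𝓕⁻ ((TemperedDistribution.smulLeftCLM ℂ
      fun x : R4 => Complex.ofReal (‖x‖ ^ 2)) (Lp.toTemperedDistribution (𝓕 ψ : L2)) : 𝓢'(R4, ℂ)) :
        𝓢'(R4, ℂ)) (𝓕 u)) = _
    rw [neg_smul, neg_neg, TemperedDistribution.fourierInv_apply, FourierTransform.fourierInv_fourier_eq,
      TemperedDistribution.smulLeftCLM_apply_apply, Lp.toTemperedDistribution_apply,
      ← integral_smul]
    refine integral_congr_ae (ae_of_all _ fun x => ?_)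
    simp only [SchwartzMap.smulLeftCLM_apply_apply htg, smul_eq_mul, Complex.real_smul]
    push_cast; ring
  have hsp : Lp.toTemperedDistribution (hφ.toLp _) (𝓕 u) = ∫ x, u x • 𝓕 (potMul V ψ) x := by
    rw [Lp.toTemperedDistribution_apply]
    have h2 : ∫ x, (𝓕 u) x • (hφ.toLp _) x = ∫ x, (𝓕 u) x * potMul V ψ x := by
      apply integral_congr_ae
      filter_upwards [hφ.coeFn_toLp] with x hx
      rw [hx, smul_eq_mul]
    rw [h2]
    have h3 := VectorFourier.integral_fourierIntegral_smul_eq_flip (L := innerₗ R4) (μ := volume)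
      (ν := volume) (f := (u : R4 → ℂ)) (g := potMul V ψ) Real.continuous_fourierChar
      (by exact continuous_inner) u.integrable hφ₁
    rw [flip_innerₗ] at h3
    exact h3
  change (-(-(2 * Real.pi) ^ 2 • 𝓕⁻ ((TemperedDistribution.smulLeftCLM ℂ
      fun x : R4 => Complex.ofReal (‖x‖ ^ 2)) (𝓕 (Lp.toTemperedDistribution ψ)))) :
        𝓢'(R4, ℂ)) (𝓕 u) + Lp.toTemperedDistribution (hφ.toLp _) (𝓕 u) = 0 at h
  rw [hsm, hsp] at h
  have := eq_neg_of_add_eq_zero_left h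
  simp only [smul_neg, integral_neg]
  simpa [hu] using this

/-- A locally square integrable function of the form `|ξ|⁻² g`, with `g` continuous, has
`g 0 = 0`. -/
theorem eq_zero_of_norm_sq_mul_eq {g : R4 → ℂ} (hg : Continuous g) {u : R4 → ℂ}
    (hu : MemLp u 2 volume) (h : ∀ᵐ ξ : R4, ((4 * Real.pi ^ 2 * ‖ξ‖ ^ 2 : ℝ) : ℂ) * u ξ = g ξ) :
    g 0 = 0 := by
  by_contra hne
  have hpos : 0 < ‖g 0‖ / 2 := by positivity
  have hev : ∀ᶠ ξ in 𝓝 (0 : R4), ‖g 0‖ / 2 < ‖g ξ‖ :=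
    hg.norm.continuousAt.eventually (lt_mem_nhds (by simp only; linarith))
  obtain ⟨r, hr, hball⟩ := Metric.eventually_nhds_iff_ball.1 hev
  -- If `g 0 ≠ 0` then `|u|² ≳ |ξ|⁻⁴` near `0`, which would make `|ξ|⁻⁴` integrable there; in polar
  -- coordinates this is `∫ y³ y⁻⁴ dy`, which diverges.
  have hInt : IntegrableOn (fun x : R4 => ‖x‖ ^ (-4 : ℝ)) (Metric.ball 0 r) := by
    have h2 := (hu.integrable_norm_pow (by norm_num)).const_mul ((4 * Real.pi ^ 2 / (‖g 0‖ / 2)) ^ 2)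
    refine (h2.integrableOn (s := Metric.ball 0 r)).mono'
      (measurable_norm.pow_const _).aestronglyMeasurable ?_
    refine (ae_restrict_iff' measurableSet_ball).2 ?_
    have hne0 : ∀ᵐ x : R4, x ≠ 0 := by simp [ae_iff]
    filter_upwards [h, hne0] with ξ hξ hξ0 hm
    have hn : 0 < ‖ξ‖ := norm_pos_iff.2 hξ0
    have h3 := hball ξ hm
    rw [← hξ, norm_mul, Complex.norm_real, Real.norm_of_nonneg (by positivity)] at h3
    rw [Real.norm_of_nonneg (by positivity), show (-4 : ℝ) = -((4 : ℕ) : ℝ) by norm_num,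
      Real.rpow_neg hn.le, Real.rpow_natCast]
    have h4 : (‖ξ‖ ^ 2)⁻¹ ≤ 4 * Real.pi ^ 2 / (‖g 0‖ / 2) * ‖u ξ‖ := by
      rw [inv_le_iff_one_le_mul₀ (by positivity), div_mul_eq_mul_div, div_mul_eq_mul_div,
        one_le_div hpos]
      nlinarith
    calc (‖ξ‖ ^ 4)⁻¹ = ((‖ξ‖ ^ 2)⁻¹) ^ 2 := by rw [inv_pow]; ring
      _ ≤ (4 * Real.pi ^ 2 / (‖g 0‖ / 2) * ‖u ξ‖) ^ 2 := by gcongr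
      _ = _ := by ring
  have h5 := (integrableOn_fun_norm_addHaar (volume : Measure R4) (f := fun t => t ^ (-4 : ℝ))).1
    hInt
  have h6 : IntegrableOn (fun y : ℝ => y ^ (-1 : ℝ)) (Ioo 0 r) := by
    refine h5.congr_fun (fun y hy => ?_) measurableSet_Ioo
    simp only [finrank_euclideanSpace, Fintype.card_fin, smul_eq_mul]
    rw [show (-1 : ℝ) = ((4 - 1 : ℕ) : ℝ) + (-4) by norm_num, Real.rpow_add hy.1,
      Real.rpow_natCast]
  rw [intervalIntegral.integrableOn_Ioo_rpow_iff hr] at h6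
  exact lt_irrefl _ h6

/-- The integral is the value at `0` of the Fourier transform of `Vψ`, which is continuous and
equals `-4π²|ξ|²ψ̂` with `ψ̂ ∈ L²`. This is the cancellation on which the whole estimate depends. -/
theorem integral_potMul_eq_zero (hV : Measurable V) (hd : ∀ z, |V z| ≤ C * bracket z ^ (-δ))
    (hδ : 2 < δ) {ψ : L2} (hψ : ψ ∈ zeroEigenspace V) : ∫ x, potMul V ψ x = 0 := by
  have hφ₁ := integrable_potMul hV hd hδ ψ
  have hcont : Continuous (𝓕 (potMul V ψ)) := VectorFourier.fourierIntegral_continuous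
    Real.continuous_fourierChar (by exact continuous_inner) hφ₁
  have := eq_zero_of_norm_sq_mul_eq hcont.neg (Lp.memLp (𝓕 ψ : L2))
    (fourier_eigenfunction hV hd hδ hψ)
  simpa [Real.fourier_eq] using this

theorem integrable_norm_sq (u : L2) : Integrable fun x => ‖u x‖ ^ 2 :=
  (Lp.memLp u).integrable_norm_pow (by norm_num)

theorem integral_norm_sq (u : L2) : ∫ x, ‖u x‖ ^ 2 = ‖u‖ ^ 2 := by
  have h := inner_self_eq_norm_sq_to_K (𝕜 := ℂ) u
  rw [L2.inner_def] at h
  simp only [inner_self_eq_norm_sq_to_K] at h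
  have h2 : ∫ x, ((‖u x‖ ^ 2 : ℝ) : ℂ) = ((‖u‖ ^ 2 : ℝ) : ℂ) := by
    push_cast; exact h
  rw [← Complex.ofReal_inj, ← h2]
  exact integral_ofReal.symm

theorem norm_fourierChar_sub_one_le (t : ℝ) :
    ‖((Real.fourierChar t : Circle) : ℂ) - 1‖ ≤ 2 * Real.pi * |t| := by
  have := Real.norm_exp_I_mul_ofReal_sub_one_le (x := 2 * Real.pi * t)
  rw [Real.fourierChar_apply, mul_comm]
  refine this.trans ?_
  rw [Real.norm_eq_abs, abs_mul, abs_of_pos (by positivity : 0 < 2 * Real.pi)]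

theorem conj_fourierChar (t : ℝ) :
    (starRingEnd ℂ) ((Real.fourierChar t : Circle) : ℂ) = ((Real.fourierChar (-t) : Circle) : ℂ) := by
  rw [Real.fourierChar_apply, Real.fourierChar_apply, ← Complex.exp_conj]
  simp only [map_mul, Complex.conj_ofReal, Complex.conj_I, mul_neg, Complex.ofReal_neg, neg_mul]

/-- Since `∫ V b_i = 0`, the Fourier transform of `V b_i` at `ξ` is the inner product of `b_i` with
`V(e^{2πi x·ξ} - 1)`, whose `L²` norm is `O(|ξ|)` because `⟨x⟩V ∈ L²`. Bessel's inequality bounds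
the sum independently of the number of functions. -/
theorem sum_norm_sq_fourier_potMul_le (hV : Measurable V)
    (hd : ∀ z, |V z| ≤ C * bracket z ^ (-δ)) (hδ : 3 < δ) :
    ∃ K : ℝ, 0 ≤ K ∧ ∀ {ι : Type} [Fintype ι] {b : ι → L2}, Orthonormal ℂ b →
      (∀ i, b i ∈ zeroEigenspace V) → ∀ ξ, ∑ i, ‖𝓕 (potMul V (b i)) ξ‖ ^ 2 ≤ K * ‖ξ‖ ^ 2 := by
  have hbV := memLp_bracket_rpow_mul hV hd (m := 1) (by linarith)
  refine ⟨(2 * Real.pi * ‖hbV.toLp _‖) ^ 2, by positivity, ?_⟩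
  intro ι _ b hb hE ξ
  let w : R4 → ℂ := fun x => (V x : ℂ) * (((Real.fourierChar (inner ℝ x ξ) : Circle) : ℂ) - 1)
  have hwb : ∀ x, ‖w x‖ ≤ 2 * Real.pi * ‖ξ‖ * ‖bracket x ^ (1 : ℝ) * V x‖ := by
    intro x
    simp only [w, norm_mul, Complex.norm_real]
    have h1 := norm_fourierChar_sub_one_le (inner ℝ x ξ)
    have h2 := (abs_real_inner_le_norm x ξ).trans
      (mul_le_mul_of_nonneg_right (norm_le_bracket x) (norm_nonneg ξ))
    rw [Real.rpow_one, Real.norm_of_nonneg (bracket_pos x).le]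
    calc ‖V x‖ * _ ≤ ‖V x‖ * (2 * Real.pi * (bracket x * ‖ξ‖)) := by
          gcongr
          exact h1.trans (by gcongr)
      _ = _ := by ring
  have hw : MemLp w 2 volume := by
    refine hbV.of_le_mul (c := 2 * Real.pi * ‖ξ‖) ?_ (ae_of_all _ hwb)
    refine ((Complex.measurable_ofReal.comp hV).mul ?_).aestronglyMeasurable
    refine Measurable.sub_const ?_ _
    exact (continuous_subtype_val.comp (Real.continuous_fourierChar.comp
      (by fun_prop : Continuous fun x : R4 => (inner ℝ x ξ : ℝ)))).measurable
  have hwn : ‖hw.toLp w‖ ≤ 2 * Real.pi * ‖ξ‖ * ‖hbV.toLp _‖ := by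
    refine Lp.norm_le_mul_norm_of_ae_le_mul ?_
    filter_upwards [hw.coeFn_toLp, hbV.coeFn_toLp] with x h1 h2
    rw [h1, h2]
    exact hwb x
  have hinner : ∀ i, 𝓕 (potMul V (b i)) ξ = inner ℂ (hw.toLp w) (b i) := by
    intro i
    have hi := integrable_potMul hV hd (by linarith) (b i)
    have h0 := integral_potMul_eq_zero hV hd (by linarith) (hE i)
    have hi' : Integrable fun x => Real.fourierChar (-inner ℝ x ξ) • potMul V (b i) x :=
      (Real.fourierIntegral_convergent_iff ξ).2 hi
    rw [L2.inner_def, Real.fourier_eq, ← sub_zero (∫ x, _ • _), ← h0, ← integral_sub hi' hi]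
    apply integral_congr_ae
    filter_upwards [hw.coeFn_toLp] with x h1
    rw [h1]
    simp only [w, potMul, RCLike.inner_apply, map_mul, Complex.conj_ofReal, map_sub, map_one,
      conj_fourierChar, Circle.smul_def, smul_eq_mul]
    ring
  calc ∑ i, ‖𝓕 (potMul V (b i)) ξ‖ ^ 2 = ∑ i, ‖inner ℂ (b i) (hw.toLp w)‖ ^ 2 := by
        simp only [hinner, norm_inner_symm]
    _ ≤ ‖hw.toLp w‖ ^ 2 := hb.sum_inner_products_le _
    _ ≤ (2 * Real.pi * ‖ξ‖ * ‖hbV.toLp _‖) ^ 2 := by gcongr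
    _ = _ := by ring

/-- Sum `∫ |b̂_i|² = 1` over the family. At low frequency the sum of the integrands is at most
`K|ξ|⁻²`, locally integrable on `ℝ⁴`, whatever the size of the family; at frequency at least `M` the
decay `|ξ|⁻⁴` in `b̂_i` makes the total at most half the cardinality. So the cardinality is at most
twice the low frequency integral. -/
theorem exists_card_le_of_orthonormal (hV : Measurable V)
    (hd : ∀ z, |V z| ≤ C * bracket z ^ (-δ)) (hδ : 3 < δ) :
    ∃ N : ℕ, ∀ {ι : Type} [Fintype ι] {b : ι → L2}, Orthonormal ℂ b →
      (∀ i, b i ∈ zeroEigenspace V) → Fintype.card ι ≤ N := by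
  obtain ⟨K, hK, hKb⟩ := sum_norm_sq_fourier_potMul_le hV hd hδ
  have hδ0 : 0 ≤ δ := by linarith
  have hC := decay_const_nonneg hd
  -- Chosen so that `M⁻⁴ C² ≤ 1/2`, where `C` bounds `‖V b_i‖₂`.
  set M : ℝ := 1 + 2 * C ^ 2 with hM
  have hM1 : 1 ≤ M := by nlinarith [sq_nonneg C]
  have hnear : IntegrableOn (fun ξ : R4 => K * (nearInv ξ + 1)) (Metric.ball 0 M) :=
    ((integrable_nearInv.integrableOn).add
      (integrableOn_const (by exact measure_ball_lt_top.ne))).const_mul K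
  set B : ℝ := ∫ ξ in Metric.ball (0 : R4) M, K * (nearInv ξ + 1) with hB
  obtain ⟨N, hN⟩ := exists_nat_ge (2 * B)
  refine ⟨N, ?_⟩
  intro ι _ b hb hE
  have hφ := fun i => memLp_potMul hV hd hδ0 (b i)
  have hφn : ∀ i, ‖(hφ i).toLp _‖ ≤ C := by
    intro i
    have := Lp.norm_le_mul_norm_of_ae_le_mul (f := (hφ i).toLp _) (g := b i) (c := C) (by
      filter_upwards [(hφ i).coeFn_toLp] with x h1
      rw [h1, potMul, norm_mul, Complex.norm_real, Real.norm_eq_abs]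
      gcongr; exact abs_potential_le hd hδ0 x)
    simpa [hb.1 i] using this
  have hpt : ∀ᵐ ξ : R4, ∑ i, ‖(𝓕 (b i) : L2) ξ‖ ^ 2 ≤
      (Metric.ball (0 : R4) M).indicator (fun ξ => K * (nearInv ξ + 1)) ξ +
        (M ^ 4)⁻¹ * ∑ i, ‖(𝓕 ((hφ i).toLp _) : L2) ξ‖ ^ 2 := by
    have h1 : ∀ᵐ ξ : R4, ∀ i, ((4 * Real.pi ^ 2 * ‖ξ‖ ^ 2 : ℝ) : ℂ) * (𝓕 (b i) : L2) ξ =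
        - 𝓕 (potMul V (b i)) ξ :=
      ae_all_iff.2 fun i => fourier_eigenfunction hV hd (by linarith) (hE i)
    have h2 : ∀ᵐ ξ : R4, ∀ i, (𝓕 ((hφ i).toLp _) : L2) ξ = 𝓕 (potMul V (b i)) ξ :=
      ae_all_iff.2 fun i => fourier_toLp_ae (integrable_potMul hV hd (by linarith) (b i)) (hφ i)
    have hne0 : ∀ᵐ x : R4, x ≠ 0 := by simp [ae_iff]
    filter_upwards [h1, h2, hne0] with ξ h1 h2 hξ
    have hn : 0 < ‖ξ‖ := norm_pos_iff.2 hξ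
    have hpi : 1 ≤ 4 * Real.pi ^ 2 := by nlinarith [Real.pi_gt_three]
    have h3 : ∀ i, ‖(𝓕 (b i) : L2) ξ‖ ^ 2 ≤ (‖ξ‖ ^ 4)⁻¹ * ‖𝓕 (potMul V (b i)) ξ‖ ^ 2 := by
      intro i
      have h4 := congrArg norm (h1 i)
      rw [norm_mul, norm_neg, Complex.norm_real, Real.norm_of_nonneg (by positivity)] at h4
      have h5 : ‖ξ‖ ^ 2 * ‖(𝓕 (b i) : L2) ξ‖ ≤ ‖𝓕 (potMul V (b i)) ξ‖ := by
        rw [← h4, mul_assoc (4 * Real.pi ^ 2)]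
        exact le_mul_of_one_le_left (by positivity) hpi
      rw [le_inv_mul_iff₀ (by positivity)]
      calc _ = (‖ξ‖ ^ 2 * ‖(𝓕 (b i) : L2) ξ‖) ^ 2 := by ring
        _ ≤ _ := by gcongr
    have h6 : ∑ i, ‖(𝓕 (b i) : L2) ξ‖ ^ 2 ≤
        (‖ξ‖ ^ 4)⁻¹ * ∑ i, ‖𝓕 (potMul V (b i)) ξ‖ ^ 2 := by
      rw [Finset.mul_sum]
      exact Finset.sum_le_sum fun i _ => h3 i
    simp only [h2]
    have hs : 0 ≤ ∑ i, ‖𝓕 (potMul V (b i)) ξ‖ ^ 2 := by positivity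
    by_cases hm : ξ ∈ Metric.ball (0 : R4) M
    · rw [indicator_of_mem hm]
      have h7 : (‖ξ‖ ^ 4)⁻¹ * ∑ i, ‖𝓕 (potMul V (b i)) ξ‖ ^ 2 ≤ K * (nearInv ξ + 1) := by
        calc _ ≤ (‖ξ‖ ^ 4)⁻¹ * (K * ‖ξ‖ ^ 2) := by gcongr; exact hKb hb hE ξ
          _ = K * (‖ξ‖ ^ 2)⁻¹ := by field_simp
          _ ≤ K * (nearInv ξ + 1) := by
            gcongr
            by_cases h1 : ‖ξ‖ < 1
            · rw [nearInv_of_lt h1]; linarith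
            · have : (‖ξ‖ ^ 2)⁻¹ ≤ 1 := inv_le_one_of_one_le₀ (one_le_pow₀ (not_lt.1 h1))
              linarith [nearInv_nonneg ξ]
      have : 0 ≤ (M ^ 4)⁻¹ * ∑ i, ‖𝓕 (potMul V (b i)) ξ‖ ^ 2 := by positivity
      linarith
    · rw [indicator_of_notMem hm, zero_add]
      refine h6.trans ?_
      have : M ≤ ‖ξ‖ := by simpa using hm
      gcongr
  have hI1 : Integrable fun ξ : R4 => ∑ i, ‖(𝓕 (b i) : L2) ξ‖ ^ 2 :=
    integrable_finsetSum _ fun i _ => integrable_norm_sq _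
  have hI2 : Integrable fun ξ : R4 => ∑ i, ‖(𝓕 ((hφ i).toLp _) : L2) ξ‖ ^ 2 :=
    integrable_finsetSum _ fun i _ => integrable_norm_sq _
  have hI3 := (integrable_indicator_iff measurableSet_ball).2 hnear
  have hmono := integral_mono_ae hI1 (hI3.add (hI2.const_mul ((M ^ 4)⁻¹))) hpt
  simp only [Pi.add_apply] at hmono
  rw [integral_add hI3 (hI2.const_mul _), integral_indicator measurableSet_ball, ← hB,
    integral_const_mul, integral_finsetSum _ fun i _ => integrable_norm_sq _,
    integral_finsetSum _ fun i _ => integrable_norm_sq _] at hmono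
  simp only [integral_norm_sq, Lp.norm_fourier_eq, hb.1, one_pow, Finset.sum_const,
    Finset.card_univ, nsmul_eq_mul, mul_one] at hmono
  have h8 : ∑ i, ‖(hφ i).toLp _‖ ^ 2 ≤ Fintype.card ι * C ^ 2 := by
    calc _ ≤ ∑ _i : ι, C ^ 2 := Finset.sum_le_sum fun i _ => by gcongr; exact hφn i
      _ = _ := by simp
  have h9 : (M ^ 4)⁻¹ * ∑ i, ‖(hφ i).toLp _‖ ^ 2 ≤ Fintype.card ι / 2 := by
    rw [inv_mul_le_iff₀ (by positivity)]
    refine h8.trans ?_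
    have : M ≤ M ^ 4 := le_self_pow₀ hM1 (by norm_num)
    have hc : (0 : ℝ) ≤ Fintype.card ι := by positivity
    nlinarith
  have : (Fintype.card ι : ℝ) ≤ N := by linarith
  exact_mod_cast this

theorem finiteDimensional_zeroEigenspace (hV : Measurable V)
    (hd : ∀ z, |V z| ≤ C * bracket z ^ (-δ)) (hδ : 3 < δ) :
    FiniteDimensional ℂ (zeroEigenspace V) := by
  obtain ⟨N, hN⟩ := exists_card_le_of_orthonormal hV hd hδ
  -- A finite independent set of size `n` spans an `n`-dimensional space; an orthonormal basis of
  -- that span is an orthonormal family of eigenfunctions, so `n ≤ N`.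
  refine Module.rank_lt_aleph0_iff.1 (lt_of_le_of_lt (rank_le (n := N) fun s hs => ?_)
    (Cardinal.natCast_lt_aleph0))
  have hcard := finrank_span_finset_eq_card (R := ℂ) (s := s) hs
  have : FiniteDimensional ℂ (Submodule.span ℂ (s : Set (zeroEigenspace V))) :=
    FiniteDimensional.span_finset ℂ s
  have hob := (stdOrthonormalBasis ℂ (Submodule.span ℂ (s : Set (zeroEigenspace V)))).orthonormal
  have h2 := hob.comp_linearIsometry ((Submodule.subtypeₗᵢ (zeroEigenspace V)).comp
    (Submodule.subtypeₗᵢ (Submodule.span ℂ (s : Set (zeroEigenspace V)))))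
  have h3 := hN h2 (fun i => Subtype.prop _)
  rwa [Fintype.card_fin, hcard] at h3

/-- `P_e` is a finite sum of rank one projections onto eigenfunctions. -/
theorem exists_eigenProj_eq_sum (hV : Measurable V)
    (hd : ∀ z, |V z| ≤ C * bracket z ^ (-δ)) (hδ : 3 < δ) :
    ∃ (n : ℕ) (b : Fin n → L2), (∀ i, b i ∈ zeroEigenspace V) ∧
      ∀ u, eigenProj V u = ∑ i, inner ℂ (b i) u • b i := by
  have := finiteDimensional_zeroEigenspace hV hd hδ
  let B := stdOrthonormalBasis ℂ (zeroEigenspace V)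
  refine ⟨_, fun i => (B i : L2), fun i => (B i).2, fun u => ?_⟩
  rw [eigenProj, Submodule.starProjection_apply, B.orthogonalProjectionOnto_apply_eq_sum]
  simp

end Potential

/-! ### Symbols and integration by parts. -/

/-- `f` has `n` continuous derivatives on `S`, all of norm at most `M` there. -/
def SymbolOn (S : Set ℝ) : ℕ → (ℝ → ℂ) → ℝ → Prop
  | 0, f, M => ContinuousOn f S ∧ ∀ x ∈ S, ‖f x‖ ≤ M
  | n + 1, f, M => (∀ x ∈ S, ‖f x‖ ≤ M) ∧
      ∃ f' : ℝ → ℂ, (∀ x ∈ S, HasDerivAt f (f' x) x) ∧ SymbolOn S n f' M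

namespace SymbolOn

variable {S : Set ℝ} {n : ℕ} {f g : ℝ → ℂ} {M N : ℝ}

theorem norm_le (h : SymbolOn S n f M) : ∀ x ∈ S, ‖f x‖ ≤ M := by
  cases n with
  | zero => exact h.2
  | succ n => exact h.1

theorem continuousOn (h : SymbolOn S n f M) : ContinuousOn f S := by
  cases n with
  | zero => exact h.1
  | succ n =>
    obtain ⟨-, f', hd, -⟩ := h
    exact fun x hx => (hd x hx).continuousAt.continuousWithinAt

theorem pred (h : SymbolOn S (n + 1) f M) : SymbolOn S n f M := by
  induction n generalizing f with
  | zero => exact ⟨h.continuousOn, h.norm_le⟩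
  | succ n ih =>
    obtain ⟨hb, f', hd, hf'⟩ := h
    exact ⟨hb, f', hd, ih hf'⟩

theorem mono (h : SymbolOn S n f M) (hMN : M ≤ N) : SymbolOn S n f N := by
  induction n generalizing f with
  | zero => exact ⟨h.1, fun x hx => (h.2 x hx).trans hMN⟩
  | succ n ih =>
    obtain ⟨hb, f', hd, hf'⟩ := h
    exact ⟨fun x hx => (hb x hx).trans hMN, f', hd, ih hf'⟩

theorem add (hf : SymbolOn S n f M) (hg : SymbolOn S n g N) :
    SymbolOn S n (fun x => f x + g x) (M + N) := by
  induction n generalizing f g with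
  | zero => exact ⟨hf.1.add hg.1, fun x hx => norm_add_le_of_le (hf.2 x hx) (hg.2 x hx)⟩
  | succ n ih =>
    obtain ⟨hb, f', hd, hf'⟩ := hf
    obtain ⟨hb2, g', hd2, hg'⟩ := hg
    exact ⟨fun x hx => norm_add_le_of_le (hb x hx) (hb2 x hx), _,
      fun x hx => (hd x hx).add (hd2 x hx), ih hf' hg'⟩

theorem const_mul (hf : SymbolOn S n f M) (c : ℂ) :
    SymbolOn S n (fun x => c * f x) (‖c‖ * M) := by
  induction n generalizing f with
  | zero =>
    exact ⟨continuousOn_const.mul hf.1, fun x hx => by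
      rw [norm_mul]; exact mul_le_mul_of_nonneg_left (hf.2 x hx) (norm_nonneg _)⟩
  | succ n ih =>
    obtain ⟨hb, f', hd, hf'⟩ := hf
    exact ⟨fun x hx => by
      rw [norm_mul]; exact mul_le_mul_of_nonneg_left (hb x hx) (norm_nonneg _), _,
      fun x hx => (hd x hx).const_mul c, ih hf'⟩

/-- Leibniz rule; `2ⁿ` bounds the number of terms after at most `n` differentiations. -/
theorem mul (hf : SymbolOn S n f M) (hg : SymbolOn S n g N) (hM : 0 ≤ M) (hN : 0 ≤ N) :
    SymbolOn S n (fun x => f x * g x) (2 ^ n * (M * N)) := by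
  induction n generalizing f g with
  | zero =>
    refine ⟨hf.1.mul hg.1, fun x hx => ?_⟩
    rw [norm_mul, pow_zero, one_mul]
    exact mul_le_mul (hf.2 x hx) (hg.2 x hx) (norm_nonneg _) hM
  | succ n ih =>
    have hf0 := hf.pred
    have hg0 := hg.pred
    obtain ⟨hb, f', hd, hf'⟩ := hf
    obtain ⟨hb2, g', hd2, hg'⟩ := hg
    refine ⟨fun x hx => ?_, _, fun x hx => (hd x hx).mul (hd2 x hx), ?_⟩
    · rw [norm_mul]
      calc _ ≤ M * N := mul_le_mul (hb x hx) (hb2 x hx) (norm_nonneg _) hM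
        _ ≤ _ := le_mul_of_one_le_left (by positivity) (one_le_pow₀ (by norm_num))
    · refine ((ih hf' hg0).add (ih hf0 hg')).mono ?_
      rw [pow_succ]; linarith

theorem exists_of_contDiff {K : Set ℝ} (hK : IsCompact K) (hSK : S ⊆ K)
    (hf : ContDiff ℝ ∞ f) (n : ℕ) : ∃ M, 0 ≤ M ∧ SymbolOn S n f M := by
  induction n generalizing f with
  | zero =>
    obtain ⟨M, hM⟩ := hK.exists_bound_of_continuousOn hf.continuous.continuousOn
    exact ⟨max M 0, le_max_right _ _, hf.continuous.continuousOn,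
      fun x hx => (hM x (hSK hx)).trans (le_max_left _ _)⟩
  | succ n ih =>
    obtain ⟨M, hM⟩ := hK.exists_bound_of_continuousOn hf.continuous.continuousOn
    obtain ⟨N, hN0, hN⟩ := ih (f := deriv f) (contDiff_infty_iff_deriv.1 hf).2
    exact ⟨max M N, hN0.trans (le_max_right _ _),
      fun x hx => (hM x (hSK hx)).trans (le_max_left _ _), deriv f,
      fun x _ => (hf.differentiable (by simp) x).hasDerivAt, hN.mono (le_max_right _ _)⟩

/-- Repeated integration by parts. -/
theorem norm_integral_exp_mul_le {a L a₁ L₁ : ℝ} (hS : IsOpen S) (hsub : Icc a₁ L₁ ⊆ S)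
    (hle : a₁ ≤ L₁) (ha : a₁ < a) (hL : L < L₁) {t : ℝ} (ht : t ≠ 0)
    (hf : SymbolOn S n f M) (h0 : ∀ x ∈ S, x ∉ Icc a L → f x = 0) :
    ‖∫ x in a₁..L₁, Complex.exp (Complex.I * (t * x : ℝ)) * f x‖ ≤
      M * (L₁ - a₁) * (|t| ^ n)⁻¹ := by
  have hnorm : ∀ x : ℝ, ‖Complex.exp (Complex.I * (t * x : ℝ))‖ = 1 := fun x => by
    rw [mul_comm, Complex.norm_exp_ofReal_mul_I]
  induction n generalizing f with
  | zero =>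
    have := intervalIntegral.norm_integral_le_of_norm_le_const (a := a₁) (b := L₁) (C := M)
      (f := fun x : ℝ => Complex.exp (Complex.I * (t * x : ℝ)) * f x) (fun x hx => by
        rw [uIoc_of_le hle] at hx
        rw [norm_mul, hnorm, one_mul]
        exact hf.2 x (hsub (Ioc_subset_Icc_self hx)))
    simpa [abs_of_nonneg (sub_nonneg.2 hle)] using this
  | succ n ih =>
    have hfc := hf.continuousOn
    obtain ⟨hb, f', hd, hf'⟩ := hf
    -- The complement of `[a, L]` is open, so the derivative vanishes there too and the induction
    -- hypothesis applies to it.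
    have h0' : ∀ x ∈ S, x ∉ Icc a L → f' x = 0 := by
      intro x hx hxn
      refine (hd x hx).unique ((hasDerivAt_const x (0 : ℂ)).congr_of_eventuallyEq ?_)
      filter_upwards [hS.mem_nhds hx, isClosed_Icc.isOpen_compl.mem_nhds hxn] with y h1 h2
      exact h0 y h1 h2
    have hIt : Complex.I * t ≠ 0 := mul_ne_zero Complex.I_ne_zero (by exact_mod_cast ht)
    have hE : ∀ x : ℝ, HasDerivAt (fun x : ℝ => (Complex.I * t)⁻¹ *
        Complex.exp (Complex.I * (t * x : ℝ))) (Complex.exp (Complex.I * (t * x : ℝ))) x := by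
      intro x
      have h1 : HasDerivAt (fun x : ℝ => Complex.I * ((t * x : ℝ) : ℂ)) (Complex.I * t) x := by
        have := ((hasDerivAt_id x).const_mul t).ofReal_comp.const_mul Complex.I
        simpa using this
      refine ((h1.cexp).const_mul ((Complex.I * t)⁻¹)).congr_deriv ?_
      rw [mul_comm (Complex.exp _), inv_mul_cancel_left₀ hIt]
    have hsubu : uIcc a₁ L₁ ⊆ S := by rw [uIcc_of_le hle]; exact hsub
    have hparts := intervalIntegral.integral_deriv_mul_eq_sub (a := a₁) (b := L₁)
      (fun x _ => hE x) (fun x hx => hd x (hsubu hx))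
      (Continuous.intervalIntegrable (by fun_prop) _ _)
      ((hf'.continuousOn.mono hsubu).intervalIntegrable)
    have hi1 : IntervalIntegrable (fun x : ℝ => Complex.exp (Complex.I * (t * x : ℝ)) * f x)
        volume a₁ L₁ :=
      ContinuousOn.intervalIntegrable
        ((Continuous.continuousOn (by fun_prop)).mul (hfc.mono hsubu))
    have hi2 : IntervalIntegrable (fun x : ℝ => (Complex.I * t)⁻¹ *
        Complex.exp (Complex.I * (t * x : ℝ)) * f' x) volume a₁ L₁ :=
      ContinuousOn.intervalIntegrable
        ((Continuous.continuousOn (by fun_prop)).mul (hf'.continuousOn.mono hsubu))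
    rw [intervalIntegral.integral_add hi1 hi2, h0 L₁ (hsub ⟨hle, le_rfl⟩) (fun h => by
      linarith [h.2]), h0 a₁ (hsub ⟨le_rfl, hle⟩) (fun h => by linarith [h.1])] at hparts
    simp only [mul_zero, sub_zero, mul_assoc (Complex.I * (t : ℂ))⁻¹,
      intervalIntegral.integral_const_mul] at hparts
    rw [eq_neg_of_add_eq_zero_left hparts, norm_neg, norm_mul, norm_inv, norm_mul, Complex.norm_I,
      one_mul, Complex.norm_real, Real.norm_eq_abs]
    calc |t|⁻¹ * _ ≤ |t|⁻¹ * (M * (L₁ - a₁) * (|t| ^ n)⁻¹) := by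
          gcongr; exact ih hf' h0'
      _ = _ := by rw [pow_succ, mul_inv]; ring

/-- Three integrations by parts when `|t| > 1` and the trivial bound when `|t| ≤ 1`; in either case
`8` absorbs the passage to `1 + |t|`. -/
theorem norm_integral_exp_mul_le_inv_pow {a L a₁ L₁ : ℝ} (hS : IsOpen S) (hsub : Icc a₁ L₁ ⊆ S)
    (hle : a₁ ≤ L₁) (ha : a₁ < a) (hL : L < L₁) (hM : 0 ≤ M) (t : ℝ)
    (hf : SymbolOn S 3 f M) (h0 : ∀ x ∈ S, x ∉ Icc a L → f x = 0) :
    ‖∫ x in a₁..L₁, Complex.exp (Complex.I * (t * x : ℝ)) * f x‖ ≤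
      8 * (M * (L₁ - a₁)) * ((1 + |t|) ^ 3)⁻¹ := by
  have hP : 0 ≤ M * (L₁ - a₁) := mul_nonneg hM (sub_nonneg.2 hle)
  by_cases ht : |t| ≤ 1
  · have := intervalIntegral.norm_integral_le_of_norm_le_const (a := a₁) (b := L₁) (C := M)
      (f := fun x : ℝ => Complex.exp (Complex.I * (t * x : ℝ)) * f x) (fun x hx => by
        rw [uIoc_of_le hle] at hx
        rw [norm_mul, mul_comm Complex.I, Complex.norm_exp_ofReal_mul_I, one_mul]
        exact hf.norm_le x (hsub (Ioc_subset_Icc_self hx)))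
    rw [abs_of_nonneg (sub_nonneg.2 hle)] at this
    refine this.trans ?_
    rw [le_mul_inv_iff₀ (by positivity), mul_comm 8]
    gcongr
    calc (1 + |t|) ^ 3 ≤ (1 + 1) ^ 3 := by gcongr
      _ = 8 := by norm_num
  · push Not at ht
    have ht0 : t ≠ 0 := by rintro rfl; simp at ht; linarith
    refine (norm_integral_exp_mul_le hS hsub hle ha hL ht0 hf h0).trans ?_
    rw [mul_comm 8, mul_assoc (M * (L₁ - a₁))]
    gcongr
    have : (1 + |t|) ^ 3 ≤ 8 * |t| ^ 3 := by
      calc (1 + |t|) ^ 3 ≤ (2 * |t|) ^ 3 := by gcongr; linarith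
        _ = _ := by ring
    rw [← div_eq_mul_inv, inv_le_comm₀ (by positivity) (by positivity), inv_div,
      div_le_iff₀ (by norm_num)]
    linarith

/-- The derivatives in `l` of the amplitude `A_α(c r l)`, `c = ± i`, are `O(r^α)`. -/
theorem hankelAmp_comp {b B : ℝ} (hb : 0 < b) {c : ℂ} (hc : ‖c‖ = 1) (hre : c.re = 0) (n : ℕ)
    {α : ℝ} (hα : α ≤ 0) :
    ∃ K, 0 ≤ K ∧ ∀ r : ℝ, 0 < r →
      SymbolOn (Ioo b B) n (fun l => hankelAmp α (c * r * l)) (K * r ^ α) := by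
  have hz : ∀ r l : ℝ, 0 < r → l ∈ Ioo b B → 0 ≤ (c * r * l).re ∧ c * r * l ≠ 0 ∧
      ‖c * r * l‖ = r * l := by
    intro r l hr hl
    have hl0 : 0 < l := hb.trans hl.1
    refine ⟨by simp [hre], ?_, ?_⟩
    · have : c ≠ 0 := by rintro rfl; simp at hc
      have h1 : (r : ℂ) ≠ 0 := by exact_mod_cast hr.ne'
      have h2 : (l : ℂ) ≠ 0 := by exact_mod_cast hl0.ne'
      positivity
    · simp [hc, abs_of_pos hr, abs_of_pos hl0]
  have hbd : ∀ β : ℝ, β ≤ 0 → ∀ r l : ℝ, 0 < r → l ∈ Ioo b B →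
      ‖hankelAmp β (c * r * l)‖ ≤ hankelConst * (2 * b) ^ β * r ^ β := by
    intro β hβ r l hr hl
    obtain ⟨h1, h2, h3⟩ := hz r l hr hl
    refine (norm_hankelAmp_le hβ h1 h2).trans ?_
    rw [h3, mul_assoc, ← Real.mul_rpow (by positivity) hr.le]
    refine mul_le_mul_of_nonneg_left ?_ hankelConst_nonneg
    refine Real.rpow_le_rpow_of_nonpos (by positivity) ?_ hβ
    nlinarith [hl.1]
  have hder : ∀ β : ℝ, β ≤ 0 → ∀ r l : ℝ, 0 < r → l ∈ Ioo b B →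
      HasDerivAt (fun l : ℝ => hankelAmp β (c * r * l))
        (2 * β * c * r * hankelAmp (β - 1) (c * r * l)) l := by
    intro β hβ r l hr hl
    obtain ⟨h1, h2, -⟩ := hz r l hr hl
    have h3 := hasDerivAt_hankelAmp (α := β) (by linarith) h1 h2 (integrableOn_hankelAmp hβ h1 h2)
    have h4 : HasDerivAt (fun l : ℝ => c * r * (l : ℂ)) (c * r) l := by
      simpa using ((hasDerivAt_id l).ofReal_comp).const_mul (c * r)
    exact (HasDerivAt.comp (h₂ := hankelAmp β) (h := fun l : ℝ => c * r * (l : ℂ)) l h3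
      h4).congr_deriv (by ring)
  induction n generalizing α with
  | zero =>
    refine ⟨hankelConst * (2 * b) ^ α, by have := hankelConst_nonneg; positivity, fun r hr =>
      ⟨fun l hl => (hder α hα r l hr hl).continuousAt.continuousWithinAt, fun l hl =>
        hbd α hα r l hr hl⟩⟩
  | succ n ih =>
    obtain ⟨K, hK, hKs⟩ := ih (α := α - 1) (by linarith)
    refine ⟨max (hankelConst * (2 * b) ^ α) (2 * |α| * K), ?_, fun r hr => ⟨fun l hl => ?_, _,
      fun l hl => hder α hα r l hr hl, ?_⟩⟩
    · exact le_max_of_le_right (by positivity)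
    · exact (hbd α hα r l hr hl).trans (by gcongr; exact le_max_left _ _)
    -- Differentiating in `l` produces a factor `r` and lowers the exponent by one, and `r · r^{α-1}
    -- = r^α`: no power of `r` is lost.
    · refine ((hKs r hr).const_mul (2 * α * c * r)).mono ?_
      have hn : ‖2 * (α : ℂ) * c * r‖ = 2 * |α| * r := by simp [hc, abs_of_pos hr]
      rw [hn]
      calc 2 * |α| * r * (K * r ^ (α - 1)) = 2 * |α| * K * (r * r ^ (α - 1)) := by ring
        _ = 2 * |α| * K * r ^ α := by rw [Real.rpow_sub_one hr.ne']; field_simp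
        _ ≤ _ := by gcongr; exact le_max_right _ _

/-- The amplitude itself grows like `√(1+r)`. Its first derivative in `l` is `r` times an amplitude
of exponent `-1/2`, hence `O(√r)`, and further derivatives keep this size by `hankelAmp_comp`. So
`e^{±irl}` carries all the oscillation in `l`. -/
theorem hankelAmp_half_comp {b B : ℝ} (hb : 0 < b) {c : ℂ} (hc : ‖c‖ = 1) (hre : c.re = 0)
    (n : ℕ) :
    ∃ K, 0 ≤ K ∧ ∀ r : ℝ, 0 < r →
      SymbolOn (Ioo b B) (n + 1) (fun l => hankelAmp (1 / 2) (c * r * l)) (K * √(1 + r)) := by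
  obtain ⟨K, hK, hKs⟩ := hankelAmp_comp (B := B) hb hc hre n (α := -1 / 2) (by norm_num)
  have hB := Real.sqrt_nonneg (2 * B)
  have hA := hankelConst_nonneg
  refine ⟨max (hankelConst * √(2 * B) + 1) K, le_max_of_le_right hK, fun r hr =>
    ⟨fun l hl => ?_, fun l => c * r * hankelAmp (-1 / 2) (c * r * l), fun l hl => ?_, ?_⟩⟩
  · have hl0 : 0 < l := hb.trans hl.1
    refine (norm_hankelAmp_half_le _).trans ?_
    have h3 : ‖c * r * l‖ = r * l := by simp [hc, abs_of_pos hr, abs_of_pos hl0]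
    have h1 : √(2 * (r * l)) ≤ √(2 * B) * √(1 + r) := by
      rw [← Real.sqrt_mul (by linarith [hl.2])]
      apply Real.sqrt_le_sqrt
      nlinarith [hl.2]
    have h2 : 1 ≤ √(1 + r) := Real.one_le_sqrt.2 (by linarith)
    rw [h3]
    calc hankelConst * √(2 * (r * l)) + 1
        ≤ hankelConst * (√(2 * B) * √(1 + r)) + √(1 + r) := by gcongr
      _ = (hankelConst * √(2 * B) + 1) * √(1 + r) := by ring
      _ ≤ _ := by gcongr; exact le_max_left _ _
  · have hl0 : 0 < l := hb.trans hl.1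
    have hz0 : c * r * l ≠ 0 := by
      have : c ≠ 0 := by rintro rfl; simp at hc
      have h1 : (r : ℂ) ≠ 0 := by exact_mod_cast hr.ne'
      have h2 : (l : ℂ) ≠ 0 := by exact_mod_cast hl0.ne'
      positivity
    have h3 := hasDerivAt_hankelAmp_half (z := c * r * l) (by simp [hre]) hz0
    have h4 : HasDerivAt (fun l : ℝ => c * r * (l : ℂ)) (c * r) l := by
      simpa using ((hasDerivAt_id l).ofReal_comp).const_mul (c * r)
    exact (HasDerivAt.comp (h₂ := hankelAmp (1 / 2)) (h := fun l : ℝ => c * r * (l : ℂ)) l h3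
      h4).congr_deriv (mul_comm _ _)
  · refine ((hKs r hr).const_mul (c * r)).mono ?_
    have hn : ‖c * (r : ℂ)‖ = r := by simp [hc, abs_of_pos hr]
    rw [hn]
    have : r * r ^ (-1 / 2 : ℝ) = √r := by
      rw [Real.sqrt_eq_rpow, ← Real.rpow_one_add' hr.le (by norm_num)]; norm_num
    calc r * (K * r ^ (-1 / 2 : ℝ)) = K * (r * r ^ (-1 / 2 : ℝ)) := by ring
      _ = K * √r := by rw [this]
      _ ≤ K * √(1 + r) := by gcongr; linarith
      _ ≤ _ := by gcongr; exact le_max_right _ _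

end SymbolOn

/-! ### The kernel of a dyadic piece. -/

/-- A smooth function supported, on `l ≥ 0`, in `[a, L]` with `a > 0`, and vanishing near `0`. -/
structure IsAnnularCutoff (χ : ℝ → ℝ) (a L : ℝ) : Prop where
  pos : 0 < a
  le : a ≤ L
  contDiff : ContDiff ℝ ∞ χ
  eq_zero_of_abs_lt : ∀ l, |l| < a → χ l = 0
  eq_zero_of_lt : ∀ l, L < l → χ l = 0

namespace IsAnnularCutoff

variable {χ : ℝ → ℝ} {a L : ℝ}

theorem eq_zero_of_notMem (h : IsAnnularCutoff χ a L) {l : ℝ} (hl : 0 < l) (hl' : l ∉ Icc a L) :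
    χ l = 0 := by
  by_cases h1 : l < a
  · exact h.eq_zero_of_abs_lt l (by rwa [abs_of_pos hl])
  · exact h.eq_zero_of_lt l (by
      by_contra h2
      exact hl' ⟨not_lt.1 h1, not_lt.1 h2⟩)

theorem contDiff_mul_inv (h : IsAnnularCutoff χ a L) : ContDiff ℝ ∞ fun l => χ l * l⁻¹ := by
  rw [contDiff_iff_contDiffAt]
  intro l
  by_cases hl : l = 0
  · subst hl
    refine (contDiffAt_const (c := (0 : ℝ))).congr_of_eventuallyEq ?_
    have : ∀ᶠ l : ℝ in 𝓝 0, |l| < a := by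
      have := Metric.ball_mem_nhds (0 : ℝ) h.pos
      filter_upwards [this] with l hl
      simpa using hl
    filter_upwards [this] with l hl
    rw [h.eq_zero_of_abs_lt l hl, zero_mul]
  · exact h.contDiff.contDiffAt.mul (contDiffAt_inv ℝ hl)

end IsAnnularCutoff

/-- The oscillatory integral in `l` behind the kernel of a dyadic piece of `W_s`. -/
noncomputable def radialOsc (χ : ℝ → ℝ) (a₁ L₁ r ρ : ℝ) : ℂ :=
  ∫ l in a₁..L₁, Complex.exp (Complex.I * (r * l : ℝ)) *
    (((χ l * l : ℝ) : ℂ) * hankelAmp (1 / 2) (-Complex.I * r * l)) * sphereProfile (l * ρ)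

theorem inv_one_add_pow_le {s t c : ℝ} (hc : 0 ≤ c) (hs : 0 ≤ s) (ht : 0 ≤ t)
    (h : s ≤ t + c) : ((1 + t) ^ 3)⁻¹ ≤ (1 + c) ^ 3 * ((1 + s) ^ 3)⁻¹ := by
  rw [← div_eq_mul_inv, inv_le_comm₀ (by positivity) (by positivity), inv_div,
    div_le_iff₀ (by positivity), ← mul_pow]
  gcongr
  nlinarith

variable {χ : ℝ → ℝ} {a L : ℝ}

/-- For `ρ ≥ 1`, `exp_mul_hankelAmp_sub` writes the sphere profile as `ρ⁻²` times two oscillating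
terms `e^{±iρl}` with symbol amplitudes of size `√(1+ρ)`. The phases in `l` become `r ± ρ`, both at
least `|r - ρ|` in absolute value, and three integrations by parts give the decay. -/
theorem exists_norm_radialOsc_le_of_one_le (h : IsAnnularCutoff χ a L) :
    ∃ C, 0 ≤ C ∧ ∀ r ρ : ℝ, 0 < r → 1 ≤ ρ → ‖radialOsc χ (a / 2) (L + 1) r ρ‖ ≤
      C * (√(1 + r) * (1 + ρ) ^ (-(3 / 2) : ℝ) * ((1 + |r - ρ|) ^ 3)⁻¹) := by
  have ha := h.pos
  have haL := h.le
  set S := Ioo (a / 4) (L + 2) with hSdef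
  have hSpos : ∀ l ∈ S, 0 < l := fun l hl => lt_trans (by positivity) hl.1
  have hsub : Icc (a / 2) (L + 1) ⊆ S := fun l hl => ⟨by linarith [hl.1], by linarith [hl.2]⟩
  obtain ⟨Q, hQ, hQs⟩ := SymbolOn.exists_of_contDiff (S := S) isCompact_Icc Ioo_subset_Icc_self
    (f := fun l => ((χ l * l⁻¹ : ℝ) : ℂ)) (Complex.ofRealCLM.contDiff.comp h.contDiff_mul_inv) 3
  obtain ⟨K, hK, hKs⟩ := SymbolOn.hankelAmp_half_comp (b := a / 4) (B := L + 2) (by positivity)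
    (c := -Complex.I) (by simp) (by simp) 2
  obtain ⟨K', hK', hKs'⟩ := SymbolOn.hankelAmp_half_comp (b := a / 4) (B := L + 2) (by positivity)
    (c := Complex.I) (by simp) (by simp) 2
  -- `64 = 2³ · 2³` comes from two applications of the Leibniz bound with three derivatives, `8`
  -- from the integration by parts lemma.
  set D := 8 * (64 * Q * (L + 1 - a / 2)) with hD
  have hD0 : 0 ≤ D := by
    have : 0 ≤ L + 1 - a / 2 := by linarith
    positivity
  refine ⟨4 * (D * K * (K + K')), by positivity, fun r ρ hr hρ => ?_⟩
  have hρ0 : 0 < ρ := by linarith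
  have hmain : ∀ (c : ℂ) (κ : ℝ), 0 ≤ κ → (SymbolOn S 3 (fun l => hankelAmp (1 / 2) (c * ρ * l))
      (κ * √(1 + ρ))) → ∀ t : ℝ, |r - ρ| ≤ |t| →
      ‖∫ l in (a / 2)..(L + 1), Complex.exp (Complex.I * (t * l : ℝ)) * (((χ l * l⁻¹ : ℝ) : ℂ) *
        hankelAmp (1 / 2) (-Complex.I * r * l) * hankelAmp (1 / 2) (c * ρ * l))‖ ≤
        D * K * κ * (√(1 + r) * √(1 + ρ) * ((1 + |r - ρ|) ^ 3)⁻¹) := by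
    intro c κ hκ hs t ht
    have hprod := (hQs.mul (hKs r hr) hQ (by positivity)).mul hs (by positivity) (by positivity)
    have hb := SymbolOn.norm_integral_exp_mul_le_inv_pow (a := a) (L := L) isOpen_Ioo hsub
      (by linarith) (by linarith) (by linarith) (by positivity) t hprod (fun l hl hl' => by
        simp [h.eq_zero_of_notMem (hSpos l hl) hl'])
    refine hb.trans ?_
    have h1 : ((1 + |t|) ^ 3)⁻¹ ≤ ((1 + |r - ρ|) ^ 3)⁻¹ := by gcongr
    calc _ ≤ 8 * (2 ^ 3 * (2 ^ 3 * (Q * (K * √(1 + r))) * (κ * √(1 + ρ))) * (L + 1 - a / 2)) *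
          ((1 + |r - ρ|) ^ 3)⁻¹ := by
          refine mul_le_mul_of_nonneg_left h1 ?_
          have : 0 ≤ L + 1 - a / 2 := by linarith
          positivity
      _ = _ := by rw [hD]; ring
  have hsplit : radialOsc χ (a / 2) (L + 1) r ρ = -Complex.I * ((ρ : ℂ) ^ 2)⁻¹ *
      ((∫ l in (a / 2)..(L + 1), Complex.exp (Complex.I * ((r + ρ) * l : ℝ)) *
        (((χ l * l⁻¹ : ℝ) : ℂ) * hankelAmp (1 / 2) (-Complex.I * r * l) *
          hankelAmp (1 / 2) (-Complex.I * ρ * l))) -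
       ∫ l in (a / 2)..(L + 1), Complex.exp (Complex.I * ((r - ρ) * l : ℝ)) *
        (((χ l * l⁻¹ : ℝ) : ℂ) * hankelAmp (1 / 2) (-Complex.I * r * l) *
          hankelAmp (1 / 2) (Complex.I * ρ * l))) := by
    have hci : ∀ (c : ℂ) (κ t : ℝ), (SymbolOn S 3 (fun l => hankelAmp (1 / 2) (c * ρ * l)) κ) →
        IntervalIntegrable (fun l : ℝ => Complex.exp (Complex.I * (t * l : ℝ)) *
        (((χ l * l⁻¹ : ℝ) : ℂ) * hankelAmp (1 / 2) (-Complex.I * r * l) *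
          hankelAmp (1 / 2) (c * ρ * l))) volume (a / 2) (L + 1) := by
      intro c κ t hs
      apply ContinuousOn.intervalIntegrable
      rw [uIcc_of_le (by linarith)]
      exact (Continuous.continuousOn (by fun_prop)).mul
        (((hQs.continuousOn.mul (hKs r hr).continuousOn).mul hs.continuousOn).mono hsub)
    rw [← intervalIntegral.integral_sub (hci _ _ _ (hKs ρ hρ0)) (hci _ _ _ (hKs' ρ hρ0)),
      ← intervalIntegral.integral_const_mul, radialOsc]
    refine intervalIntegral.integral_congr fun l hl => ?_
    rw [uIcc_of_le (by linarith)] at hl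
    have hl0 := hSpos l (hsub hl)
    have hl' : (l : ℂ) ≠ 0 := by exact_mod_cast hl0.ne'
    have hρ' : (ρ : ℂ) ≠ 0 := by exact_mod_cast hρ0.ne'
    have hid := exp_mul_hankelAmp_sub (mul_pos hl0 hρ0)
    have e1 : -Complex.I * ((l * ρ : ℝ) : ℂ) = -Complex.I * ρ * l := by push_cast; ring
    have e2 : Complex.I * ((l * ρ : ℝ) : ℂ) = Complex.I * ρ * l := by push_cast; ring
    have e3 : sphereProfile (l * ρ) = -Complex.I * ((l : ℂ) * ρ)⁻¹ ^ 2 *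
        (Complex.exp (Complex.I * ρ * l) * hankelAmp (1 / 2) (-Complex.I * ρ * l) -
        Complex.exp (-(Complex.I * ρ * l)) * hankelAmp (1 / 2) (Complex.I * ρ * l)) := by
      rw [e1, e2] at hid
      rw [hid]
      have hI : Complex.I * Complex.I = -1 := Complex.I_mul_I
      push_cast
      field_simp
      linear_combination (sphereProfile (l * ρ)) * hI
    have e4 : Complex.exp (Complex.I * ((r + ρ) * l : ℝ)) =
        Complex.exp (Complex.I * (r * l : ℝ)) * Complex.exp (Complex.I * ρ * l) := by
      rw [← Complex.exp_add]; congr 1; push_cast; ring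
    have e5 : Complex.exp (Complex.I * ((r - ρ) * l : ℝ)) =
        Complex.exp (Complex.I * (r * l : ℝ)) * Complex.exp (-(Complex.I * ρ * l)) := by
      rw [← Complex.exp_add]; congr 1; push_cast; ring
    simp only [e4, e5, e3]
    push_cast
    field_simp
  rw [hsplit, norm_mul, norm_mul, norm_neg, Complex.norm_I, one_mul, norm_inv, norm_pow,
    Complex.norm_real, Real.norm_of_nonneg hρ0.le]
  have h1 := hmain (-Complex.I) K hK (hKs ρ hρ0) (r + ρ) (by
    rw [abs_of_pos (by linarith : 0 < r + ρ), abs_le]; constructor <;> linarith)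
  have h2 := hmain Complex.I K' hK' (hKs' ρ hρ0) (r - ρ) le_rfl
  have hpow : (ρ ^ 2)⁻¹ * √(1 + ρ) ≤ 4 * (1 + ρ) ^ (-(3 / 2) : ℝ) := by
    have hx : (0 : ℝ) < 1 + ρ := by linarith
    have e : (1 + ρ) ^ (-(3 / 2) : ℝ) = ((1 + ρ) ^ 2)⁻¹ * √(1 + ρ) := by
      rw [Real.sqrt_eq_rpow, ← Real.rpow_natCast, ← Real.rpow_neg hx.le, ← Real.rpow_add hx]
      norm_num
    rw [e, ← mul_assoc]
    gcongr
    rw [← div_eq_mul_inv, inv_le_comm₀ (by positivity) (by positivity), inv_div,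
      div_le_iff₀ (by positivity)]
    nlinarith
  calc (ρ ^ 2)⁻¹ * ‖_ - _‖
      ≤ (ρ ^ 2)⁻¹ * (D * K * K * (√(1 + r) * √(1 + ρ) * ((1 + |r - ρ|) ^ 3)⁻¹) +
        D * K * K' * (√(1 + r) * √(1 + ρ) * ((1 + |r - ρ|) ^ 3)⁻¹)) := by
        gcongr
        exact norm_sub_le_of_le h1 h2
    _ = (D * K * (K + K')) * (√(1 + r) * ((1 + |r - ρ|) ^ 3)⁻¹) * ((ρ ^ 2)⁻¹ * √(1 + ρ)) := by
        ring
    _ ≤ (D * K * (K + K')) * (√(1 + r) * ((1 + |r - ρ|) ^ 3)⁻¹) *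
        (4 * (1 + ρ) ^ (-(3 / 2) : ℝ)) := by gcongr
    _ = _ := by ring

/-- For `ρ ≤ 1` the asymptotic form, singular at `ρ = 0`, is not used. Instead the integral over `s
∈ [-1,1]` defining the profile is taken outside: the phase is `r + ρs`, which differs from `r - ρ`
by at most `2`, so the decay in `r - ρ` survives with the factor `(1+2)³`. -/
theorem exists_norm_radialOsc_le_of_le_one (h : IsAnnularCutoff χ a L) :
    ∃ C, 0 ≤ C ∧ ∀ r ρ : ℝ, 0 < r → 0 ≤ ρ → ρ ≤ 1 → ‖radialOsc χ (a / 2) (L + 1) r ρ‖ ≤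
      C * (√(1 + r) * (1 + ρ) ^ (-(3 / 2) : ℝ) * ((1 + |r - ρ|) ^ 3)⁻¹) := by
  have ha := h.pos
  have haL := h.le
  set S := Ioo (a / 4) (L + 2) with hSdef
  have hSpos : ∀ l ∈ S, 0 < l := fun l hl => lt_trans (by positivity) hl.1
  have hsub : Icc (a / 2) (L + 1) ⊆ S := fun l hl => ⟨by linarith [hl.1], by linarith [hl.2]⟩
  obtain ⟨Q, hQ, hQs⟩ := SymbolOn.exists_of_contDiff (S := S) isCompact_Icc Ioo_subset_Icc_self
    (f := fun l => ((χ l * l : ℝ) : ℂ))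
    (Complex.ofRealCLM.contDiff.comp (h.contDiff.mul contDiff_id)) 3
  obtain ⟨K, hK, hKs⟩ := SymbolOn.hankelAmp_half_comp (b := a / 4) (B := L + 2) (by positivity)
    (c := -Complex.I) (by simp) (by simp) 2
  set D := 8 * (8 * Q * (L + 1 - a / 2)) with hD
  have hD0 : 0 ≤ D := by
    have : 0 ≤ L + 1 - a / 2 := by linarith
    positivity
  refine ⟨4 * (54 * (D * K)), by positivity, fun r ρ hr hρ hρ1 => ?_⟩
  set u : ℝ → ℂ := fun l => ((χ l * l : ℝ) : ℂ) * hankelAmp (1 / 2) (-Complex.I * r * l) with hu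
  have hus : SymbolOn S 3 u _ := hQs.mul (hKs r hr) hQ (by positivity)
  have hswap : radialOsc χ (a / 2) (L + 1) r ρ = ∫ s in (-1 : ℝ)..1, (√(1 - s ^ 2) : ℂ) *
      ∫ l in (a / 2)..(L + 1), Complex.exp (Complex.I * ((r + ρ * s) * l : ℝ)) * u l := by
    have hc : ContinuousOn (Function.uncurry fun (l s : ℝ) =>
        (√(1 - s ^ 2) : ℂ) * (Complex.exp (Complex.I * ((r + ρ * s) * l : ℝ)) * u l))
        (uIcc (a / 2) (L + 1) ×ˢ uIcc (-1) 1) := by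
      rw [uIcc_of_le (by linarith : a / 2 ≤ L + 1)]
      have hu2 : ContinuousOn (fun q : ℝ × ℝ => u q.1)
          (Icc (a / 2) (L + 1) ×ˢ uIcc (-1) 1) :=
        (hus.continuousOn.mono hsub).comp continuousOn_fst fun q hq => hq.1
      refine ContinuousOn.mul (Continuous.continuousOn (by fun_prop)) (ContinuousOn.mul
        (Continuous.continuousOn (by fun_prop)) hu2)
    have hsw := intervalIntegral_intervalIntegral_swap
      (((hc.integrableOn_compact (isCompact_uIcc.prod isCompact_uIcc)).mono_set
        (prod_mono uIoc_subset_uIcc uIoc_subset_uIcc)))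
    simp only [intervalIntegral.integral_const_mul] at hsw
    rw [← hsw, radialOsc]
    refine intervalIntegral.integral_congr fun l hl => ?_
    simp only [sphereProfile]
    rw [← intervalIntegral.integral_const_mul]
    refine intervalIntegral.integral_congr fun s hs => ?_
    have e : Complex.exp (Complex.I * ((r + ρ * s) * l : ℝ)) =
        Complex.exp (Complex.I * (r * l : ℝ)) * Complex.exp (Complex.I * (l * ρ * s : ℝ)) := by
      rw [← Complex.exp_add]; congr 1; push_cast; ring
    simp only [e, hu]
    ring
  have hinner : ∀ s ∈ uIoc (-1 : ℝ) 1, ‖(√(1 - s ^ 2) : ℂ) *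
      ∫ l in (a / 2)..(L + 1), Complex.exp (Complex.I * ((r + ρ * s) * l : ℝ)) * u l‖ ≤
      27 * (D * K) * (√(1 + r) * ((1 + |r - ρ|) ^ 3)⁻¹) := by
    intro s hs
    rw [uIoc_of_le (by norm_num)] at hs
    have hb := SymbolOn.norm_integral_exp_mul_le_inv_pow (a := a) (L := L) isOpen_Ioo hsub
      (by linarith) (by linarith) (by linarith) (by positivity) (r + ρ * s) hus (fun l hl hl' => by
        simp [hu, h.eq_zero_of_notMem (hSpos l hl) hl'])
    have h1 : ((1 + |r + ρ * s|) ^ 3)⁻¹ ≤ (1 + 2) ^ 3 * ((1 + |r - ρ|) ^ 3)⁻¹ := by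
      refine inv_one_add_pow_le (by norm_num) (abs_nonneg _) (abs_nonneg _) ?_
      have : |r - ρ| ≤ |r + ρ * s| + |ρ * s + ρ| := by
        have := abs_sub (r + ρ * s) (ρ * s + ρ)
        rwa [show r + ρ * s - (ρ * s + ρ) = r - ρ by ring] at this
      have h3 : |ρ * s + ρ| ≤ 2 := by
        rw [abs_le]; constructor <;> nlinarith [hs.1, hs.2]
      linarith
    have h2 : ‖(√(1 - s ^ 2) : ℂ)‖ ≤ 1 := by
      rw [Complex.norm_real, Real.norm_of_nonneg (Real.sqrt_nonneg _)]
      exact Real.sqrt_le_one.2 (by nlinarith)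
    rw [norm_mul]
    refine (mul_le_of_le_one_left (norm_nonneg _) h2).trans (hb.trans ?_)
    calc _ ≤ 8 * (2 ^ 3 * (Q * (K * √(1 + r))) * (L + 1 - a / 2)) *
          ((1 + 2) ^ 3 * ((1 + |r - ρ|) ^ 3)⁻¹) := by
          refine mul_le_mul_of_nonneg_left h1 ?_
          have : 0 ≤ L + 1 - a / 2 := by linarith
          positivity
      _ = _ := by rw [hD]; ring
  have hfin := intervalIntegral.norm_integral_le_of_norm_le_const hinner
  rw [hswap]
  refine hfin.trans ?_
  have hpow : 1 ≤ 4 * (1 + ρ) ^ (-(3 / 2) : ℝ) := by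
    have h1 : (2 : ℝ) ^ (-(3 / 2) : ℝ) ≤ (1 + ρ) ^ (-(3 / 2) : ℝ) :=
      Real.rpow_le_rpow_of_nonpos (by linarith) (by linarith) (by norm_num)
    have h2 : (2 : ℝ) ^ (-2 : ℝ) ≤ (2 : ℝ) ^ (-(3 / 2) : ℝ) :=
      Real.rpow_le_rpow_of_exponent_le (by norm_num) (by norm_num)
    have h3 : (2 : ℝ) ^ (-2 : ℝ) = 1 / 4 := by
      rw [show (-2 : ℝ) = ((-2 : ℤ) : ℝ) by norm_num, Real.rpow_intCast]; norm_num
    linarith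
  have hX : 0 ≤ 54 * (D * K) * (√(1 + r) * ((1 + |r - ρ|) ^ 3)⁻¹) := by positivity
  rw [show |(1 : ℝ) - -1| = 2 by norm_num]
  calc _ = 54 * (D * K) * (√(1 + r) * ((1 + |r - ρ|) ^ 3)⁻¹) * 1 := by ring
    _ ≤ 54 * (D * K) * (√(1 + r) * ((1 + |r - ρ|) ^ 3)⁻¹) * (4 * (1 + ρ) ^ (-(3 / 2) : ℝ)) :=
      mul_le_mul_of_nonneg_left hpow hX
    _ = _ := by ring

/-- The kernel, as a function of two radii, of a dyadic piece of `W_s`. -/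
noncomputable def radialKer (χ : ℝ → ℝ) (r ρ : ℝ) : ℂ :=
  ∫ l in Ioi (0 : ℝ), ((χ l * l⁻¹ : ℝ) : ℂ) * green (-Complex.I * l) r *
    (Complex.I * ((l ^ 2 / (4 * Real.pi ^ 2) : ℝ) : ℂ) * sphereProfile (l * ρ))

theorem radialKer_eq (h : IsAnnularCutoff χ a L) (r ρ : ℝ) :
    radialKer χ r ρ = ((4 * Real.pi ^ 2 * r ^ 2 : ℝ) : ℂ)⁻¹ *
      (Complex.I * ((4 * Real.pi ^ 2 : ℝ) : ℂ)⁻¹) * radialOsc χ (a / 2) (L + 1) r ρ := by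
  have ha := h.pos
  have haL := h.le
  rw [radialKer, radialOsc, intervalIntegral.integral_of_le (by linarith), ← integral_const_mul]
  have hsub : Ioc (a / 2) (L + 1) ⊆ Ioi 0 := fun l hl => lt_trans (by positivity) hl.1
  rw [setIntegral_eq_of_subset_of_forall_sdiff_eq_zero measurableSet_Ioi hsub]
  · refine setIntegral_congr_fun measurableSet_Ioc fun l hl => ?_
    have hl' : (l : ℂ) ≠ 0 := by exact_mod_cast (hsub hl).ne'
    have e1 : -(-Complex.I * (l : ℂ) * r) = Complex.I * ((r * l : ℝ) : ℂ) := by push_cast; ring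
    have e2 : -Complex.I * (l : ℂ) * r = -Complex.I * r * l := by ring
    simp only [green]
    rw [e1, e2]
    push_cast
    field_simp
  · intro l hl
    have : χ l = 0 := h.eq_zero_of_notMem hl.1 fun h2 => hl.2
      ⟨by linarith [h2.1], by linarith [h2.2]⟩
    simp [this]

/-- `radialKer_eq` takes out `r⁻²`, and the two regimes of `ρ` give one bound for the oscillatory
factor. -/
theorem exists_norm_radialKer_le (h : IsAnnularCutoff χ a L) :
    ∃ C, 0 ≤ C ∧ ∀ r ρ : ℝ, 0 ≤ r → 0 ≤ ρ → ‖radialKer χ r ρ‖ ≤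
      C * ((r ^ 2)⁻¹ * √(1 + r) * (1 + ρ) ^ (-(3 / 2) : ℝ) * ((1 + |r - ρ|) ^ 3)⁻¹) := by
  obtain ⟨C₁, hC₁, h₁⟩ := exists_norm_radialOsc_le_of_one_le h
  obtain ⟨C₂, hC₂, h₂⟩ := exists_norm_radialOsc_le_of_le_one h
  refine ⟨C₁ + C₂, by positivity, fun r ρ hr hρ => ?_⟩
  rcases hr.eq_or_lt with rfl | hr
  · simp [radialKer_eq h]
  rw [radialKer_eq h, norm_mul, norm_mul, norm_mul, norm_inv, norm_inv, Complex.norm_I, one_mul,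
    Complex.norm_real, Complex.norm_real, Real.norm_of_nonneg (by positivity),
    Real.norm_of_nonneg (by positivity)]
  set P := √(1 + r) * (1 + ρ) ^ (-(3 / 2) : ℝ) * ((1 + |r - ρ|) ^ 3)⁻¹ with hP
  have hP0 : 0 ≤ P := by positivity
  have hosc : ‖radialOsc χ (a / 2) (L + 1) r ρ‖ ≤ (C₁ + C₂) * P := by
    rcases le_total ρ 1 with h3 | h3
    · exact (h₂ r ρ hr hρ h3).trans (by gcongr; linarith)
    · exact (h₁ r ρ hr h3).trans (by gcongr; linarith)
  have hpi : 1 ≤ 4 * Real.pi ^ 2 := by nlinarith [Real.pi_gt_three]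
  calc (4 * Real.pi ^ 2 * r ^ 2)⁻¹ * (4 * Real.pi ^ 2)⁻¹ * ‖radialOsc χ (a / 2) (L + 1) r ρ‖
      ≤ (1 * r ^ 2)⁻¹ * 1 * ((C₁ + C₂) * P) := by
        gcongr
        exact inv_le_one_of_one_le₀ hpi
    _ = _ := by rw [hP]; ring

/-- The kernels of the dyadic pieces are rescalings of each other. -/
theorem radialKer_comp_mul (χ : ℝ → ℝ) {s : ℝ} (hs : 0 < s) (r ρ : ℝ) :
    radialKer (fun l => χ (s * l)) r ρ = ((s⁻¹ ^ 4 : ℝ) : ℂ) * radialKer χ (s⁻¹ * r) (s⁻¹ * ρ) := by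
  have hs' : (s : ℂ) ≠ 0 := by exact_mod_cast hs.ne'
  rw [radialKer, radialKer, ← integral_const_mul]
  have := integral_comp_mul_left_Ioi (fun l : ℝ => ((s⁻¹ ^ 4 : ℝ) : ℂ) * (((χ l * l⁻¹ : ℝ) : ℂ) *
    green (-Complex.I * l) (s⁻¹ * r) * (Complex.I * ((l ^ 2 / (4 * Real.pi ^ 2) : ℝ) : ℂ) *
      sphereProfile (l * (s⁻¹ * ρ))))) 0 hs
  rw [mul_zero] at this
  rw [← inv_smul_eq_iff₀ (inv_ne_zero hs.ne'), inv_inv] at this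
  rw [← this, ← integral_smul]
  refine setIntegral_congr_fun measurableSet_Ioi fun l hl => ?_
  have hl' : (l : ℂ) ≠ 0 := by exact_mod_cast (ne_of_gt hl)
  have e1 : s * l * (s⁻¹ * ρ) = l * ρ := by field_simp
  have e2 : -Complex.I * ((s * l : ℝ) : ℂ) * ((s⁻¹ * r : ℝ) : ℂ) = -Complex.I * l * r := by
    push_cast; field_simp
  simp only [green, e1, e2, Complex.real_smul]
  by_cases hr : r = 0
  · subst hr; simp
  have hr' : (r : ℂ) ≠ 0 := by exact_mod_cast hr
  push_cast
  field_simp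

/-! ### The jump kernel is reproduced by low-pass kernels. -/

section Reproducing

variable {η : R4 → ℂ} {B : ℝ}

theorem integrable_nearInv_mul_of_bound (hc : AEStronglyMeasurable η volume)
    (hb : ∀ x, ‖η x‖ ≤ B) (x : R4) : Integrable fun y => nearInv (x - y) * ‖η y‖ :=
  (integrable_nearInv.comp_sub_left x).mul_bdd (c := B) hc.norm
    (ae_of_all _ fun y => by simpa using hb y)

theorem greenMaj_le_of_bound (hc : AEStronglyMeasurable η volume)
    (hb : ∀ x, ‖η x‖ ≤ B) (x : R4) : greenMaj η x ≤ (∫ y, nearInv y) * B + ∫ y, ‖η y‖ := by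
  have h : conv nearInv (fun y => ‖η y‖) x ≤ (∫ y, nearInv y) * B := by
    rw [← integral_sub_left_eq_self (fun y => nearInv y) volume x, ← integral_mul_const, conv]
    refine integral_mono (integrable_nearInv_mul_of_bound hc hb x)
      ((integrable_nearInv.comp_sub_left x).mul_const B) fun y => ?_
    exact mul_le_mul_of_nonneg_left (hb y) (nearInv_nonneg _)
  rw [greenMaj]
  linarith

theorem integral_green_mul_fourier {k : ℂ} (hk : 0 < k.re) (u : 𝓢(R4, ℂ)) :
    ∫ x : R4, green k ‖x‖ * (𝓕 u) x = ∫ ξ, ((4 * Real.pi ^ 2 * ‖ξ‖ ^ 2 : ℝ) + k ^ 2)⁻¹ * u ξ := by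
  have h3 := VectorFourier.integral_fourierIntegral_smul_eq_flip (L := innerₗ R4) (μ := volume)
    (ν := volume) (f := fun x : R4 => green k ‖x‖) (g := (u : R4 → ℂ)) Real.continuous_fourierChar
    (by exact continuous_inner) (integrable_green hk) u.integrable
  rw [flip_innerₗ] at h3
  simp only [← fourier_green hk]
  exact h3.symm

theorem integral_conv_green_mul_fourier (hi : Integrable η) {k : ℂ} (hk : 0 < k.re)
    (u : 𝓢(R4, ℂ)) :
    ∫ x : R4, conv (fun x => green k ‖x‖) η x * (𝓕 u) x =
      ∫ ξ, ((4 * Real.pi ^ 2 * ‖ξ‖ ^ 2 : ℝ) + k ^ 2)⁻¹ * 𝓕 η ξ * u ξ := by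
  have h3 := VectorFourier.integral_fourierIntegral_smul_eq_flip (L := innerₗ R4) (μ := volume)
    (ν := volume) (f := conv (fun x => green k ‖x‖) η) (g := (u : R4 → ℂ))
    Real.continuous_fourierChar (by exact continuous_inner)
    (integrable_conv (integrable_green hk) hi) u.integrable
  rw [flip_innerₗ] at h3
  simp only [← fourier_green hk, ← fourier_conv (integrable_green hk) hi]
  exact h3.symm

theorem norm_fourier_le (f : R4 → ℂ) (ξ : R4) : ‖𝓕 f ξ‖ ≤ ∫ x, ‖f x‖ :=
  VectorFourier.norm_fourierIntegral_le_integral_norm _ _ _ _ _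

/-- Off the sphere `2π|ξ| = l` the jump of the resolvent symbol across the spectrum vanishes. -/
theorem norm_symbol_sub_le {l c ε t : ℝ} (hl : 0 < l) (hc : 0 < c) (hε : 0 < ε)
    (hε' : ε ^ 2 ≤ c * l / 2) (ht : 0 ≤ t) (htl : c ≤ |2 * Real.pi * t - l|) :
    ‖((4 * Real.pi ^ 2 * t ^ 2 : ℝ) + (ε - Complex.I * l) ^ 2)⁻¹ -
      ((4 * Real.pi ^ 2 * t ^ 2 : ℝ) + (ε + Complex.I * l) ^ 2)⁻¹‖ ≤
      4 * l * ((c * l / 2) ^ 2)⁻¹ * ε := by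
  set D₁ : ℂ := (4 * Real.pi ^ 2 * t ^ 2 : ℝ) + ((ε : ℂ) - Complex.I * l) ^ 2 with hD₁
  set D₂ : ℂ := (4 * Real.pi ^ 2 * t ^ 2 : ℝ) + ((ε : ℂ) + Complex.I * l) ^ 2 with hD₂
  have hcl : 0 < c * l := mul_pos hc hl
  have hpt : 0 ≤ 2 * Real.pi * t := by positivity
  have hX : c * l ≤ |4 * Real.pi ^ 2 * t ^ 2 - l ^ 2| := by
    rw [show 4 * Real.pi ^ 2 * t ^ 2 - l ^ 2 = (2 * Real.pi * t - l) * (2 * Real.pi * t + l) by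
      ring, abs_mul]
    refine mul_le_mul htl ?_ hl.le (abs_nonneg _)
    exact (by linarith : l ≤ 2 * Real.pi * t + l).trans (le_abs_self _)
  have hY : c * l / 2 ≤ |4 * Real.pi ^ 2 * t ^ 2 + ε ^ 2 - l ^ 2| := by
    have h1 : |4 * Real.pi ^ 2 * t ^ 2 - l ^ 2| ≤
        |4 * Real.pi ^ 2 * t ^ 2 + ε ^ 2 - l ^ 2| + |ε ^ 2| := by
      have := abs_sub (4 * Real.pi ^ 2 * t ^ 2 + ε ^ 2 - l ^ 2) (ε ^ 2)
      rwa [show 4 * Real.pi ^ 2 * t ^ 2 + ε ^ 2 - l ^ 2 - ε ^ 2 =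
        4 * Real.pi ^ 2 * t ^ 2 - l ^ 2 by ring] at this
    rw [abs_of_nonneg (sq_nonneg ε)] at h1
    linarith
  have hre₁ : D₁.re = 4 * Real.pi ^ 2 * t ^ 2 + ε ^ 2 - l ^ 2 := by
    rw [hD₁, Complex.add_re, Complex.ofReal_re]; simp [sq]; ring
  have hre₂ : D₂.re = 4 * Real.pi ^ 2 * t ^ 2 + ε ^ 2 - l ^ 2 := by
    rw [hD₂, Complex.add_re, Complex.ofReal_re]; simp [sq]; ring
  have hn₁ : c * l / 2 ≤ ‖D₁‖ := by
    have := Complex.abs_re_le_norm D₁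
    rw [hre₁] at this; linarith
  have hn₂ : c * l / 2 ≤ ‖D₂‖ := by
    have := Complex.abs_re_le_norm D₂
    rw [hre₂] at this; linarith
  have h₁ : D₁ ≠ 0 := norm_pos_iff.1 (by linarith)
  have h₂ : D₂ ≠ 0 := norm_pos_iff.1 (by linarith)
  have hsub : D₂ - D₁ = 4 * Complex.I * ε * l := by rw [hD₁, hD₂]; ring
  rw [inv_sub_inv h₁ h₂, hsub, norm_div, norm_mul D₁]
  have hnum : ‖4 * Complex.I * (ε : ℂ) * l‖ = 4 * ε * l := by
    simp [abs_of_pos hε, abs_of_pos hl]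
  rw [hnum, div_eq_mul_inv]
  calc 4 * ε * l * (‖D₁‖ * ‖D₂‖)⁻¹ ≤ 4 * ε * l * ((c * l / 2) * (c * l / 2))⁻¹ := by gcongr
    _ = _ := by rw [← sq]; ring

/-- The jump kernel at energy `l²` is reproduced by any kernel whose Fourier transform is `1` near
the sphere `2π|ξ| = l`. -/
theorem conv_jumpKer_eq (hc : Continuous η) (hi : Integrable η) (hb : ∀ x, ‖η x‖ ≤ B)
    {l c : ℝ} (hl : 0 < l) (hcpos : 0 < c)
    (h1 : ∀ ξ : R4, |2 * Real.pi * ‖ξ‖ - l| < c → 𝓕 η ξ = 1) (x : R4) :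
    conv (jumpKer l) η x = jumpKer l x := by
  have hJc : Continuous (conv (jumpKer l) η) := by
    have := continuous_jumpKer l
    refine continuous_of_dominated (bound := fun y => l ^ 2 * ‖η y‖)
      (fun x => ((by fun_prop : Continuous fun y => jumpKer l (x - y) * η y)).aestronglyMeasurable)
      (fun x => ae_of_all _ fun y => ?_) (hi.norm.const_mul _) (ae_of_all _ fun y => by fun_prop)
    rw [norm_mul]
    exact mul_le_mul_of_nonneg_right (norm_jumpKer_le l _) (norm_nonneg _)
  have hηm := hc.aestronglyMeasurable (μ := (volume : Measure R4))
  -- Both sides are continuous, so equality may be tested against `g = 𝓕 u`. The jump is the limit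
  -- of differences of resolvent kernels at `±il + ε`, for which the pairing can be computed on the
  -- Fourier side.
  suffices hae : conv (jumpKer l) η =ᵐ[volume] jumpKer l by
    exact congrFun (Continuous.ae_eq_iff_eq volume hJc (continuous_jumpKer l) |>.1 hae) x
  apply ae_eq_of_integral_contDiff_smul_eq hJc.locallyIntegrable
    (continuous_jumpKer l).locallyIntegrable
  intro g hg hgc
  have hg' : ContDiff ℝ ∞ (fun x => (g x : ℂ)) := Complex.ofRealCLM.contDiff.comp hg
  have hgc' : HasCompactSupport (fun x => (g x : ℂ)) := hgc.comp_left (g := Complex.ofReal) rfl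
  let v : 𝓢(R4, ℂ) := hgc'.toSchwartzMap hg'
  have hv : ∀ x, v x = g x := fun x => rfl
  obtain ⟨u, hu⟩ : ∃ u : 𝓢(R4, ℂ), 𝓕 u = v := ⟨𝓕⁻ v, FourierTransform.fourier_fourierInv_eq v⟩
  let e : ℕ → ℝ := fun n => 1 / ((n : ℝ) + 1)
  have he : ∀ n, 0 < e n := fun n => by positivity
  have he0 : Tendsto e atTop (𝓝 0) := tendsto_one_div_add_atTop_nhds_zero_nat
  have hvi : Integrable (v : R4 → ℂ) := v.integrable
  obtain ⟨Bv, hBv⟩ := hgc'.exists_bound_of_continuous hg'.continuous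
  have hlimk : ∀ s : ℝ, Tendsto (fun n => (e n : ℂ) + Complex.I * (s * l : ℝ)) atTop
      (𝓝 (Complex.I * (s * l : ℝ))) := by
    intro s
    have := ((Complex.continuous_ofReal.tendsto 0).comp he0).add_const (Complex.I * (s * l : ℝ))
    simpa using this
  have hre : ∀ (s : ℝ) n, 0 < ((e n : ℂ) + Complex.I * (s * l : ℝ)).re := by
    intro s n; simpa using he n
  have hre0 : ∀ s : ℝ, 0 ≤ (Complex.I * ((s * l : ℝ) : ℂ)).re := by intro s; simp
  have hA : ∀ s : ℝ, Tendsto (fun n => ∫ x : R4, green ((e n : ℂ) + Complex.I * (s * l : ℝ)) ‖x‖ * v x)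
      atTop (𝓝 (∫ x : R4, green (Complex.I * (s * l : ℝ)) ‖x‖ * v x)) := by
    intro s
    have := tendsto_conv_green (f := (v : R4 → ℂ)) hvi
      (integrable_nearInv_mul_of_bound hvi.1 hBv 0) (fun n => (hre s n).le) (hre0 s) (hlimk s)
    simpa [conv] using this
  have hBt : ∀ s : ℝ, Tendsto (fun n => ∫ x : R4,
      conv (fun x => green ((e n : ℂ) + Complex.I * (s * l : ℝ)) ‖x‖) η x * v x)
      atTop (𝓝 (∫ x : R4, conv (fun x => green (Complex.I * (s * l : ℝ)) ‖x‖) η x * v x)) := by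
    intro s
    have hev : ∀ᶠ n in atTop, ‖(e n : ℂ) + Complex.I * (s * l : ℝ)‖ ≤
        ‖Complex.I * ((s * l : ℝ) : ℂ)‖ + 1 :=
      ((hlimk s).norm.eventually (gt_mem_nhds (lt_add_one _))).mono fun x hx => le_of_lt hx
    set M := ‖Complex.I * ((s * l : ℝ) : ℂ)‖ + 1 with hM
    refine tendsto_integral_filter_of_dominated_convergence (fun x => ((hankelConst * √(2 * M) + 1) *
      ((∫ y, nearInv y) * B + ∫ y, ‖η y‖)) * ‖v x‖) ?_ ?_ (hvi.norm.const_mul _) ?_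
    · exact Eventually.of_forall fun n => (aestronglyMeasurable_conv_green hi _).mul hvi.1
    · filter_upwards [hev] with n hn
      refine ae_of_all _ fun x => ?_
      rw [norm_mul]
      refine mul_le_mul_of_nonneg_right ?_ (norm_nonneg _)
      refine (norm_conv_green_le hi (integrable_nearInv_mul_of_bound hηm hb x)
        (hre s n).le hn).trans ?_
      refine mul_le_mul_of_nonneg_left (greenMaj_le_of_bound hηm hb x) ?_
      have := hankelConst_nonneg
      positivity
    · exact ae_of_all _ fun x => (tendsto_conv_green hi (integrable_nearInv_mul_of_bound hηm hb x)
        (fun n => (hre s n).le) (hre0 s) (hlimk s)).mul_const _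
  -- On the Fourier side the difference is `∫ (A - D)(𝓕η - 1)u` with `A`, `D` the two resolvent
  -- symbols.
  have hdiff : Tendsto (fun n =>
      ((∫ x : R4, conv (fun x => green ((e n : ℂ) + Complex.I * ((-1 : ℝ) * l : ℝ)) ‖x‖) η x * v x) -
       ∫ x : R4, conv (fun x => green ((e n : ℂ) + Complex.I * ((1 : ℝ) * l : ℝ)) ‖x‖) η x * v x) -
      ((∫ x : R4, green ((e n : ℂ) + Complex.I * ((-1 : ℝ) * l : ℝ)) ‖x‖ * v x) -
       ∫ x : R4, green ((e n : ℂ) + Complex.I * ((1 : ℝ) * l : ℝ)) ‖x‖ * v x)) atTop (𝓝 0) := by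
    have hsymb : ∀ (s : ℝ) n, ∃ K : ℝ, ∀ ξ : R4, ‖((4 * Real.pi ^ 2 * ‖ξ‖ ^ 2 : ℝ) +
        ((e n : ℂ) + Complex.I * (s * l : ℝ)) ^ 2)⁻¹‖ ≤ K := by
      intro s n
      refine ⟨((((e n : ℂ) + Complex.I * (s * l : ℝ)).re) ^ 2)⁻¹, fun ξ => ?_⟩
      rw [norm_inv]
      have h2 := re_sq_le_norm_add_sq (hre s n)
        (t := 4 * Real.pi ^ 2 * ‖ξ‖ ^ 2) (by positivity)
      have h3 := pow_pos (hre s n) 2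
      gcongr
    have hmeas : ∀ (s : ℝ) n, Measurable fun ξ : R4 => ((4 * Real.pi ^ 2 * ‖ξ‖ ^ 2 : ℝ) +
        ((e n : ℂ) + Complex.I * (s * l : ℝ)) ^ 2)⁻¹ := by
      intro s n
      fun_prop
    have hηF : Continuous (𝓕 η) := VectorFourier.fourierIntegral_continuous
      Real.continuous_fourierChar (by exact continuous_inner) hi
    have hint1 : ∀ (s : ℝ) n, Integrable fun ξ : R4 => ((4 * Real.pi ^ 2 * ‖ξ‖ ^ 2 : ℝ) +
        ((e n : ℂ) + Complex.I * (s * l : ℝ)) ^ 2)⁻¹ * u ξ := by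
      intro s n
      obtain ⟨K, hK⟩ := hsymb s n
      exact u.integrable.bdd_mul (c := K) (hmeas s n).aestronglyMeasurable (ae_of_all _ hK)
    have hint2 : ∀ (s : ℝ) n, Integrable fun ξ : R4 => ((4 * Real.pi ^ 2 * ‖ξ‖ ^ 2 : ℝ) +
        ((e n : ℂ) + Complex.I * (s * l : ℝ)) ^ 2)⁻¹ * 𝓕 η ξ * u ξ := by
      intro s n
      refine ((hint1 s n).bdd_mul (c := ∫ x, ‖η x‖) hηF.aestronglyMeasurable
        (ae_of_all _ (norm_fourier_le η))).congr (ae_of_all _ fun ξ => ?_)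
      simp only; ring
    have hint1' : ∀ n, Integrable fun ξ : R4 => ((4 * Real.pi ^ 2 * ‖ξ‖ ^ 2 : ℝ) +
        ((e n : ℂ) + Complex.I * ((-1 : ℝ) * l : ℝ)) ^ 2)⁻¹ * u ξ -
        ((4 * Real.pi ^ 2 * ‖ξ‖ ^ 2 : ℝ) + ((e n : ℂ) + Complex.I * ((1 : ℝ) * l : ℝ)) ^ 2)⁻¹ *
        u ξ := fun n => (hint1 _ n).sub (hint1 _ n)
    have hint2' : ∀ n, Integrable fun ξ : R4 => ((4 * Real.pi ^ 2 * ‖ξ‖ ^ 2 : ℝ) +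
        ((e n : ℂ) + Complex.I * ((-1 : ℝ) * l : ℝ)) ^ 2)⁻¹ * 𝓕 η ξ * u ξ -
        ((4 * Real.pi ^ 2 * ‖ξ‖ ^ 2 : ℝ) + ((e n : ℂ) + Complex.I * ((1 : ℝ) * l : ℝ)) ^ 2)⁻¹ *
        𝓕 η ξ * u ξ := fun n => (hint2 _ n).sub (hint2 _ n)
    have hev : ∀ᶠ n in atTop, (e n) ^ 2 ≤ c * l / 2 := by
      have h3 : Tendsto (fun n => e n ^ 2) atTop (𝓝 0) := by simpa using he0.pow 2
      exact (h3.eventually (gt_mem_nhds (by positivity : (0 : ℝ) < c * l / 2))).mono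
        fun _ h => le_of_lt h
    set Q := 4 * l * ((c * l / 2) ^ 2)⁻¹ with hQ
    have hQ0 : 0 ≤ Q := by positivity
    refine squeeze_zero_norm' (a := fun n => e n * (Q * ((∫ x, ‖η x‖) + 1) * ∫ ξ, ‖u ξ‖)) ?_ ?_
    · filter_upwards [hev] with n hn
      simp only [← hu]
      rw [integral_conv_green_mul_fourier hi (hre _ n), integral_conv_green_mul_fourier hi (hre _ n),
        integral_green_mul_fourier (hre _ n), integral_green_mul_fourier (hre _ n),
        ← integral_sub (hint2 _ n) (hint2 _ n), ← integral_sub (hint1 _ n) (hint1 _ n),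
        ← integral_sub (hint2' n) (hint1' n), ← mul_assoc, ← integral_const_mul]
      refine norm_integral_le_of_norm_le (u.integrable.norm.const_mul _) (ae_of_all _ fun ξ => ?_)
      have hfac : ∀ A D E U : ℂ, (A * E * U - D * E * U) - (A * U - D * U) =
        (A - D) * (E - 1) * U := by intros; ring
      rw [hfac, norm_mul, norm_mul]
      refine mul_le_mul_of_nonneg_right ?_ (norm_nonneg _)
      -- Near the sphere `𝓕η - 1` vanishes, however singular the symbols; away from it the two
      -- symbols differ by `O(ε)`.
      by_cases hξ : |2 * Real.pi * ‖ξ‖ - l| < c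
      · rw [h1 ξ hξ, sub_self, norm_zero, mul_zero]
        have := he n
        have h5 : 0 ≤ ∫ x, ‖η x‖ := integral_nonneg fun _ => norm_nonneg _
        positivity
      · have h4 := norm_symbol_sub_le hl hcpos (he n) hn (norm_nonneg ξ) (not_lt.1 hξ)
        have h5 : ‖𝓕 η ξ - 1‖ ≤ (∫ x, ‖η x‖) + 1 :=
          norm_sub_le_of_le (norm_fourier_le η ξ) (by simp)
        have e1 : (e n : ℂ) + Complex.I * ((-1 : ℝ) * l : ℝ) = e n - Complex.I * l := by
          push_cast; ring
        have e2 : (e n : ℂ) + Complex.I * ((1 : ℝ) * l : ℝ) = e n + Complex.I * l := by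
          push_cast; ring
        rw [e1, e2]
        calc _ ≤ (Q * e n) * ((∫ x, ‖η x‖) + 1) :=
              mul_le_mul h4 h5 (norm_nonneg _) (mul_nonneg hQ0 (he n).le)
          _ = _ := by ring
    · simpa using he0.mul_const (Q * ((∫ x, ‖η x‖) + 1) * ∫ ξ, ‖u ξ‖)
  have hlim := ((hBt (-1)).sub (hBt 1)).sub ((hA (-1)).sub (hA 1))
  have hzero := tendsto_nhds_unique hlim hdiff
  have hgreen_int : ∀ (s : ℝ) (f : R4 → ℂ) (D : ℝ), Integrable f → (∀ x, ‖f x‖ ≤ D) → ∀ x,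
      Integrable fun y => green (Complex.I * (s * l : ℝ)) ‖x - y‖ * f y := by
    intro s f D hf hfb x
    obtain ⟨h3, -⟩ := integral_greenMaj_integrand hf (integrable_nearInv_mul_of_bound hf.1 hfb x)
    refine (h3.const_mul (hankelConst * √(2 * ‖Complex.I * ((s * l : ℝ) : ℂ)‖) + 1)).mono' ?_
      (ae_of_all _ fun y => ?_)
    · exact ((measurable_green_norm _).comp
        (measurable_const.sub measurable_id)).aestronglyMeasurable.mul hf.1
    · rw [norm_mul, ← mul_assoc]
      exact mul_le_mul_of_nonneg_right (norm_green_le_nearInv (hre0 s) le_rfl _) (norm_nonneg _)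
  have hJ : ∀ z : R4, z ≠ 0 → jumpKer l z = green (Complex.I * ((-1 : ℝ) * l : ℝ)) ‖z‖ -
      green (Complex.I * ((1 : ℝ) * l : ℝ)) ‖z‖ := by
    intro z hz
    have := green_sub_green hl (norm_pos_iff.2 hz)
    rw [jumpKer, ← this]
    congr 2 <;> push_cast <;> ring
  have hne0 : ∀ x : R4, ∀ᵐ y : R4, x - y ≠ 0 := by
    intro x
    have : ∀ᵐ y : R4, y ≠ x := by simp [ae_iff]
    filter_upwards [this] with y hy h
    exact hy (sub_eq_zero.1 h).symm
  have hconvJ : ∀ x, conv (jumpKer l) η x =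
      conv (fun x => green (Complex.I * ((-1 : ℝ) * l : ℝ)) ‖x‖) η x -
      conv (fun x => green (Complex.I * ((1 : ℝ) * l : ℝ)) ‖x‖) η x := by
    intro x
    rw [conv, conv, conv, ← integral_sub (hgreen_int _ _ B hi hb x) (hgreen_int _ _ B hi hb x)]
    refine integral_congr_ae ?_
    filter_upwards [hne0 x] with y hy
    rw [hJ _ hy, sub_mul]
  have hgv : ∀ s : ℝ, Integrable fun x : R4 => green (Complex.I * (s * l : ℝ)) ‖x‖ * v x := by
    intro s
    simpa using hgreen_int s v Bv hvi hBv 0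
  have hcgv : ∀ s : ℝ, Integrable fun x : R4 =>
      conv (fun x => green (Complex.I * (s * l : ℝ)) ‖x‖) η x * v x := by
    intro s
    refine hvi.bdd_mul (c := (hankelConst * √(2 * ‖Complex.I * ((s * l : ℝ) : ℂ)‖) + 1) *
      ((∫ y, nearInv y) * B + ∫ y, ‖η y‖)) (aestronglyMeasurable_conv_green hi _)
      (ae_of_all _ fun x => ?_)
    refine (norm_conv_green_le hi (integrable_nearInv_mul_of_bound hηm hb x) (hre0 s)
      le_rfl).trans ?_
    refine mul_le_mul_of_nonneg_left (greenMaj_le_of_bound hηm hb x) ?_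
    have := hankelConst_nonneg
    positivity
  rw [← integral_sub (hcgv _) (hcgv _), ← integral_sub (hgv _) (hgv _), sub_eq_zero] at hzero
  calc ∫ x, g x • conv (jumpKer l) η x
      = ∫ x : R4, (conv (fun x => green (Complex.I * ((-1 : ℝ) * l : ℝ)) ‖x‖) η x * v x -
          conv (fun x => green (Complex.I * ((1 : ℝ) * l : ℝ)) ‖x‖) η x * v x) := by
        refine integral_congr_ae (ae_of_all _ fun x => ?_)
        simp only [hconvJ, hv, Complex.real_smul]
        ring
    _ = _ := hzero
    _ = ∫ x, g x • jumpKer l x := by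
        refine integral_congr_ae ?_
        filter_upwards [hne0 0] with x hx
        rw [hJ x (by simpa using hx), hv, Complex.real_smul]
        ring

end Reproducing

theorem lintegral_comp_smul_R4 (g : R4 → ℝ≥0∞) {s : ℝ} (hs : 0 < s) :
    ∫⁻ x, g (s • x) = ENNReal.ofReal (s⁻¹ ^ 4) * ∫⁻ x, g x := by
  have h := lintegral_map_equiv (μ := (volume : Measure R4)) g
    (Homeomorph.smulOfNeZero s hs.ne').toMeasurableEquiv
  have h2 : Measure.map (Homeomorph.smulOfNeZero s hs.ne').toMeasurableEquiv
      (volume : Measure R4) = ENNReal.ofReal (s⁻¹ ^ 4) • volume := by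
    have := Measure.map_addHaar_smul (volume : Measure R4) hs.ne'
    rw [finrank_euclideanSpace, Fintype.card_fin, abs_of_pos (by positivity), ← inv_pow] at this
    exact this
  rw [h2, lintegral_smul_measure] at h
  exact h.symm

/-! ### Low-pass kernels at scale `s`. -/

section Dilation

/-- The `L¹`-normalized dilation `s⁴ η(s ·)`. -/
noncomputable def dilate (s : ℝ) (η : R4 → ℂ) (x : R4) : ℂ := ((s ^ 4 : ℝ) : ℂ) * η (s • x)

variable {η : R4 → ℂ} {s : ℝ}

theorem continuous_dilate (hη : Continuous η) (s : ℝ) : Continuous (dilate s η) := by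
  unfold dilate; fun_prop

theorem integrable_dilate (hη : Integrable η) (hs : 0 < s) : Integrable (dilate s η) :=
  (hη.comp_smul hs.ne').const_mul _

theorem norm_dilate_le {B : ℝ} (hη : ∀ x, ‖η x‖ ≤ B) (s : ℝ) (x : R4) :
    ‖dilate s η x‖ ≤ s ^ 4 * B := by
  rw [dilate, norm_mul, Complex.norm_real, Real.norm_of_nonneg (by positivity)]
  gcongr
  exact hη _

theorem fourier_dilate (η : R4 → ℂ) (hs : 0 < s) (ξ : R4) :
    𝓕 (dilate s η) ξ = 𝓕 η (s⁻¹ • ξ) := by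
  rw [Real.fourier_eq, Real.fourier_eq]
  have h := Measure.integral_comp_smul (volume : Measure R4)
    (fun v => Real.fourierChar (-inner ℝ v (s⁻¹ • ξ)) • η v) s
  rw [finrank_euclideanSpace, Fintype.card_fin, abs_of_pos (by positivity),
    ← inv_smul_eq_iff₀ (by positivity), inv_inv] at h
  rw [← h, ← integral_smul]
  refine integral_congr_ae (ae_of_all _ fun v => ?_)
  simp only [dilate]
  rw [inner_smul_left, inner_smul_right, Circle.smul_def, Circle.smul_def, Complex.real_smul,
    smul_eq_mul, smul_eq_mul]
  simp only [conj_trivial, mul_inv_cancel_left₀ hs.ne']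
  ring

/-- The inverse Fourier transform of a smooth bump function equal to `1` on a large ball. -/
theorem exists_lowPass (Λ : ℝ) :
    ∃ η : 𝓢(R4, ℂ), ∀ ξ : R4, 2 * Real.pi * ‖ξ‖ ≤ Λ → 𝓕 (η : R4 → ℂ) ξ = 1 := by
  let f : ContDiffBump (0 : R4) := ⟨|Λ| + 1, |Λ| + 2, by positivity, by linarith⟩
  have hc : HasCompactSupport (fun x => (f x : ℂ)) :=
    f.hasCompactSupport.comp_left (g := Complex.ofReal) rfl
  have hs : ContDiff ℝ ∞ (fun x => (f x : ℂ)) := Complex.ofRealCLM.contDiff.comp f.contDiff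
  refine ⟨𝓕⁻ (hc.toSchwartzMap hs), fun ξ hξ => ?_⟩
  have h1 : 𝓕 ((𝓕⁻ (hc.toSchwartzMap hs) : 𝓢(R4, ℂ)) : R4 → ℂ) ξ =
      (𝓕 (𝓕⁻ (hc.toSchwartzMap hs)) : 𝓢(R4, ℂ)) ξ := by
    rw [SchwartzMap.fourier_coe]
  rw [h1, FourierTransform.fourier_fourierInv_eq]
  change (f ξ : ℂ) = 1
  rw [f.one_of_mem_closedBall, Complex.ofReal_one]
  rw [mem_closedBall_zero_iff]
  change ‖ξ‖ ≤ |Λ| + 1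
  have := le_abs_self Λ
  nlinarith [Real.pi_gt_three, norm_nonneg ξ]

/-- Dilation by `s` makes the Fourier transform equal to `1` for `2π|ξ| ≤ s(Λ+1)`. The unit of slack
in `Λ + 1` is the neighbourhood of width `s` of the sphere `2π|ξ| = l` that `conv_jumpKer_eq`
requires. -/
theorem conv_jumpKer_dilate {η : 𝓢(R4, ℂ)} {Λ : ℝ}
    (hη : ∀ ξ : R4, 2 * Real.pi * ‖ξ‖ ≤ Λ + 1 → 𝓕 (η : R4 → ℂ) ξ = 1) (hs : 0 < s) {l : ℝ}
    (hl : 0 < l) (hls : l ≤ s * Λ) (x : R4) :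
    conv (jumpKer l) (dilate s η) x = jumpKer l x := by
  have hb : ∀ x, ‖η x‖ ≤ ‖η.toBoundedContinuousFunction‖ :=
    η.toBoundedContinuousFunction.norm_coe_le_norm
  refine conv_jumpKer_eq (continuous_dilate η.continuous s) (integrable_dilate η.integrable hs)
    (norm_dilate_le hb s) hl hs (fun ξ hξ => ?_) x
  rw [fourier_dilate _ hs]
  apply hη
  rw [norm_smul, norm_inv, Real.norm_of_nonneg hs.le]
  have h1 := (abs_lt.1 hξ).2
  rw [show 2 * Real.pi * (s⁻¹ * ‖ξ‖) = (2 * Real.pi * ‖ξ‖) / s by field_simp, div_le_iff₀ hs]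
  linarith

end Dilation

/-! ### Moving the low-pass kernel onto `φ`. -/

section Pairing

/-- The correlation `∫ conj(φ(x)) η(x + v) dx`. -/
noncomputable def correl (φ η : R4 → ℂ) (v : R4) : ℂ :=
  ∫ x, (starRingEnd ℂ) (φ x) * η (x + v)

variable {φ f η : R4 → ℂ}

theorem integrable_conj (hφ : Integrable φ) : Integrable fun x => (starRingEnd ℂ) (φ x) :=
  hφ.congr' (Complex.continuous_conj.comp_aestronglyMeasurable hφ.1)
    (ae_of_all _ fun x => by simp)

theorem integrable_correl_integrand (hφ : Integrable φ) (hη : Integrable η) :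
    Integrable (fun q : R4 × R4 => (starRingEnd ℂ) (φ q.1) * η (q.1 + q.2))
      (volume.prod volume) :=
  (measurePreserving_prod_add (volume : Measure R4) (volume : Measure R4)).integrable_comp_of_integrable
    ((integrable_conj hφ).mul_prod hη)

theorem integrable_correl (hφ : Integrable φ) (hη : Integrable η) : Integrable (correl φ η) :=
  (integrable_correl_integrand hφ hη).integral_prod_right

/-- Replace the jump kernel by its convolution with `η` and exchange the integrals: `η` is then
averaged against `φ`, where the vanishing moments of `φ` can act. -/
theorem integral_conj_mul_jumpKer (hφ : Integrable φ) (hη : Integrable η) {l : ℝ}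
    (hrep : ∀ x, conv (jumpKer l) η x = jumpKer l x) (y : R4) :
    ∫ x, (starRingEnd ℂ) (φ x) * jumpKer l (x - y) = ∫ u, jumpKer l u * correl φ η (u - y) := by
  have hJ := continuous_jumpKer l
  have h1 : ∀ x, (starRingEnd ℂ) (φ x) * jumpKer l (x - y) =
      ∫ v, jumpKer l (y + v) * ((starRingEnd ℂ) (φ x) * η (x + v)) := by
    intro x
    rw [← hrep (x - y), conv, ← integral_add_left_eq_self _ x, ← integral_const_mul]
    refine integral_congr_ae (ae_of_all _ fun v => ?_)
    simp only
    rw [show x - y - (x + v) = -(y + v) by abel, jumpKer_neg]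
    ring
  have hInt : Integrable (fun q : R4 × R4 => jumpKer l (y + q.2) *
      ((starRingEnd ℂ) (φ q.1) * η (q.1 + q.2))) (volume.prod volume) :=
    (integrable_correl_integrand hφ hη).bdd_mul (c := l ^ 2)
      (by fun_prop : Continuous fun q : R4 × R4 => jumpKer l (y + q.2)).aestronglyMeasurable
      (ae_of_all _ fun q => norm_jumpKer_le l _)
  simp only [h1]
  rw [integral_integral_swap hInt,
    ← integral_add_left_eq_self (fun u => jumpKer l u * correl φ η (u - y)) y]
  refine integral_congr_ae (ae_of_all _ fun v => ?_)
  simp only [integral_const_mul, add_sub_cancel_left, correl]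

theorem integral_conj_mul_conv_jumpKer (hφ : Integrable φ) (hf : Integrable f)
    (hη : Integrable η) {l : ℝ} (hrep : ∀ x, conv (jumpKer l) η x = jumpKer l x) :
    ∫ x, (starRingEnd ℂ) (φ x) * conv (jumpKer l) f x =
      ∫ u, jumpKer l u * conv (correl φ η) f u := by
  have hJ := continuous_jumpKer l
  have hint1 : Integrable (fun q : R4 × R4 => jumpKer l (q.1 - q.2) *
      ((starRingEnd ℂ) (φ q.1) * f q.2)) (volume.prod volume) :=
    ((integrable_conj hφ).mul_prod hf).bdd_mul (c := l ^ 2)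
      (by fun_prop : Continuous fun q : R4 × R4 => jumpKer l (q.1 - q.2)).aestronglyMeasurable
      (ae_of_all _ fun q => norm_jumpKer_le l _)
  have hint2 : Integrable (fun q : R4 × R4 => jumpKer l q.1 *
      (correl φ η (q.1 - q.2) * f q.2)) (volume.prod volume) :=
    (integrable_conv_integrand (integrable_correl hφ hη) hf).bdd_mul (c := l ^ 2)
      (by fun_prop : Continuous fun q : R4 × R4 => jumpKer l q.1).aestronglyMeasurable
      (ae_of_all _ fun q => norm_jumpKer_le l _)
  calc ∫ x, (starRingEnd ℂ) (φ x) * conv (jumpKer l) f x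
      = ∫ x, ∫ y, jumpKer l (x - y) * ((starRingEnd ℂ) (φ x) * f y) := by
        refine integral_congr_ae (ae_of_all _ fun x => ?_)
        simp only [conv]
        rw [← integral_const_mul]
        refine integral_congr_ae (ae_of_all _ fun y => ?_)
        simp only; ring
    _ = ∫ y, ∫ x, jumpKer l (x - y) * ((starRingEnd ℂ) (φ x) * f y) :=
        integral_integral_swap hint1
    _ = ∫ y, ∫ u, jumpKer l u * (correl φ η (u - y) * f y) := by
        refine integral_congr_ae (ae_of_all _ fun y => ?_)
        simp only
        have := integral_conj_mul_jumpKer hφ hη hrep y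
        calc _ = (∫ x, (starRingEnd ℂ) (φ x) * jumpKer l (x - y)) * f y := by
              rw [← integral_mul_const]
              refine integral_congr_ae (ae_of_all _ fun x => ?_)
              simp only; ring
          _ = _ := by
              rw [this, ← integral_mul_const]
              refine integral_congr_ae (ae_of_all _ fun x => ?_)
              simp only; ring
    _ = ∫ u, ∫ y, jumpKer l u * (correl φ η (u - y) * f y) :=
        (integral_integral_swap hint2).symm
    _ = _ := by
        refine integral_congr_ae (ae_of_all _ fun u => ?_)
        simp only [integral_const_mul, conv]

end Pairing

/-! ### Taylor remainders in `L¹`. -/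

section Taylor

variable {F : Type*} [NormedAddCommGroup F] [NormedSpace ℝ F] [CompleteSpace F]

theorem sub_eq_integral_fderiv {f : R4 → F} (hf : ContDiff ℝ 1 f) (v w : R4) :
    f (v + w) - f v = ∫ t in (0 : ℝ)..1, fderiv ℝ f (v + t • w) w := by
  have hd : ∀ t : ℝ, HasDerivAt (fun t : ℝ => f (v + t • w)) (fderiv ℝ f (v + t • w) w) t := by
    intro t
    have h1 : HasDerivAt (fun t : ℝ => v + t • w) w t := by
      simpa using ((hasDerivAt_id t).smul_const w).const_add v
    exact ((hf.differentiable (by norm_num) _).hasFDerivAt).comp_hasDerivAt t h1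
  have hc : Continuous fun t : ℝ => fderiv ℝ f (v + t • w) w := by
    have := hf.continuous_fderiv (by norm_num)
    fun_prop
  have := intervalIntegral.integral_eq_sub_of_hasDerivAt (a := 0) (b := 1) (fun t _ => hd t)
    (hc.intervalIntegrable _ _)
  rw [this]
  simp

/-- Write the increment as an integral of the derivative along the segment, exchange the integrals,
and use translation invariance. -/
theorem lintegral_enorm_add_sub_le {f : R4 → F} (hf : ContDiff ℝ 1 f) (w : R4) :
    ∫⁻ v, ‖f (v + w) - f v‖ₑ ≤ ‖w‖ₑ * ∫⁻ v, ‖fderiv ℝ f v‖ₑ := by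
  have hfd := hf.continuous_fderiv (by norm_num)
  calc ∫⁻ v, ‖f (v + w) - f v‖ₑ
      ≤ ∫⁻ v, ∫⁻ t in Ioc (0 : ℝ) 1, ‖w‖ₑ * ‖fderiv ℝ f (v + t • w)‖ₑ := by
        refine lintegral_mono fun v => ?_
        rw [sub_eq_integral_fderiv hf, intervalIntegral.integral_of_le zero_le_one]
        refine (enorm_integral_le_lintegral_enorm _).trans (lintegral_mono fun t => ?_)
        rw [mul_comm]
        exact ContinuousLinearMap.le_opENorm _ _
    _ = ∫⁻ t in Ioc (0 : ℝ) 1, ∫⁻ v, ‖w‖ₑ * ‖fderiv ℝ f (v + t • w)‖ₑ := by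
        refine lintegral_lintegral_swap ?_
        refine (Continuous.measurable ?_).aemeasurable
        refine ENNReal.continuous_const_mul (by simp) |>.comp (continuous_enorm.comp ?_)
        change Continuous fun q : R4 × ℝ => fderiv ℝ f (q.1 + q.2 • w)
        fun_prop
    _ = ∫⁻ t in Ioc (0 : ℝ) 1, ‖w‖ₑ * ∫⁻ v, ‖fderiv ℝ f v‖ₑ := by
        refine lintegral_congr fun t => ?_
        rw [lintegral_const_mul' _ _ (by simp), lintegral_add_right_eq_self
          (fun v => ‖fderiv ℝ f v‖ₑ)]
    _ = _ := by simp

/-- The remainder is the integral over the segment of increments of the derivative, so the first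
order bound applies to `fderiv ℝ f`. -/
theorem lintegral_enorm_add_sub_sub_le {f : R4 → F} (hf : ContDiff ℝ 2 f) (w : R4) :
    ∫⁻ v, ‖f (v + w) - f v - fderiv ℝ f v w‖ₑ ≤
      ‖w‖ₑ ^ 2 * ∫⁻ v, ‖fderiv ℝ (fderiv ℝ f) v‖ₑ := by
  have hf1 : ContDiff ℝ 1 f := hf.of_le (by norm_num)
  have hfd' : ContDiff ℝ 1 (fderiv ℝ f) := hf.fderiv_right (by norm_num)
  have hfd := hfd'.continuous
  calc ∫⁻ v, ‖f (v + w) - f v - fderiv ℝ f v w‖ₑ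
      ≤ ∫⁻ v, ∫⁻ t in Ioc (0 : ℝ) 1, ‖w‖ₑ * ‖fderiv ℝ f (v + t • w) - fderiv ℝ f v‖ₑ := by
        refine lintegral_mono fun v => ?_
        have h1 : f (v + w) - f v - fderiv ℝ f v w =
            ∫ t in (0 : ℝ)..1, (fderiv ℝ f (v + t • w) - fderiv ℝ f v) w := by
          rw [sub_eq_integral_fderiv hf1]
          simp only [sub_apply]
          rw [intervalIntegral.integral_sub
            (Continuous.intervalIntegrable (by fun_prop) _ _)
            (Continuous.intervalIntegrable (by fun_prop) _ _)]
          simp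
        rw [h1, intervalIntegral.integral_of_le zero_le_one]
        refine (enorm_integral_le_lintegral_enorm _).trans (lintegral_mono fun t => ?_)
        rw [mul_comm]
        exact ContinuousLinearMap.le_opENorm _ _
    _ = ∫⁻ t in Ioc (0 : ℝ) 1, ∫⁻ v, ‖w‖ₑ * ‖fderiv ℝ f (v + t • w) - fderiv ℝ f v‖ₑ := by
        refine lintegral_lintegral_swap ?_
        refine (Continuous.measurable ?_).aemeasurable
        refine ENNReal.continuous_const_mul (by simp) |>.comp (continuous_enorm.comp ?_)
        change Continuous fun q : R4 × ℝ => fderiv ℝ f (q.1 + q.2 • w) - fderiv ℝ f q.1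
        fun_prop
    _ ≤ ∫⁻ t in Ioc (0 : ℝ) 1, ‖w‖ₑ ^ 2 * ∫⁻ v, ‖fderiv ℝ (fderiv ℝ f) v‖ₑ := by
        refine setLIntegral_mono' measurableSet_Ioc fun t ht => ?_
        rw [lintegral_const_mul' _ _ (by simp), sq, mul_assoc]
        gcongr
        refine (lintegral_enorm_add_sub_le hfd' (t • w)).trans ?_
        gcongr
        rw [enorm_smul]
        refine mul_le_of_le_one_left' ?_
        rw [← ofReal_norm, Real.norm_of_nonneg ht.1.le]
        exact ENNReal.ofReal_le_one.2 ht.2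
    _ = _ := by simp

end Taylor

/-! ### Vanishing moments make the correlation small. -/

section Correlation

variable {φ : R4 → ℂ}

/-- The change of variables `u = sv` moves the dilation from `η` to `φ`: at small `s` the function
`φ` looks concentrated at the origin, so Taylor expansion of `η` is effective. -/
theorem lintegral_enorm_correl_dilate (φ η : R4 → ℂ) {s : ℝ} (hs : 0 < s) :
    ∫⁻ v, ‖correl φ (dilate s η) v‖ₑ =
      ∫⁻ u, ‖∫ x, (starRingEnd ℂ) (φ x) * η (u + s • x)‖ₑ := by
  have h1 : ∀ v, ‖correl φ (dilate s η) v‖ₑ = ENNReal.ofReal (s ^ 4) *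
      ‖∫ x, (starRingEnd ℂ) (φ x) * η (s • v + s • x)‖ₑ := by
    intro v
    have : correl φ (dilate s η) v = ((s ^ 4 : ℝ) : ℂ) *
        ∫ x, (starRingEnd ℂ) (φ x) * η (s • v + s • x) := by
      rw [correl, ← integral_const_mul]
      refine integral_congr_ae (ae_of_all _ fun x => ?_)
      simp only [dilate, smul_add, add_comm (s • x)]
      ring
    rw [this, enorm_mul, ← ofReal_norm (((s ^ 4 : ℝ) : ℂ)), Complex.norm_real,
      Real.norm_of_nonneg (by positivity)]
  simp only [h1]
  rw [lintegral_const_mul' _ _ (by simp), lintegral_comp_smul_R4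
    (fun v => ‖∫ x, (starRingEnd ℂ) (φ x) * η (v + s • x)‖ₑ) hs, ← mul_assoc,
    ← ENNReal.ofReal_mul (by positivity), ← mul_pow, mul_inv_cancel₀ hs.ne']
  simp

theorem lintegral_enorm_integral_conj_mul_le (hφ : AEStronglyMeasurable φ volume)
    {R : R4 → R4 → ℂ} (hR : Continuous (Function.uncurry R)) :
    ∫⁻ u, ‖∫ x, (starRingEnd ℂ) (φ x) * R u x‖ₑ ≤ ∫⁻ x, ‖φ x‖ₑ * ∫⁻ u, ‖R u x‖ₑ := by
  calc _ ≤ ∫⁻ u, ∫⁻ x, ‖φ x‖ₑ * ‖R u x‖ₑ := by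
        refine lintegral_mono fun u => (enorm_integral_le_lintegral_enorm _).trans (le_of_eq ?_)
        refine lintegral_congr fun x => ?_
        rw [enorm_mul, RCLike.enorm_conj]
    _ = ∫⁻ x, ∫⁻ u, ‖φ x‖ₑ * ‖R u x‖ₑ := by
        refine lintegral_lintegral_swap ?_
        exact hφ.enorm.comp_snd.mul hR.enorm.measurable.aemeasurable
    _ = _ := by
        refine lintegral_congr fun x => ?_
        rw [lintegral_const_mul' _ _ (by simp)]

theorem integrable_conj_mul_schwartz (hφ : Integrable φ) (η : 𝓢(R4, ℂ)) (u : R4) (s : ℝ) :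
    Integrable fun x => (starRingEnd ℂ) (φ x) * η (u + s • x) := by
  have hη := η.continuous
  exact (integrable_conj hφ).mul_bdd (c := ‖η.toBoundedContinuousFunction‖)
    (by fun_prop : Continuous fun x => η (u + s • x)).aestronglyMeasurable
    (ae_of_all _ fun x => η.toBoundedContinuousFunction.norm_coe_le_norm _)

theorem integral_conj_eq_zero (h0 : ∫ x, φ x = 0) : ∫ x, (starRingEnd ℂ) (φ x) = 0 := by
  rw [integral_conj, h0, map_zero]

/-- Correlation of a mean-zero function with a wide kernel is small in `L¹`. -/
theorem lintegral_enorm_correl_dilate_le (hφ : Integrable φ) (h0 : ∫ x, φ x = 0) (η : 𝓢(R4, ℂ))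
    {s : ℝ} (hs : 0 < s) :
    ∫⁻ v, ‖correl φ (dilate s η) v‖ₑ ≤ ENNReal.ofReal s *
      ((∫⁻ x, ‖φ x‖ₑ * ‖x‖ₑ) * ∫⁻ v, ‖fderiv ℝ η v‖ₑ) := by
  have hη := η.continuous
  rw [lintegral_enorm_correl_dilate _ _ hs]
  -- The constant term `η u` may be subtracted because `φ` has mean zero.
  have h1 : ∀ u, ∫ x, (starRingEnd ℂ) (φ x) * η (u + s • x) =
      ∫ x, (starRingEnd ℂ) (φ x) * (η (u + s • x) - η u) := by
    intro u
    simp only [mul_sub]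
    rw [integral_sub (integrable_conj_mul_schwartz hφ η u s) ((integrable_conj hφ).mul_const _),
      integral_mul_const, integral_conj_eq_zero h0, zero_mul, sub_zero]
  simp only [h1]
  refine (lintegral_enorm_integral_conj_mul_le hφ.1 (R := fun u x => η (u + s • x) - η u)
    (by simp only [Function.uncurry_def]; fun_prop)).trans ?_
  calc _ ≤ ∫⁻ x, ‖φ x‖ₑ * (ENNReal.ofReal s * ‖x‖ₑ * ∫⁻ v, ‖fderiv ℝ η v‖ₑ) := by
        refine lintegral_mono fun x => ?_
        gcongr
        refine (lintegral_enorm_add_sub_le (η.smooth 1) (s • x)).trans ?_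
        rw [enorm_smul, ← ofReal_norm s, Real.norm_of_nonneg hs.le]
    _ = ∫⁻ x, (ENNReal.ofReal s * ∫⁻ v, ‖fderiv ℝ η v‖ₑ) * (‖φ x‖ₑ * ‖x‖ₑ) := by
        refine lintegral_congr fun x => ?_
        ring
    _ = _ := by
        have h2 : AEMeasurable fun x => ‖φ x‖ₑ * ‖x‖ₑ :=
          hφ.1.enorm.mul continuous_enorm.measurable.aemeasurable
        rw [lintegral_const_mul'' _ h2]
        ring

/-- The gain is quadratic when the first moments vanish as well. -/
theorem lintegral_enorm_correl_dilate_le_sq (hφ : Integrable φ) (h0 : ∫ x, φ x = 0)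
    (hm : ∀ A : R4 →L[ℝ] ℂ, Integrable (fun x => (starRingEnd ℂ) (φ x) * A x) ∧
      ∫ x, (starRingEnd ℂ) (φ x) * A x = 0) (η : 𝓢(R4, ℂ)) {s : ℝ} (hs : 0 < s) :
    ∫⁻ v, ‖correl φ (dilate s η) v‖ₑ ≤ ENNReal.ofReal (s ^ 2) *
      ((∫⁻ x, ‖φ x‖ₑ * ‖x‖ₑ ^ 2) * ∫⁻ v, ‖fderiv ℝ (fderiv ℝ η) v‖ₑ) := by
  have hη := η.continuous
  have hηd : Continuous (fderiv ℝ η) := (η.smooth 1).continuous_fderiv (by norm_num)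
  rw [lintegral_enorm_correl_dilate _ _ hs]
  -- The constant and linear terms of the Taylor expansion integrate to zero against `conj φ`.
  have h1 : ∀ u, ∫ x, (starRingEnd ℂ) (φ x) * η (u + s • x) =
      ∫ x, (starRingEnd ℂ) (φ x) * (η (u + s • x) - η u - fderiv ℝ η u (s • x)) := by
    intro u
    have e1 := integrable_conj_mul_schwartz hφ η u s
    have e2 := (integrable_conj hφ).mul_const (η u)
    have e3 := hm (s • fderiv ℝ η u)
    simp only [mul_sub]
    have e4 : ∀ x, (starRingEnd ℂ) (φ x) * fderiv ℝ η u (s • x) =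
        (starRingEnd ℂ) (φ x) * (s • fderiv ℝ η u) x := by
      intro x; rw [map_smul]; rfl
    simp only [e4]
    have e5 : Integrable fun x => (starRingEnd ℂ) (φ x) * η (u + s • x) -
        (starRingEnd ℂ) (φ x) * η u := e1.sub e2
    rw [integral_sub e5 e3.1, integral_sub e1 e2,
      integral_mul_const, integral_conj_eq_zero h0, zero_mul, sub_zero, e3.2, sub_zero]
  simp only [h1]
  refine (lintegral_enorm_integral_conj_mul_le hφ.1
    (R := fun u x => η (u + s • x) - η u - fderiv ℝ η u (s • x))
    (by simp only [Function.uncurry_def]; fun_prop)).trans ?_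
  calc _ ≤ ∫⁻ x, ‖φ x‖ₑ * (ENNReal.ofReal (s ^ 2) * ‖x‖ₑ ^ 2 *
          ∫⁻ v, ‖fderiv ℝ (fderiv ℝ η) v‖ₑ) := by
        refine lintegral_mono fun x => ?_
        gcongr
        refine (lintegral_enorm_add_sub_sub_le (η.smooth 2) (s • x)).trans ?_
        rw [enorm_smul, ← ofReal_norm s, Real.norm_of_nonneg hs.le, mul_pow,
          ENNReal.ofReal_pow hs.le]
    _ = ∫⁻ x, (ENNReal.ofReal (s ^ 2) * ∫⁻ v, ‖fderiv ℝ (fderiv ℝ η) v‖ₑ) *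
          (‖φ x‖ₑ * ‖x‖ₑ ^ 2) := by
        refine lintegral_congr fun x => ?_
        ring
    _ = _ := by
        have h2 : AEMeasurable fun x => ‖φ x‖ₑ * ‖x‖ₑ ^ 2 :=
          hφ.1.enorm.mul (continuous_enorm.measurable.pow_const 2).aemeasurable
        rw [lintegral_const_mul'' _ h2]
        ring

theorem lintegral_enorm_fderiv_lt_top (η : 𝓢(R4, ℂ)) : ∫⁻ v, ‖fderiv ℝ η v‖ₑ < ⊤ :=
  (SchwartzMap.fderivCLM ℝ R4 ℂ η).integrable.2

theorem lintegral_enorm_fderiv_fderiv_lt_top (η : 𝓢(R4, ℂ)) :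
    ∫⁻ v, ‖fderiv ℝ (fderiv ℝ η) v‖ₑ < ⊤ :=
  (SchwartzMap.fderivCLM ℝ R4 _ (SchwartzMap.fderivCLM ℝ R4 ℂ η)).integrable.2

end Correlation

/-! ### Splitting the radial kernel into far and near parts. -/

section Kernels

/-- The part of the radial kernel away from the diagonal singularity of the Green function. -/
noncomputable def farKer (r ρ : ℝ) : ℝ :=
  (1 + r) ^ (-(3 / 2) : ℝ) * (1 + ρ) ^ (-(3 / 2) : ℝ) * ((1 + |r - ρ|) ^ 3)⁻¹

theorem farKer_comm (r ρ : ℝ) : farKer r ρ = farKer ρ r := by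
  rw [farKer, farKer, abs_sub_comm]; ring

theorem farKer_nonneg {r ρ : ℝ} (hr : 0 ≤ r) (hρ : 0 ≤ ρ) : 0 ≤ farKer r ρ := by
  unfold farKer; positivity

theorem measurable_farKer : Measurable fun q : ℝ × ℝ => farKer q.1 q.2 := by
  unfold farKer
  fun_prop

theorem inv_sq_mul_sqrt_le {r : ℝ} (hr : 1 ≤ r) :
    (r ^ 2)⁻¹ * √(1 + r) ≤ 4 * (1 + r) ^ (-(3 / 2) : ℝ) := by
  have hx : (0 : ℝ) < 1 + r := by linarith
  have e : (1 + r) ^ (-(3 / 2) : ℝ) = ((1 + r) ^ 2)⁻¹ * √(1 + r) := by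
    rw [Real.sqrt_eq_rpow, ← Real.rpow_natCast, ← Real.rpow_neg hx.le, ← Real.rpow_add hx]
    norm_num
  rw [e, ← mul_assoc]
  gcongr
  rw [← div_eq_mul_inv, inv_le_comm₀ (by positivity) (by positivity), inv_div,
    div_le_iff₀ (by positivity)]
  nlinarith

/-- For `|z| ≥ 1`, `r⁻²(1+r)^{1/2}` is comparable to `(1+r)^{-3/2}`, which makes the bound
symmetric. For `|z| < 1` the factor `(1+|r-ρ|)⁻³` is decay in `ρ` alone, for a total exponent `-3/2
- 3 = -9/2 < -4`, integrable on `ℝ⁴`; only the singularity `|z|⁻²` is left. -/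
theorem radial_bound_le (z : R4) {ρ : ℝ} (hρ : 0 ≤ ρ) :
    (‖z‖ ^ 2)⁻¹ * √(1 + ‖z‖) * (1 + ρ) ^ (-(3 / 2) : ℝ) * ((1 + |‖z‖ - ρ|) ^ 3)⁻¹ ≤
      4 * farKer ‖z‖ ρ + 16 * (nearInv z * (1 + ρ) ^ (-(9 / 2) : ℝ)) := by
  have hr := norm_nonneg z
  by_cases h : ‖z‖ < 1
  · have h1 : ((1 + |‖z‖ - ρ|) ^ 3)⁻¹ ≤ (1 + 1) ^ 3 * ((1 + ρ) ^ 3)⁻¹ := by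
      refine inv_one_add_pow_le (by norm_num) hρ (abs_nonneg _) ?_
      have := neg_le_abs (‖z‖ - ρ)
      linarith
    have h2 : √(1 + ‖z‖) ≤ 2 := by
      rw [Real.sqrt_le_left (by norm_num)]; linarith
    have h3 : (1 + ρ) ^ (-(9 / 2) : ℝ) = (1 + ρ) ^ (-(3 / 2) : ℝ) * ((1 + ρ) ^ 3)⁻¹ := by
      have hx : (0 : ℝ) < 1 + ρ := by linarith
      rw [← Real.rpow_natCast (1 + ρ) 3, ← Real.rpow_neg hx.le, ← Real.rpow_add hx]
      norm_num
    rw [nearInv_of_lt h, h3]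
    have h4 := farKer_nonneg hr hρ
    calc _ ≤ (‖z‖ ^ 2)⁻¹ * 2 * (1 + ρ) ^ (-(3 / 2) : ℝ) * ((1 + 1) ^ 3 * ((1 + ρ) ^ 3)⁻¹) := by
          gcongr
      _ = 16 * ((‖z‖ ^ 2)⁻¹ * ((1 + ρ) ^ (-(3 / 2) : ℝ) * ((1 + ρ) ^ 3)⁻¹)) := by ring
      _ ≤ _ := by linarith
  · have h1 := inv_sq_mul_sqrt_le (not_lt.1 h)
    have h2 : 0 ≤ 16 * (nearInv z * (1 + ρ) ^ (-(9 / 2) : ℝ)) := by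
      have := nearInv_nonneg z
      positivity
    calc _ ≤ (4 * (1 + ‖z‖) ^ (-(3 / 2) : ℝ)) * (1 + ρ) ^ (-(3 / 2) : ℝ) *
          ((1 + |‖z‖ - ρ|) ^ 3)⁻¹ := by gcongr
      _ = 4 * farKer ‖z‖ ρ := by rw [farKer]; ring
      _ ≤ _ := by linarith

/-- Trade `(1+r)^{-3/2}` for `(1+y)^{-3/2}` at the cost of `(1+|y-r|)^{3/2}`. The total `(1+y)⁻³`
cancels the polar density `y³`, and `(1+|y-r|)^{-3/2}` remains, integrable on the line uniformly in
`r`. The exponent `3` gained by integration by parts is what leaves an integrable power here. -/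
theorem pow_three_mul_farKer_le {r y : ℝ} (hr : 0 ≤ r) (hy : 0 ≤ y) :
    y ^ 3 * farKer r y ≤ (1 + |y - r|) ^ (-(3 / 2) : ℝ) := by
  have ht : (0 : ℝ) < 1 + |y - r| := by positivity
  have h1 : (1 + r) ^ (-(3 / 2) : ℝ) ≤
      (1 + y) ^ (-(3 / 2) : ℝ) * (1 + |y - r|) ^ (3 / 2 : ℝ) := by
    have h2 : 1 + y ≤ (1 + r) * (1 + |y - r|) := by
      have := le_abs_self (y - r)
      nlinarith [abs_nonneg (y - r)]
    have h3 : (1 + y) ^ (3 / 2 : ℝ) ≤ (1 + r) ^ (3 / 2 : ℝ) * (1 + |y - r|) ^ (3 / 2 : ℝ) := by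
      rw [← Real.mul_rpow (by positivity) ht.le]
      exact Real.rpow_le_rpow (by positivity) h2 (by norm_num)
    rw [Real.rpow_neg (by positivity), Real.rpow_neg (by positivity), inv_mul_eq_div,
      le_div_iff₀ (by positivity), inv_mul_le_iff₀ (by positivity)]
    exact h3
  have h4 : (1 + y) ^ (-(3 / 2) : ℝ) * (1 + y) ^ (-(3 / 2) : ℝ) = ((1 + y) ^ 3)⁻¹ := by
    have hx : (0 : ℝ) < 1 + y := by linarith
    rw [← Real.rpow_add hx, ← Real.rpow_natCast, ← Real.rpow_neg hx.le]
    norm_num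
  have h5 : (1 + |y - r|) ^ (3 / 2 : ℝ) * ((1 + |y - r|) ^ 3)⁻¹ = (1 + |y - r|) ^ (-(3 / 2) : ℝ) := by
    rw [← Real.rpow_natCast, ← Real.rpow_neg ht.le, ← Real.rpow_add ht]
    norm_num
  rw [farKer, abs_sub_comm r y]
  calc y ^ 3 * ((1 + r) ^ (-(3 / 2) : ℝ) * (1 + y) ^ (-(3 / 2) : ℝ) * ((1 + |y - r|) ^ 3)⁻¹)
      ≤ (1 + y) ^ 3 * (((1 + y) ^ (-(3 / 2) : ℝ) * (1 + |y - r|) ^ (3 / 2 : ℝ)) *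
        (1 + y) ^ (-(3 / 2) : ℝ) * ((1 + |y - r|) ^ 3)⁻¹) := by
        gcongr
        linarith
    _ = (1 + y) ^ 3 * ((1 + y) ^ (-(3 / 2) : ℝ) * (1 + y) ^ (-(3 / 2) : ℝ)) *
        ((1 + |y - r|) ^ (3 / 2 : ℝ) * ((1 + |y - r|) ^ 3)⁻¹) := by ring
    _ = _ := by
        rw [h4, h5, mul_inv_cancel₀ (by positivity), one_mul]

theorem exists_lintegral_farKer_le :
    ∃ C : ℝ≥0∞, C ≠ ⊤ ∧ ∀ r : ℝ, 0 ≤ r → ∫⁻ u : R4, ENNReal.ofReal (farKer r ‖u‖) ≤ C := by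
  have hInt : Integrable fun t : ℝ => (1 + ‖t‖) ^ (-(3 / 2) : ℝ) :=
    integrable_one_add_norm (by norm_num)
  refine ⟨ENNReal.ofReal (4 * (volume.real (Metric.ball (0 : R4) 1) *
    ∫ t : ℝ, (1 + ‖t‖) ^ (-(3 / 2) : ℝ))), ENNReal.ofReal_ne_top, fun r hr => ?_⟩
  have hsh : Integrable fun y : ℝ => (1 + |y - r|) ^ (-(3 / 2) : ℝ) := by
    simpa using hInt.comp_sub_right r
  have hm : Measurable fun y => farKer r y := measurable_farKer.comp measurable_prodMk_left
  have hon : IntegrableOn (fun y : ℝ => y ^ 3 • farKer r y) (Ioi 0) := by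
    refine hsh.integrableOn.mono' (by fun_prop) ?_
    filter_upwards [self_mem_ae_restrict measurableSet_Ioi] with y hy
    rw [smul_eq_mul, Real.norm_of_nonneg (mul_nonneg (pow_nonneg (le_of_lt hy) 3)
      (farKer_nonneg hr (le_of_lt hy)))]
    exact pow_three_mul_farKer_le hr (le_of_lt hy)
  have hR4 : Integrable fun u : R4 => farKer r ‖u‖ := by
    rw [integrable_fun_norm_addHaar (volume : Measure R4)]
    simpa using hon
  rw [← ofReal_integral_eq_lintegral_ofReal hR4
    (ae_of_all _ fun u => farKer_nonneg hr (norm_nonneg _))]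
  apply ENNReal.ofReal_le_ofReal
  rw [integral_fun_norm_addHaar (volume : Measure R4) (fun y => farKer r y)]
  simp only [finrank_euclideanSpace, Fintype.card_fin, nsmul_eq_mul, smul_eq_mul]
  push_cast
  gcongr
  calc ∫ y in Ioi (0 : ℝ), y ^ 3 * farKer r y ≤ ∫ y in Ioi (0 : ℝ), (1 + |y - r|) ^ (-(3 / 2) : ℝ) := by
        refine setIntegral_mono_on hon hsh.integrableOn measurableSet_Ioi fun y hy => ?_
        exact pow_three_mul_farKer_le hr (le_of_lt hy)
    _ ≤ ∫ y : ℝ, (1 + |y - r|) ^ (-(3 / 2) : ℝ) :=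
        setIntegral_le_integral hsh (ae_of_all _ fun y => by positivity)
    _ = _ := by
        simpa using integral_sub_right_eq_self (fun t : ℝ => (1 + ‖t‖) ^ (-(3 / 2) : ℝ)) r

end Kernels

/-! ### `L^p` bounds for the rescaled kernels. -/

section LpBounds

variable {p : ℝ≥0∞}

/-- The factor `s⁴` is the Jacobian of the dilation, so the Schur constant does not depend on `s`;
the kernel is symmetric, so one of the two Schur integrals suffices. -/
theorem exists_eLpNorm_farKer_le :
    ∃ C : ℝ≥0∞, C ≠ ⊤ ∧ ∀ (p : ℝ≥0∞), 1 ≤ p → p ≠ ⊤ → ∀ (s : ℝ), 0 < s → ∀ G : R4 → ℝ≥0∞,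
      AEMeasurable G → eLpNorm (fun z : R4 => ∫⁻ u, ENNReal.ofReal
        (s ^ 4 * farKer (s * ‖z‖) (s * ‖u‖)) * G u) p volume ≤ C * eLpNorm G p volume := by
  obtain ⟨C, hC, hCb⟩ := exists_lintegral_farKer_le
  refine ⟨C, hC, fun p hp hp' s hs G hG => ?_⟩
  have key : ∀ z : R4, ∫⁻ u : R4, ENNReal.ofReal (s ^ 4 * farKer (s * ‖z‖) (s * ‖u‖)) ≤ C := by
    intro z
    have h1 : ∀ u : R4, ENNReal.ofReal (s ^ 4 * farKer (s * ‖z‖) (s * ‖u‖)) =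
        ENNReal.ofReal (s ^ 4) * ENNReal.ofReal (farKer (s * ‖z‖) ‖s • u‖) := by
      intro u
      rw [ENNReal.ofReal_mul (by positivity), norm_smul, Real.norm_of_nonneg hs.le]
    simp only [h1]
    rw [lintegral_const_mul' _ _ ENNReal.ofReal_ne_top, lintegral_comp_smul_R4
      (fun u => ENNReal.ofReal (farKer (s * ‖z‖) ‖u‖)) hs, ← mul_assoc,
      ← ENNReal.ofReal_mul (by positivity), ← mul_pow, mul_inv_cancel₀ hs.ne']
    simpa using hCb (s * ‖z‖) (by positivity)
  refine eLpNorm_lintegral_le_of_schur ?_ hG key (fun u => ?_) hp hp'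
  · refine ENNReal.measurable_ofReal.comp (Measurable.const_mul ?_ _)
    exact measurable_farKer.comp (f := fun q : R4 × R4 => (s * ‖q.1‖, s * ‖q.2‖)) (by fun_prop)
  · simp only [farKer_comm _ (s * ‖u‖)]
    exact key u

theorem lintegral_mul_le_rpow_mul_eLpNorm {w G : R4 → ℝ≥0∞} (hw : Measurable w)
    (hw1 : ∀ x, w x ≤ 1) (hG : AEMeasurable G) {C : ℝ≥0∞} (hC0 : C ≠ 0) (hC : C ≠ ⊤)
    (hwC : ∫⁻ x, w x ≤ C) (hp : 1 ≤ p) (hp' : p ≠ ⊤) :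
    ∫⁻ x, w x * G x ≤ C ^ (1 - 1 / p.toReal) * eLpNorm G p volume := by
  -- Hölder read off from Schur's test: the target is a one-point space of mass `C`, on which the
  -- two Schur conditions are `∫ w ≤ C` and `w ≤ 1`, and the norm of a constant contributes
  -- `C^{1/p}`.
  have h := eLpNorm_lintegral_le_of_schur (μ := C • Measure.dirac ()) (ν := (volume : Measure R4))
    (K := fun _ u => w u) (hw.comp measurable_snd) hG (C := C) (fun _ => hwC) (fun u => by
      simpa using mul_le_of_le_one_left' (hw1 u)) hp hp'
  have hp0 : p ≠ 0 := (zero_lt_one.trans_le hp).ne'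
  rw [eLpNorm_const' _ hp0 hp'] at h
  simp only [Measure.smul_apply, measure_univ, smul_eq_mul,
    mul_one, enorm_eq_self] at h
  rw [ENNReal.rpow_sub _ _ hC0 hC, ENNReal.rpow_one, ← ENNReal.mul_div_right_comm,
    ENNReal.le_div_iff_mul_le (Or.inl ?_) (Or.inl ?_)]
  · exact h
  · simp [hC0, hC]
  · exact ENNReal.rpow_ne_top_of_nonneg (by positivity) hC

/-- Hölder with a weight of total mass `O(s⁻⁴)`, whence `s^{-4(1-1/p)} = s^{4/p-4}`. -/
theorem exists_lintegral_weight_le :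
    ∃ c : ℝ≥0∞, c ≠ ⊤ ∧ ∀ (p : ℝ≥0∞), 1 ≤ p → p ≠ ⊤ → ∀ (s : ℝ), 0 < s → ∀ G : R4 → ℝ≥0∞,
      AEMeasurable G → ∫⁻ u : R4, ENNReal.ofReal ((1 + s * ‖u‖) ^ (-(9 / 2) : ℝ)) * G u ≤
        c * ENNReal.ofReal (s ^ (4 / p.toReal - 4)) * eLpNorm G p volume := by
  have hInt : Integrable fun u : R4 => (1 + ‖u‖) ^ (-(9 / 2) : ℝ) :=
    integrable_one_add_norm (by simp; norm_num)
  -- The summand `1` ensures `c ≥ 1`, so that `c^{1-1/p} ≤ c` uniformly in `p`.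
  set c : ℝ := 1 + ∫ u : R4, (1 + ‖u‖) ^ (-(9 / 2) : ℝ) with hc
  have hI : 0 ≤ ∫ u : R4, (1 + ‖u‖) ^ (-(9 / 2) : ℝ) := integral_nonneg fun u => by positivity
  have hc1 : 1 ≤ c := by linarith
  refine ⟨ENNReal.ofReal c, ENNReal.ofReal_ne_top, fun p hp hp' s hs G hG => ?_⟩
  have hq1 : 1 ≤ p.toReal := by
    simpa using (ENNReal.toReal_le_toReal ENNReal.one_ne_top hp').2 hp
  have hw : ∫⁻ u : R4, ENNReal.ofReal ((1 + s * ‖u‖) ^ (-(9 / 2) : ℝ)) ≤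
      ENNReal.ofReal (s⁻¹ ^ 4 * c) := by
    have h1 : ∀ u : R4, s * ‖u‖ = ‖s • u‖ := fun u => by
      rw [norm_smul, Real.norm_of_nonneg hs.le]
    simp only [h1]
    rw [lintegral_comp_smul_R4 (fun u => ENNReal.ofReal ((1 + ‖u‖) ^ (-(9 / 2) : ℝ))) hs,
      ← ofReal_integral_eq_lintegral_ofReal hInt (ae_of_all _ fun u => by positivity),
      ← ENNReal.ofReal_mul (by positivity)]
    apply ENNReal.ofReal_le_ofReal
    gcongr
    linarith
  have hpos : 0 < s⁻¹ ^ 4 * c := by positivity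
  refine (lintegral_mul_le_rpow_mul_eLpNorm (by fun_prop) (fun u => ?_) hG
    (by simpa using hpos) ENNReal.ofReal_ne_top hw hp hp').trans ?_
  · rw [ENNReal.ofReal_le_one]
    exact Real.rpow_le_one_of_one_le_of_nonpos (by nlinarith [norm_nonneg u]) (by norm_num)
  · gcongr
    have he : 0 ≤ 1 - 1 / p.toReal := by
      rw [sub_nonneg, div_le_one (by linarith)]; exact hq1
    rw [ENNReal.ofReal_rpow_of_pos hpos, ← ENNReal.ofReal_mul (by positivity)]
    apply ENNReal.ofReal_le_ofReal
    rw [Real.mul_rpow (by positivity) (by positivity), mul_comm]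
    have h2 : (s⁻¹ ^ 4) ^ (1 - 1 / p.toReal) = s ^ (4 / p.toReal - 4) := by
      rw [inv_pow, ← Real.rpow_natCast, ← Real.rpow_neg hs.le, ← Real.rpow_mul hs.le]
      congr 1; push_cast; ring
    rw [h2]
    gcongr
    calc c ^ (1 - 1 / p.toReal) ≤ c ^ (1 : ℝ) :=
          Real.rpow_le_rpow_of_exponent_le hc1 (by
            have : 0 ≤ 1 / p.toReal := by positivity
            linarith)
      _ = c := Real.rpow_one c

end LpBounds

/-! ### Convolution with the local singularity. -/

section Near

variable {p : ℝ≥0∞} {φ : R4 → ℂ}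

theorem ennreal_rpow_le_add_sq {q : ℝ} (h1 : 1 ≤ q) (h2 : q ≤ 2) (t : ℝ≥0∞) :
    t ^ q ≤ t + t ^ 2 := by
  rcases le_total t 1 with h | h
  · calc t ^ q ≤ t ^ (1 : ℝ) := ENNReal.rpow_le_rpow_of_exponent_ge h h1
      _ = t := ENNReal.rpow_one t
      _ ≤ _ := le_self_add
  · calc t ^ q ≤ t ^ (2 : ℝ) := ENNReal.rpow_le_rpow_of_exponent_le h h2
      _ = t ^ 2 := by rw [← ENNReal.rpow_natCast]; norm_num
      _ ≤ _ := le_add_self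

theorem lintegral_enorm_sq_lt_top (hφ₂ : MemLp φ 2 volume) : ∫⁻ x, ‖φ x‖ₑ ^ 2 < ⊤ := by
  have := lintegral_rpow_enorm_lt_top_of_eLpNorm_lt_top (by norm_num) (by norm_num) hφ₂.2
  simpa using this

theorem eLpNorm_lt_top_of_le_two (hφ₁ : Integrable φ) (hφ₂ : MemLp φ 2 volume) (hp : 1 ≤ p)
    (hp2 : p ≤ 2) : eLpNorm φ p volume < ⊤ := by
  have hp' : p ≠ ⊤ := ne_top_of_le_ne_top (by norm_num) hp2
  have hp0 : p ≠ 0 := (zero_lt_one.trans_le hp).ne'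
  have hq1 : 1 ≤ p.toReal := by
    simpa using (ENNReal.toReal_le_toReal ENNReal.one_ne_top hp').2 hp
  have hq2 : p.toReal ≤ 2 := by
    simpa using (ENNReal.toReal_le_toReal hp' (by norm_num)).2 hp2
  rw [eLpNorm_lt_top_iff_lintegral_rpow_enorm_lt_top hp0 hp']
  calc ∫⁻ x, ‖φ x‖ₑ ^ p.toReal ≤ ∫⁻ x, (‖φ x‖ₑ + ‖φ x‖ₑ ^ 2) :=
        lintegral_mono fun x => ennreal_rpow_le_add_sq hq1 hq2 _
    _ = (∫⁻ x, ‖φ x‖ₑ) + ∫⁻ x, ‖φ x‖ₑ ^ 2 := lintegral_add_left' hφ₁.1.enorm _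
    _ < ⊤ := ENNReal.add_lt_top.2 ⟨hφ₁.2, lintegral_enorm_sq_lt_top hφ₂⟩

theorem lintegral_lconvolution_comm (A B : R4 → ℝ≥0∞) (x : R4) :
    ∫⁻ w, A (x - w) * B w = ∫⁻ w, B (x - w) * A w := by
  rw [← lintegral_sub_left_eq_self (fun w => A (x - w) * B w) x]
  refine lintegral_congr fun w => ?_
  rw [sub_sub_cancel, mul_comm]

theorem aemeasurable_lconvolution {A B : R4 → ℝ≥0∞} (hA : AEMeasurable A) (hB : AEMeasurable B) :
    AEMeasurable fun x => ∫⁻ w, A (x - w) * B w := by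
  have : AEMeasurable (fun q : R4 × R4 => A (q.1 - q.2) * B q.2) (volume.prod volume) :=
    (hA.comp_quasiMeasurePreserving (quasiMeasurePreserving_sub volume volume)).mul hB.comp_snd
  exact this.lintegral_prod_right'

theorem lintegral_nearInv_rpow_lt_top {b : ℝ} (hb0 : 0 < b) (hb : b < 2) :
    ∫⁻ x : R4, ENNReal.ofReal (nearInv x) ^ b < ⊤ := by
  have hInt : IntegrableOn (fun x : R4 => ((‖x‖ ^ 2)⁻¹) ^ b) (Metric.ball 0 1) := by
    refine integrableOn_ball_of_norm_le_rpow (α := 2 * b) (C := 1) ?_ ?_ ?_ ?_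
    · simp
    · simp; linarith
    · refine Eventually.of_forall fun x => ?_
      rw [Real.norm_of_nonneg (by positivity), one_mul, Real.rpow_neg (norm_nonneg _),
        Real.inv_rpow (by positivity), Real.rpow_mul (norm_nonneg _)]
      norm_cast
    · apply Measurable.aestronglyMeasurable; fun_prop
  have h2 : ∫⁻ x in Metric.ball (0 : R4) 1, ENNReal.ofReal (((‖x‖ ^ 2)⁻¹) ^ b) < ⊤ := by
    rw [← ofReal_integral_eq_lintegral_ofReal hInt (ae_of_all _ fun x => by positivity)]
    exact ENNReal.ofReal_lt_top
  rw [← lintegral_indicator measurableSet_ball] at h2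
  refine lt_of_le_of_lt (lintegral_mono fun x => ?_) h2
  by_cases hx : x ∈ Metric.ball (0 : R4) 1
  · rw [indicator_of_mem hx, nearInv_of_lt (by simpa using hx),
      ENNReal.ofReal_rpow_of_nonneg (by positivity) hb0.le]
  · rw [nearInv, indicator_of_notMem hx]
    simp [hb0]

/-- Convolution with the local singularity `|x|⁻²` maps `L¹ ∩ L²` to `L^p`, `1 ≤ p < ∞`. -/
theorem eLpNorm_lconvolution_nearInv_lt_top (hφ₁ : Integrable φ) (hφ₂ : MemLp φ 2 volume)
    (hp : 1 ≤ p) (hp' : p ≠ ⊤) :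
    eLpNorm (fun x => ∫⁻ w, ENNReal.ofReal (nearInv (x - w)) * ‖φ w‖ₑ) p volume < ⊤ := by
  have hm : Measurable fun x => ENNReal.ofReal (nearInv x) :=
    ENNReal.measurable_ofReal.comp measurable_nearInv
  have hp0 : p ≠ 0 := (zero_lt_one.trans_le hp).ne'
  have h1 : ∫⁻ x, ENNReal.ofReal (nearInv x) < ⊤ := by
    rw [← ofReal_integral_eq_lintegral_ofReal integrable_nearInv (ae_of_all _ nearInv_nonneg)]
    exact ENNReal.ofReal_lt_top
  rcases le_or_gt p 2 with hp2 | hp2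
  · refine (eLpNorm_lconvolution_le hm.aemeasurable hφ₁.1.enorm hp hp').trans_lt ?_
    rw [eLpNorm_enorm]
    exact ENNReal.mul_lt_top h1 (eLpNorm_lt_top_of_le_two hφ₁ hφ₂ hp hp2)
  set q := p.toReal with hq
  have hq2 : 2 < q := by
    simpa using (ENNReal.toReal_lt_toReal (by norm_num) hp').2 hp2
  -- For `p > 2`, Cauchy–Schwarz with the splitting `h = h^{(2-a)/2} h^{a/2}` of the singularity
  -- `h`. Since `2 - a < 2`, `h^{2-a}` is integrable; since `a · q/2 = 1`, `hᵃ` lies in `L^{q/2}`,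
  -- and Young applies with `|φ|² ∈ L¹`.
  set a : ℝ := 2 / q with ha
  have ha0 : 0 < a := by positivity
  have ha1 : a < 1 := by rw [ha, div_lt_one (by linarith)]; exact hq2
  set h : R4 → ℝ≥0∞ := fun x => ENNReal.ofReal (nearInv x) with hh
  have hfin : ∀ x, h x ≠ ⊤ := fun x => ENNReal.ofReal_ne_top
  set c₀ := ∫⁻ x, h x ^ (2 - a) with hc₀
  have hc₀' : c₀ < ⊤ := lintegral_nearInv_rpow_lt_top (by linarith) (by linarith)
  set S : R4 → ℝ≥0∞ := fun x => ∫⁻ w, h (x - w) ^ a * ‖φ w‖ₑ ^ 2 with hS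
  have hCS : ∀ x, (∫⁻ w, h (x - w) * ‖φ w‖ₑ) ^ (2 : ℝ) ≤ c₀ * S x := by
    intro x
    have hmx : Measurable fun w => h (x - w) := hm.comp (measurable_const.sub measurable_id)
    have hH := ENNReal.lintegral_mul_le_Lp_mul_Lq volume (p := 2) (q := 2)
      (Real.HolderConjugate.two_two) (f := fun w => h (x - w) ^ ((2 - a) / 2))
      (g := fun w => h (x - w) ^ (a / 2) * ‖φ w‖ₑ) (hmx.pow_const _).aemeasurable
      ((hmx.pow_const _).aemeasurable.mul hφ₁.1.enorm)
    have e1 : ∀ w, ((fun w => h (x - w) ^ ((2 - a) / 2)) *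
        fun w => h (x - w) ^ (a / 2) * ‖φ w‖ₑ) w = h (x - w) * ‖φ w‖ₑ := by
      intro w
      simp only [Pi.mul_apply]
      rw [← mul_assoc, ← ENNReal.rpow_add_of_nonneg _ _ (by linarith) (by linarith),
        show (2 - a) / 2 + a / 2 = 1 by ring, ENNReal.rpow_one]
    have e2 : ∀ w, (h (x - w) ^ ((2 - a) / 2)) ^ (2 : ℝ) = h (x - w) ^ (2 - a) := by
      intro w; rw [← ENNReal.rpow_mul]; congr 1; ring
    have e3 : ∀ w, (h (x - w) ^ (a / 2) * ‖φ w‖ₑ) ^ (2 : ℝ) = h (x - w) ^ a * ‖φ w‖ₑ ^ 2 := by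
      intro w
      rw [ENNReal.mul_rpow_of_nonneg _ _ (by norm_num), ← ENNReal.rpow_mul,
        show a / 2 * 2 = a by ring, ← ENNReal.rpow_natCast]
      norm_num
    simp only [e1, e2, e3] at hH
    rw [lintegral_sub_left_eq_self (fun w => h w ^ (2 - a)) x] at hH
    calc _ ≤ (c₀ ^ (1 / 2 : ℝ) * S x ^ (1 / 2 : ℝ)) ^ (2 : ℝ) := by gcongr
      _ = c₀ * S x := by
        rw [ENNReal.mul_rpow_of_nonneg _ _ (by norm_num), ← ENNReal.rpow_mul, ← ENNReal.rpow_mul]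
        norm_num
  have hSp : eLpNorm S (p / 2) volume < ⊤ := by
    have hp2' : 1 ≤ p / 2 := by
      rw [ENNReal.le_div_iff_mul_le (by simp) (by simp), one_mul]; exact hp2.le
    have hp2t : p / 2 ≠ ⊤ := ENNReal.div_ne_top hp' (by norm_num)
    simp only [hS]
    simp only [lintegral_lconvolution_comm (fun z => h z ^ a) (fun w => ‖φ w‖ₑ ^ 2)]
    refine (eLpNorm_lconvolution_le (a := fun w => ‖φ w‖ₑ ^ 2) (hφ₁.1.enorm.pow_const 2)
      (hm.pow_const a).aemeasurable hp2' hp2t).trans_lt ?_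
    refine ENNReal.mul_lt_top (lintegral_enorm_sq_lt_top hφ₂) ?_
    rw [eLpNorm_lt_top_iff_lintegral_rpow_enorm_lt_top (zero_lt_one.trans_le hp2').ne' hp2t]
    have e : ∀ x, ‖h x ^ a‖ₑ ^ (p / 2).toReal = h x := by
      intro x
      rw [enorm_eq_self, ENNReal.toReal_div, ENNReal.toReal_ofNat, ← hq, ← ENNReal.rpow_mul, ha,
        show 2 / q * (q / 2) = 1 by field_simp, ENNReal.rpow_one]
    simp only [e]
    exact h1
  rw [eLpNorm_lt_top_iff_lintegral_rpow_enorm_lt_top hp0 hp']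
  have hp2t : p / 2 ≠ ⊤ := ENNReal.div_ne_top hp' (by norm_num)
  have hp20 : p / 2 ≠ 0 := by simp [hp0]
  rw [eLpNorm_lt_top_iff_lintegral_rpow_enorm_lt_top hp20 hp2t] at hSp
  simp only [enorm_eq_self, ENNReal.toReal_div, ENNReal.toReal_ofNat, ← hq] at hSp ⊢
  calc _ ≤ ∫⁻ x, c₀ ^ (q / 2) * S x ^ (q / 2) := by
        refine lintegral_mono fun x => ?_
        rw [← ENNReal.mul_rpow_of_nonneg _ _ (by positivity)]
        calc (∫⁻ w, h (x - w) * ‖φ w‖ₑ) ^ q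
            = ((∫⁻ w, h (x - w) * ‖φ w‖ₑ) ^ (2 : ℝ)) ^ (q / 2) := by
              rw [← ENNReal.rpow_mul]; congr 1; ring
          _ ≤ _ := ENNReal.rpow_le_rpow (hCS x) (by positivity)
    _ = c₀ ^ (q / 2) * ∫⁻ x, S x ^ (q / 2) :=
        lintegral_const_mul' _ _ (ENNReal.rpow_ne_top_of_nonneg (by positivity) hc₀'.ne)
    _ < ⊤ := ENNReal.mul_lt_top (ENNReal.rpow_lt_top_of_nonneg (by positivity) hc₀'.ne) hSp

end Near

/-! ### `L^p` bound for a dyadic piece. -/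

section Piece

variable {p : ℝ≥0∞} {φ : R4 → ℂ}

/-- After rescaling, the singularity `|z|⁻²` is cut off at `|z| = 1/s` instead of `1`. On the
annulus `1 ≤ |z| < 1/s` one has `|z|⁻² = |z|^θ |z|^{-2-θ} ≤ s^{-θ}|z|^{-2-θ}`: a loss `s^{-θ}` buys
enough decay for the function to be in `L^p`. -/
theorem nearInv_smul_le {s θ : ℝ} (hs : 0 < s) (hθ : 0 ≤ θ) (z : R4) :
    s ^ 2 * nearInv (s • z) ≤ nearInv z + s ^ (-θ) * 2 ^ (2 + θ) * (1 + ‖z‖) ^ (-(2 + θ)) := by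
  have hr := norm_nonneg z
  have hpos : 0 ≤ s ^ (-θ) * 2 ^ (2 + θ) * (1 + ‖z‖) ^ (-(2 + θ)) := by positivity
  have hsz : ‖s • z‖ = s * ‖z‖ := by rw [norm_smul, Real.norm_of_nonneg hs.le]
  by_cases h1 : ‖s • z‖ < 1
  · have e : s ^ 2 * nearInv (s • z) = (‖z‖ ^ 2)⁻¹ := by
      rw [nearInv_of_lt h1, hsz, mul_pow, mul_inv, mul_inv_cancel_left₀ (by positivity)]
    rw [e]
    by_cases h2 : ‖z‖ < 1
    · rw [nearInv_of_lt h2]; linarith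
    · have h2' := not_lt.1 h2
      have hz : 0 < ‖z‖ := by linarith
      have h3 : (1 + ‖z‖) ^ (-(2 + θ)) * 2 ^ (2 + θ) ≥ ‖z‖ ^ (-(2 + θ)) := by
        rw [Real.rpow_neg (by positivity), Real.rpow_neg hz.le, ge_iff_le, inv_mul_eq_div,
          le_div_iff₀ (by positivity), inv_mul_le_iff₀ (by positivity),
          ← Real.mul_rpow hz.le (by norm_num)]
        exact Real.rpow_le_rpow (by positivity) (by linarith) (by positivity)
      have h4 : ‖z‖ ^ θ ≤ s ^ (-θ) := by
        rw [Real.rpow_neg hs.le, ← Real.inv_rpow hs.le]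
        refine Real.rpow_le_rpow hz.le ?_ hθ
        rw [le_inv_comm₀ hz hs, ← one_div, le_div_iff₀ hz, ← hsz]
        exact h1.le
      have h5 : (‖z‖ ^ 2)⁻¹ = ‖z‖ ^ θ * ‖z‖ ^ (-(2 + θ)) := by
        rw [← Real.rpow_add hz, ← Real.rpow_natCast, ← Real.rpow_neg hz.le]
        congr 1; push_cast; ring
      calc (‖z‖ ^ 2)⁻¹ = ‖z‖ ^ θ * ‖z‖ ^ (-(2 + θ)) := h5
        _ ≤ s ^ (-θ) * ((1 + ‖z‖) ^ (-(2 + θ)) * 2 ^ (2 + θ)) := by gcongr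
        _ = s ^ (-θ) * 2 ^ (2 + θ) * (1 + ‖z‖) ^ (-(2 + θ)) := by ring
        _ ≤ _ := by linarith [nearInv_nonneg z]
  · have : nearInv (s • z) = 0 := by
      rw [nearInv, indicator_of_notMem (by simpa using h1)]
    rw [this, mul_zero]
    linarith [nearInv_nonneg z]

/-- The bound for the radial kernel of the unit scale piece. -/
noncomputable def radialBound (r ρ : ℝ) : ℝ :=
  (r ^ 2)⁻¹ * √(1 + r) * (1 + ρ) ^ (-(3 / 2) : ℝ) * ((1 + |r - ρ|) ^ 3)⁻¹

theorem lintegral_radialBound_le {s θ : ℝ} (hs : 0 < s) (hθ : 0 ≤ θ) {G : R4 → ℝ≥0∞}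
    (hG : Measurable G) (z : R4) :
    ∫⁻ u : R4, ENNReal.ofReal (s ^ 4 * radialBound (s * ‖z‖) (s * ‖u‖)) * G u ≤
      4 * (∫⁻ u : R4, ENNReal.ofReal (s ^ 4 * farKer (s * ‖z‖) (s * ‖u‖)) * G u) +
      (16 * ENNReal.ofReal (s ^ 2) *
        ∫⁻ u : R4, ENNReal.ofReal ((1 + s * ‖u‖) ^ (-(9 / 2) : ℝ)) * G u) *
      (ENNReal.ofReal (nearInv z) + ENNReal.ofReal (s ^ (-θ) * 2 ^ (2 + θ)) *
        ENNReal.ofReal ((1 + ‖z‖) ^ (-(2 + θ)))) := by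
  have hsz : ∀ z : R4, ‖s • z‖ = s * ‖z‖ := fun z => by
    rw [norm_smul, Real.norm_of_nonneg hs.le]
  set X := nearInv z + s ^ (-θ) * 2 ^ (2 + θ) * (1 + ‖z‖) ^ (-(2 + θ)) with hX
  have hX0 : 0 ≤ X := by have := nearInv_nonneg z; positivity
  have e : ENNReal.ofReal (nearInv z) + ENNReal.ofReal (s ^ (-θ) * 2 ^ (2 + θ)) *
        ENNReal.ofReal ((1 + ‖z‖) ^ (-(2 + θ))) = ENNReal.ofReal X := by
    rw [← ENNReal.ofReal_mul (by positivity), ← ENNReal.ofReal_add (nearInv_nonneg z)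
      (by positivity)]
  have hpt : ∀ u : R4, ENNReal.ofReal (s ^ 4 * radialBound (s * ‖z‖) (s * ‖u‖)) * G u ≤
      4 * (ENNReal.ofReal (s ^ 4 * farKer (s * ‖z‖) (s * ‖u‖)) * G u) +
      (16 * ENNReal.ofReal (s ^ 2) * ENNReal.ofReal X) *
        (ENNReal.ofReal ((1 + s * ‖u‖) ^ (-(9 / 2) : ℝ)) * G u) := by
    intro u
    have h1 := radial_bound_le (s • z) (ρ := s * ‖u‖) (by positivity)
    rw [hsz] at h1
    have h2 := nearInv_smul_le hs hθ z
    have h0 := farKer_nonneg (r := s * ‖z‖) (ρ := s * ‖u‖) (by positivity) (by positivity)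
    have h3 : s ^ 4 * radialBound (s * ‖z‖) (s * ‖u‖) ≤
        4 * (s ^ 4 * farKer (s * ‖z‖) (s * ‖u‖)) +
          16 * s ^ 2 * X * (1 + s * ‖u‖) ^ (-(9 / 2) : ℝ) := by
      calc _ ≤ s ^ 4 * (4 * farKer (s * ‖z‖) (s * ‖u‖) +
            16 * (nearInv (s • z) * (1 + s * ‖u‖) ^ (-(9 / 2) : ℝ))) := by
            gcongr; exact h1
        _ = 4 * (s ^ 4 * farKer (s * ‖z‖) (s * ‖u‖)) +
            16 * s ^ 2 * (s ^ 2 * nearInv (s • z)) * (1 + s * ‖u‖) ^ (-(9 / 2) : ℝ) := by ring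
        _ ≤ _ := by gcongr
    calc _ ≤ ENNReal.ofReal (4 * (s ^ 4 * farKer (s * ‖z‖) (s * ‖u‖)) +
          16 * s ^ 2 * X * (1 + s * ‖u‖) ^ (-(9 / 2) : ℝ)) * G u := by
          gcongr
      _ = _ := by
          have e1 : ENNReal.ofReal (4 * (s ^ 4 * farKer (s * ‖z‖) (s * ‖u‖))) =
              4 * ENNReal.ofReal (s ^ 4 * farKer (s * ‖z‖) (s * ‖u‖)) := by
            rw [ENNReal.ofReal_mul (by norm_num), ENNReal.ofReal_ofNat]
          have e2 : ENNReal.ofReal (16 * s ^ 2 * X * (1 + s * ‖u‖) ^ (-(9 / 2) : ℝ)) =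
              16 * ENNReal.ofReal (s ^ 2) * ENNReal.ofReal X *
                ENNReal.ofReal ((1 + s * ‖u‖) ^ (-(9 / 2) : ℝ)) := by
            rw [ENNReal.ofReal_mul (by positivity), ENNReal.ofReal_mul (by positivity),
              ENNReal.ofReal_mul (by norm_num), ENNReal.ofReal_ofNat]
          rw [ENNReal.ofReal_add (by positivity) (by positivity), e1, e2]
          ring
  have hm1 : Measurable fun u : R4 =>
      ENNReal.ofReal (s ^ 4 * farKer (s * ‖z‖) (s * ‖u‖)) * G u := by
    refine (ENNReal.measurable_ofReal.comp (Measurable.const_mul ?_ _)).mul hG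
    exact measurable_farKer.comp (f := fun u : R4 => (s * ‖z‖, s * ‖u‖)) (by fun_prop)
  refine (lintegral_mono hpt).trans (le_of_eq ?_)
  rw [lintegral_add_left (hm1.const_mul 4), lintegral_const_mul' _ _ (by norm_num),
    lintegral_const_mul' _ _ (by finiteness), e]
  ring

/-- The far part is bounded uniformly in `s`. In the near part the kernel factorizes: the
`u`-integral gives `s^{4/p-4}‖G‖_p`, the kernel supplies `s²`, and the function of `x` is a
convolution of `|φ|` with the local singularity or with `(1+|z|)^{-2-θ}`, the latter in `L^p`
precisely because `(2+θ)p > 4`. Together with the loss `s^{-θ}` this is `s^{4/p-2-θ}`. -/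
theorem exists_eLpNorm_piece_le (hφ₁ : Integrable φ) (hφ₂ : MemLp φ 2 volume)
    (hp : 1 ≤ p) (hp' : p ≠ ⊤) {θ : ℝ} (hθ : 0 ≤ θ) (hθp : 4 < (2 + θ) * p.toReal) :
    ∃ C : ℝ≥0∞, C ≠ ⊤ ∧ ∀ s : ℝ, 0 < s → s ≤ 1 → ∀ G : R4 → ℝ≥0∞, AEMeasurable G →
      eLpNorm (fun x => ∫⁻ w, (∫⁻ u : R4, ENNReal.ofReal
        (s ^ 4 * radialBound (s * ‖x - w‖) (s * ‖u‖)) * G u) * ‖φ w‖ₑ) p volume ≤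
      C * (1 + ENNReal.ofReal (s ^ (4 / p.toReal - 2 - θ))) * eLpNorm G p volume := by
  obtain ⟨C₁, hC₁, hF⟩ := exists_eLpNorm_farKer_le
  obtain ⟨c, hc, hW⟩ := exists_lintegral_weight_le
  have hp0 : p ≠ 0 := (zero_lt_one.trans_le hp).ne'
  have hq0 : 0 < p.toReal := ENNReal.toReal_pos hp0 hp'
  set n₁ := ∫⁻ w, ‖φ w‖ₑ with hn₁
  have hn₁' : n₁ < ⊤ := hφ₁.2
  set N : R4 → ℝ≥0∞ := fun x => ∫⁻ w, ENNReal.ofReal (nearInv (x - w)) * ‖φ w‖ₑ with hN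
  have hNp : eLpNorm N p volume < ⊤ := eLpNorm_lconvolution_nearInv_lt_top hφ₁ hφ₂ hp hp'
  set far : R4 → ℝ≥0∞ := fun z => ENNReal.ofReal ((1 + ‖z‖) ^ (-(2 + θ))) with hfar
  have hfarm : Measurable far := by fun_prop
  have hfarp : eLpNorm far p volume < ⊤ := by
    rw [eLpNorm_lt_top_iff_lintegral_rpow_enorm_lt_top hp0 hp']
    have e : ∀ z, ‖far z‖ₑ ^ p.toReal =
        ENNReal.ofReal ((1 + ‖z‖) ^ (-((2 + θ) * p.toReal))) := by
      intro z
      rw [enorm_eq_self, hfar, ENNReal.ofReal_rpow_of_nonneg (by positivity) hq0.le,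
        ← Real.rpow_mul (by positivity), neg_mul]
    simp only [e]
    have hInt : Integrable fun u : R4 => (1 + ‖u‖) ^ (-((2 + θ) * p.toReal)) :=
      integrable_one_add_norm (by simpa using hθp)
    rw [← ofReal_integral_eq_lintegral_ofReal hInt (ae_of_all _ fun u => by positivity)]
    exact ENNReal.ofReal_lt_top
  set Fa : R4 → ℝ≥0∞ := fun x => ∫⁻ w, far (x - w) * ‖φ w‖ₑ with hFa
  have hFap : eLpNorm Fa p volume ≤ n₁ * eLpNorm far p volume := by
    simp only [hFa, lintegral_lconvolution_comm far]
    exact eLpNorm_lconvolution_le hφ₁.1.enorm hfarm.aemeasurable hp hp'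
  have hNm : AEMeasurable N := aemeasurable_lconvolution
    (ENNReal.measurable_ofReal.comp measurable_nearInv).aemeasurable hφ₁.1.enorm
  have hFam : AEMeasurable Fa := aemeasurable_lconvolution hfarm.aemeasurable hφ₁.1.enorm
  set A := 4 * n₁ * C₁ with hA
  set B := 16 * c * (eLpNorm N p volume +
    ENNReal.ofReal (2 ^ (2 + θ)) * (n₁ * eLpNorm far p volume)) with hB
  refine ⟨A + B, ?_, fun s hs hs1 G₀ hG₀ => ?_⟩
  · have := hn₁'.ne
    have := hNp.ne
    have := hfarp.ne
    rw [hA, hB]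
    finiteness
  obtain ⟨G, hG, hGG⟩ : ∃ G : R4 → ℝ≥0∞, Measurable G ∧ G₀ =ᵐ[volume] G :=
    ⟨hG₀.mk G₀, hG₀.measurable_mk, hG₀.ae_eq_mk⟩
  have hrepl : ∀ z : R4, (∫⁻ u : R4, ENNReal.ofReal
      (s ^ 4 * radialBound (s * ‖z‖) (s * ‖u‖)) * G₀ u) = ∫⁻ u : R4, ENNReal.ofReal
      (s ^ 4 * radialBound (s * ‖z‖) (s * ‖u‖)) * G u := by
    intro z
    refine lintegral_congr_ae ?_
    filter_upwards [hGG] with u hu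
    rw [hu]
  simp only [hrepl]
  rw [eLpNorm_congr_ae hGG]
  set g := eLpNorm G p volume with hg
  set e := ENNReal.ofReal (s ^ (4 / p.toReal - 2 - θ)) with he
  set H₁ : R4 → ℝ≥0∞ := fun z => ∫⁻ u : R4, ENNReal.ofReal
    (s ^ 4 * farKer (s * ‖z‖) (s * ‖u‖)) * G u with hH₁
  have hH₁m : Measurable H₁ := by
    refine Measurable.lintegral_prod_right' (f := fun q : R4 × R4 => ENNReal.ofReal
      (s ^ 4 * farKer (s * ‖q.1‖) (s * ‖q.2‖)) * G q.2) ?_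
    refine (ENNReal.measurable_ofReal.comp (Measurable.const_mul ?_ _)).mul
      (hG.comp measurable_snd)
    exact measurable_farKer.comp (f := fun q : R4 × R4 => (s * ‖q.1‖, s * ‖q.2‖)) (by fun_prop)
  set P : R4 → ℝ≥0∞ := fun x => ∫⁻ w, H₁ (x - w) * ‖φ w‖ₑ with hP
  have hPm : AEMeasurable P := aemeasurable_lconvolution hH₁m.aemeasurable hφ₁.1.enorm
  have hPp : eLpNorm P p volume ≤ n₁ * (C₁ * g) := by
    simp only [hP, lintegral_lconvolution_comm H₁]
    refine (eLpNorm_lconvolution_le hφ₁.1.enorm hH₁m.aemeasurable hp hp').trans ?_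
    gcongr
    exact hF p hp hp' s hs G hG.aemeasurable
  set D := ∫⁻ u : R4, ENNReal.ofReal ((1 + s * ‖u‖) ^ (-(9 / 2) : ℝ)) * G u with hD
  have hDb : D ≤ c * ENNReal.ofReal (s ^ (4 / p.toReal - 4)) * g := hW p hp hp' s hs G hG.aemeasurable
  set t := ENNReal.ofReal (s ^ (-θ) * 2 ^ (2 + θ)) with ht
  have hpt : ∀ x, (∫⁻ w, (∫⁻ u : R4, ENNReal.ofReal
      (s ^ 4 * radialBound (s * ‖x - w‖) (s * ‖u‖)) * G u) * ‖φ w‖ₑ) ≤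
      4 * P x + (16 * ENNReal.ofReal (s ^ 2) * D) * (N x + t * Fa x) := by
    intro x
    have hnx : AEMeasurable fun w => ENNReal.ofReal (nearInv (x - w)) * ‖φ w‖ₑ :=
      (ENNReal.measurable_ofReal.comp (measurable_nearInv.comp
        (measurable_const.sub measurable_id))).aemeasurable.mul hφ₁.1.enorm
    have hfx : AEMeasurable fun w => far (x - w) * ‖φ w‖ₑ :=
      (hfarm.comp (measurable_const.sub measurable_id)).aemeasurable.mul hφ₁.1.enorm
    have hhx : AEMeasurable fun w => H₁ (x - w) * ‖φ w‖ₑ :=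
      (hH₁m.comp (measurable_const.sub measurable_id)).aemeasurable.mul hφ₁.1.enorm
    have hsum : AEMeasurable fun w => ENNReal.ofReal (nearInv (x - w)) * ‖φ w‖ₑ +
        t * (far (x - w) * ‖φ w‖ₑ) := hnx.add (hfx.const_mul t)
    calc _ ≤ ∫⁻ w, (4 * (H₁ (x - w) * ‖φ w‖ₑ) + (16 * ENNReal.ofReal (s ^ 2) * D) *
          (ENNReal.ofReal (nearInv (x - w)) * ‖φ w‖ₑ + t * (far (x - w) * ‖φ w‖ₑ))) := by
          refine lintegral_mono fun w => ?_
          refine (mul_le_mul_left (lintegral_radialBound_le hs hθ hG (x - w)) _).trans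
            (le_of_eq ?_)
          simp only [hH₁, hfar, ← hD, ← ht]
          ring
      _ = _ := by
          rw [lintegral_add_left' (hhx.const_mul 4), lintegral_const_mul'' _ hhx,
            lintegral_const_mul'' _ hsum,
            lintegral_add_left' hnx, lintegral_const_mul'' _ hfx]
  have hs2 : ENNReal.ofReal (s ^ 2) * ENNReal.ofReal (s ^ (4 / p.toReal - 4)) =
      ENNReal.ofReal (s ^ (4 / p.toReal - 2)) := by
    rw [← ENNReal.ofReal_mul (by positivity), ← Real.rpow_natCast, ← Real.rpow_add hs]
    congr 2; push_cast; ring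
  have hle1 : ENNReal.ofReal (s ^ (4 / p.toReal - 2)) ≤ e :=
    ENNReal.ofReal_le_ofReal (Real.rpow_le_rpow_of_exponent_ge hs hs1 (by linarith))
  have hle2 : ENNReal.ofReal (s ^ (4 / p.toReal - 2)) * t = e * ENNReal.ofReal (2 ^ (2 + θ)) := by
    rw [ht, he, ENNReal.ofReal_mul (by positivity), ← mul_assoc,
      ← ENNReal.ofReal_mul (by positivity), ← Real.rpow_add hs]
    congr 3
  have hK2 : (16 * ENNReal.ofReal (s ^ 2) * D) * (eLpNorm N p volume + t * eLpNorm Fa p volume) ≤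
      B * e * g := by
    calc _ ≤ (16 * ENNReal.ofReal (s ^ 2) * (c * ENNReal.ofReal (s ^ (4 / p.toReal - 4)) * g)) *
          (eLpNorm N p volume + t * (n₁ * eLpNorm far p volume)) := by gcongr
      _ = 16 * c * g * (ENNReal.ofReal (s ^ 2) * ENNReal.ofReal (s ^ (4 / p.toReal - 4))) *
          (eLpNorm N p volume + t * (n₁ * eLpNorm far p volume)) := by ring
      _ = 16 * c * g * (ENNReal.ofReal (s ^ (4 / p.toReal - 2)) * eLpNorm N p volume +
          (ENNReal.ofReal (s ^ (4 / p.toReal - 2)) * t) * (n₁ * eLpNorm far p volume)) := by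
          rw [hs2]; ring
      _ ≤ 16 * c * g * (e * eLpNorm N p volume +
          (e * ENNReal.ofReal (2 ^ (2 + θ))) * (n₁ * eLpNorm far p volume)) := by
          rw [hle2]; gcongr
      _ = B * e * g := by rw [hB]; ring
  have hNF : AEMeasurable fun x => N x + t * Fa x := hNm.add (hFam.const_mul t)
  calc _ ≤ eLpNorm (fun x => 4 * P x + (16 * ENNReal.ofReal (s ^ 2) * D) * (N x + t * Fa x)) p
        volume := eLpNorm_mono_enorm fun x => by simpa using hpt x
    _ ≤ eLpNorm (fun x => 4 * P x) p volume +
        eLpNorm (fun x => (16 * ENNReal.ofReal (s ^ 2) * D) * (N x + t * Fa x)) p volume :=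
        eLpNorm_add_le (hPm.const_mul 4).aestronglyMeasurable
          (hNF.const_mul _).aestronglyMeasurable hp
    _ ≤ 4 * eLpNorm P p volume + (16 * ENNReal.ofReal (s ^ 2) * D) *
        eLpNorm (fun x => N x + t * Fa x) p volume := by
        gcongr
        · exact eLpNorm_le_mul_eLpNorm_of_ae_le_mul'' p hPm.aestronglyMeasurable
            (ae_of_all _ fun x => by simp)
        · exact eLpNorm_le_mul_eLpNorm_of_ae_le_mul'' p hNF.aestronglyMeasurable
            (ae_of_all _ fun x => by simp)
    _ ≤ 4 * (n₁ * (C₁ * g)) + (16 * ENNReal.ofReal (s ^ 2) * D) *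
        (eLpNorm N p volume + t * eLpNorm Fa p volume) := by
        gcongr
        refine (eLpNorm_add_le hNm.aestronglyMeasurable
          (hFam.const_mul t).aestronglyMeasurable hp).trans ?_
        gcongr
        exact eLpNorm_le_mul_eLpNorm_of_ae_le_mul'' p hFam.aestronglyMeasurable
          (ae_of_all _ fun x => by simp)
    _ ≤ A * g + B * e * g := add_le_add (le_of_eq (by rw [hA]; ring)) hK2
    _ ≤ (A + B) * (1 + e) * g := by
        have : (A + B) * (1 + e) * g = A * g + B * e * g + (B * g + A * e * g) := by ring
        rw [this]
        exact le_self_add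

end Piece

/-! ### The pairing of `φ` with the jump of the resolvent. -/

section Pairing

variable {φ f : R4 → ℂ}

/-- The pairing `⟨φ, (R₀⁺(l²) - R₀⁻(l²)) f⟩`. -/
noncomputable def pairing (φ f : R4 → ℂ) (l : ℝ) : ℂ :=
  ∫ x, (starRingEnd ℂ) (φ x) * conv (jumpKer l) f x

theorem continuous_conv_jumpKer (hf : Integrable f) (x : R4) :
    Continuous fun l => conv (jumpKer l) f x := by
  rw [continuous_iff_continuousAt]
  intro l₀
  have hJ := continuous_uncurry_jumpKer
  refine continuousAt_of_dominated (bound := fun y => (|l₀| + 1) ^ 2 * ‖f y‖) ?_ ?_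
    (hf.norm.const_mul _) ?_
  · exact Eventually.of_forall fun l => ((continuous_jumpKer l).comp
      (continuous_const.sub continuous_id)).aestronglyMeasurable.mul hf.1
  · have : ∀ᶠ l : ℝ in 𝓝 l₀, |l| < |l₀| + 1 :=
      (continuous_abs.tendsto l₀).eventually_lt_const (by linarith)
    filter_upwards [this] with l hl
    refine ae_of_all _ fun y => ?_
    rw [norm_mul]
    gcongr
    refine (norm_jumpKer_le l _).trans ?_
    rw [← sq_abs]
    gcongr
  · refine ae_of_all _ fun y => ?_
    have : Continuous fun l => jumpKer l (x - y) :=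
      hJ.comp (f := fun l => (l, x - y)) (by fun_prop)
    exact (this.mul continuous_const).continuousAt

theorem norm_pairing_le (hφ : Integrable φ) (hf : Integrable f) (l : ℝ) :
    ‖pairing φ f l‖ ≤ l ^ 2 * ((∫ x, ‖φ x‖) * ∫ x, ‖f x‖) := by
  have h := norm_integral_le_of_norm_le (f := fun x => (starRingEnd ℂ) (φ x) * conv (jumpKer l) f x)
    (hφ.norm.mul_const (l ^ 2 * ∫ y, ‖f y‖)) (ae_of_all _ fun x => by
      rw [norm_mul, RCLike.norm_conj]
      gcongr
      exact norm_conv_jumpKer_le hf l x)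
  refine h.trans (le_of_eq ?_)
  rw [integral_mul_const]
  ring

theorem continuous_pairing (hφ : Integrable φ) (hf : Integrable f) :
    Continuous (pairing φ f) := by
  rw [continuous_iff_continuousAt]
  intro l₀
  refine continuousAt_of_dominated
    (bound := fun x => ‖φ x‖ * ((|l₀| + 1) ^ 2 * ∫ y, ‖f y‖)) ?_ ?_ (hφ.norm.mul_const _) ?_
  · exact Eventually.of_forall fun l => (integrable_conj hφ).1.mul
      (aestronglyMeasurable_conv (continuous_jumpKer l).aestronglyMeasurable hf.1)
  · have : ∀ᶠ l : ℝ in 𝓝 l₀, |l| < |l₀| + 1 :=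
      (continuous_abs.tendsto l₀).eventually_lt_const (by linarith)
    filter_upwards [this] with l hl
    refine ae_of_all _ fun x => ?_
    rw [norm_mul, RCLike.norm_conj]
    gcongr
    refine (norm_conv_jumpKer_le hf l x).trans ?_
    rw [← sq_abs]
    have : 0 ≤ ∫ y, ‖f y‖ := integral_nonneg fun _ => norm_nonneg _
    gcongr
  · exact ae_of_all _ fun x =>
      (continuous_const.mul (continuous_conv_jumpKer hf x)).continuousAt

end Pairing

/-! ### The rank one contribution to `W_s`. -/

section SpectralIntegral

variable {φ f : R4 → ℂ} {χ : ℝ → ℝ} {B L : ℝ}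

/-- The integrand of `spectralIntegral`. -/
noncomputable def spectralIntegrand (χ : ℝ → ℝ) (φ f : R4 → ℂ) (l : ℝ) (x : R4) : ℂ :=
  ((χ l * l⁻¹ : ℝ) : ℂ) * pairing φ f l * conv (fun x => green (-Complex.I * l) ‖x‖) φ x

/-- The function `∫₀^∞ ⟨φ, (R₀⁺(l²) - R₀⁻(l²)) f⟩ R₀⁺(l²) φ χ(l) l⁻¹ dl`. -/
noncomputable def spectralIntegral (χ : ℝ → ℝ) (φ f : R4 → ℂ) (x : R4) : ℂ :=
  ∫ l in Ioi (0 : ℝ), spectralIntegrand χ φ f l x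

theorem aestronglyMeasurable_uncurry_conv_green (hφ : Integrable φ) :
    AEStronglyMeasurable (fun q : ℝ × R4 => conv (fun x => green (-Complex.I * q.1) ‖x‖) φ q.2)
      ((volume.restrict (Ioi 0)).prod volume) := by
  refine AEStronglyMeasurable.integral_prod_right' (f := fun q : (ℝ × R4) × R4 =>
    green (-Complex.I * q.1.1) ‖q.1.2 - q.2‖ * φ q.2) ?_
  refine AEStronglyMeasurable.mul ?_ hφ.1.comp_snd
  exact (Measurable.comp (g := fun q : ℂ × ℝ => green q.1 q.2)
    (f := fun q : (ℝ × R4) × R4 => (-Complex.I * q.1.1, ‖q.1.2 - q.2‖)) measurable_green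
    (by fun_prop)).aestronglyMeasurable

theorem aestronglyMeasurable_uncurry_spectralIntegrand (hφ : Integrable φ) (hf : Integrable f)
    (hχ : Continuous χ) :
    AEStronglyMeasurable (fun q : ℝ × R4 => spectralIntegrand χ φ f q.1 q.2)
      ((volume.restrict (Ioi 0)).prod volume) := by
  refine AEStronglyMeasurable.mul ?_ (aestronglyMeasurable_uncurry_conv_green hφ)
  have h : Measurable fun l : ℝ => ((χ l * l⁻¹ : ℝ) : ℂ) * pairing φ f l :=
    (Complex.measurable_ofReal.comp (hχ.measurable.mul measurable_inv)).mul
      (continuous_pairing hφ hf).measurable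
  exact (h.comp measurable_fst).aestronglyMeasurable

theorem aestronglyMeasurable_spectralIntegral (hφ : Integrable φ) (hf : Integrable f)
    (hχ : Continuous χ) : AEStronglyMeasurable (spectralIntegral χ φ f) volume :=
  AEStronglyMeasurable.integral_prod_right'
    (aestronglyMeasurable_uncurry_spectralIntegrand hφ hf hχ).prod_swap

/-- A bound for `spectralIntegrand` that is uniform in the energy. -/
noncomputable def spectralConst (φ f : R4 → ℂ) (B L : ℝ) : ℝ :=
  B * (L * ((∫ x, ‖φ x‖) * ∫ x, ‖f x‖)) * (hankelConst * √(2 * L) + 1)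

/-- The pairing is `O(l²)`, which beats the factor `l⁻¹`; hence the absolute convergence of the
integral at zero energy. -/
theorem norm_coef_mul_pairing_le (hφ : Integrable φ) (hf : Integrable f)
    (hB : ∀ l, |χ l| ≤ B) {l : ℝ} (hl : 0 < l) (hlL : l ≤ L) :
    ‖((χ l * l⁻¹ : ℝ) : ℂ) * pairing φ f l‖ ≤ B * (L * ((∫ x, ‖φ x‖) * ∫ x, ‖f x‖)) := by
  have hB0 : 0 ≤ B := (abs_nonneg _).trans (hB 0)
  set N := (∫ x, ‖φ x‖) * ∫ x, ‖f x‖ with hN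
  have hN0 : 0 ≤ N :=
    mul_nonneg (integral_nonneg fun _ => norm_nonneg _) (integral_nonneg fun _ => norm_nonneg _)
  rw [norm_mul, Complex.norm_real, Real.norm_eq_abs, abs_mul, abs_of_pos (inv_pos.2 hl)]
  calc |χ l| * l⁻¹ * ‖pairing φ f l‖ ≤ B * l⁻¹ * (l ^ 2 * N) := by
        gcongr
        · exact hB l
        · exact norm_pairing_le hφ hf l
    _ = B * (l * N) := by field_simp
    _ ≤ B * (L * N) := by gcongr

theorem norm_spectralIntegrand_le (hφ : Integrable φ) (hf : Integrable f)
    (hB : ∀ l, |χ l| ≤ B) (hL : ∀ l, L < l → χ l = 0) {x : R4}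
    (hx : Integrable fun y => nearInv (x - y) * ‖φ y‖) {l : ℝ} (hl : 0 < l) :
    ‖spectralIntegrand χ φ f l x‖ ≤
      (Ioc 0 L).indicator (fun _ => spectralConst φ f B L) l * greenMaj φ x := by
  by_cases hlL : l ≤ L
  · rw [indicator_of_mem (show l ∈ Ioc 0 L from ⟨hl, hlL⟩), spectralIntegrand, norm_mul,
      spectralConst, mul_assoc _ _ (greenMaj φ x)]
    have h2 := norm_conv_green_le hφ hx (k := -Complex.I * l) (by simp) (M := L)
      (by simpa [abs_of_pos hl] using hlL)
    exact mul_le_mul (norm_coef_mul_pairing_le hφ hf hB hl hlL) h2 (norm_nonneg _)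
      ((norm_nonneg _).trans (norm_coef_mul_pairing_le hφ hf hB hl hlL))
  · rw [spectralIntegrand, hL l (not_le.1 hlL), indicator_of_notMem (fun h => hlL h.2)]
    simp

theorem integrable_indicator_const (c : ℝ) :
    Integrable ((Ioc 0 L).indicator fun _ => c) (volume.restrict (Ioi 0)) :=
  ((integrable_indicator_iff measurableSet_Ioc).2
    (integrableOn_const (by simp))).restrict

theorem aestronglyMeasurable_spectralIntegrand (hφ : Integrable φ) (hf : Integrable f)
    (hχ : Continuous χ) {x : R4} (hx : Integrable fun y => nearInv (x - y) * ‖φ y‖) :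
    AEStronglyMeasurable (fun l => spectralIntegrand χ φ f l x) (volume.restrict (Ioi 0)) := by
  have h : Measurable fun l : ℝ => ((χ l * l⁻¹ : ℝ) : ℂ) * pairing φ f l :=
    (Complex.measurable_ofReal.comp (hχ.measurable.mul measurable_inv)).mul
      (continuous_pairing hφ hf).measurable
  have h2 : Continuous fun l : ℝ => conv (fun x => green (-Complex.I * l) ‖x‖) φ x := by
    rw [continuous_iff_continuousAt]
    intro l₀
    refine tendsto_conv_green hφ hx (κ := fun l : ℝ => -Complex.I * l) (fun l => by simp)
      (by simp) ?_
    exact (by fun_prop : Continuous fun l : ℝ => -Complex.I * (l : ℂ)).tendsto l₀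
  exact (h.mul h2.measurable).aestronglyMeasurable

theorem integrableOn_spectralIntegrand (hφ : Integrable φ) (hf : Integrable f)
    (hχ : Continuous χ) (hB : ∀ l, |χ l| ≤ B) (hL : ∀ l, L < l → χ l = 0) {x : R4}
    (hx : Integrable fun y => nearInv (x - y) * ‖φ y‖) :
    IntegrableOn (fun l => spectralIntegrand χ φ f l x) (Ioi 0) :=
  ((integrable_indicator_const _).mul_const _).mono'
    (aestronglyMeasurable_spectralIntegrand hφ hf hχ hx)
    ((ae_restrict_mem measurableSet_Ioi).mono fun _ hl =>
      norm_spectralIntegrand_le hφ hf hB hL hx hl)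

end SpectralIntegral

/-! ### A dyadic piece is dominated by the radial kernel. -/

section Annular

variable {φ f g : R4 → ℂ} {χ : ℝ → ℝ} {a L : ℝ}

theorem IsAnnularCutoff.comp_inv_mul (h : IsAnnularCutoff χ a L) {s : ℝ} (hs : 0 < s) :
    IsAnnularCutoff (fun l => χ (s⁻¹ * l)) (s * a) (s * L) where
  pos := mul_pos hs h.pos
  le := mul_le_mul_of_nonneg_left h.le hs.le
  contDiff := h.contDiff.comp (by fun_prop)
  eq_zero_of_abs_lt l hl := h.eq_zero_of_abs_lt _ <| by
    rw [abs_mul, abs_of_pos (inv_pos.2 hs), inv_mul_lt_iff₀ hs]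
    exact hl
  eq_zero_of_lt l hl := h.eq_zero_of_lt _ <| by
    rw [lt_inv_mul_iff₀ hs]
    exact hl

/-- Exchange the integrals so that the energy integral is done first. The absolute value is taken
only afterwards, which preserves the oscillation in `l` inside `radialKer`. -/
theorem enorm_spectralIntegral_le (h : IsAnnularCutoff χ a L) (hφ : Integrable φ)
    (hg : Integrable g) (hpair : ∀ l ∈ Icc a L, pairing φ f l = ∫ u, jumpKer l u * g u) {x : R4}
    (hx : Integrable fun y => nearInv (x - y) * ‖φ y‖) :
    ‖spectralIntegral χ φ f x‖ₑ ≤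
      ∫⁻ w, (∫⁻ u : R4, ‖radialKer χ ‖x - w‖ ‖u‖‖ₑ * ‖g u‖ₑ) * ‖φ w‖ₑ := by
  set c : ℝ → ℝ := fun l => χ l * l⁻¹ with hc
  have hcc : Continuous c := h.contDiff_mul_inv.continuous
  set F : ℝ → R4 × R4 → ℂ := fun l q => (c l : ℂ) *
    ((green (-Complex.I * l) ‖x - q.1‖ * φ q.1) * (jumpKer l q.2 * g q.2)) with hF
  have h1 : spectralIntegral χ φ f x = ∫ l in Ioi (0 : ℝ), ∫ q, F l q ∂(volume.prod volume) := by
    refine setIntegral_congr_fun measurableSet_Ioi fun l hl => ?_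
    simp only [hF, spectralIntegrand]
    rw [integral_const_mul, integral_prod_mul
      (fun w => green (-Complex.I * l) ‖x - w‖ * φ w) (fun u => jumpKer l u * g u)]
    by_cases hl' : l ∈ Icc a L
    · rw [hpair l hl', conv]
      ring
    · simp [hc, h.eq_zero_of_notMem hl hl']
  set K := hankelConst * √(2 * L) + 1 with hK
  have hK0 : 0 ≤ K := by have := hankelConst_nonneg; positivity
  have hL0 : 0 < L := h.pos.trans_le h.le
  have hc0 : ∀ l ∈ Ioi (0 : ℝ) \ Icc a L, c l = 0 := fun l hl => by
    simp [hc, h.eq_zero_of_notMem hl.1 hl.2]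
  have hcInt : IntegrableOn c (Ioi 0) :=
    (hcc.continuousOn.integrableOn_Icc (a := a) (b := L)).of_forall_sdiff_eq_zero
      measurableSet_Ioi hc0
  obtain ⟨hmaj, -⟩ := integral_greenMaj_integrand hφ hx
  have hF_int : Integrable (Function.uncurry F)
      ((volume.restrict (Ioi 0)).prod (volume.prod volume)) := by
    refine ((hcInt.norm.mul_prod (hmaj.mul_prod hg.norm)).const_mul (K * L ^ 2)).mono' ?_ ?_
    · have m1 : Measurable fun q : ℝ × (R4 × R4) => green (-Complex.I * q.1) ‖x - q.2.1‖ :=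
        Measurable.comp (g := fun q : ℂ × ℝ => green q.1 q.2)
          (f := fun q : ℝ × (R4 × R4) => (-Complex.I * q.1, ‖x - q.2.1‖)) measurable_green
          (by fun_prop)
      have m2 : Measurable fun q : ℝ × (R4 × R4) => jumpKer q.1 q.2.2 :=
        (continuous_uncurry_jumpKer.comp (f := fun q : ℝ × (R4 × R4) => (q.1, q.2.2))
          (by fun_prop)).measurable
      have m3 : Measurable fun q : ℝ × (R4 × R4) => (c q.1 : ℂ) :=
        Complex.measurable_ofReal.comp (hcc.measurable.comp measurable_fst)
      have m4 : AEStronglyMeasurable (fun q : ℝ × (R4 × R4) => φ q.2.1)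
          ((volume.restrict (Ioi 0)).prod (volume.prod volume)) :=
        (hφ.1.comp_fst (ν := (volume : Measure R4))).comp_snd
      have m5 : AEStronglyMeasurable (fun q : ℝ × (R4 × R4) => g q.2.2)
          ((volume.restrict (Ioi 0)).prod (volume.prod volume)) :=
        (hg.1.comp_snd (μ := (volume : Measure R4))).comp_snd
      exact m3.aestronglyMeasurable.mul
        ((m1.aestronglyMeasurable.mul m4).mul (m2.aestronglyMeasurable.mul m5))
    · have hmem : ∀ᵐ q : ℝ × (R4 × R4) ∂((volume.restrict (Ioi 0)).prod (volume.prod volume)),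
          q.1 ∈ Ioi (0 : ℝ) :=
        Measure.quasiMeasurePreserving_fst.ae (ae_restrict_mem measurableSet_Ioi)
      filter_upwards [hmem] with q hq
      have hq0 : 0 < q.1 := hq
      simp only [Function.uncurry, hF, norm_mul, Complex.norm_real]
      by_cases hl : q.1 ∈ Icc a L
      · have e1 := norm_green_le_nearInv (k := -Complex.I * q.1) (by simp) (M := L)
          (by simpa [abs_of_pos hq0] using hl.2) (x - q.2.1)
        have e2 : ‖jumpKer q.1 q.2.2‖ ≤ L ^ 2 :=
          (norm_jumpKer_le _ _).trans (by have := hl.2; gcongr)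
        have e3 := nearInv_nonneg (x - q.2.1)
        calc _ ≤ ‖c q.1‖ * (K * (nearInv (x - q.2.1) + 1) * ‖φ q.2.1‖ *
              (L ^ 2 * ‖g q.2.2‖)) := by gcongr
          _ = _ := by ring
      · simp [hc0 q.1 ⟨hq, hl⟩]
  have h2 : ∀ q, ∫ l in Ioi (0 : ℝ), F l q =
      radialKer χ ‖x - q.1‖ ‖q.2‖ * g q.2 * φ q.1 := by
    intro q
    rw [radialKer, ← integral_mul_const, ← integral_mul_const]
    refine integral_congr_ae (ae_of_all _ fun l => ?_)
    simp only [hF, jumpKer, hc]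
    ring
  rw [h1, integral_integral_swap hF_int]
  have h3 := hF_int.integral_prod_right
  simp only [Function.uncurry_apply_pair, h2] at h3 ⊢
  rw [integral_prod _ h3]
  refine (enorm_integral_le_lintegral_enorm _).trans (lintegral_mono fun w => ?_)
  dsimp only
  rw [integral_mul_const, enorm_mul]
  gcongr
  refine (enorm_integral_le_lintegral_enorm _).trans (le_of_eq (lintegral_congr fun u => ?_))
  rw [enorm_mul]

end Annular

/-! ### A dyadic piece at scale `s`. -/

section Scale

variable {φ : R4 → ℂ} {χ : ℝ → ℝ} {a L : ℝ} {p : ℝ≥0∞}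

/-- The low-pass kernel replaces `f` by `g = correl φ η_s * f`, gaining `sᵐ` in `L^p`, and the
rescaled radial kernel then acts on `g`. The exponent `m` is the order to which `φ` cancels. -/
theorem exists_eLpNorm_spectralIntegral_scale_le (h : IsAnnularCutoff χ a L) (hφ₁ : Integrable φ)
    (hφ₂ : MemLp φ 2 volume) {m : ℕ}
    (hcor : ∀ η : 𝓢(R4, ℂ), ∃ K : ℝ≥0∞, K ≠ ⊤ ∧ ∀ s : ℝ, 0 < s →
      ∫⁻ v, ‖correl φ (dilate s η) v‖ₑ ≤ ENNReal.ofReal (s ^ m) * K)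
    (hp : 1 ≤ p) (hp' : p ≠ ⊤) {θ : ℝ} (hθ : 0 ≤ θ) (hθp : 4 < (2 + θ) * p.toReal) :
    ∃ C : ℝ≥0∞, C ≠ ⊤ ∧ ∀ s : ℝ, 0 < s → s ≤ 1 → ∀ f : R4 → ℂ, Integrable f →
      eLpNorm (spectralIntegral (fun l => χ (s⁻¹ * l)) φ f) p volume ≤
        C * (ENNReal.ofReal (s ^ m) * (1 + ENNReal.ofReal (s ^ (4 / p.toReal - 2 - θ)))) *
          eLpNorm f p volume := by
  obtain ⟨η, hη⟩ := exists_lowPass (L + 1)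
  obtain ⟨K, hK, hcorK⟩ := hcor η
  obtain ⟨C₀, hC₀, hker⟩ := exists_norm_radialKer_le h
  obtain ⟨C₁, hC₁, hpiece⟩ := exists_eLpNorm_piece_le hφ₁ hφ₂ hp hp' hθ hθp
  refine ⟨C₁ * ENNReal.ofReal C₀ * K, by finiteness, fun s hs hs1 f hf => ?_⟩
  have hηi : Integrable (dilate s η) := integrable_dilate η.integrable hs
  have hcor_int := integrable_correl hφ₁ hηi
  set g := conv (correl φ (dilate s η)) f with hg
  have hgi : Integrable g := integrable_conv hcor_int hf
  have hs' := h.comp_inv_mul hs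
  have hpair : ∀ l ∈ Icc (s * a) (s * L), pairing φ f l = ∫ u, jumpKer l u * g u := by
    intro l hl
    exact integral_conj_mul_conv_jumpKer hφ₁ hf hηi
      (conv_jumpKer_dilate hη hs ((mul_pos hs h.pos).trans_le hl.1) hl.2)
  have hk : ∀ r ρ : ℝ, 0 ≤ r → 0 ≤ ρ → ‖radialKer (fun l => χ (s⁻¹ * l)) r ρ‖ₑ ≤
      ENNReal.ofReal (s ^ 4 * radialBound (s * r) (s * ρ)) * ENNReal.ofReal C₀ := by
    intro r ρ hr hρ
    have h1 := hker (s * r) (s * ρ) (by positivity) (by positivity)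
    rw [radialKer_comp_mul χ (inv_pos.2 hs), inv_inv, ← ENNReal.ofReal_mul' hC₀,
      ← ofReal_norm, norm_mul, Complex.norm_real, Real.norm_of_nonneg (by positivity)]
    refine ENNReal.ofReal_le_ofReal ?_
    rw [mul_assoc, mul_comm (radialBound _ _)]
    gcongr
    exact h1
  have hGm : AEMeasurable fun u => ENNReal.ofReal C₀ * ‖g u‖ₑ := hgi.1.enorm.const_mul _
  have hgn : eLpNorm g p volume ≤ ENNReal.ofReal (s ^ m) * K * eLpNorm f p volume :=
    (eLpNorm_conv_le hcor_int.1 hf.1 hp hp').trans (mul_le_mul_left (hcorK s hs) _)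
  calc _ ≤ eLpNorm (fun x => ∫⁻ w, (∫⁻ u : R4, ENNReal.ofReal
        (s ^ 4 * radialBound (s * ‖x - w‖) (s * ‖u‖)) * (ENNReal.ofReal C₀ * ‖g u‖ₑ)) *
          ‖φ w‖ₑ) p volume := by
        refine eLpNorm_mono_enorm_ae ?_
        filter_upwards [ae_integrable_nearInv hφ₁] with x hx
        rw [enorm_eq_self]
        refine (enorm_spectralIntegral_le hs' hφ₁ hgi hpair hx).trans ?_
        refine lintegral_mono fun w => mul_le_mul_left (lintegral_mono fun u => ?_) _
        rw [← mul_assoc]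
        exact mul_le_mul_left (hk _ _ (norm_nonneg _) (norm_nonneg _)) _
    _ ≤ C₁ * (1 + ENNReal.ofReal (s ^ (4 / p.toReal - 2 - θ))) *
        eLpNorm (fun u => ENNReal.ofReal C₀ * ‖g u‖ₑ) p volume := hpiece s hs hs1 _ hGm
    _ ≤ C₁ * (1 + ENNReal.ofReal (s ^ (4 / p.toReal - 2 - θ))) *
        (ENNReal.ofReal C₀ * (ENNReal.ofReal (s ^ m) * K * eLpNorm f p volume)) := by
        gcongr
        refine (eLpNorm_le_mul_eLpNorm_of_ae_le_mul'' (c := ENNReal.ofReal C₀) p hgi.1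
          (ae_of_all _ fun x => by simp)).trans ?_
        gcongr
    _ = _ := by ring

end Scale

/-! ### Summing the dyadic pieces. -/

section LowEnergy

variable {φ : R4 → ℂ} {Φ : ℝ → ℝ} {p : ℝ≥0∞}

theorem IsLowEnergyCutoff.exists_eq_zero (hΦ : IsLowEnergyCutoff Φ) :
    ∃ R, 0 < R ∧ ∀ l, R < |l| → Φ l = 0 := by
  obtain ⟨R, hR⟩ := hΦ.2.1.isCompact.isBounded.subset_closedBall (0 : ℝ)
  refine ⟨|R| + 1, by positivity, fun l hl => image_eq_zero_of_notMem_tsupport fun hl' => ?_⟩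
  have h1 := hR hl'
  rw [mem_closedBall_zero_iff, Real.norm_eq_abs] at h1
  linarith [le_abs_self R]

theorem IsLowEnergyCutoff.exists_bound (hΦ : IsLowEnergyCutoff Φ) : ∃ B, ∀ l, |Φ l| ≤ B :=
  hΦ.2.1.exists_bound_of_continuous hΦ.1.continuous

/-- Near `0` both terms are `1` and cancel. -/
theorem IsLowEnergyCutoff.exists_isAnnularCutoff (hΦ : IsLowEnergyCutoff Φ) :
    ∃ a L, IsAnnularCutoff (fun l => Φ l - Φ (2 * l)) a L := by
  obtain ⟨R, hR0, hR⟩ := hΦ.exists_eq_zero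
  obtain ⟨ε, hε, h1⟩ := Metric.eventually_nhds_iff.1 hΦ.2.2
  have h1' : ∀ l : ℝ, |l| < ε → Φ l = 1 := fun l hl => h1 (by simpa using hl)
  refine ⟨ε / 2, max R (ε / 2), ⟨by positivity, le_max_right _ _, ?_, fun l hl => ?_,
    fun l hl => ?_⟩⟩
  · exact hΦ.1.sub (hΦ.1.comp (by fun_prop))
  · rw [h1' l (by linarith), h1' (2 * l) (by rw [abs_mul, abs_two]; linarith), sub_self]
  · have hl' : R < l := (le_max_left _ _).trans_lt hl
    rw [hR l (hl'.trans_le (le_abs_self l)), hR (2 * l), sub_self]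
    exact lt_of_lt_of_le (by linarith) (le_abs_self _)

theorem sum_dyadic (Φ : ℝ → ℝ) (N : ℕ) (l : ℝ) :
    ∑ j ∈ Finset.range N, (Φ (((1 / 2 : ℝ) ^ j)⁻¹ * l) - Φ (2 * (((1 / 2 : ℝ) ^ j)⁻¹ * l))) =
      Φ l - Φ (2 ^ N * l) := by
  induction N with
  | zero => simp
  | succ n ih =>
    rw [Finset.sum_range_succ, ih, pow_succ, one_div, inv_pow, inv_inv, ← mul_assoc 2,
      mul_comm 2 ((2 : ℝ) ^ n)]
    ring

/-- Two geometric series, with ratios `2^{-m}` and `2^{-(m+e)}`. -/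
theorem tsum_scale_ne_top {m : ℕ} (hm : 0 < m) {e : ℝ} (he : 0 < m + e) :
    ∑' j : ℕ, ENNReal.ofReal (((1 / 2 : ℝ) ^ j) ^ m) *
      (1 + ENNReal.ofReal (((1 / 2 : ℝ) ^ j) ^ e)) ≠ ⊤ := by
  have h1 : ∀ j : ℕ, ENNReal.ofReal (((1 / 2 : ℝ) ^ j) ^ m) *
      (1 + ENNReal.ofReal (((1 / 2 : ℝ) ^ j) ^ e)) =
      ENNReal.ofReal ((1 / 2 : ℝ) ^ m) ^ j + ENNReal.ofReal ((1 / 2 : ℝ) ^ (m + e)) ^ j := by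
    intro j
    rw [mul_add, mul_one, ← ENNReal.ofReal_mul (by positivity), ← ENNReal.ofReal_pow (by positivity),
      ← ENNReal.ofReal_pow (by positivity), pow_right_comm, Real.rpow_add (by norm_num), mul_pow,
      Real.rpow_natCast, Real.rpow_pow_comm (by norm_num)]
  simp only [h1]
  rw [ENNReal.tsum_add, ENNReal.tsum_geometric, ENNReal.tsum_geometric]
  have h2 : ENNReal.ofReal ((1 / 2 : ℝ) ^ m) < 1 := by
    rw [ENNReal.ofReal_lt_one]
    exact pow_lt_one₀ (by norm_num) (by norm_num) hm.ne'
  have h3 : ENNReal.ofReal ((1 / 2 : ℝ) ^ (m + e)) < 1 := by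
    rw [ENNReal.ofReal_lt_one]
    exact Real.rpow_lt_one (by norm_num) (by norm_num) he
  refine ENNReal.add_ne_top.2 ⟨?_, ?_⟩
  · rw [ENNReal.inv_ne_top]
    exact (tsub_pos_of_lt h2).ne'
  · rw [ENNReal.inv_ne_top]
    exact (tsub_pos_of_lt h3).ne'

/-- For each `l > 0` the subtracted term `Φ(2^N l)` is eventually zero, and the bound on the
integrand is uniform in `N`. -/
theorem tendsto_spectralIntegral (hΦ : IsLowEnergyCutoff Φ) (hφ : Integrable φ) {f : R4 → ℂ}
    (hf : Integrable f) {x : R4} (hx : Integrable fun y => nearInv (x - y) * ‖φ y‖) :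
    Tendsto (fun N : ℕ => spectralIntegral (fun l => Φ l - Φ (2 ^ N * l)) φ f x) atTop
      (𝓝 (spectralIntegral Φ φ f x)) := by
  obtain ⟨R, hR0, hR⟩ := hΦ.exists_eq_zero
  obtain ⟨B, hB⟩ := hΦ.exists_bound
  have hc := hΦ.1.continuous
  refine tendsto_integral_of_dominated_convergence
    (fun l => (Ioc 0 R).indicator (fun _ => spectralConst φ f (B + B) R) l * greenMaj φ x)
    (fun N => aestronglyMeasurable_spectralIntegrand hφ hf (by fun_prop) hx)
    ((integrable_indicator_const _).mul_const _) (fun N => ?_) ?_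
  · filter_upwards [ae_restrict_mem measurableSet_Ioi] with l hl
    refine norm_spectralIntegrand_le hφ hf
      (fun l => (abs_sub _ _).trans (add_le_add (hB _) (hB _))) (fun l hl => ?_) hx hl
    have hl0 : 0 < l := hR0.trans hl
    rw [hR l (hl.trans_le (le_abs_self l)), hR (2 ^ N * l), sub_self]
    rw [abs_of_pos (by positivity)]
    have : (1 : ℝ) ≤ 2 ^ N := one_le_pow₀ (by norm_num)
    nlinarith
  · filter_upwards [ae_restrict_mem measurableSet_Ioi] with l hl
    have hl0 : 0 < l := hl
    have h1 : Tendsto (fun N : ℕ => (2 : ℝ) ^ N * l) atTop atTop :=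
      (tendsto_pow_atTop_atTop_of_one_lt (by norm_num)).atTop_mul_const hl0
    refine tendsto_const_nhds.congr' ?_
    filter_upwards [h1.eventually_gt_atTop R] with N hN
    simp only [spectralIntegrand]
    rw [hR (2 ^ N * l) (hN.trans_le (le_abs_self _)), sub_zero]

theorem spectralIntegral_dyadic_sum (hΦ : IsLowEnergyCutoff Φ) (hφ : Integrable φ) {f : R4 → ℂ}
    (hf : Integrable f) {x : R4} (hx : Integrable fun y => nearInv (x - y) * ‖φ y‖) (N : ℕ) :
    spectralIntegral (fun l => Φ l - Φ (2 ^ N * l)) φ f x =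
      ∑ j ∈ Finset.range N, spectralIntegral (fun l => Φ (((1 / 2 : ℝ) ^ j)⁻¹ * l) -
        Φ (2 * (((1 / 2 : ℝ) ^ j)⁻¹ * l))) φ f x := by
  obtain ⟨R, hR0, hR⟩ := hΦ.exists_eq_zero
  obtain ⟨B, hB⟩ := hΦ.exists_bound
  have hc := hΦ.1.continuous
  simp only [spectralIntegral]
  rw [← integral_finsetSum]
  · refine integral_congr_ae (ae_of_all _ fun l => ?_)
    simp only [spectralIntegrand]
    rw [← Finset.sum_mul, ← Finset.sum_mul, ← sum_dyadic, Finset.sum_mul]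
    push_cast
    rfl
  · intro j _
    refine integrableOn_spectralIntegrand hφ hf (by fun_prop) (B := B + B) (L := R)
      (fun l => (abs_sub _ _).trans (add_le_add (hB _) (hB _))) (fun l hl => ?_) hx
    have hl0 : 0 < l := hR0.trans hl
    have h1 : (1 : ℝ) ≤ ((1 / 2 : ℝ) ^ j)⁻¹ :=
      (one_le_inv₀ (by positivity)).2 (pow_le_one₀ (by norm_num) (by norm_num))
    rw [hR _ _, hR _ _, sub_self]
    all_goals
      rw [abs_of_pos (by positivity)]
      nlinarith

/-- The bounds `sᵐ(1 + s^{4/p-2-θ})` are summed over `s = 2⁻ʲ`. The parameter `θ` must exceed `4/p -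
2` for membership in `L^p` and stay below `m + 4/p - 2` for convergence; with `θ ≥ 0` the latter is
possible exactly when `m + 4/p > 2`. -/
theorem exists_eLpNorm_spectralIntegral_le (hΦ : IsLowEnergyCutoff Φ) (hφ₁ : Integrable φ)
    (hφ₂ : MemLp φ 2 volume) {m : ℕ} (hm : 0 < m)
    (hcor : ∀ η : 𝓢(R4, ℂ), ∃ K : ℝ≥0∞, K ≠ ⊤ ∧ ∀ s : ℝ, 0 < s →
      ∫⁻ v, ‖correl φ (dilate s η) v‖ₑ ≤ ENNReal.ofReal (s ^ m) * K)
    (hp : 1 ≤ p) (hp' : p ≠ ⊤) (hmp : 2 < m + 4 / p.toReal) :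
    ∃ C : ℝ≥0∞, C ≠ ⊤ ∧ ∀ f : R4 → ℂ, Integrable f →
      eLpNorm (spectralIntegral Φ φ f) p volume ≤ C * eLpNorm f p volume := by
  have hp1 : 1 ≤ p.toReal := (ENNReal.toReal_mono hp' hp).trans' (by simp)
  obtain ⟨θ, hθ, hθp, he⟩ : ∃ θ : ℝ, 0 ≤ θ ∧ 4 < (2 + θ) * p.toReal ∧
      0 < m + (4 / p.toReal - 2 - θ) := by
    have hm1 : (1 : ℝ) ≤ m := by exact_mod_cast hm
    -- A value `1/2` above the lower limit `4/p - 2`: if it is positive the exponent to be summed is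
    -- `m - 1/2 > 0`, otherwise `θ = 0` and the hypothesis `2 < m + 4/p` is what is needed.
    refine ⟨max 0 (4 / p.toReal - 3 / 2), le_max_left _ _, ?_, ?_⟩
    · have h1 : 4 / p.toReal < 2 + max 0 (4 / p.toReal - 3 / 2) := by
        have := le_max_right 0 (4 / p.toReal - 3 / 2)
        linarith
      rwa [div_lt_iff₀ (by linarith)] at h1
    · rcases max_cases 0 (4 / p.toReal - 3 / 2) with ⟨h1, h2⟩ | ⟨h1, h2⟩ <;> rw [h1] <;> linarith
  obtain ⟨a, L, hχ⟩ := hΦ.exists_isAnnularCutoff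
  obtain ⟨C, hC, hb⟩ := exists_eLpNorm_spectralIntegral_scale_le hχ hφ₁ hφ₂ hcor hp hp' hθ hθp
  have hc := hΦ.1.continuous
  refine ⟨C * _, ENNReal.mul_ne_top hC (tsum_scale_ne_top hm he), fun f hf => ?_⟩
  -- Fatou: the partial sums converge only almost everywhere, and each obeys the bound by the total
  -- of the series.
  refine (Lp.eLpNorm_lim_le_liminf_eLpNorm
    (fun N => aestronglyMeasurable_spectralIntegral hφ₁ hf
      (by fun_prop : Continuous fun l => Φ l - Φ (2 ^ N * l))) _
    ((ae_integrable_nearInv hφ₁).mono fun x hx => tendsto_spectralIntegral hΦ hφ₁ hf hx)).trans ?_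
  refine liminf_le_of_le (by isBoundedDefault) fun b hb' => ?_
  obtain ⟨N, hN⟩ := hb'.exists
  refine hN.trans ?_
  have e : spectralIntegral (fun l => Φ l - Φ (2 ^ N * l)) φ f =ᵐ[volume]
      ∑ j ∈ Finset.range N, spectralIntegral (fun l => Φ (((1 / 2 : ℝ) ^ j)⁻¹ * l) -
        Φ (2 * (((1 / 2 : ℝ) ^ j)⁻¹ * l))) φ f := by
    filter_upwards [ae_integrable_nearInv hφ₁] with x hx
    rw [spectralIntegral_dyadic_sum hΦ hφ₁ hf hx, Finset.sum_apply]
  rw [eLpNorm_congr_ae e]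
  refine (eLpNorm_sum_le (fun j _ => aestronglyMeasurable_spectralIntegral hφ₁ hf
    (by fun_prop)) hp).trans ?_
  calc _ ≤ ∑ j ∈ Finset.range N, C * (ENNReal.ofReal (((1 / 2 : ℝ) ^ j) ^ m) *
        (1 + ENNReal.ofReal (((1 / 2 : ℝ) ^ j) ^ (4 / p.toReal - 2 - θ)))) *
          eLpNorm f p volume := Finset.sum_le_sum fun j _ =>
        hb ((1 / 2 : ℝ) ^ j) (by positivity) (pow_le_one₀ (by norm_num) (by norm_num)) f hf
    _ ≤ _ := by
        rw [← Finset.sum_mul, ← Finset.mul_sum]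
        gcongr
        exact ENNReal.sum_le_tsum _

end LowEnergy

/-! ### The cancellation order of `Vψ`. -/

section Cancellation

variable {V : R4 → ℝ} {δ C : ℝ}

theorem lintegral_enorm_potMul_mul_enorm_pow_lt_top (hV : Measurable V)
    (hd : ∀ z, |V z| ≤ C * bracket z ^ (-δ)) {m : ℕ} (hm : (m : ℝ) + 2 < δ) (ψ : L2) :
    ∫⁻ x, ‖potMul V ψ x‖ₑ * ‖x‖ₑ ^ m < ⊤ := by
  have h := (integrable_norm_pow_mul_norm_potMul hV hd hm ψ).2
  refine lt_of_eq_of_lt (lintegral_congr fun x => ?_) h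
  rw [enorm_mul, enorm_pow, enorm_norm, enorm_norm, mul_comm]

/-- First order gain: mean zero together with a finite first absolute moment. -/
theorem exists_lintegral_correl_potMul_le (hV : Measurable V)
    (hd : ∀ z, |V z| ≤ C * bracket z ^ (-δ)) (hδ : 3 < δ) {ψ : L2} (hψ : ψ ∈ zeroEigenspace V)
    (η : 𝓢(R4, ℂ)) : ∃ K : ℝ≥0∞, K ≠ ⊤ ∧ ∀ s : ℝ, 0 < s →
      ∫⁻ v, ‖correl (potMul V ψ) (dilate s η) v‖ₑ ≤ ENNReal.ofReal (s ^ 1) * K := by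
  have h1 := lintegral_enorm_potMul_mul_enorm_pow_lt_top hV hd (m := 1)
    (by push_cast; linarith) ψ
  simp only [pow_one] at h1 ⊢
  exact ⟨_, ENNReal.mul_ne_top h1.ne (lintegral_enorm_fderiv_lt_top η).ne, fun s hs =>
    lintegral_enorm_correl_dilate_le (integrable_potMul hV hd (by linarith) ψ)
      (integral_potMul_eq_zero hV hd (by linarith) hψ) η hs⟩

/-- A real linear functional on `ℝ⁴` is a combination of coordinates, and since `V` and `x_j` are
real the moments of the conjugate are conjugates of the moments assumed to vanish. -/
theorem integral_conj_potMul_mul_eq_zero (hV : Measurable V)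
    (hd : ∀ z, |V z| ≤ C * bracket z ^ (-δ)) (hδ : 3 < δ) (hmom : FirstMomentsVanish V) {ψ : L2}
    (hψ : ψ ∈ zeroEigenspace V) (A : R4 →L[ℝ] ℂ) :
    Integrable (fun x => (starRingEnd ℂ) (potMul V ψ x) * A x) ∧
      ∫ x, (starRingEnd ℂ) (potMul V ψ x) * A x = 0 := by
  have hInt := integrable_norm_pow_mul_norm_potMul hV hd (m := 1) (by push_cast; linarith) ψ
  have hm := aestronglyMeasurable_potMul hV ψ
  have hcm := Complex.continuous_conj.comp_aestronglyMeasurable hm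
  have hj : ∀ j : Fin 4, Integrable fun x : R4 => (starRingEnd ℂ) (potMul V ψ x) * (x j : ℂ) := by
    intro j
    refine hInt.mono' (hcm.mul
      (by fun_prop : Continuous fun x : R4 => ((x j : ℝ) : ℂ)).aestronglyMeasurable)
      (ae_of_all _ fun x => ?_)
    rw [norm_mul, RCLike.norm_conj, Complex.norm_real, pow_one, mul_comm]
    gcongr
    exact PiLp.norm_apply_le x j
  have h0 : ∀ j : Fin 4, ∫ x : R4, (starRingEnd ℂ) (potMul V ψ x) * (x j : ℂ) = 0 := by
    intro j
    have h := congrArg (starRingEnd ℂ) (hmom ψ hψ j)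
    rw [← integral_conj, map_zero] at h
    rw [← h]
    refine integral_congr_ae (ae_of_all _ fun x => ?_)
    simp only [potMul, map_mul, Complex.conj_ofReal, Complex.ofReal_mul]
    ring
  have hA : ∀ x : R4, (starRingEnd ℂ) (potMul V ψ x) * A x =
      ∑ j : Fin 4, (starRingEnd ℂ) (potMul V ψ x) * (x j : ℂ) *
        A (EuclideanSpace.basisFun (Fin 4) ℝ j) := by
    intro x
    have e : A x = ∑ j : Fin 4, (x j : ℂ) * A (EuclideanSpace.basisFun (Fin 4) ℝ j) := by
      conv_lhs => rw [← (EuclideanSpace.basisFun (Fin 4) ℝ).sum_repr x]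
      simp [map_sum]
    rw [e, Finset.mul_sum]
    exact Finset.sum_congr rfl fun j _ => by ring
  simp only [hA]
  refine ⟨integrable_finsetSum _ fun j _ => (hj j).mul_const _, ?_⟩
  rw [integral_finsetSum _ fun j _ => (hj j).mul_const _]
  refine Finset.sum_eq_zero fun j _ => ?_
  rw [integral_mul_const, h0 j, zero_mul]

theorem exists_lintegral_correl_potMul_le_sq (hV : Measurable V)
    (hd : ∀ z, |V z| ≤ C * bracket z ^ (-δ)) (hδ : 4 < δ) (hmom : FirstMomentsVanish V) {ψ : L2}
    (hψ : ψ ∈ zeroEigenspace V)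
    (η : 𝓢(R4, ℂ)) : ∃ K : ℝ≥0∞, K ≠ ⊤ ∧ ∀ s : ℝ, 0 < s →
      ∫⁻ v, ‖correl (potMul V ψ) (dilate s η) v‖ₑ ≤ ENNReal.ofReal (s ^ 2) * K := by
  have h1 := lintegral_enorm_potMul_mul_enorm_pow_lt_top hV hd (m := 2)
    (by push_cast; linarith) ψ
  exact ⟨_, ENNReal.mul_ne_top h1.ne (lintegral_enorm_fderiv_fderiv_lt_top η).ne, fun s hs =>
    lintegral_enorm_correl_dilate_le_sq (integrable_potMul hV hd (by linarith) ψ)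
      (integral_potMul_eq_zero hV hd (by linarith) hψ)
      (integral_conj_potMul_mul_eq_zero hV hd (by linarith) hmom hψ) η hs⟩

end Cancellation

/-! ### The integrand of `W_s` in rank one terms. -/

section Integrand

variable {V : R4 → ℝ} {δ C : ℝ}

theorem bracket_pow_mul_invWeight (x : R4) :
    ((bracket x ^ wt : ℝ) : ℂ) * (invWeight x : ℂ) = 1 := by
  rw [invWeight, ← Complex.ofReal_mul, mul_inv_cancel₀ (pow_pos (bracket_pos x) _).ne',
    Complex.ofReal_one]

theorem weightedPotential_ae (hV : Measurable V) (hd : ∀ z, |V z| ≤ C * bracket z ^ (-δ))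
    (hδ : 3 ≤ δ) (u : L2) :
    weightedPotential V u =ᵐ[volume] fun x => ((bracket x ^ wt * V x : ℝ) : ℂ) * u x :=
  mulOp_ae (memLp_top_weightedPotential hV hd hδ) u

theorem unweight_weightedPotential_ae (hV : Measurable V)
    (hd : ∀ z, |V z| ≤ C * bracket z ^ (-δ)) (hδ : 3 ≤ δ) (u : L2) :
    unweight (weightedPotential V u) =ᵐ[volume] potMul V u := by
  filter_upwards [weightedPotential_ae hV hd hδ u] with x hx
  rw [unweight, hx, potMul, Complex.ofReal_mul]
  linear_combination ((V x : ℂ) * u x) * bracket_pow_mul_invWeight x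

theorem weightedBoundaryResolvent_weightedPotential (hV : Measurable V)
    (hd : ∀ z, |V z| ≤ C * bracket z ^ (-δ)) (hδ : 3 ≤ δ) (ψ : L2) (l : ℝ) :
    weightedBoundaryResolvent 1 l (weightedPotential V ψ) =
      boundaryVec (integrable_potMul hV hd (by linarith) ψ)
        (memLp_potMul hV hd (by linarith) ψ) l := by
  rw [weightedBoundaryResolvent_eq (by norm_num), one_mul]
  apply Lp.ext
  refine (boundaryVec_ae _ _ l).trans (EventuallyEq.trans ?_ (boundaryVec_ae _ _ l).symm)
  rw [conv_congr_ae (unweight_weightedPotential_ae hV hd hδ ψ)]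

/-- The weight `⟨x⟩^σ` attached to the potential cancels the `⟨x⟩^{-σ}` of the boundary resolvent,
and `V`, being real, moves to the eigenfunction. -/
theorem inner_weightedPotential (hV : Measurable V)
    (hd : ∀ z, |V z| ≤ C * bracket z ^ (-δ)) (hδ : 3 ≤ δ) (ψ h : L2) {l : ℝ} (hl : 0 < l) :
    inner ℂ ψ (weightedPotential V
      (weightedBoundaryResolvent 1 l h - weightedBoundaryResolvent (-1) l h)) =
      pairing (potMul V ψ) (unweight h) l := by
  rw [weightedBoundaryResolvent_eq (by norm_num), weightedBoundaryResolvent_eq (by norm_num),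
    one_mul, neg_one_mul, L2.inner_def, pairing]
  refine integral_congr_ae ?_
  filter_upwards [weightedPotential_ae hV hd hδ (boundaryVec (integrable_unweight_coe h)
    (memLp_unweight_coe h) l - boundaryVec (integrable_unweight_coe h) (memLp_unweight_coe h) (-l)),
    boundaryVec_sub_ae (integrable_unweight_coe h) (memLp_unweight_coe h) hl] with x h1 h2
  rw [h1, h2, RCLike.inner_apply, potMul, map_mul, Complex.conj_ofReal, Complex.ofReal_mul]
  simp only [unweight]
  linear_combination ((V x : ℂ) * conv (jumpKer l) (unweight h) x *
    (starRingEnd ℂ) (ψ x)) * bracket_pow_mul_invWeight x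

/-- The vector valued integrand whose integral is `⟨x⟩^{-σ}` times a `spectralIntegral`. -/
noncomputable def vecIntegrand (χ : ℝ → ℝ) {φ : R4 → ℂ} (hφ₁ : Integrable φ)
    (hφ₂ : MemLp φ 2 volume) (f : R4 → ℂ) (l : ℝ) : L2 :=
  (((χ l * l⁻¹ : ℝ) : ℂ) * pairing φ f l) • boundaryVec hφ₁ hφ₂ l

theorem wsIntegrand_eq_sum (hV : Measurable V) (hd : ∀ z, |V z| ≤ C * bracket z ^ (-δ))
    (hδ : 3 ≤ δ) {n : ℕ} {b : Fin n → L2} (hb : ∀ u, eigenProj V u = ∑ i, inner ℂ (b i) u • b i)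
    (Φ : ℝ → ℝ) (h : L2) {l : ℝ} (hl : 0 < l) :
    wsIntegrand V Φ h l = ∑ i, vecIntegrand Φ (integrable_potMul hV hd (by linarith) (b i))
      (memLp_potMul hV hd (by linarith) (b i)) (unweight h) l := by
  rw [wsIntegrand, hb, map_sum]
  simp only [map_smul, inner_weightedPotential hV hd hδ _ h hl]
  rw [weightedBoundaryResolvent_sum (by norm_num), Finset.smul_sum]
  simp only [weightedBoundaryResolvent_weightedPotential hV hd hδ, smul_smul, vecIntegrand]

end Integrand

/-! ### The `L²`-valued integral agrees with the pointwise one. -/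

section Bochner

variable {φ f : R4 → ℂ} {χ : ℝ → ℝ} {B L : ℝ}

theorem integrableOn_vecIntegrand (hφ₁ : Integrable φ) (hφ₂ : MemLp φ 2 volume)
    (hf : Integrable f) (hχ : Continuous χ) (hB : ∀ l, |χ l| ≤ B) (hL : ∀ l, L < l → χ l = 0) :
    IntegrableOn (vecIntegrand χ hφ₁ hφ₂ f) (Ioi 0) := by
  have hb := continuous_boundaryVec hφ₁ hφ₂
  obtain ⟨M, hM⟩ := (isCompact_Icc (a := 0) (b := L)).exists_bound_of_continuousOn hb.continuousOn
  have hm : Measurable fun l : ℝ => ((χ l * l⁻¹ : ℝ) : ℂ) * pairing φ f l :=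
    (Complex.measurable_ofReal.comp (hχ.measurable.mul measurable_inv)).mul
      (continuous_pairing hφ₁ hf).measurable
  refine (integrable_indicator_const (L := L)
    (B * (L * ((∫ x, ‖φ x‖) * ∫ x, ‖f x‖)) * M)).mono'
    (hm.aestronglyMeasurable.smul hb.aestronglyMeasurable) ?_
  filter_upwards [ae_restrict_mem measurableSet_Ioi] with l hl
  have hl0 : 0 < l := hl
  by_cases hlL : l ≤ L
  · rw [indicator_of_mem (show l ∈ Ioc 0 L from ⟨hl0, hlL⟩), vecIntegrand, norm_smul]
    have h1 := norm_coef_mul_pairing_le hφ₁ hf hB hl0 hlL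
    exact mul_le_mul h1 (hM l ⟨hl0.le, hlL⟩) (norm_nonneg _) ((norm_nonneg _).trans h1)
  · rw [vecIntegrand, hL l (not_le.1 hlL), indicator_of_notMem (fun h => hlL h.2)]
    simp

/-- A Bochner integral in `L²` has no pointwise meaning by itself, so the two functions are compared
through their integrals over sets of finite measure. -/
theorem integral_vecIntegrand_ae (hφ₁ : Integrable φ) (hφ₂ : MemLp φ 2 volume)
    (hf : Integrable f) (hχ : Continuous χ) (hB : ∀ l, |χ l| ≤ B) (hL : ∀ l, L < l → χ l = 0) :
    (∫ l in Ioi (0 : ℝ), vecIntegrand χ hφ₁ hφ₂ f l : L2) =ᵐ[volume]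
      unweight (spectralIntegral χ φ f) := by
  have hvec := integrableOn_vecIntegrand hφ₁ hφ₂ hf hχ hB hL
  have hpt : ∀ l : ℝ, vecIntegrand χ hφ₁ hφ₂ f l =ᵐ[volume]
      fun x => (invWeight x : ℂ) * spectralIntegrand χ φ f l x := by
    intro l
    filter_upwards [Lp.coeFn_smul (((χ l * l⁻¹ : ℝ) : ℂ) * pairing φ f l)
      (boundaryVec hφ₁ hφ₂ l), boundaryVec_ae hφ₁ hφ₂ l] with x h1 h2
    rw [vecIntegrand, h1, Pi.smul_apply, h2, smul_eq_mul, spectralIntegrand, unweight]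
    ring
  have hprod : ∀ s : Set R4, MeasurableSet s → volume s < ⊤ → Integrable
      (fun q : ℝ × R4 => (invWeight q.2 : ℂ) * spectralIntegrand χ φ f q.1 q.2)
      ((volume.restrict (Ioi 0)).prod (volume.restrict s)) := by
    intro s hs hμs
    have : IsFiniteMeasure (volume.restrict s) := ⟨by simpa using hμs⟩
    have hmaj : Integrable (fun x => invWeight x * greenMaj φ x) (volume.restrict s) :=
      ((memLp_invWeight_mul_greenMaj hφ₂).restrict s).integrable one_le_two
    have hac : (volume.restrict (Ioi (0 : ℝ))).prod ((volume : Measure R4).restrict s) ≪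
        (volume.restrict (Ioi (0 : ℝ))).prod (volume : Measure R4) :=
      Measure.AbsolutelyContinuous.rfl.prod Measure.absolutelyContinuous_restrict
    refine ((integrable_indicator_const (L := L) (spectralConst φ f B L)).mul_prod hmaj).mono' ?_ ?_
    · refine AEStronglyMeasurable.mul ?_
        ((aestronglyMeasurable_uncurry_spectralIntegrand hφ₁ hf hχ).mono_ac hac)
      have := continuous_invWeight
      exact (by fun_prop : Continuous fun q : ℝ × R4 => (invWeight q.2 : ℂ)).aestronglyMeasurable
    · have h1 : ∀ᵐ q : ℝ × R4 ∂((volume.restrict (Ioi 0)).prod (volume.restrict s)),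
          q.1 ∈ Ioi (0 : ℝ) :=
        Measure.quasiMeasurePreserving_fst.ae (ae_restrict_mem measurableSet_Ioi)
      have h2 : ∀ᵐ q : ℝ × R4 ∂((volume.restrict (Ioi 0)).prod (volume.restrict s)),
          Integrable fun y => nearInv (q.2 - y) * ‖φ y‖ :=
        Measure.quasiMeasurePreserving_snd.ae (ae_restrict_of_ae (ae_integrable_nearInv hφ₁))
      filter_upwards [h1, h2] with q hq1 hq2
      rw [norm_mul, Complex.norm_real, Real.norm_of_nonneg (invWeight_pos _).le]
      calc _ ≤ invWeight q.2 * ((Ioc 0 L).indicator (fun _ => spectralConst φ f B L) q.1 *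
            greenMaj φ q.2) := by
            have := (invWeight_pos q.2).le
            gcongr
            exact norm_spectralIntegrand_le hφ₁ hf hB hL hq2 hq1
        _ = _ := by ring
  have hun : ∀ x, unweight (spectralIntegral χ φ f) x =
      ∫ l in Ioi (0 : ℝ), (invWeight x : ℂ) * spectralIntegrand χ φ f l x := by
    intro x
    rw [integral_const_mul, unweight, spectralIntegral]
  refine ae_eq_of_forall_setIntegral_eq_of_sigmaFinite (fun s hs hμs => ?_) (fun s hs hμs => ?_)
    fun s hs hμs => ?_
  · have : IsFiniteMeasure (volume.restrict s) := ⟨by simpa using hμs⟩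
    exact ((Lp.memLp _).restrict s).integrable one_le_two
  · exact (hprod s hs hμs).integral_prod_right.congr (ae_of_all _ fun x => (hun x).symm)
  · simp only [hun]
    -- Integration over `s` is the inner product with an indicator, a continuous functional that
    -- commutes with the Bochner integral; on the other side Fubini applies.
    rw [← integral_integral_swap (hprod s hs hμs), ← L2.inner_indicatorConstLp_one (𝕜 := ℂ) hs hμs.ne,
      ← innerSL_apply_apply, ← ContinuousLinearMap.integral_comp_comm _ hvec]
    refine integral_congr_ae (ae_of_all _ fun l => ?_)
    dsimp only
    rw [innerSL_apply_apply, L2.inner_indicatorConstLp_one]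
    exact integral_congr_ae (ae_restrict_of_ae (hpt l))

end Bochner

/-! ### The `L^p` estimate for `W_s`. -/

section WaveOperator

variable {V : R4 → ℝ} {δ C : ℝ} {Φ : ℝ → ℝ} {p : ℝ≥0∞}

theorem integrableOn_wsIntegrand (hV : Measurable V) (hd : ∀ z, |V z| ≤ C * bracket z ^ (-δ))
    (hδ : 3 < δ) (hΦ : IsLowEnergyCutoff Φ) (h : L2) :
    IntegrableOn (wsIntegrand V Φ h) (Ioi 0) := by
  obtain ⟨n, b, -, hb⟩ := exists_eigenProj_eq_sum hV hd hδ
  obtain ⟨R, hR0, hR⟩ := hΦ.exists_eq_zero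
  obtain ⟨B, hB⟩ := hΦ.exists_bound
  have hv := fun i => integrableOn_vecIntegrand
    (integrable_potMul hV hd (by linarith) (b i)) (memLp_potMul hV hd (by linarith) (b i))
    (integrable_unweight_coe h) hΦ.1.continuous hB
    (fun l hl => hR l (hl.trans_le (le_abs_self l)))
  refine (integrable_finsetSum Finset.univ fun i _ => (hv i).integrable).congr ?_
  filter_upwards [ae_restrict_mem measurableSet_Ioi] with l hl
  rw [wsIntegrand_eq_sum hV hd hδ.le hb Φ h hl]

theorem wsDefined (hV : Measurable V) (hd : ∀ z, |V z| ≤ C * bracket z ^ (-δ))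
    (hδ : 3 < δ) (hΦ : IsLowEnergyCutoff Φ) : WsDefined V Φ :=
  ⟨fun l _ => limitsExist l, integrableOn_wsIntegrand hV hd hδ hΦ⟩

theorem ws_ae_eq_sum (hV : Measurable V) (hd : ∀ z, |V z| ≤ C * bracket z ^ (-δ))
    (hδ : 3 < δ) (hΦ : IsLowEnergyCutoff Φ) {n : ℕ} {b : Fin n → L2}
    (hb : ∀ u, eigenProj V u = ∑ i, inner ℂ (b i) u • b i) (h : L2) :
    Ws V Φ h =ᵐ[volume] fun x => ((Real.pi : ℂ) * Complex.I)⁻¹ *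
      ∑ i, spectralIntegral Φ (potMul V (b i)) (unweight h) x := by
  obtain ⟨R, hR0, hR⟩ := hΦ.exists_eq_zero
  obtain ⟨B, hB⟩ := hΦ.exists_bound
  have hL : ∀ l, R < l → Φ l = 0 := fun l hl => hR l (hl.trans_le (le_abs_self l))
  have hφ₁ := fun i => integrable_potMul hV hd (by linarith) (b i)
  have hφ₂ := fun i => memLp_potMul hV hd (by linarith) (b i)
  have h1 : ∫ l in Ioi (0 : ℝ), wsIntegrand V Φ h l =
      ∑ i, ∫ l in Ioi (0 : ℝ), vecIntegrand Φ (hφ₁ i) (hφ₂ i) (unweight h) l := by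
    rw [← integral_finsetSum _ fun i _ => integrableOn_vecIntegrand (hφ₁ i) (hφ₂ i)
      (integrable_unweight_coe h) hΦ.1.continuous hB hL]
    exact setIntegral_congr_fun measurableSet_Ioi fun l hl =>
      wsIntegrand_eq_sum hV hd hδ.le hb Φ h hl
  have h2 : ∀ᵐ x, ∀ i, (∫ l in Ioi (0 : ℝ), vecIntegrand Φ (hφ₁ i) (hφ₂ i) (unweight h) l : L2) x =
      unweight (spectralIntegral Φ (potMul V (b i)) (unweight h)) x :=
    ae_all_iff.2 fun i => integral_vecIntegrand_ae (hφ₁ i) (hφ₂ i) (integrable_unweight_coe h)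
      hΦ.1.continuous hB hL
  filter_upwards [h2, Lp.coeFn_smul ((Real.pi : ℂ) * Complex.I)⁻¹
      (∫ l in Ioi (0 : ℝ), wsIntegrand V Φ h l : L2),
    Lp.coeFn_finsetSum Finset.univ
      fun i => (∫ l in Ioi (0 : ℝ), vecIntegrand Φ (hφ₁ i) (hφ₂ i) (unweight h) l : L2)]
    with x h2 h3 h4
  rw [Ws, weightedWs, h3, Pi.smul_apply, h1, h4, smul_eq_mul, Finset.sum_apply]
  simp only [h2, unweight, ← Finset.mul_sum]
  linear_combination (((Real.pi : ℂ) * Complex.I)⁻¹ * ∑ i, spectralIntegral Φ (potMul V (b i))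
    (unweight h) x) * bracket_pow_mul_invWeight x

theorem weightedBoundaryResolvent_add {s : ℝ} (hs : s ^ 2 = 1) (l : ℝ) (h h' : L2) :
    weightedBoundaryResolvent s l (h + h') =
      weightedBoundaryResolvent s l h + weightedBoundaryResolvent s l h' := by
  simpa using weightedBoundaryResolvent_sum hs l Finset.univ (fun _ : Fin 2 => 1) ![h, h']

theorem weightedBoundaryResolvent_smul {s : ℝ} (hs : s ^ 2 = 1) (l : ℝ) (c : ℂ) (h : L2) :
    weightedBoundaryResolvent s l (c • h) = c • weightedBoundaryResolvent s l h := by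
  simpa using weightedBoundaryResolvent_sum hs l Finset.univ (fun _ : Fin 1 => c) ![h]

theorem wsIntegrand_add (V : R4 → ℝ) (Φ : ℝ → ℝ) (h h' : L2) (l : ℝ) :
    wsIntegrand V Φ (h + h') l = wsIntegrand V Φ h l + wsIntegrand V Φ h' l := by
  simp only [wsIntegrand]
  rw [weightedBoundaryResolvent_add (by norm_num), weightedBoundaryResolvent_add (by norm_num),
    add_sub_add_comm, map_add, map_add, map_add, weightedBoundaryResolvent_add (by norm_num),
    smul_add]

theorem wsIntegrand_smul (V : R4 → ℝ) (Φ : ℝ → ℝ) (c : ℂ) (h : L2) (l : ℝ) :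
    wsIntegrand V Φ (c • h) l = c • wsIntegrand V Φ h l := by
  simp only [wsIntegrand]
  rw [weightedBoundaryResolvent_smul (by norm_num), weightedBoundaryResolvent_smul (by norm_num),
    ← smul_sub, map_smul, map_smul, map_smul, weightedBoundaryResolvent_smul (by norm_num),
    smul_comm]

theorem weightedWs_add (hV : Measurable V) (hd : ∀ z, |V z| ≤ C * bracket z ^ (-δ))
    (hδ : 3 < δ) (hΦ : IsLowEnergyCutoff Φ) (h h' : L2) :
    weightedWs V Φ (h + h') = weightedWs V Φ h + weightedWs V Φ h' := by
  simp only [weightedWs, wsIntegrand_add]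
  rw [integral_add (integrableOn_wsIntegrand hV hd hδ hΦ h)
    (integrableOn_wsIntegrand hV hd hδ hΦ h'), smul_add]

theorem weightedWs_smul (V : R4 → ℝ) (Φ : ℝ → ℝ) (c : ℂ) (h : L2) :
    weightedWs V Φ (c • h) = c • weightedWs V Φ h := by
  simp only [weightedWs, wsIntegrand_smul]
  rw [integral_smul, smul_comm]

theorem ws_add_ae (hV : Measurable V) (hd : ∀ z, |V z| ≤ C * bracket z ^ (-δ))
    (hδ : 3 < δ) (hΦ : IsLowEnergyCutoff Φ) (h h' : L2) :
    Ws V Φ (h + h') =ᵐ[volume] Ws V Φ h + Ws V Φ h' := by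
  filter_upwards [Lp.coeFn_add (weightedWs V Φ h) (weightedWs V Φ h')] with x hx
  simp only [Ws, Pi.add_apply]
  rw [weightedWs_add hV hd hδ hΦ, hx, Pi.add_apply, mul_add]

theorem ws_smul_ae (V : R4 → ℝ) (Φ : ℝ → ℝ) (c : ℂ) (h : L2) :
    Ws V Φ (c • h) =ᵐ[volume] c • Ws V Φ h := by
  filter_upwards [Lp.coeFn_smul c (weightedWs V Φ h)] with x hx
  simp only [Ws, Pi.smul_apply, smul_eq_mul]
  rw [weightedWs_smul, hx, Pi.smul_apply, smul_eq_mul]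
  ring

theorem aestronglyMeasurable_ws (V : R4 → ℝ) (Φ : ℝ → ℝ) (h : L2) :
    AEStronglyMeasurable (Ws V Φ h) volume := by
  have := continuous_bracket
  exact (by fun_prop : Continuous fun x => ((bracket x ^ wt : ℝ) : ℂ)).aestronglyMeasurable.mul
    (Lp.memLp (weightedWs V Φ h)).1

theorem exists_eLpNorm_ws_le (hV : Measurable V) (hd : ∀ z, |V z| ≤ C * bracket z ^ (-δ))
    (hδ : 3 < δ) (hΦ : IsLowEnergyCutoff Φ) {m : ℕ} (hm : 0 < m)
    (hcor : ∀ ψ ∈ zeroEigenspace V, ∀ η : 𝓢(R4, ℂ), ∃ K : ℝ≥0∞, K ≠ ⊤ ∧ ∀ s : ℝ, 0 < s →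
      ∫⁻ v, ‖correl (potMul V ψ) (dilate s η) v‖ₑ ≤ ENNReal.ofReal (s ^ m) * K)
    (hp : 1 ≤ p) (hp' : p ≠ ⊤) (hmp : 2 < m + 4 / p.toReal) :
    ∃ M : ℝ≥0∞, M ≠ ⊤ ∧ ∀ h : L2,
      eLpNorm (Ws V Φ h) p volume ≤ M * eLpNorm (unweight h) p volume := by
  obtain ⟨n, b, hbE, hb⟩ := exists_eigenProj_eq_sum hV hd hδ
  have hφ₁ := fun i => integrable_potMul hV hd (by linarith) (b i)
  choose M hM hbd using fun i => exists_eLpNorm_spectralIntegral_le hΦ (hφ₁ i)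
    (memLp_potMul hV hd (by linarith) (b i)) hm (hcor (b i) (hbE i)) hp hp' hmp
  refine ⟨‖((Real.pi : ℂ) * Complex.I)⁻¹‖ₑ * ∑ i, M i, ENNReal.mul_ne_top enorm_ne_top
    (ENNReal.sum_ne_top.2 fun i _ => hM i), fun h => ?_⟩
  have hf := integrable_unweight_coe h
  have hmeas := fun i => aestronglyMeasurable_spectralIntegral (hφ₁ i) hf hΦ.1.continuous
  rw [eLpNorm_congr_ae (ws_ae_eq_sum hV hd hδ hΦ hb h)]
  have e : (fun x => ((Real.pi : ℂ) * Complex.I)⁻¹ *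
      ∑ i, spectralIntegral Φ (potMul V (b i)) (unweight h) x) =
      ((Real.pi : ℂ) * Complex.I)⁻¹ •
        ∑ i, spectralIntegral Φ (potMul V (b i)) (unweight h) := by
    ext x
    simp
  rw [e, eLpNorm_const_smul, mul_assoc, Finset.sum_mul]
  gcongr
  refine (eLpNorm_sum_le (fun i _ => hmeas i) hp).trans ?_
  gcongr with i
  exact hbd i _ hf

end WaveOperator

/-! ### Extension to a bounded operator on `L^p`. -/

section Extension

variable {p : ℝ≥0∞} [Fact (1 ≤ p)]

/-- The space `L^p ∩ L^{2,σ}`, as a subspace of `L^p`. -/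
noncomputable def weightedDomain (p : ℝ≥0∞) [Fact (1 ≤ p)] :
    Submodule ℂ (Lp ℂ p (volume : Measure R4)) where
  carrier := {f | MemLp (fun x => ((bracket x ^ wt : ℝ) : ℂ) * f x) 2 volume}
  zero_mem' := by
    refine MemLp.ae_eq ?_ (MemLp.zero' (p := 2) (ε := ℂ))
    filter_upwards [Lp.coeFn_zero ℂ p (volume : Measure R4)] with x hx
    rw [hx]
    simp
  add_mem' {f g} hf hg := by
    refine MemLp.ae_eq ?_ (hf.add hg)
    filter_upwards [Lp.coeFn_add f g] with x hx
    rw [hx]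
    simp [mul_add]
  smul_mem' c f hf := by
    refine MemLp.ae_eq ?_ (hf.const_smul c)
    filter_upwards [Lp.coeFn_smul c f] with x hx
    rw [hx]
    simp only [Pi.smul_apply, smul_eq_mul]
    ring

theorem mem_weightedDomain {f : Lp ℂ p (volume : Measure R4)} :
    f ∈ weightedDomain p ↔ MemLp (fun x => ((bracket x ^ wt : ℝ) : ℂ) * f x) 2 volume :=
  Iff.rfl

/-- Continuous compactly supported functions are dense in `L^p` and belong to every weighted `L²`.
-/
theorem dense_weightedDomain (hp' : p ≠ ⊤) :
    Dense (weightedDomain p : Set (Lp ℂ p (volume : Measure R4))) := by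
  intro f
  rw [Metric.mem_closure_iff]
  intro ε hε
  obtain ⟨g, hgc, hg, hgcont, hgp⟩ := (Lp.memLp f).exists_hasCompactSupport_eLpNorm_sub_le hp'
    (ε := ENNReal.ofReal (ε / 2)) (by simpa using hε)
  have := continuous_bracket
  have hg2 : MemLp (fun x => ((bracket x ^ wt : ℝ) : ℂ) * g x) 2 volume :=
    (by fun_prop : Continuous fun x => ((bracket x ^ wt : ℝ) : ℂ) * g x).memLp_of_hasCompactSupport
      hgc.mul_left
  refine ⟨hgp.toLp g, mem_weightedDomain.2 (hg2.ae_eq ?_), ?_⟩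
  · filter_upwards [hgp.coeFn_toLp] with x hx
    rw [hx]
  · rw [dist_edist, ← Lp.toLp_coeFn f (Lp.memLp f), Lp.edist_toLp_toLp]
    refine (ENNReal.toReal_mono ENNReal.ofReal_ne_top hg).trans_lt ?_
    rw [ENNReal.toReal_ofReal (by positivity)]
    linarith

/-- The element `⟨x⟩^σ f` of `L²`. -/
noncomputable def toWeighted : weightedDomain p →ₗ[ℂ] L2 where
  toFun f := (mem_weightedDomain.1 f.2).toLp _
  map_add' f g := by
    refine (MemLp.toLp_congr _ ((mem_weightedDomain.1 f.2).add (mem_weightedDomain.1 g.2)) ?_).trans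
      (MemLp.toLp_add _ _)
    filter_upwards [Lp.coeFn_add (f : Lp ℂ p (volume : Measure R4)) g] with x hx
    rw [Pi.add_apply, ← mul_add, ← Pi.add_apply, ← hx]
    rfl
  map_smul' c f := by
    refine (MemLp.toLp_congr _ ((mem_weightedDomain.1 f.2).const_smul c) ?_).trans
      (MemLp.toLp_const_smul c _)
    filter_upwards [Lp.coeFn_smul c (f : Lp ℂ p (volume : Measure R4))] with x hx
    simp only [SetLike.val_smul, hx, Pi.smul_apply, smul_eq_mul]
    ring

theorem unweight_toWeighted_ae (f : weightedDomain p) :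
    unweight (toWeighted f) =ᵐ[volume] (f : Lp ℂ p (volume : Measure R4)) := by
  have h : toWeighted f = (mem_weightedDomain.1 f.2).toLp _ := rfl
  filter_upwards [MemLp.coeFn_toLp (mem_weightedDomain.1 f.2)] with x hx
  rw [unweight, h, hx]
  linear_combination ((f : Lp ℂ p (volume : Measure R4)) x) * bracket_pow_mul_invWeight x

/-- The estimate makes `W_s` a bounded linear map on the dense subspace `L^p ∩ L^{2,σ}`, which
extends by continuity. Any `h` occurring in the definition is the image under `toWeighted` of its
`f`, so the extension agrees with `W_s` wherever required. -/
theorem wsBoundedOn {V : R4 → ℝ} {δ C : ℝ} {Φ : ℝ → ℝ} (hV : Measurable V)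
    (hd : ∀ z, |V z| ≤ C * bracket z ^ (-δ))
    (hδ : 3 < δ) (hΦ : IsLowEnergyCutoff Φ) (hp' : p ≠ ⊤) {M : ℝ≥0∞} (hM : M ≠ ⊤)
    (hbd : ∀ h : L2, eLpNorm (Ws V Φ h) p volume ≤ M * eLpNorm (unweight h) p volume) :
    WsBoundedOn V Φ p := by
  have hnorm : ∀ f : weightedDomain p, eLpNorm (Ws V Φ (toWeighted f)) p volume ≤
      M * eLpNorm (f : Lp ℂ p (volume : Measure R4)) p volume := fun f => by
    rw [← eLpNorm_congr_ae (unweight_toWeighted_ae f)]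
    exact hbd _
  have hmem : ∀ f : weightedDomain p, MemLp (Ws V Φ (toWeighted f)) p volume := fun f =>
    ⟨aestronglyMeasurable_ws V Φ _, (hnorm f).trans_lt
      (ENNReal.mul_lt_top hM.lt_top (Lp.eLpNorm_lt_top _))⟩
  let T₀ : weightedDomain p →ₗ[ℂ] Lp ℂ p (volume : Measure R4) :=
    { toFun := fun f => (hmem f).toLp _
      map_add' := fun f g => by
        rw [← MemLp.toLp_add]
        refine MemLp.toLp_congr _ _ ?_
        rw [map_add]
        exact ws_add_ae hV hd hδ hΦ _ _
      map_smul' := fun c f => by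
        rw [RingHom.id_apply, ← MemLp.toLp_const_smul]
        refine MemLp.toLp_congr _ _ ?_
        rw [map_smul]
        exact ws_smul_ae V Φ c _ }
  have hT₀ : ∀ f, ‖T₀ f‖ ≤ M.toReal * ‖f‖ := fun f => by
    change ‖(hmem f).toLp _‖ ≤ _
    rw [Lp.norm_toLp, Submodule.coe_norm, Lp.norm_def, ← ENNReal.toReal_mul]
    exact ENNReal.toReal_mono (ENNReal.mul_ne_top hM (Lp.eLpNorm_ne_top _)) (hnorm f)
  let T₁ := T₀.mkContinuous M.toReal hT₀
  have hdense : DenseRange (weightedDomain p).subtypeL := by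
    simpa [DenseRange] using dense_weightedDomain hp'
  refine ⟨T₁.extend (weightedDomain p).subtypeL, fun f h hfh => ?_⟩
  have hf : f ∈ weightedDomain p := (Lp.memLp h).ae_eq hfh
  have hh : toWeighted ⟨f, hf⟩ = h := Lp.ext <|
    (MemLp.coeFn_toLp (mem_weightedDomain.1 hf)).trans (EventuallyEq.symm hfh)
  have h1 := T₁.extend_eq hdense isUniformEmbedding_subtype_val.isUniformInducing ⟨f, hf⟩
  have h2 : T₁.extend (weightedDomain p).subtypeL f = (hmem ⟨f, hf⟩).toLp _ := h1
  rw [h2]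
  refine (hmem ⟨f, hf⟩).coeFn_toLp.trans ?_
  rw [hh]

end Extension

end WaveOp

theorem proposition2p1 (V : WaveOp.R4 → ℝ) (hV : Measurable V)
    (Φ : ℝ → ℝ) (hΦ : WaveOp.IsLowEnergyCutoff Φ) (δ C : ℝ)
    (hdecay : ∀ z, |V z| ≤ C * WaveOp.bracket z ^ (-δ)) :
    (4 < δ → WaveOp.WsDefined V Φ ∧
      ∀ (p : ℝ≥0∞) [Fact (1 ≤ p)], p < 4 → WaveOp.WsBoundedOn V Φ p) ∧
    (6 < δ → WaveOp.FirstMomentsVanish V →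
      ∀ (p : ℝ≥0∞) [Fact (1 ≤ p)], p < ⊤ → WaveOp.WsBoundedOn V Φ p) := by
  have key : ∀ (p : ℝ≥0∞) [Fact (1 ≤ p)], p ≠ ⊤ → 0 < p.toReal := fun p hp hp' =>
    ENNReal.toReal_pos (zero_lt_one.trans_le hp.out).ne' hp'
  refine ⟨fun hδ => ⟨WaveOp.wsDefined hV hdecay (by linarith) hΦ, fun p hp hp4 => ?_⟩,
    fun hδ hmom p hp hpt => ?_⟩
  · have hp' : p ≠ ⊤ := (hp4.trans (by simp)).ne
    have hp0 := key p hp'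
    have hq : p.toReal < 4 := by
      have := (ENNReal.toReal_lt_toReal hp' (by simp)).2 hp4
      simpa using this
    -- Cancellation of order `m = 1`: the condition `2 < 1 + 4/p` is `p < 4`.
    obtain ⟨M, hM, hbd⟩ := WaveOp.exists_eLpNorm_ws_le hV hdecay (by linarith) hΦ one_pos
      (fun ψ hψ η => WaveOp.exists_lintegral_correl_potMul_le hV hdecay (by linarith) hψ η)
      hp.out hp' (by
        have : 1 < 4 / p.toReal := (one_lt_div hp0).2 hq
        push_cast
        linarith)
    exact WaveOp.wsBoundedOn hV hdecay (by linarith) hΦ hp' hM hbd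
  · have hp0 := key p hpt.ne
    -- Cancellation of order `m = 2`: the condition `2 < 2 + 4/p` holds for every finite `p`.
    obtain ⟨M, hM, hbd⟩ := WaveOp.exists_eLpNorm_ws_le hV hdecay (by linarith) hΦ two_pos
      (fun ψ hψ η => WaveOp.exists_lintegral_correl_potMul_le_sq hV hdecay (by linarith) hmom hψ η)
      hp.out hpt.ne (by
        have : 0 < 4 / p.toReal := by positivity
        push_cast
        linarith)
    exact WaveOp.wsBoundedOn hV hdecay (by linarith) hΦ hpt.ne hM hbd
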